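/- Let $p,q\in\mathbb R$, $c=a+ib\in\mathbb C$ and $\omega_2(x)=\omega_2^{(c)}(x)=(1-ix)^{c}(1+ix)^{\bar c}=(1+x^2)^{a}e^{2b\arctan x}$ on $\mathbb R$, let $P_n=P_n^{(c)}$ be the monic orthogonal (Routh--Romanovski) polynomials for $\omega_2$, $h_n=\int\omega_2P_n^2$, $\gamma_j=(-\operatorname{Re}c-1-j)/h_j$, $\tilde\omega_1(x)=(\omega_2(x)/(1+x^2))^{1/2}$, $\tilde\omega_4(x)=\omega_2(x)(1+x^2)$, $\tilde s_k=\frac12\int\tilde\omega_1P_k$, and $$S^{(c)}_{n}(x,y)=(\omega_2(x)\omega_2(y))^{1/2}\sum_{k=0}^{n-1}\frac{P_k(x)P_k(y)}{h_k}.$$ The kernels $S_{N,\beta}$ of the generalised circular Jacobi ensemble (in the Cauchy variable $x=-\cot(\theta/2)$) are: * $\beta=2$: $S_{N,2}=S^{(c)}_N$ with $c=-N-p+iq$. * $\beta=1$, with $c=-N-p+2iq$: for $N$ even $S_{N,1}=T_N$, where $$T_m(x,y)=\sqrt{\tfrac{\omega_2(x)}{\omega_2(y)}}\,\frac{\tilde\omega_1(y)}{\tilde\omega_1(x)}S^{(c)}_{m-1}(x,y)+\tfrac12\gamma_{m-2}\tilde\omega_1(y)P_{m-1}(y)\int_{\mathbb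 R}\operatorname{sgn}(x-t)P_{m-2}(t)\tilde\omega_1(t)\,dt ;$$ for $N$ odd (with the same $c$) $$S_{N,1}(x,y)=T_{N-1}(x,y)+\frac{\tilde\omega_1(y)P_{N-1}(y)}{2\tilde s_{N-1}}-\tfrac12\gamma_{N-3}\tilde s_{N-3}\frac{\tilde\omega_1(y)}{\tilde s_{N-1}}\int_{\mathbb R}\tilde\omega_1(t)\operatorname{sgn}(x-t)\bigl(P_{N-1}(t)P_{N-2}(y)-P_{N-2}(t)P_{N-1}(y)\bigr)dt .$$ * $\beta=4$, with $c=-2N-2p+iq$: $$S_{N,4}(x,y)=\tfrac12\sqrt{\tfrac{\omega_2(y)\tilde\omega_4(x)}{\tilde\omega_4(y)\omega_2(x)}}\,S^{(c)}_{2N}(x,y)-\tfrac12\gamma_{2N-1}\frac{\omega_2(y)}{\sqrt{\tilde\omega_4(y)}}P_{2N}(y)\int_x^\infty P_{2N-1}(t)\frac{\omega_2(t)}{\sqrt{\tilde\omega_4(t)}}\,dt .$$ For $M>0$ put $z_M(X)=i\,\dfrac{1+e^{2iX/M}}{1-e^{2iX/M}}=-\cot(X/M)$. Define, with ${}_1F_1$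 the confluent hypergeometric series and ${}_1F_1(0;0;\cdot):=1$, $$\tilde A^{(r,q)}(j;X)=\tfrac{(r-iq)_j}{(2r)_j}\,{}_1F_1(r+j-iq;2r+j;2iX),\qquad \tilde C_0^{(p,q,k)}(X)=\tilde A^{(p+k,q)}(0;X),$$ (with $\tilde A^{(0,0)}(j;X):=0$ for $j\ge1$), $$\tilde C_1^{(p,q,k)}(X)=\tfrac12(2iX)^2\bigl(\tilde A^{(p+k,q)}(1;X)-\tilde A^{(p+k,q)}(2;X)\bigr)-2ikX\tilde A^{(p+k,q)}(1;X)+(ik+q)X\tilde C_0^{(p,q,k)}(X),$$ $$J_0^{(p,q,k)}=X\tilde C_0^{(p,q,k+1)}(X)\tilde C_0^{(p,q,k)}(Y)-(X\leftrightarrow Y),$$ $$J_1^{(p,q,k)}=X\bigl(\tilde C_0^{(p,q,k+1)}(X)\tilde C_1^{(p,q,k)}(Y)+\tilde C_1^{(p,q,k+1)}(X)\tilde C_0^{(p,q,k)}(Y)\bigr)-(X\leftrightarrow Y),$$ $$g^{(p,q;k)}(X,Y)=\frac{2^{2(p+k)}|\Gamma(p+k+1-iq)|^2}{\pi\Gamma(2p+2k+2)\Gamma(2p+2k+1)}e^{-i(X+Y)-q\pi}\frac{(XY)^{p+k+1}}{X^2(X-Y)},$$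 $$\hat K_2^{(p,q;k)}=g^{(p,q;k)}J_0^{(p,q,k)},\qquad \hat L_2^{(p,q;k)}=g^{(p,q;k)}\bigl(J_1^{(p,q,k)}+p(2p+2k+1)J_0^{(p,q,k)}\bigr).$$ *Case $\beta=2$:* $\hat K_{\infty,2}=\hat K_2^{(p,q;0)}$, $\hat L_{1,2}=\hat L_2^{(p,q;0)}$. *Case $\beta=1$:* with $\mathcal J_o[f]=\int_0^Xe^{-is-q\pi}s^{p+1}f(s)\,ds$, $\eta_1=\dfrac{2\sqrt\pi\,\Gamma(p+2)\Gamma(p+5/2)}{|\Gamma((p+3)/2+iq)|^2}$ and $\eta_2=-(p+1)e^{-q\pi}\dfrac{2^{2p+2}|\Gamma(p+2-2iq)|^2}{\pi\Gamma(2p+4)\Gamma(2p+3)}$, and with $\tilde C_j^{(k)}=\tilde C_j^{(p,2q,k)}$, $$\hat K_{\infty,1}=\tfrac YX\hat K_2^{(p,2q;1)}(X,Y)+\tfrac{\eta_2}{X^2}e^{-iY}Y^{p+2}\,\tilde C_0^{(1)}(Y)\bigl(\mathcal J_o[\tilde C_0^{(2)}]-\tfrac{\eta_1}2\bigr),$$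 $$\hat L_{1,1}=\tfrac YX\hat L_2^{(p,2q;1)}(X,Y)+\tfrac{\eta_2}{X^2}e^{-iY}Y^{p+2}\Bigl[\tilde C_0^{(1)}(Y)\bigl(\mathcal J_o[\tilde C_1^{(2)}]+\tfrac{p(p+2)\eta_1}2\bigr)+\bigl(\tilde C_1^{(1)}(Y)+p(2p+3)\tilde C_0^{(1)}(Y)\bigr)\bigl(\mathcal J_o[\tilde C_0^{(2)}]-\tfrac{\eta_1}2\bigr)\Bigr].$$ *Case $\beta=4$:* with $\mathcal J_s[f]=-p\,\dfrac{2^{8p+1}|\Gamma(2p+1-iq)|^2}{\pi\Gamma(4p+1)\Gamma(4p+2)}e^{-q\pi-2iY}Y^{2p+1}\displaystyle\int_0^Xe^{-2is}s^{2p}f(s)\,ds$, and with $\bar C_j^{(k)}(X)=\tilde C_j^{(2p,q,k)}(2X)$, $$\hat K_{\infty,4}=\tfrac YX\hat K_2^{(2p,q;0)}(2X,2Y)+\tfrac1{X^2}\mathcal J_{s,0},\qquad \hat L_{1,4}=\tfrac12\Bigl[\tfrac YX\hat L_2^{(2p,q;0)}(2X,2Y)+\tfrac1{X^2}\mathcal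 J_{s,1}\Bigr],$$ where $\mathcal J_{s,0}=\mathcal J_s[\bar C_0^{(0)}(Y)\bar C_0^{(1)}(s)]$ and $\mathcal J_{s,1}=\mathcal J_s[\bar C_1^{(0)}(Y)\bar C_0^{(1)}(s)+\bar C_0^{(0)}(Y)\bar C_1^{(1)}(s)]+2p(4p+1)\mathcal J_{s,0}$. **Proposition.** Let $\beta\in\{1,2,4\}$. Assume $p>-1$ if $\beta=1$, and $p>0$ or $p=q=0$ if $\beta=2$ or $4$. Then, for $X,Y>0$, $X\ne Y$, and as $N\to\infty$ (through all integers), $$S_{N,\beta}(z_N(X),z_N(Y))\frac{dz_N}{dX}=\hat K_{\infty,\beta}(X,Y)+\frac1N\hat L_{1,\beta}(X,Y)+O\Bigl(\frac1{N^2}\Bigr),$$ $\hat K_{\infty,\beta}$ is differentiable and $$\hat L_{1,\beta}(X,Y)=p\Bigl(X\frac{\partial}{\partial X}+Y\frac{\partial}{\partial Y}+1\Bigr)\hat K_{\infty,\beta}(X,Y),$$ and consequently, with the shifted scaling, $$S_{N,\beta}(z_{N+p}(X),z_{N+p}(Y))\frac{dz_{N+p}}{dX}=\hat K_{\infty,\beta}(X,Y)+O\Bigl(\frac1{N^2}\Bigr).$$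 Both error terms are uniform on compact subsets of $\{X>0,\ Y>0,\ X\ne Y\}$. -/

import Mathlib

namespace CircularJacobi

noncomputable section

open Real MeasureTheory Polynomial

/-! ### The finite `N` kernels -/

/-- The generalised Cauchy weight `ω₂(x) = (1 - i x) ^ c * (1 + i x) ^ (conj c)` on the real line,
in its real form; see `cauchyWeight_eq_cpow`. -/
def cauchyWeight (c : ℂ) (x : ℝ) : ℝ :=
  (1 + x ^ 2) ^ c.re * Real.exp (2 * c.im * Real.arctan x)

/-- The monic orthogonal polynomials of a weight `w` on the line (Gram-Schmidt applied to
`1, x, x ^ 2, …`): `P n` is monic of degree `n` and `∫ w P_n P_m = 0` for `m < n`, as long as the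
integrals that occur converge. -/
def orthoPoly (w : ℝ → ℝ) (n : ℕ) : ℝ[X] :=
  X ^ n - ∑ m : Fin n,
    C ((∫ x, w x * x ^ n * (orthoPoly w m).eval x) / ∫ x, w x * (orthoPoly w m).eval x ^ 2)
      * orthoPoly w m
termination_by n
decreasing_by all_goals exact m.isLt

/-- The Routh-Romanovski polynomials: monic and orthogonal for the weight `ω₂`. -/
def rr (c : ℂ) (n : ℕ) (x : ℝ) : ℝ := (orthoPoly (cauchyWeight c) n).eval x

/-- The normalisation `h_n`. -/
def rrNorm (c : ℂ) (n : ℕ) : ℝ := ∫ x, cauchyWeight c x * rr c n x ^ 2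

/-- The Christoffel-Darboux sum
`(ω₂(x) ω₂(y)) ^ (1/2) * ∑_{k < n} P_k(x) P_k(y) / h_k` for the weight `ω₂` with exponent `c`. -/
def cdKernel (c : ℂ) (n : ℕ) (x y : ℝ) : ℝ :=
  √(cauchyWeight c x * cauchyWeight c y) *
    ∑ k ∈ Finset.range n, rr c k x * rr c k y / rrNorm c k

/-- `γ_j = (-Re c - 1 - j) / h_j`. -/
def gammaCoeff (c : ℂ) (j : ℕ) : ℝ := (-c.re - 1 - j) / rrNorm c j

/-- The weight `ω̃₁ = (ω₂ / f) ^ (1/2)` with `f = 1 + x ^ 2`. -/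
def weightOne (c : ℂ) (x : ℝ) : ℝ := √(cauchyWeight c x / (1 + x ^ 2))

/-- The weight `ω̃₄ = ω₂ f` with `f = 1 + x ^ 2`. -/
def weightFour (c : ℂ) (x : ℝ) : ℝ := cauchyWeight c x * (1 + x ^ 2)

/-- The kernel for Dyson index 2: `c = -N - p + i q`. -/
def kernelTwo (p q : ℝ) (N : ℕ) (x y : ℝ) : ℝ := cdKernel ⟨-N - p, q⟩ N x y

/-- The kernel for Dyson index 1 and an even number `m ≥ 2` of particles, the weight being kept as
a free parameter. -/
def kernelOneEven (c : ℂ) (m : ℕ) (x y : ℝ) : ℝ :=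
  √(cauchyWeight c x / cauchyWeight c y) * (weightOne c y / weightOne c x) *
      cdKernel c (m - 1) x y +
    1 / 2 * gammaCoeff c (m - 2) * weightOne c y * rr c (m - 1) y *
      ∫ t, Real.sign (x - t) * rr c (m - 2) t * weightOne c t

/-- `s̃_k = (1/2) ∫ ω̃₁ P_k`. -/
def sTilde (c : ℂ) (k : ℕ) : ℝ := 1 / 2 * ∫ t, weightOne c t * rr c k t

/-- The kernel for Dyson index 1 and an odd number `m ≥ 3` of particles. -/
def kernelOneOdd (c : ℂ) (m : ℕ) (x y : ℝ) : ℝ :=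
  kernelOneEven c (m - 1) x y + weightOne c y * rr c (m - 1) y / (2 * sTilde c (m - 1)) -
    1 / 2 * gammaCoeff c (m - 3) * sTilde c (m - 3) * (weightOne c y / sTilde c (m - 1)) *
      ∫ t, weightOne c t * Real.sign (x - t) *
        (rr c (m - 1) t * rr c (m - 2) y - rr c (m - 2) t * rr c (m - 1) y)

open Classical in
/-- The kernel for Dyson index 1: `c = -N - p + 2 i q`. -/
def kernelOne (p q : ℝ) (N : ℕ) (x y : ℝ) : ℝ :=
  if Even N then kernelOneEven ⟨-N - p, 2 * q⟩ N x y else kernelOneOdd ⟨-N - p, 2 * q⟩ N x y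

/-- The kernel for Dyson index 4 with the weight kept as a free parameter. -/
def kernelFourAux (c : ℂ) (N : ℕ) (x y : ℝ) : ℝ :=
  1 / 2 * √(cauchyWeight c y * weightFour c x / (weightFour c y * cauchyWeight c x)) *
      cdKernel c (2 * N) x y -
    1 / 2 * gammaCoeff c (2 * N - 1) * (cauchyWeight c y / √(weightFour c y)) * rr c (2 * N) y *
      ∫ t in Set.Ioi x, rr c (2 * N - 1) t * (cauchyWeight c t / √(weightFour c t))

/-- The kernel for Dyson index 4: `c = -2 N - 2 p + i q`. -/
def kernelFour (p q : ℝ) (N : ℕ) (x y : ℝ) : ℝ := kernelFourAux ⟨-2 * N - 2 * p, q⟩ N x y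

/-! ### The scaling at the spectrum singularity -/

/-- `z(X) = i (1 + exp (2 i X / M)) / (1 - exp (2 i X / M))`, which is the real number
`-cot (X / M)`; see `zScale_eq`. -/
def zScale (M X : ℝ) : ℝ := -Real.cot (X / M)

/-- `S(z(X), z(Y)) dz/dX`. -/
def scaled (S : ℝ → ℝ → ℝ) (M X Y : ℝ) : ℝ :=
  S (zScale M X) (zScale M Y) * deriv (zScale M) X

/-- `E_N(X, Y) = O(1 / N ^ 2)`, uniformly on compact subsets of `{X > 0, Y > 0, X ≠ Y}`. -/
def IsOInvSq (E : ℕ → ℝ → ℝ → ℂ) : Prop :=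
  ∀ T : Set (ℝ × ℝ), IsCompact T → (∀ Z ∈ T, 0 < Z.1 ∧ 0 < Z.2 ∧ Z.1 ≠ Z.2) →
    ∃ (B : ℝ) (N₀ : ℕ), ∀ N ≥ N₀, ∀ Z ∈ T, ‖E N Z.1 Z.2‖ ≤ B / (N : ℝ) ^ 2

/-- `L = p (X ∂/∂X + Y ∂/∂Y + 1) K` on `{X > 0, Y > 0, X ≠ Y}`, where `K` is differentiable. -/
def IsDerivCorrection (p : ℝ) (K L : ℝ → ℝ → ℂ) : Prop :=
  ∀ X Y : ℝ, 0 < X → 0 < Y → X ≠ Y →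
    DifferentiableAt ℝ (fun Z : ℝ × ℝ => K Z.1 Z.2) (X, Y) ∧
    L X Y = p * (X * deriv (fun x => K x Y) X + Y * deriv (fun y => K X y) Y + K X Y)

/-! ### The limiting kernels and their corrections -/

/-- The confluent hypergeometric series `₁F₁(a; b; z) = ∑ (a)_n / (b)_n * z ^ n / n!`. With
Lean's `0 / 0 = 0` this gives `₁F₁(0; 0; z) = 1`. -/
def hyp11 (a b z : ℂ) : ℂ :=
  ∑' n : ℕ, (ascPochhammer ℂ n).eval a / (ascPochhammer ℂ n).eval b * z ^ n / (n.factorial : ℂ)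

/-- `Ã^{(a,q)}(j; X) = (a - i q)_j / (2 a)_j * ₁F₁(a + j - i q; 2 a + j; 2 i X)`. -/
def Atilde (a q : ℝ) (j : ℕ) (X : ℝ) : ℂ :=
  (ascPochhammer ℂ j).eval (a - Complex.I * q) / (ascPochhammer ℂ j).eval (2 * a : ℂ) *
    hyp11 (a + j - Complex.I * q) (2 * a + j) (2 * Complex.I * X)

/-- `C̃₀^{(p,q,k)}`. -/
def C₀ (p q : ℝ) (k : ℕ) (X : ℝ) : ℂ :=
  hyp11 (p + k - Complex.I * q) (2 * p + 2 * k) (2 * Complex.I * X)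

/-- `C̃₁^{(p,q,k)}`. -/
def C₁ (p q : ℝ) (k : ℕ) (X : ℝ) : ℂ :=
  1 / 2 * (2 * Complex.I * X) ^ 2 * (Atilde (p + k) q 1 X - Atilde (p + k) q 2 X) -
    k * (2 * Complex.I * X) * Atilde (p + k) q 1 X + (Complex.I * k + q) * X * C₀ p q k X

/-- `J₀^{(p,q,k)}`. -/
def J₀ (p q : ℝ) (k : ℕ) (X Y : ℝ) : ℂ :=
  X * C₀ p q (k + 1) X * C₀ p q k Y - Y * C₀ p q (k + 1) Y * C₀ p q k X

/-- `J₁^{(p,q,k)}`. -/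
def J₁ (p q : ℝ) (k : ℕ) (X Y : ℝ) : ℂ :=
  X * (C₀ p q (k + 1) X * C₁ p q k Y + C₁ p q (k + 1) X * C₀ p q k Y) -
    Y * (C₀ p q (k + 1) Y * C₁ p q k X + C₁ p q (k + 1) Y * C₀ p q k X)

/-- The common prefactor of the limiting kernel for Dyson index 2 and of its correction. -/
def prefactorTwo (p q : ℝ) (k : ℕ) (X Y : ℝ) : ℂ :=
  (2 ^ (2 * (p + k)) * ‖Complex.Gamma (p + k + 1 - Complex.I * q)‖ ^ 2 /
      (π * Real.Gamma (2 * p + 2 * k + 2) * Real.Gamma (2 * p + 2 * k + 1)) : ℝ) *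
    Complex.exp (-Complex.I * (X + Y) - q * π) *
    ((X * Y) ^ (p + k + 1) / (X ^ 2 * (X - Y)) : ℝ)

/-- The limiting kernel `K̂_{∞,2}^{(p,q;k)}`. -/
def KTwo (p q : ℝ) (k : ℕ) (X Y : ℝ) : ℂ := prefactorTwo p q k X Y * J₀ p q k X Y

/-- The correction `L̂_{1,2}^{(p,q;k)}`. -/
def LTwo (p q : ℝ) (k : ℕ) (X Y : ℝ) : ℂ :=
  prefactorTwo p q k X Y * (J₁ p q k X Y + p * (2 * p + 2 * k + 1) * J₀ p q k X Y)

/-- `η₁`. -/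
def η₁ (p q : ℝ) : ℝ :=
  2 * √π * (Real.Gamma (p + 2) * Real.Gamma (p + 5 / 2)) /
    ‖Complex.Gamma ((p + 3) / 2 + Complex.I * q)‖ ^ 2

/-- `η₂`. -/
def η₂ (p q : ℝ) : ℝ :=
  -((p + 1) * Real.exp (-q * π)) *
    (2 ^ (2 * p + 2) * ‖Complex.Gamma (p + 2 - 2 * Complex.I * q)‖ ^ 2 /
      (π * Real.Gamma (2 * p + 4) * Real.Gamma (2 * p + 3)))

/-- The integral operator `𝒥_o[f](X) = ∫_0^X e^{-i s - q π} s^{p+1} f(s) ds`. -/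
def Jo (p q : ℝ) (f : ℝ → ℂ) (X : ℝ) : ℂ :=
  ∫ s in (0 : ℝ)..X, Complex.exp (-Complex.I * s - q * π) * ((s ^ (p + 1) : ℝ) : ℂ) * f s

/-- The limiting kernel `K̂_{∞,1}` for Dyson index 1. -/
def KOne (p q : ℝ) (X Y : ℝ) : ℂ :=
  Y / X * KTwo p (2 * q) 1 X Y +
    η₂ p q / X ^ 2 * Complex.exp (-Complex.I * Y) * ((Y ^ (p + 2) : ℝ) : ℂ) *
      (C₀ p (2 * q) 1 Y * (Jo p q (C₀ p (2 * q) 2) X - η₁ p q / 2))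

/-- The correction `L̂_{1,1}` for Dyson index 1. -/
def LOne (p q : ℝ) (X Y : ℝ) : ℂ :=
  Y / X * LTwo p (2 * q) 1 X Y +
    η₂ p q / X ^ 2 * Complex.exp (-Complex.I * Y) * ((Y ^ (p + 2) : ℝ) : ℂ) *
      (C₀ p (2 * q) 1 Y * (Jo p q (C₁ p (2 * q) 2) X + p * (p + 2) * η₁ p q / 2) +
        (C₁ p (2 * q) 1 Y + p * (2 * p + 3) * C₀ p (2 * q) 1 Y) *
          (Jo p q (C₀ p (2 * q) 2) X - η₁ p q / 2))

/-- The integral operator `𝒥_s`. -/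
def Js (p q : ℝ) (f : ℝ → ℂ) (X Y : ℝ) : ℂ :=
  (-p * (2 ^ (8 * p + 1) * ‖Complex.Gamma (2 * p + 1 - Complex.I * q)‖ ^ 2 /
      (π * Real.Gamma (4 * p + 1) * Real.Gamma (4 * p + 2))) : ℝ) *
    Complex.exp (-q * π - 2 * Complex.I * Y) * ((Y ^ (2 * p + 1) : ℝ) : ℂ) *
    ∫ s in (0 : ℝ)..X, Complex.exp (-2 * Complex.I * s) * ((s ^ (2 * p) : ℝ) : ℂ) * f s

/-- `𝒥_{s,0}`. -/
def Js₀ (p q : ℝ) (X Y : ℝ) : ℂ :=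
  Js p q (fun s => C₀ (2 * p) q 0 (2 * Y) * C₀ (2 * p) q 1 (2 * s)) X Y

/-- `𝒥_{s,1}`. -/
def Js₁ (p q : ℝ) (X Y : ℝ) : ℂ :=
  Js p q (fun s => C₁ (2 * p) q 0 (2 * Y) * C₀ (2 * p) q 1 (2 * s) +
      C₀ (2 * p) q 0 (2 * Y) * C₁ (2 * p) q 1 (2 * s)) X Y +
    2 * p * (4 * p + 1) * Js₀ p q X Y

/-- The limiting kernel `K̂_{∞,4}` for Dyson index 4. -/
def KFour (p q : ℝ) (X Y : ℝ) : ℂ :=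
  Y / X * KTwo (2 * p) q 0 (2 * X) (2 * Y) + 1 / X ^ 2 * Js₀ p q X Y

/-- The correction `L̂_{1,4}` for Dyson index 4, as the coefficient of `1 / N` (the polynomials
that occur have degree about `2 N`; the coefficient of `1 / (2 N)` is twice this). -/
def LFour (p q : ℝ) (X Y : ℝ) : ℂ :=
  1 / 2 * (Y / X * LTwo (2 * p) q 0 (2 * X) (2 * Y) + 1 / X ^ 2 * Js₁ p q X Y)

/-! ### Agreement of the real forms with the complex ones -/

theorem cauchyWeight_eq_cpow (c : ℂ) (x : ℝ) :
    (cauchyWeight c x : ℂ) =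
      (1 - Complex.I * x) ^ c * (1 + Complex.I * x) ^ (starRingEnd ℂ c) := by
  have hpos : (0 : ℝ) < 1 + x ^ 2 := by positivity
  have hs : √(1 + x ^ 2) ≠ 0 := (Real.sqrt_pos.2 hpos).ne'
  have hL : ((√(1 + x ^ 2) : ℝ) : ℂ) = Complex.exp (Real.log (1 + x ^ 2) / 2 : ℝ) := by
    rw [← Complex.ofReal_exp, Real.exp_half, Real.exp_log hpos]
  have hplus : (1 + Complex.I * x : ℂ) =
      Complex.exp ((Real.log (1 + x ^ 2) / 2 : ℝ) + Real.arctan x * Complex.I) := by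
    rw [Complex.exp_add, ← hL, Complex.exp_mul_I, ← Complex.ofReal_cos, ← Complex.ofReal_sin,
      Real.cos_arctan, Real.sin_arctan]
    have : ((√(1 + x ^ 2) : ℝ) : ℂ) ≠ 0 := by exact_mod_cast hs
    push_cast
    field_simp
  have hminus : (1 - Complex.I * x : ℂ) =
      Complex.exp ((Real.log (1 + x ^ 2) / 2 : ℝ) + (-Real.arctan x : ℝ) * Complex.I) := by
    rw [Complex.exp_add, ← hL, Complex.exp_mul_I, ← Complex.ofReal_cos, ← Complex.ofReal_sin,
      Real.cos_neg, Real.sin_neg, Real.cos_arctan, Real.sin_arctan]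
    have : ((√(1 + x ^ 2) : ℝ) : ℂ) ≠ 0 := by exact_mod_cast hs
    push_cast
    field_simp
    ring
  have h1 := Real.arctan_lt_pi_div_two x
  have h2 := Real.neg_pi_div_two_lt_arctan x
  have h3 := Real.pi_pos
  rw [hplus, hminus, Complex.cpow_def_of_ne_zero (Complex.exp_ne_zero _),
    Complex.cpow_def_of_ne_zero (Complex.exp_ne_zero _), Complex.log_exp, Complex.log_exp,
    ← Complex.exp_add, cauchyWeight, Real.rpow_def_of_pos hpos, ← Real.exp_add,
    Complex.ofReal_exp]
  · congr 1
    apply Complex.ext <;> simp <;> ring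
  all_goals simp [-Complex.ofReal_arctan]
  all_goals linarith

theorem zScale_eq (M X : ℝ) :
    (zScale M X : ℂ) = Complex.I * (1 + Complex.exp (2 * Complex.I * X / M)) /
      (1 - Complex.exp (2 * Complex.I * X / M)) := by
  rw [zScale, Complex.ofReal_neg, Complex.ofReal_cot, Complex.cot_eq_exp_ratio,
    show (2 * Complex.I * ((X / M : ℝ) : ℂ)) = 2 * Complex.I * X / M by push_cast; ring,
    ← div_div, div_eq_mul_inv _ Complex.I, Complex.inv_I]
  ring

end

end CircularJacobi

open CircularJacobi

/-!
The proof rests on an Euler integral for the Routh-Romanovski polynomials. With `r = -Re c - n` and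
`q = Im c`, the polynomial `P_n(x)` is the mean of `(x - i (2 t - 1)) ^ n` with respect to the
normalised weight `t ^ (r - i q - 1) (1 - t) ^ (r + i q - 1)` on `[0, 1]` (`rr_eq_euler`): both are
monic and solve the same second-order equation. At `x = -cot θ` the integrand becomes, up to a power
of `sin θ`, `(cos θ + i v sin θ) ^ n` with `v = 2 t - 1`; for `θ = X / M` this tends to
`exp (i v X)`, whose mean is `exp (-i X)` times a confluent hypergeometric function (`euler_exp`),
and this is where the functions `C₀` come from.

The scale `M = N + p` is the right one because the term of order `1 / M` in this expansion is the
mean of a total derivative in `t`, hence zero (`euler_first_order`). So the polynomials converge with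
an error `O(1 / N ^ 2)` (`uniformApprox_trigEuler`). The remaining factors have no term of order
`1 / M` either: the sines are even in `1 / M` up to a power, and the norms `h_n`, which come from the
closed form `cauchyMass_eq` of the mass of the weight, bring in quotients of Gamma functions whose
arguments are placed symmetrically (`exists_abs_gammaRatio_sub_one_le`). Multiplying everything
gives the limit of the Christoffel-Darboux kernel, `uniformApprox_cdKernel`. At `p = q = 0` the
polynomial of degree `N` is not defined by orthogonality, as its product with `P_{N-1}` is not
integrable against the weight. The mean over the end points `t = 0, 1` replaces it: it is still orthogonal to `P_m` for `m ≤ N - 2`, which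
suffices for Christoffel-Darboux summation (`sum_rr_eq_euler`), and the resulting combination is
again the one in the limiting kernel (`expEuler_combination`).

For Dyson indices 1 and 4 the kernel is `√((1 + x²) / (1 + y²))` times a Christoffel-Darboux kernel
plus a rank one term with an incomplete integral of `ω̃₁ P_j` (`kernelOneEven_eq`, `kernelOneOdd_eq`,
`kernelFourAux_eq`). These formulas use the structure relation `skewOp_orthoPoly_succ`, by which
`ω̃₁ P_j` for two indices of the same parity combine to a total derivative, and `s̃_j = 0` for odd
`j`. For index 1 the constants in the rank one term are different expressions for even and odd
particle numbers. They have the same limit, by the closed form `sTilde_even` and the duplication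
formula. The limits are `uniformApprox_kernelOne` and `uniformApprox_kernelFour`.

Kummer's equation turns the definition of `C₁` into `C₁ = p (X C₀' - i X C₀)` (`C₁_eq`): up to the
exponential, `C₁` is the derivative of `C₀` along dilations. Therefore the correction `L` is `p` times
the derivative at `t = 1` of `t K(t X, t Y)`; in the integrals the derivative is removed by parts.
This is the differential identity, and it also gives the expansion at the scale `N`: the change from
`X / N` to `X / (N + p)` is a dilation by `1 + p / N`, and Taylor's formula of second order applies
(`exists_dilation_bound`, `isOInvSq_unshifted`).
-/

namespace CircularJacobi

noncomputable section

open Real MeasureTheory Polynomial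

/-! ### The normalised Euler integral -/

/-- The normalised Euler integral
`∫₀¹ t ^ (r - i q - 1) (1 - t) ^ (r + i q - 1) f(t) dt / B(r - i q, r + i q)`. For `r = 0` it stands
for its limit at `q = 0`, the mean of `f` over the two end points. -/
def euler (r q : ℝ) (f : ℝ → ℂ) : ℂ :=
  if r = 0 then (f 0 + f 1) / 2 else
    (∫ t in (0 : ℝ)..1, (t : ℂ) ^ ((r - Complex.I * q : ℂ) - 1) *
      (1 - (t : ℂ)) ^ ((r + Complex.I * q : ℂ) - 1) * f t) /
      Complex.betaIntegral (r - Complex.I * q) (r + Complex.I * q)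

/-- The parameters for which `euler` is used: a convergent integral, or its limit at the origin. -/
def EulerParam (r q : ℝ) : Prop := 0 < r ∨ (r = 0 ∧ q = 0)

theorem betaIntegral_ne_zero {u v : ℂ} (hu : 0 < u.re) (hv : 0 < v.re) :
    Complex.betaIntegral u v ≠ 0 := by
  intro h
  have := Complex.Gamma_mul_Gamma_eq_betaIntegral hu hv
  rw [h, mul_zero] at this
  exact mul_ne_zero (Complex.Gamma_ne_zero_of_re_pos hu) (Complex.Gamma_ne_zero_of_re_pos hv) this

theorem intervalIntegrable_beta_mul {r : ℝ} (q : ℝ) (hr : 0 < r) {f : ℝ → ℂ} (hf : Continuous f) :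
    IntervalIntegrable (fun t : ℝ => (t : ℂ) ^ ((r - Complex.I * q : ℂ) - 1) *
      (1 - (t : ℂ)) ^ ((r + Complex.I * q : ℂ) - 1) * f t) volume 0 1 :=
  (Complex.betaIntegral_convergent (by simpa using hr) (by simpa using hr)).mul_continuousOn
    hf.continuousOn

theorem euler_add (r q : ℝ) (h : EulerParam r q) {f g : ℝ → ℂ} (hf : Continuous f)
    (hg : Continuous g) : euler r q (fun t => f t + g t) = euler r q f + euler r q g := by
  unfold euler
  split_ifs with h0
  · ring
  · have hr : 0 < r := h.resolve_right fun h' => h0 h'.1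
    rw [← add_div, ← intervalIntegral.integral_add (intervalIntegrable_beta_mul q hr hf)
      (intervalIntegrable_beta_mul q hr hg)]
    simp only [mul_add]

theorem euler_const_mul (r q : ℝ) (z : ℂ) (f : ℝ → ℂ) :
    euler r q (fun t => z * f t) = z * euler r q f := by
  unfold euler
  split_ifs with h0
  · ring
  · rw [← mul_div_assoc, ← intervalIntegral.integral_const_mul]
    congr 2
    ext t
    ring

theorem euler_zero (r q : ℝ) : euler r q (fun _ => 0) = 0 := by
  have := euler_const_mul r q 0 (fun _ => 0)
  simpa using this

theorem euler_sum (r q : ℝ) (h : EulerParam r q) {ι : Type*} (s : Finset ι) {f : ι → ℝ → ℂ}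
    (hf : ∀ i, Continuous (f i)) :
    euler r q (fun t => ∑ i ∈ s, f i t) = ∑ i ∈ s, euler r q (f i) := by
  classical
  induction s using Finset.induction_on with
  | empty => simpa using euler_zero r q
  | insert i s hi ih =>
    simp only [Finset.sum_insert hi]
    rw [euler_add r q h (hf i) (continuous_finsetSum s fun j _ => hf j), ih]

theorem euler_one (r q : ℝ) (h : EulerParam r q) : euler r q (fun _ => 1) = 1 := by
  unfold euler
  split_ifs with h0
  · norm_num
  · have hr : 0 < r := h.resolve_right fun h' => h0 h'.1
    simp only [mul_one]
    exact div_self (betaIntegral_ne_zero (by simpa using hr) (by simpa using hr))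

/-- The Euler integral is a bounded functional for the sup norm on `[0, 1]`, so uniform expansions of
the integrand can be integrated term by term. -/
theorem exists_norm_euler_le (r q : ℝ) (h : EulerParam r q) :
    ∃ B : ℝ, 0 < B ∧ ∀ (f : ℝ → ℂ) (ε : ℝ), (∀ t ∈ Set.Icc (0 : ℝ) 1, ‖f t‖ ≤ ε) →
      ‖euler r q f‖ ≤ B * ε := by
  by_cases h0 : r = 0
  · refine ⟨1, one_pos, fun f ε hf => ?_⟩
    have h1 := hf 0 (by simp)
    have h2 := hf 1 (by simp)
    rw [euler, if_pos h0, norm_div, Complex.norm_two]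
    have := norm_add_le (f 0) (f 1)
    linarith
  · have hr : 0 < r := h.resolve_right fun h' => h0 h'.1
    have hint := intervalIntegrable_beta_mul q hr (f := fun _ => 1) continuous_const
    simp only [mul_one] at hint
    have hne := betaIntegral_ne_zero (u := r - Complex.I * q) (v := r + Complex.I * q)
      (by simpa using hr) (by simpa using hr)
    have hI : 0 ≤ ∫ t in (0 : ℝ)..1, ‖(t : ℂ) ^ ((r - Complex.I * q : ℂ) - 1) *
        (1 - (t : ℂ)) ^ ((r + Complex.I * q : ℂ) - 1)‖ :=
      intervalIntegral.integral_nonneg zero_le_one fun t _ => norm_nonneg _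
    refine ⟨(∫ t in (0 : ℝ)..1, ‖(t : ℂ) ^ ((r - Complex.I * q : ℂ) - 1) *
        (1 - (t : ℂ)) ^ ((r + Complex.I * q : ℂ) - 1)‖) /
        ‖Complex.betaIntegral (r - Complex.I * q) (r + Complex.I * q)‖ + 1, by positivity,
        fun f ε hf => ?_⟩
    have hε : 0 ≤ ε := (norm_nonneg _).trans (hf 0 (by simp))
    rw [euler, if_neg h0, norm_div, add_mul, div_mul_eq_mul_div]
    refine le_add_of_le_of_nonneg ?_ (by positivity)
    gcongr
    rw [← intervalIntegral.integral_mul_const]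
    refine intervalIntegral.norm_integral_le_of_norm_le zero_le_one ?_ (hint.norm.mul_const ε)
    refine Filter.Eventually.of_forall fun t ht => ?_
    rw [norm_mul _ (f t)]
    exact mul_le_mul_of_nonneg_left (hf t ⟨ht.1.le, ht.2⟩) (norm_nonneg _)

/-- Integration by parts for the Euler integral. -/
theorem euler_integral_by_parts (r q : ℝ) (h : EulerParam r q) {f f' : ℝ → ℂ}
    (hf : ∀ t, HasDerivAt f (f' t) t) (hf' : Continuous f') :
    euler r q (fun t => t * (1 - t) * f' t +
      ((r - Complex.I * q) * (1 - t) - (r + Complex.I * q) * t) * f t) = 0 := by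
  have hfc : Continuous f := continuous_iff_continuousAt.2 fun t => (hf t).continuousAt
  unfold euler
  split_ifs with h0
  · have hq : q = 0 := h.elim (fun h' => absurd h0 h'.ne') fun h' => h'.2
    simp [h0, hq]
  have hr : 0 < r := h.resolve_right fun h' => h0 h'.1
  set u : ℂ := r - Complex.I * q with hu
  set v : ℂ := r + Complex.I * q with hv
  have hur : 0 < u.re := by simpa [hu] using hr
  have hvr : 0 < v.re := by simpa [hv] using hr
  have hu0 : u ≠ 0 := by rintro h'; simp [h'] at hur
  have hv0 : v ≠ 0 := by rintro h'; simp [h'] at hvr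
  let F : ℝ → ℂ := fun t => (t : ℂ) ^ u * (1 - (t : ℂ)) ^ v * f t
  have hc : ContinuousOn F (Set.Icc 0 1) := by
    refine ((continuousOn_of_forall_continuousAt fun x hx => ?_).mul
        (continuousOn_of_forall_continuousAt fun x hx => ?_)).mul hfc.continuousOn
    · refine (Complex.continuousAt_cpow_const_of_re_pos (Or.inl ?_) hur).comp
        Complex.continuous_ofReal.continuousAt
      rw [Complex.ofReal_re]; exact hx.1
    · refine (Complex.continuousAt_cpow_const_of_re_pos (Or.inl ?_) hvr).comp (by fun_prop)
      rw [Complex.sub_re, Complex.one_re, Complex.ofReal_re, sub_nonneg]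
      exact hx.2
  have hder : ∀ x ∈ Set.Ioo (0 : ℝ) 1, HasDerivAt F ((x : ℂ) ^ (u - 1) *
      (1 - (x : ℂ)) ^ (v - 1) * (x * (1 - x) * f' x + (u * (1 - x) - v * x) * f x)) x := by
    intro x hx
    have hx0 : (x : ℂ) ≠ 0 := by exact_mod_cast hx.1.ne'
    have hx1 : (1 - x : ℂ) ≠ 0 := by exact_mod_cast (sub_pos.2 hx.2).ne'
    have U : HasDerivAt (fun y : ℂ => y ^ u) (u * (x : ℂ) ^ (u - 1)) ↑x := by
      have := @HasDerivAt.cpow_const _ _ _ u (hasDerivAt_id (x : ℂ)) (Or.inl hx.1)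
      simpa using this
    have V : HasDerivAt (fun y : ℂ => (1 - y) ^ v) (-(v * (1 - (x : ℂ)) ^ (v - 1))) ↑x := by
      have B : HasDerivAt (fun y : ℂ => 1 - y) (-1) ↑x := (hasDerivAt_id _).const_sub _
      have := @HasDerivAt.cpow_const _ _ _ v B (Or.inl (by simpa using hx.2))
      simpa using this
    convert! ((U.mul V).comp_ofReal).mul (hf x) using 1
    simp only [Pi.mul_apply]
    rw [Complex.cpow_sub _ _ hx0, Complex.cpow_sub _ _ hx1, Complex.cpow_one, Complex.cpow_one]
    field_simp
    ring
  have hint := intervalIntegrable_beta_mul q hr (f := fun t : ℝ => (t : ℂ) * (1 - t) * f' t +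
    (u * (1 - t) - v * t) * f t) (by fun_prop)
  rw [intervalIntegral.integral_eq_sub_of_hasDerivAt_of_le zero_le_one hc hder hint]
  simp [F, hu0, hv0]

/-- The moments of the Euler integral. -/
theorem euler_pow_succ (r q : ℝ) (h : EulerParam r q) (j : ℕ) :
    (2 * r + j : ℂ) * euler r q (fun t => (t : ℂ) ^ (j + 1)) =
      (r - Complex.I * q + j) * euler r q (fun t => (t : ℂ) ^ j) := by
  have hd : ∀ t : ℝ, HasDerivAt (fun t : ℝ => (t : ℂ) ^ j) (j * (t : ℂ) ^ (j - 1)) t := fun t => by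
    have := (hasDerivAt_pow j (t : ℂ)).comp_ofReal
    simpa using this
  have key := euler_integral_by_parts r q h hd (by fun_prop)
  have e : (fun t : ℝ => (t : ℂ) * (1 - t) * (j * (t : ℂ) ^ (j - 1)) +
      ((r - Complex.I * q) * (1 - t) - (r + Complex.I * q) * t) * (t : ℂ) ^ j) =
      fun t : ℝ => (r - Complex.I * q + j) * (t : ℂ) ^ j +
        (-(2 * r + j : ℂ)) * (t : ℂ) ^ (j + 1) := by
    ext t
    rcases j with _ | j
    · simp; ring
    · simp only [Nat.add_sub_cancel]; push_cast; ring
  rw [e, euler_add r q h (by fun_prop) (by fun_prop), euler_const_mul, euler_const_mul] at key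
  linear_combination -key

theorem euler_pow {r : ℝ} (q : ℝ) (hr : 0 < r) (j : ℕ) :
    euler r q (fun t => (t : ℂ) ^ j) =
      (ascPochhammer ℂ j).eval (r - Complex.I * q) / (ascPochhammer ℂ j).eval (2 * r : ℂ) := by
  induction j with
  | zero => simpa using euler_one r q (Or.inl hr)
  | succ j ih =>
    have hne : (2 * r + j : ℂ) ≠ 0 := by
      have : (0 : ℝ) < 2 * r + j := by positivity
      exact_mod_cast this.ne'
    have key := euler_pow_succ r q (Or.inl hr) j
    rw [ih] at key
    rw [ascPochhammer_succ_eval, ascPochhammer_succ_eval, mul_div_mul_comm, mul_div_assoc',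
      eq_div_iff hne, mul_comm _ (2 * r + j : ℂ), key]
    ring

/-- The Fourier-type transform of the Euler weight is Kummer's function. -/
theorem euler_exp {r : ℝ} (q : ℝ) (hr : 0 < r) (z : ℂ) :
    euler r q (fun t => Complex.exp (z * t)) = hyp11 (r - Complex.I * q) (2 * r) z := by
  have h : EulerParam r q := Or.inl hr
  obtain ⟨B, hB, hbd⟩ := exists_norm_euler_le r q h
  have hpart : ∀ n : ℕ, euler r q (fun t => ∑ m ∈ Finset.range n, (z * t) ^ m / (m.factorial : ℂ)) =
      ∑ m ∈ Finset.range n, (ascPochhammer ℂ m).eval (r - Complex.I * q) /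
        (ascPochhammer ℂ m).eval (2 * r : ℂ) * z ^ m / (m.factorial : ℂ) := by
    intro n
    rw [euler_sum r q h _ (fun m => by fun_prop)]
    refine Finset.sum_congr rfl fun m _ => ?_
    have : (fun t : ℝ => (z * t) ^ m / (m.factorial : ℂ)) =
        fun t : ℝ => (z ^ m / (m.factorial : ℂ)) * (t : ℂ) ^ m := by ext t; ring
    rw [this, euler_const_mul, euler_pow q hr]
    ring
  have hlim : Filter.Tendsto (fun n : ℕ => ∑ m ∈ Finset.range n,
      (ascPochhammer ℂ m).eval (r - Complex.I * q) /
        (ascPochhammer ℂ m).eval (2 * r : ℂ) * z ^ m / (m.factorial : ℂ)) Filter.atTop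
      (nhds (euler r q (fun t => Complex.exp (z * t)))) := by
    have hto : Filter.Tendsto (fun n : ℕ => B * (Real.exp ‖z‖ -
        ∑ m ∈ Finset.range n, ‖z‖ ^ m / (m.factorial : ℝ))) Filter.atTop (nhds 0) := by
      have h1 : HasSum (fun m : ℕ => ‖z‖ ^ m / (m.factorial : ℝ)) (Real.exp ‖z‖) := by
        rw [Real.exp_eq_exp_ℝ]
        exact NormedSpace.expSeries_div_hasSum_exp ‖z‖
      have h2 := (h1.tendsto_sum_nat.const_sub (Real.exp ‖z‖)).const_mul B
      simpa using h2
    rw [tendsto_iff_norm_sub_tendsto_zero]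
    refine squeeze_zero (fun _ => norm_nonneg _) (fun n => ?_) hto
    rw [← hpart, norm_sub_rev]
    have : euler r q (fun t => Complex.exp (z * t)) -
        euler r q (fun t => ∑ m ∈ Finset.range n, (z * t) ^ m / (m.factorial : ℂ)) =
        euler r q (fun t => Complex.exp (z * t) +
          (-1) * ∑ m ∈ Finset.range n, (z * t) ^ m / (m.factorial : ℂ)) := by
      rw [euler_add r q h (by fun_prop) (by fun_prop), euler_const_mul]
      ring
    rw [this]
    refine hbd _ _ fun t ht => ?_
    rw [neg_one_mul, ← sub_eq_add_neg]
    have hz : ‖z * t‖ ≤ ‖z‖ := by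
      rw [norm_mul, Complex.norm_real, Real.norm_of_nonneg ht.1]
      exact mul_le_of_le_one_right (norm_nonneg _) ht.2
    -- the tail of the exponential series at `‖z t‖` is at most the tail at `‖z‖`
    refine (Complex.norm_exp_sub_sum_le_exp_norm_sub_sum _ n).trans ?_
    have tail : ∀ x : ℝ, HasSum (fun m : ℕ => x ^ (m + n) / ((m + n).factorial : ℝ))
        (Real.exp x - ∑ m ∈ Finset.range n, x ^ m / (m.factorial : ℝ)) := fun x => by
      have h1 : HasSum (fun m : ℕ => x ^ m / (m.factorial : ℝ)) (Real.exp x) := by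
        rw [Real.exp_eq_exp_ℝ]
        exact NormedSpace.expSeries_div_hasSum_exp x
      exact (hasSum_nat_add_iff' n).2 h1
    exact hasSum_le (fun m => by gcongr) (tail _) (tail _)
  have hs : Summable (fun m : ℕ => (ascPochhammer ℂ m).eval (r - Complex.I * q) /
        (ascPochhammer ℂ m).eval (2 * r : ℂ) * z ^ m / (m.factorial : ℂ)) := by
    refine Summable.of_norm_bounded (g := fun m : ℕ => B * (‖z‖ ^ m / (m.factorial : ℝ)))
      ((Real.summable_pow_div_factorial ‖z‖).mul_left B) fun m => ?_
    rw [← euler_pow q hr, mul_div_assoc, norm_mul, norm_div, norm_pow, Complex.norm_natCast]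
    gcongr
    refine (hbd _ 1 fun t ht => ?_).trans (by simp)
    rw [norm_pow, Complex.norm_real, Real.norm_of_nonneg ht.1]
    exact pow_le_one₀ ht.1 ht.2
  rw [hyp11]
  exact tendsto_nhds_unique hlim hs.hasSum.tendsto_sum_nat

/-! ### The generalised Cauchy weight -/

theorem cauchyWeight_pos (c : ℂ) (x : ℝ) : 0 < cauchyWeight c x := by
  unfold cauchyWeight
  positivity

theorem continuous_cauchyWeight (c : ℂ) : Continuous (cauchyWeight c) := by
  unfold cauchyWeight
  have : Continuous fun x : ℝ => (1 + x ^ 2) ^ c.re :=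
    Continuous.rpow_const (by fun_prop) fun x => Or.inl (by positivity)
  fun_prop

theorem cauchyWeight_add_one (c : ℂ) (x : ℝ) :
    cauchyWeight (c + 1) x = cauchyWeight c x * (1 + x ^ 2) := by
  unfold cauchyWeight
  rw [Complex.add_re, Complex.one_re, Complex.add_im, Complex.one_im, add_zero,
    Real.rpow_add_one (by positivity)]
  ring

theorem hasDerivAt_cauchyWeight_add_one (c : ℂ) (x : ℝ) :
    HasDerivAt (cauchyWeight (c + 1))
      (cauchyWeight c x * (2 * (c.re + 1) * x + 2 * c.im)) x := by
  have hx : (0 : ℝ) < 1 + x ^ 2 := by positivity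
  have h1 : HasDerivAt (fun x : ℝ => 1 + x ^ 2) (2 * x) x := by
    simpa using (hasDerivAt_pow 2 x).const_add 1
  have h2 := h1.rpow_const (p := c.re + 1) (Or.inl hx.ne')
  have h3 := ((Real.hasDerivAt_arctan x).const_mul (2 * c.im)).exp
  have h4 := h2.mul h3
  have e : cauchyWeight (c + 1) = (fun x : ℝ => (1 + x ^ 2) ^ (c.re + 1)) *
      fun x => Real.exp (2 * c.im * Real.arctan x) := by
    ext y
    simp [cauchyWeight]
  rw [e]
  convert! h4 using 1
  rw [add_sub_cancel_right, cauchyWeight, Real.rpow_add_one hx.ne']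
  field_simp

theorem cauchyWeight_le (c : ℂ) (x : ℝ) :
    cauchyWeight c x ≤ Real.exp (|c.im| * π) * (1 + x ^ 2) ^ c.re := by
  unfold cauchyWeight
  rw [mul_comm]
  refine mul_le_mul_of_nonneg_right (Real.exp_le_exp.2 ?_) (by positivity)
  have h : |Real.arctan x| ≤ π / 2 :=
    abs_le.2 ⟨(Real.neg_pi_div_two_lt_arctan x).le, (Real.arctan_lt_pi_div_two x).le⟩
  calc 2 * c.im * Real.arctan x ≤ |2 * c.im * Real.arctan x| := le_abs_self _
    _ = 2 * |c.im| * |Real.arctan x| := by rw [abs_mul, abs_mul, abs_two]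
    _ ≤ 2 * |c.im| * (π / 2) := by gcongr
    _ = |c.im| * π := by ring

theorem exists_abs_eval_le (A : ℝ[X]) {d : ℕ} (hd : A.natDegree ≤ d) :
    ∃ B : ℝ, 0 ≤ B ∧ ∀ x : ℝ, |A.eval x| ≤ B * (1 + x ^ 2) ^ ((d : ℝ) / 2) := by
  refine ⟨∑ i ∈ Finset.range (d + 1), |A.coeff i|, by positivity, fun x => ?_⟩
  rw [A.eval_eq_sum_range' (Nat.lt_succ_of_le hd), Finset.sum_mul]
  refine (Finset.abs_sum_le_sum_abs _ _).trans (Finset.sum_le_sum fun i hi => ?_)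
  rw [abs_mul, abs_pow]
  gcongr
  have h1 : |x| ≤ (1 + x ^ 2) ^ ((1 : ℝ) / 2) := by
    rw [← Real.sqrt_eq_rpow]
    exact Real.abs_le_sqrt (by linarith)
  have h2 : (1 : ℝ) ≤ (1 + x ^ 2) ^ ((1 : ℝ) / 2) :=
    Real.one_le_rpow (by nlinarith [sq_nonneg x]) (by norm_num)
  calc |x| ^ i ≤ ((1 + x ^ 2) ^ ((1 : ℝ) / 2)) ^ i := by gcongr
    _ ≤ ((1 + x ^ 2) ^ ((1 : ℝ) / 2)) ^ d :=
      pow_le_pow_right₀ h2 (Nat.lt_succ_iff.1 (Finset.mem_range.1 hi))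
    _ = (1 + x ^ 2) ^ ((d : ℝ) / 2) := by
      rw [← Real.rpow_natCast, ← Real.rpow_mul (by positivity)]
      congr 1
      ring

theorem exists_abs_weight_mul_eval_le (c : ℂ) (A : ℝ[X]) {d : ℕ} (hd : A.natDegree ≤ d) :
    ∃ B : ℝ, 0 ≤ B ∧ ∀ x : ℝ,
      |cauchyWeight c x * A.eval x| ≤ B * (1 + x ^ 2) ^ (c.re + (d : ℝ) / 2) := by
  obtain ⟨B, hB, h⟩ := exists_abs_eval_le A hd
  refine ⟨Real.exp (|c.im| * π) * B, by positivity, fun x => ?_⟩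
  rw [abs_mul, abs_of_pos (cauchyWeight_pos c x), Real.rpow_add (by positivity)]
  calc cauchyWeight c x * |A.eval x| ≤ (Real.exp (|c.im| * π) * (1 + x ^ 2) ^ c.re) *
        (B * (1 + x ^ 2) ^ ((d : ℝ) / 2)) :=
        mul_le_mul (cauchyWeight_le c x) (h x) (abs_nonneg _) (by positivity)
    _ = _ := by ring

theorem integrable_weight_mul_eval (c : ℂ) (A : ℝ[X]) {d : ℕ} (hd : A.natDegree ≤ d)
    (h : (d : ℝ) + 2 * c.re < -1) : Integrable fun x => cauchyWeight c x * A.eval x := by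
  obtain ⟨B, hB, hbd⟩ := exists_abs_weight_mul_eval_le c A hd
  have h1 : Integrable fun x : ℝ => (1 + ‖x‖ ^ 2) ^ (-(-(2 * c.re + d)) / 2) :=
    integrable_rpow_neg_one_add_norm_sq (by simp; linarith)
  refine (h1.const_mul B).mono' ?_ (Filter.Eventually.of_forall fun x => ?_)
  · exact ((continuous_cauchyWeight c).mul A.continuous).aestronglyMeasurable
  · refine (hbd x).trans (le_of_eq ?_)
    simp only [Real.norm_eq_abs, sq_abs]
    congr 2
    ring

theorem tendsto_weight_mul_eval (c : ℂ) (A : ℝ[X]) {d : ℕ} (hd : A.natDegree ≤ d)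
    (h : (d : ℝ) + 2 * c.re < 0) :
    Filter.Tendsto (fun x => cauchyWeight c x * A.eval x) Filter.atTop (nhds 0) ∧
    Filter.Tendsto (fun x => cauchyWeight c x * A.eval x) Filter.atBot (nhds 0) := by
  obtain ⟨B, hB, hbd⟩ := exists_abs_weight_mul_eval_le c A hd
  have h0 : Filter.Tendsto (fun y : ℝ => B * y ^ (-(-(c.re + (d : ℝ) / 2)))) Filter.atTop
      (nhds 0) := by
    simpa using (tendsto_rpow_neg_atTop (y := -(c.re + (d : ℝ) / 2)) (by linarith)).const_mul B
  have ht : Filter.Tendsto (fun x : ℝ => 1 + x ^ 2) Filter.atTop Filter.atTop :=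
    Filter.tendsto_atTop_add_const_left _ _ (Filter.tendsto_pow_atTop (by norm_num))
  have hb : Filter.Tendsto (fun x : ℝ => 1 + x ^ 2) Filter.atBot Filter.atTop := by
    have := ht.comp Filter.tendsto_neg_atBot_atTop
    simpa [Function.comp_def] using this
  constructor
  · refine squeeze_zero_norm (fun x => ?_) (h0.comp ht)
    simpa using hbd x
  · refine squeeze_zero_norm (fun x => ?_) (h0.comp hb)
    simpa using hbd x

/-- The integral of a polynomial against the generalised Cauchy weight. -/
def cauchyInt (c : ℂ) (A : ℝ[X]) : ℝ := ∫ x, cauchyWeight c x * A.eval x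

theorem cauchyInt_add (c : ℂ) (A B : ℝ[X]) {d : ℕ} (hA : A.natDegree ≤ d) (hB : B.natDegree ≤ d)
    (h : (d : ℝ) + 2 * c.re < -1) : cauchyInt c (A + B) = cauchyInt c A + cauchyInt c B := by
  unfold cauchyInt
  rw [← integral_add (integrable_weight_mul_eval c A hA h) (integrable_weight_mul_eval c B hB h)]
  simp [mul_add]

theorem cauchyInt_C_mul (c : ℂ) (k : ℝ) (A : ℝ[X]) :
    cauchyInt c (C k * A) = k * cauchyInt c A := by
  unfold cauchyInt
  rw [← integral_const_mul]
  congr 1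
  ext x
  simp only [eval_mul, eval_C]
  ring

theorem cauchyInt_zero (c : ℂ) : cauchyInt c 0 = 0 := by simp [cauchyInt]

theorem cauchyInt_neg (c : ℂ) (A : ℝ[X]) : cauchyInt c (-A) = -cauchyInt c A := by
  have := cauchyInt_C_mul c (-1) A
  simpa using this

theorem cauchyInt_sub (c : ℂ) (A B : ℝ[X]) {d : ℕ} (hA : A.natDegree ≤ d) (hB : B.natDegree ≤ d)
    (h : (d : ℝ) + 2 * c.re < -1) : cauchyInt c (A - B) = cauchyInt c A - cauchyInt c B := by
  rw [sub_eq_add_neg, cauchyInt_add c A (-B) hA (by rwa [natDegree_neg]) h, cauchyInt_neg]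
  ring

theorem cauchyInt_sum (c : ℂ) {ι : Type*} (s : Finset ι) (A : ι → ℝ[X]) {d : ℕ}
    (hA : ∀ i ∈ s, (A i).natDegree ≤ d) (h : (d : ℝ) + 2 * c.re < -1) :
    cauchyInt c (∑ i ∈ s, A i) = ∑ i ∈ s, cauchyInt c (A i) := by
  unfold cauchyInt
  rw [← integral_finsetSum s fun i hi => integrable_weight_mul_eval c (A i) (hA i hi) h]
  simp [eval_finsetSum, Finset.mul_sum]

/-- A polynomial whose square has weighted integral zero vanishes. -/
theorem eq_zero_of_cauchyInt_mul_self (c : ℂ) (A : ℝ[X]) {d : ℕ} (hA : A.natDegree ≤ d)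
    (h : (d : ℝ) + d + 2 * c.re < -1) (h0 : cauchyInt c (A * A) = 0) : A = 0 := by
  have hd : (A * A).natDegree ≤ d + d := natDegree_mul_le_of_le hA hA
  have hint := integrable_weight_mul_eval c (A * A) hd (by push_cast; linarith)
  have hnn : 0 ≤ fun x => cauchyWeight c x * (A * A).eval x := fun x => by
    simp only [eval_mul]
    exact mul_nonneg (cauchyWeight_pos c x).le (mul_self_nonneg _)
  have h1 := (integral_eq_zero_iff_of_nonneg hnn hint).1 h0
  have h2 := (Continuous.ae_eq_iff_eq volume
    ((continuous_cauchyWeight c).mul (A * A).continuous) continuous_const).1 h1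
  refine Polynomial.funext fun x => ?_
  have h3 : cauchyWeight c x * (A * A).eval x = 0 := congrFun h2 x
  simpa [(cauchyWeight_pos c x).ne'] using h3

/-- The integral over the line of the derivative of `(1 + x ^ 2) ω(x) A(x)` vanishes. -/
theorem cauchyInt_deriv (c : ℂ) (A : ℝ[X]) {d : ℕ} (hA : A.natDegree ≤ d)
    (h : (d : ℝ) + 2 * c.re + 2 < 0) :
    cauchyInt c ((1 + X ^ 2) * derivative A + (C (2 * (c.re + 1)) * X + C (2 * c.im)) * A) = 0 := by
  have hder : ∀ x, HasDerivAt (fun x => cauchyWeight (c + 1) x * A.eval x)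
      (cauchyWeight c x * ((1 + X ^ 2) * derivative A +
        (C (2 * (c.re + 1)) * X + C (2 * c.im)) * A).eval x) x := fun x => by
    convert! (hasDerivAt_cauchyWeight_add_one c x).mul (A.hasDerivAt x) using 1
    rw [cauchyWeight_add_one]
    simp
    ring
  have hdeg : ((1 + X ^ 2) * derivative A +
      (C (2 * (c.re + 1)) * X + C (2 * c.im)) * A).natDegree ≤ d + 1 := by
    refine natDegree_add_le_of_degree_le ?_ ?_
    · by_cases h0 : A.natDegree = 0
      · rw [natDegree_eq_zero.1 h0 |>.choose_spec.symm]
        simp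
      · have h1 : (derivative A).natDegree ≤ d - 1 :=
          (natDegree_derivative_le A).trans (Nat.sub_le_sub_right hA 1)
        have h2 : (1 + X ^ 2 : ℝ[X]).natDegree ≤ 2 := by compute_degree
        refine (natDegree_mul_le_of_le h2 h1).trans ?_
        omega
    · have h2 : (C (2 * (c.re + 1)) * X + C (2 * c.im) : ℝ[X]).natDegree ≤ 1 := by compute_degree
      exact (natDegree_mul_le_of_le h2 hA).trans (by omega)
  have hlim := tendsto_weight_mul_eval (c + 1) A hA (by simp; linarith)
  have := integral_of_hasDerivAt_of_tendsto hder
    (integrable_weight_mul_eval c _ hdeg (by push_cast; linarith)) hlim.2 hlim.1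
  simpa [cauchyInt] using this

/-! ### The second-order operator of the Routh-Romanovski polynomials -/

/-- The operator `A ↦ (1 + x ^ 2) A'' + (2 (a + 1) x + 2 b) A'`, symmetric for the weight `ω₂`
with `c = a + i b`. -/
def romOp {K : Type*} [CommRing K] (a b : K) (A : K[X]) : K[X] :=
  (1 + X ^ 2) * derivative (derivative A) + (C (2 * (a + 1)) * X + C (2 * b)) * derivative A

theorem coeff_romOp {K : Type*} [CommRing K] (a b : K) (A : K[X]) (k : ℕ) :
    (romOp a b A).coeff k = k * (k + 1 + 2 * a) * A.coeff k + 2 * b * (k + 1) * A.coeff (k + 1) +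
      (k + 1) * (k + 2) * A.coeff (k + 2) := by
  unfold romOp
  rw [add_mul, add_mul, one_mul, mul_assoc]
  rcases k with _ | _ | k
  · simp only [coeff_add, coeff_C_mul, coeff_X_pow_mul', coeff_X_mul_zero, coeff_derivative]
    norm_num
    ring
  · simp only [coeff_add, coeff_C_mul, coeff_X_pow_mul', coeff_X_mul, coeff_derivative]
    norm_num
    ring
  · simp only [coeff_add, coeff_C_mul, coeff_X_pow_mul', coeff_X_mul, coeff_derivative,
      if_pos (Nat.le_add_left 2 k)]
    push_cast
    ring

/-- The operator determines a monic eigenpolynomial of degree `n`, as long as `n (n + 1 + 2 a)` is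
not an eigenvalue for a smaller degree. -/
theorem eq_zero_of_romOp_eq {K : Type*} [Field K] (a b : K) (n : ℕ) (A : K[X])
    (hA : A.degree < n) (h : romOp a b A = C (n * (n + 1 + 2 * a)) * A)
    (hne : ∀ m < n, (m * (m + 1 + 2 * a) : K) ≠ n * (n + 1 + 2 * a)) : A = 0 := by
  by_contra h0
  have hm : A.natDegree < n := (natDegree_lt_iff_degree_lt h0).2 hA
  have h1 := congrArg (fun B => B.coeff A.natDegree) h
  simp only [coeff_romOp, coeff_C_mul, coeff_eq_zero_of_natDegree_lt (Nat.lt_add_one A.natDegree),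
    coeff_eq_zero_of_natDegree_lt (show A.natDegree < A.natDegree + 2 by omega), mul_zero,
    add_zero] at h1
  exact hne _ hm (mul_right_cancel₀ (leadingCoeff_ne_zero.2 h0) h1)

/-! ### Orthogonal polynomials for the generalised Cauchy weight -/

theorem orthoPoly_monic_and_degree (w : ℝ → ℝ) (n : ℕ) :
    (orthoPoly w n).Monic ∧ (orthoPoly w n).natDegree = n := by
  induction n using Nat.strong_induction_on with
  | _ n ih =>
    have hd : (-∑ m : Fin n, C ((∫ x, w x * x ^ n * (orthoPoly w m).eval x) /
        ∫ x, w x * (orthoPoly w m).eval x ^ 2) * orthoPoly w m).degree < n := by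
      rw [degree_neg, ← mem_degreeLT]
      refine Submodule.sum_mem _ fun m _ => ?_
      rw [C_mul']
      refine Submodule.smul_mem _ _ (mem_degreeLT.2 ?_)
      rw [degree_eq_natDegree (ih m m.isLt).1.ne_zero, (ih m m.isLt).2]
      exact_mod_cast m.isLt
    rw [orthoPoly, sub_eq_add_neg]
    refine ⟨monic_X_pow_add hd, ?_⟩
    refine natDegree_eq_of_degree_eq_some ?_
    rw [degree_add_eq_left_of_degree_lt (by rwa [degree_X_pow]), degree_X_pow]

theorem orthoPoly_monic (w : ℝ → ℝ) (n : ℕ) : (orthoPoly w n).Monic :=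
  (orthoPoly_monic_and_degree w n).1

theorem natDegree_orthoPoly (w : ℝ → ℝ) (n : ℕ) : (orthoPoly w n).natDegree = n :=
  (orthoPoly_monic_and_degree w n).2

theorem coeff_orthoPoly_self (w : ℝ → ℝ) (n : ℕ) : (orthoPoly w n).coeff n = 1 := by
  have := (orthoPoly_monic w n).coeff_natDegree
  rwa [natDegree_orthoPoly] at this

theorem orthoPoly_zero (w : ℝ → ℝ) : orthoPoly w 0 = 1 := by
  rw [orthoPoly]
  simp

theorem natDegree_le_of_degree_lt_succ {A : ℝ[X]} {n : ℕ} (h : A.degree < (n + 1 : ℕ)) :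
    A.natDegree ≤ n := by
  by_cases h0 : A = 0
  · simp [h0]
  · exact Nat.lt_succ_iff.1 ((natDegree_lt_iff_degree_lt h0).2 h)

theorem degree_lt_succ_of_natDegree_le {A : ℝ[X]} {n : ℕ} (h : A.natDegree ≤ n) :
    A.degree < (n + 1 : ℕ) :=
  (degree_lt_iff_coeff_zero _ _).2 fun _ hm => coeff_eq_zero_of_natDegree_lt (by omega)

theorem degree_lt_of_coeff_eq_zero {A : ℝ[X]} {n : ℕ} (hA : A.natDegree ≤ n)
    (h : A.coeff n = 0) : A.degree < n := by
  refine (degree_lt_iff_coeff_zero _ _).2 fun m hm => ?_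
  rcases hm.eq_or_lt with rfl | hm
  · exact h
  · exact coeff_eq_zero_of_natDegree_lt (by omega)

theorem degree_sub_C_mul_orthoPoly_lt (w : ℝ → ℝ) {A : ℝ[X]} {n : ℕ} (hA : A.natDegree ≤ n) :
    (A - C (A.coeff n) * orthoPoly w n).degree < n := by
  refine degree_lt_of_coeff_eq_zero ?_ (by simp [coeff_orthoPoly_self])
  refine (natDegree_sub_le_of_le hA ((natDegree_C_mul_le _ _).trans
    (natDegree_orthoPoly w n).le)).trans (by simp)

/-- Orthogonality to `P_0, …, P_{k-1}` is orthogonality to all polynomials of degree below `k`. -/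
theorem cauchyInt_mul_eq_zero_of_forall (c : ℂ) (w : ℝ → ℝ) (A : ℝ[X]) (d k : ℕ)
    (hA : A.natDegree ≤ d) (h : (d : ℝ) + k + 2 * c.re < 0)
    (horth : ∀ m < k, cauchyInt c (A * orthoPoly w m) = 0) (B : ℝ[X])
    (hB : B.degree < k) : cauchyInt c (A * B) = 0 := by
  induction k generalizing B with
  | zero =>
    have : B = 0 := by simpa using hB
    simp [this, cauchyInt_zero]
  | succ k ih =>
    have hBk : B.natDegree ≤ k := natDegree_le_of_degree_lt_succ hB
    have h1 := ih (by push_cast at h; linarith) (fun m hm => horth m (by omega)) _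
      (degree_sub_C_mul_orthoPoly_lt w hBk)
    have e : A * B = A * (B - C (B.coeff k) * orthoPoly w k) +
        C (B.coeff k) * (A * orthoPoly w k) := by ring
    have hd1 : (A * orthoPoly w k).natDegree ≤ d + k :=
      natDegree_mul_le_of_le hA (natDegree_orthoPoly w k).le
    rw [e, cauchyInt_add c (d := d + k) _ _ ?_ ((natDegree_C_mul_le _ _).trans hd1)
      (by push_cast at h ⊢; linarith), h1, cauchyInt_C_mul, horth k (by omega)]
    · simp
    · refine natDegree_mul_le_of_le hA ((natDegree_sub_le_of_le hBk ((natDegree_C_mul_le _ _).trans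
        (natDegree_orthoPoly w k).le)).trans (by simp))

theorem rrNorm_eq (c : ℂ) (n : ℕ) :
    rrNorm c n = cauchyInt c (orthoPoly (cauchyWeight c) n * orthoPoly (cauchyWeight c) n) := by
  simp only [rrNorm, rr, cauchyInt, eval_mul, sq]

theorem rrNorm_pos (c : ℂ) (n : ℕ) (h : 2 * (n : ℝ) + 2 * c.re < -1) : 0 < rrNorm c n := by
  refine lt_of_le_of_ne ?_ fun h0 => ?_
  · exact integral_nonneg fun x => mul_nonneg (cauchyWeight_pos c x).le (sq_nonneg _)
  · rw [rrNorm_eq] at h0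
    exact (orthoPoly_monic (cauchyWeight c) n).ne_zero (eq_zero_of_cauchyInt_mul_self c _
      (natDegree_orthoPoly _ n).le (by linarith) h0.symm)

theorem cauchyInt_orthoPoly_mul_orthoPoly (c : ℂ) (n : ℕ) (h : (n : ℝ) < -c.re) (m : ℕ)
    (hm : m < n) :
    cauchyInt c (orthoPoly (cauchyWeight c) n * orthoPoly (cauchyWeight c) m) = 0 := by
  induction n using Nat.strong_induction_on generalizing m with
  | _ n ih =>
    set P := orthoPoly (cauchyWeight c) with hP
    have hn1 : ((n - 1 : ℕ) : ℝ) = n - 1 := by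
      rw [Nat.cast_sub (by omega), Nat.cast_one]
    have hdeg : ∀ k ∈ (Finset.univ : Finset (Fin n)),
        (C ((∫ x, cauchyWeight c x * x ^ n * (P k).eval x) /
        ∫ x, cauchyWeight c x * (P k).eval x ^ 2) * (P k * P m)).natDegree ≤ n + (n - 1) :=
      fun k _ => (natDegree_C_mul_le _ _).trans (natDegree_mul_le_of_le
        ((natDegree_orthoPoly _ _).le.trans k.isLt.le)
        ((natDegree_orthoPoly _ _).le.trans (by omega)))
    have e : P n * P m = X ^ n * P m - ∑ k : Fin n,
        C ((∫ x, cauchyWeight c x * x ^ n * (P k).eval x) /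
        ∫ x, cauchyWeight c x * (P k).eval x ^ 2) * (P k * P m) := by
      rw [hP, orthoPoly, sub_mul, Finset.sum_mul]
      simp only [mul_assoc]
    rw [e, cauchyInt_sub c (d := n + (n - 1)), cauchyInt_sum c (d := n + (n - 1)),
      Finset.sum_eq_single (⟨m, hm⟩ : Fin n)]
    · have h1 : ∫ x, cauchyWeight c x * x ^ n * (P m).eval x = cauchyInt c (X ^ n * P m) := by
        simp [cauchyInt, mul_assoc]
      have h2 : ∫ x, cauchyWeight c x * (P m).eval x ^ 2 = cauchyInt c (P m * P m) := by
        simp [cauchyInt, sq]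
      have h3 : cauchyInt c (P m * P m) ≠ 0 := by
        rw [hP, ← rrNorm_eq]
        refine (rrNorm_pos c m ?_).ne'
        have : (m : ℝ) + 1 ≤ n := by exact_mod_cast hm
        linarith
      rw [cauchyInt_C_mul, h1, h2, div_mul_cancel₀ _ h3, sub_self]
    · intro k _ hk
      rw [cauchyInt_C_mul]
      rcases lt_trichotomy (k : ℕ) m with hkm | hkm | hkm
      · rw [mul_comm (P k), ih m hm (lt_trans (by exact_mod_cast hm) h) k hkm, mul_zero]
      · exact absurd (Fin.ext hkm) hk
      · rw [ih k k.isLt (lt_trans (by exact_mod_cast k.isLt) h) m hkm, mul_zero]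
    · simp
    · exact hdeg
    · push_cast [hn1]; linarith
    · exact natDegree_mul_le_of_le (natDegree_X_pow_le n)
        ((natDegree_orthoPoly _ _).le.trans (by omega))
    · exact natDegree_sum_le_of_forall_le _ _ hdeg
    · push_cast [hn1]; linarith

theorem cauchyInt_orthoPoly_mul (c : ℂ) (n : ℕ) (h : (n : ℝ) < -c.re) (A : ℝ[X])
    (hA : A.degree < n) : cauchyInt c (orthoPoly (cauchyWeight c) n * A) = 0 :=
  cauchyInt_mul_eq_zero_of_forall c _ _ n n (natDegree_orthoPoly _ n).le (by linarith)
    (fun m hm => cauchyInt_orthoPoly_mul_orthoPoly c n h m hm) A hA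

theorem cauchyInt_orthoPoly_mul_of_natDegree_le (c : ℂ) (n : ℕ) (h : 2 * (n : ℝ) + 2 * c.re < -1)
    (A : ℝ[X]) (hA : A.natDegree ≤ n) :
    cauchyInt c (orthoPoly (cauchyWeight c) n * A) = A.coeff n * rrNorm c n := by
  set P := orthoPoly (cauchyWeight c) n with hP
  have hPd : P.natDegree ≤ n := (natDegree_orthoPoly _ n).le
  have e : P * A = P * (A - C (A.coeff n) * P) + C (A.coeff n) * (P * P) := by ring
  have hAd := degree_sub_C_mul_orthoPoly_lt (cauchyWeight c) hA
  rw [e, cauchyInt_add c (d := n + n), cauchyInt_orthoPoly_mul c n (by linarith) _ hAd,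
    cauchyInt_C_mul, ← rrNorm_eq, zero_add]
  · exact natDegree_mul_le_of_le hPd ((natDegree_sub_le_of_le hA
      ((natDegree_C_mul_le _ _).trans hPd)).trans (by simp))
  · exact (natDegree_C_mul_le _ _).trans (natDegree_mul_le_of_le hPd hPd)
  · push_cast; linarith

/-- The second-order operator is symmetric for the weight. -/
theorem cauchyInt_romOp_mul (c : ℂ) (A B : ℝ[X]) {d e : ℕ} (hA : A.natDegree ≤ d)
    (hB : B.natDegree ≤ e) (h : (d : ℝ) + e + 2 * c.re + 1 < 0) :
    cauchyInt c (romOp c.re c.im A * B) =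
      -cauchyInt c ((1 + X ^ 2) * derivative A * derivative B) := by
  by_cases h0 : A.natDegree = 0
  · rw [natDegree_eq_zero.1 h0 |>.choose_spec.symm]
    simp [romOp, cauchyInt_zero]
  have hd1 : ((d - 1 : ℕ) : ℝ) = d - 1 := by
    rw [Nat.cast_sub (by omega), Nat.cast_one]
  have hA' : (derivative A).natDegree ≤ d - 1 :=
    (natDegree_derivative_le A).trans (Nat.sub_le_sub_right hA 1)
  have hA'' : (derivative (derivative A)).natDegree ≤ d - 2 :=
    (natDegree_derivative_le _).trans (by omega)
  have hB' : (derivative B).natDegree ≤ e := (natDegree_derivative_le B).trans (by omega)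
  have h2 : (1 + X ^ 2 : ℝ[X]).natDegree ≤ 2 := by compute_degree
  have key := cauchyInt_deriv c (derivative A * B) (d := d - 1 + e)
    (natDegree_mul_le_of_le hA' hB) (by push_cast [hd1]; linarith)
  have e1 : (1 + X ^ 2) * derivative (derivative A * B) +
      (C (2 * (c.re + 1)) * X + C (2 * c.im)) * (derivative A * B) =
      romOp c.re c.im A * B + (1 + X ^ 2) * derivative A * derivative B := by
    rw [romOp, derivative_mul]
    ring
  rw [e1, cauchyInt_add c (d := d + e)] at key
  · linarith
  · refine natDegree_mul_le_of_le (natDegree_add_le_of_degree_le ?_ ?_) hB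
    · by_cases h1 : A.natDegree = 1
      · have : derivative (derivative A) = 0 := by
          rw [eq_X_add_C_of_natDegree_le_one h1.le]
          simp
        simp [this]
      · exact (natDegree_mul_le_of_le h2 hA'').trans (by omega)
    · have h2 : (C (2 * (c.re + 1)) * X + C (2 * c.im) : ℝ[X]).natDegree ≤ 1 := by compute_degree
      exact (natDegree_mul_le_of_le h2 hA').trans (by omega)
  · by_cases h1 : B.natDegree = 0
    · rw [natDegree_eq_zero.1 h1 |>.choose_spec.symm]
      simp
    · have hB' : (derivative B).natDegree ≤ e - 1 :=
        (natDegree_derivative_le B).trans (Nat.sub_le_sub_right hB 1)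
      exact (natDegree_mul_le_of_le (natDegree_mul_le_of_le h2 hA') hB').trans (by omega)
  · push_cast; linarith

theorem natDegree_romOp_le {K : Type*} [CommRing K] (a b : K) {A : K[X]} {n : ℕ}
    (hA : A.natDegree ≤ n) : (romOp a b A).natDegree ≤ n := by
  refine natDegree_le_iff_coeff_eq_zero.2 fun k hk => ?_
  rw [coeff_romOp, coeff_eq_zero_of_natDegree_lt (show A.natDegree < k by omega),
    coeff_eq_zero_of_natDegree_lt (show A.natDegree < k + 1 by omega),
    coeff_eq_zero_of_natDegree_lt (show A.natDegree < k + 2 by omega)]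
  simp

/-- The differential equation of the Routh-Romanovski polynomials. -/
theorem romOp_orthoPoly (c : ℂ) (n : ℕ) (h : (n : ℝ) < -c.re) :
    romOp c.re c.im (orthoPoly (cauchyWeight c) n) =
      C (n * (n + 1 + 2 * c.re)) * orthoPoly (cauchyWeight c) n := by
  rcases Nat.eq_zero_or_pos n with rfl | hn
  · simp [orthoPoly_zero, romOp]
  have hn1 : ((n - 1 : ℕ) : ℝ) = n - 1 := by
    rw [Nat.cast_sub (by omega), Nat.cast_one]
  set P := orthoPoly (cauchyWeight c) n with hP
  have hPd : P.natDegree ≤ n := (natDegree_orthoPoly _ n).le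
  have hLd := natDegree_romOp_le c.re c.im hPd
  have hc : (romOp c.re c.im P).coeff n = n * (n + 1 + 2 * c.re) := by
    rw [coeff_romOp, coeff_orthoPoly_self,
      coeff_eq_zero_of_natDegree_lt (show P.natDegree < n + 1 by omega),
      coeff_eq_zero_of_natDegree_lt (show P.natDegree < n + 2 by omega)]
    ring
  have hD := degree_sub_C_mul_orthoPoly_lt (cauchyWeight c) hLd
  rw [hc, ← hP] at hD
  set D := romOp c.re c.im P - C (n * (n + 1 + 2 * c.re)) * P with hDdef
  have horth : ∀ B : ℝ[X], B.degree < n → cauchyInt c (D * B) = 0 := fun B hB => by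
    have hBd : B.natDegree ≤ n - 1 := by
      by_cases h0 : B = 0
      · simp [h0]
      · have := (natDegree_lt_iff_degree_lt h0).2 hB
        omega
    have e : D * B = romOp c.re c.im P * B - C (n * (n + 1 + 2 * c.re)) * (P * B) := by
      rw [hDdef]; ring
    have hLB : (romOp c.re c.im B).degree < n := by
      have := natDegree_romOp_le c.re c.im hBd
      refine degree_lt_of_coeff_eq_zero (this.trans (by omega))
        (coeff_eq_zero_of_natDegree_lt (by omega))
    rw [e, cauchyInt_sub c (d := n + (n - 1)), cauchyInt_C_mul,
      cauchyInt_orthoPoly_mul c n h B hB,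
      cauchyInt_romOp_mul c P B hPd hBd (by rw [hn1]; linarith)]
    · have h1 := cauchyInt_romOp_mul c B P hBd hPd (by rw [hn1]; linarith)
      rw [mul_comm, hP, cauchyInt_orthoPoly_mul c n h _ hLB, ← hP] at h1
      rw [show (1 + X ^ 2) * derivative P * derivative B =
        (1 + X ^ 2) * derivative B * derivative P by ring, ← h1]
      simp
    · exact natDegree_mul_le_of_le hLd hBd
    · exact (natDegree_C_mul_le _ _).trans (natDegree_mul_le_of_le hPd hBd)
    · push_cast [hn1]; linarith
  have hDd : D.natDegree ≤ n - 1 := by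
    by_cases h0 : D = 0
    · simp [h0]
    · have := (natDegree_lt_iff_degree_lt h0).2 hD
      omega
  exact sub_eq_zero.1 (eq_zero_of_cauchyInt_mul_self c D hDd (by rw [hn1]; linarith)
    (horth D hD))

/-! ### Christoffel-Darboux summation and the first-order structure relation -/

theorem cauchyInt_mul_self_orthoPoly_X (c : ℂ) (n : ℕ) (h : 2 * ((n + 1 : ℕ) : ℝ) + 2 * c.re < -1) :
    cauchyInt c (X * orthoPoly (cauchyWeight c) (n + 1) * orthoPoly (cauchyWeight c) n) =
      rrNorm c (n + 1) := by
  rw [show X * orthoPoly (cauchyWeight c) (n + 1) * orthoPoly (cauchyWeight c) n =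
    orthoPoly (cauchyWeight c) (n + 1) * (X * orthoPoly (cauchyWeight c) n) by ring,
    cauchyInt_orthoPoly_mul_of_natDegree_le c (n + 1) h, coeff_X_mul, coeff_orthoPoly_self, one_mul]
  refine natDegree_mul_le.trans ?_
  rw [natDegree_X, natDegree_orthoPoly, add_comm]

/-- The three-term recurrence; the polynomial `R` of degree `n + 2` need not be orthogonal to
`P_{n+1}`. -/
theorem exists_three_term (c : ℂ) (n : ℕ) (h : 2 * ((n + 1 : ℕ) : ℝ) + 2 * c.re < -1) (R : ℝ[X])
    (hR : R.Monic) (hRd : R.natDegree = n + 2)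
    (hRo : ∀ m ≤ n, cauchyInt c (R * orthoPoly (cauchyWeight c) m) = 0) :
    ∃ a : ℝ, X * orthoPoly (cauchyWeight c) (n + 1) = R + C a * orthoPoly (cauchyWeight c) (n + 1) +
      C (rrNorm c (n + 1) / rrNorm c n) * orthoPoly (cauchyWeight c) n := by
  set P := orthoPoly (cauchyWeight c) with hP
  push_cast at h
  have hXd : (X * P (n + 1)).natDegree ≤ n + 2 := by
    refine natDegree_mul_le.trans ?_
    rw [natDegree_X, natDegree_orthoPoly]
    omega
  have hRc : R.coeff (n + 2) = 1 := by rw [← hRd]; exact hR.coeff_natDegree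
  have hd1 : (X * P (n + 1) - R).natDegree ≤ n + 1 := by
    refine natDegree_le_of_degree_lt_succ (degree_lt_of_coeff_eq_zero
      ((natDegree_sub_le_of_le hXd hRd.le).trans (max_self _).le) ?_)
    rw [coeff_sub, coeff_X_mul, hRc, hP, coeff_orthoPoly_self, sub_self]
  set a := (X * P (n + 1) - R).coeff (n + 1) with ha
  have hd2 := degree_sub_C_mul_orthoPoly_lt (cauchyWeight c) hd1
  rw [← ha, ← hP] at hd2
  refine ⟨a, ?_⟩
  set D := X * P (n + 1) - R - C a * P (n + 1) - C (rrNorm c (n + 1) / rrNorm c n) * P n with hD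
  have hDd : D.natDegree ≤ n := by
    refine natDegree_sub_le_of_le ?_ ((natDegree_C_mul_le _ _).trans
      (natDegree_orthoPoly _ n).le) |>.trans (by simp : max n n ≤ n)
    exact natDegree_le_of_degree_lt_succ hd2
  have horth : ∀ m < n + 1, cauchyInt c (D * P m) = 0 := fun m hm => by
    have hPm : (P m).natDegree ≤ n := (natDegree_orthoPoly _ m).le.trans (by omega)
    have e : D * P m = (X * P (n + 1) * P m - R * P m) - (C a * (P (n + 1) * P m) +
        C (rrNorm c (n + 1) / rrNorm c n) * (P n * P m)) := by
      rw [hD]; ring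
    have hd3 : (C a * (P (n + 1) * P m)).natDegree ≤ n + 2 + n :=
      (natDegree_C_mul_le _ _).trans (natDegree_mul_le_of_le
        ((natDegree_orthoPoly _ _).le.trans (by omega)) hPm)
    have hd4 : (C (rrNorm c (n + 1) / rrNorm c n) * (P n * P m)).natDegree ≤ n + 2 + n :=
      (natDegree_C_mul_le _ _).trans (natDegree_mul_le_of_le
        ((natDegree_orthoPoly _ _).le.trans (by omega)) hPm)
    have hd5 : (X * P (n + 1) * P m).natDegree ≤ n + 2 + n := natDegree_mul_le_of_le hXd hPm
    have hd6 : (R * P m).natDegree ≤ n + 2 + n := natDegree_mul_le_of_le hRd.le hPm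
    have hlt : ((n + 2 + n : ℕ) : ℝ) + 2 * c.re < -1 := by push_cast; linarith
    rw [e, cauchyInt_sub c (d := n + 2 + n) _ _ ((natDegree_sub_le_of_le hd5 hd6).trans (by simp))
      (natDegree_add_le_of_degree_le hd3 hd4) hlt, cauchyInt_sub c _ _ hd5 hd6 hlt,
      cauchyInt_add c _ _ hd3 hd4 hlt, cauchyInt_C_mul, cauchyInt_C_mul, hRo m (by omega), hP,
      cauchyInt_orthoPoly_mul_orthoPoly c (n + 1) (by push_cast; linarith) m hm]
    rcases (Nat.lt_succ_iff.1 hm).eq_or_lt with rfl | hmn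
    · rw [cauchyInt_mul_self_orthoPoly_X c m (by push_cast; linarith), ← rrNorm_eq,
        div_mul_cancel₀ _ (rrNorm_pos c m (by linarith)).ne']
      ring
    · rw [cauchyInt_orthoPoly_mul_orthoPoly c n (by linarith) m hmn,
        show X * orthoPoly (cauchyWeight c) (n + 1) * orthoPoly (cauchyWeight c) m =
          orthoPoly (cauchyWeight c) (n + 1) * (X * orthoPoly (cauchyWeight c) m) by ring,
        cauchyInt_orthoPoly_mul c (n + 1) (by push_cast; linarith)]
      · ring
      · refine degree_lt_of_coeff_eq_zero (natDegree_mul_le.trans ?_)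
          (coeff_eq_zero_of_natDegree_lt (natDegree_mul_le.trans_lt ?_))
        all_goals rw [natDegree_X, natDegree_orthoPoly]; omega
  have hD0 : D = 0 := by
    refine eq_zero_of_cauchyInt_mul_self c D hDd (by linarith) ?_
    refine cauchyInt_mul_eq_zero_of_forall c (cauchyWeight c) D n (n + 1) hDd
      (by push_cast; linarith) horth D (degree_lt_succ_of_natDegree_le hDd)
  linear_combination hD0

/-- The Christoffel-Darboux formula; the polynomial `R` of degree `n + 1` need not be orthogonal to
`P_n`. -/
theorem christoffel_darboux (c : ℂ) (n : ℕ) (h : 2 * (n : ℝ) + 2 * c.re < -1) (R : ℝ[X])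
    (hR : R.Monic) (hRd : R.natDegree = n + 1)
    (hRo : ∀ m < n, cauchyInt c (R * orthoPoly (cauchyWeight c) m) = 0) (x y : ℝ) :
    (x - y) * ∑ k ∈ Finset.range (n + 1), rr c k x * rr c k y / rrNorm c k =
      (R.eval x * rr c n y - R.eval y * rr c n x) / rrNorm c n := by
  induction n generalizing R with
  | zero =>
    have h0 := rrNorm_pos c 0 h
    have h1 : R.natDegree = 1 := hRd
    have h2 : R = X + C (R.coeff 0) := by
      rw [← hR.eq_X_add_C h1]
    rw [h2]
    simp [rr, orthoPoly_zero]
    ring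
  | succ n ih =>
    have h' : 2 * (n : ℝ) + 2 * c.re < -1 := by push_cast at h; linarith
    have hn := (rrNorm_pos c n h').ne'
    have hn1 := (rrNorm_pos c (n + 1) h).ne'
    rw [Finset.sum_range_succ, mul_add,
      ih h' (orthoPoly (cauchyWeight c) (n + 1)) (orthoPoly_monic _ _) (natDegree_orthoPoly _ _)
      fun m hm => cauchyInt_orthoPoly_mul_orthoPoly c _ (by push_cast at h ⊢; linarith) m
        (by omega)]
    obtain ⟨a, ha⟩ := exists_three_term c n h R hR hRd fun m hm => hRo m (by omega)
    have hx := congrArg (eval x) ha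
    have hy := congrArg (eval y) ha
    simp only [eval_mul, eval_X, eval_add, eval_C] at hx hy
    change (rr c (n + 1) x * rr c n y - rr c (n + 1) y * rr c n x) / _ + _ = _
    change x * rr c (n + 1) x = eval x R + a * rr c (n + 1) x + _ * rr c n x at hx
    change y * rr c (n + 1) y = eval y R + a * rr c (n + 1) y + _ * rr c n y at hy
    field_simp
    field_simp at hx hy
    linear_combination rr c (n + 1) y * hx - rr c (n + 1) x * hy

/-- The first-order operator `A ↦ (1 + x ^ 2) A' + ((a + 1) x + b) A`, antisymmetric for the
weight `ω₂` with `c = a + i b`. -/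
def skewOp (c : ℂ) (A : ℝ[X]) : ℝ[X] :=
  (1 + X ^ 2) * derivative A + (C (c.re + 1) * X + C c.im) * A

theorem natDegree_skewOp_le (c : ℂ) {A : ℝ[X]} {n : ℕ} (hA : A.natDegree ≤ n) :
    (skewOp c A).natDegree ≤ n + 1 := by
  refine natDegree_add_le_of_degree_le ?_ ?_
  · by_cases h0 : A.natDegree = 0
    · rw [natDegree_eq_zero.1 h0 |>.choose_spec.symm]
      simp
    · have h1 : (derivative A).natDegree ≤ n - 1 :=
        (natDegree_derivative_le A).trans (Nat.sub_le_sub_right hA 1)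
      have h2 : (1 + X ^ 2 : ℝ[X]).natDegree ≤ 2 := by compute_degree
      exact (natDegree_mul_le_of_le h2 h1).trans (by omega)
  · have h2 : (C (c.re + 1) * X + C c.im : ℝ[X]).natDegree ≤ 1 := by compute_degree
    exact (natDegree_mul_le_of_le h2 hA).trans (by omega)

theorem coeff_skewOp (c : ℂ) {A : ℝ[X]} {n : ℕ} (hA : A.natDegree ≤ n) :
    (skewOp c A).coeff (n + 1) = (n + c.re + 1) * A.coeff n := by
  unfold skewOp
  rw [add_mul, add_mul, one_mul, mul_assoc]
  rcases n with _ | n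
  · simp only [coeff_add, coeff_C_mul, coeff_X_pow_mul', coeff_X_mul, coeff_derivative]
    rw [coeff_eq_zero_of_natDegree_lt (show A.natDegree < 0 + 1 by omega),
      coeff_eq_zero_of_natDegree_lt (show A.natDegree < 0 + 1 + 1 by omega)]
    norm_num
  · simp only [coeff_add, coeff_C_mul, coeff_X_pow_mul', coeff_X_mul, coeff_derivative]
    rw [coeff_eq_zero_of_natDegree_lt (show A.natDegree < n + 1 + 1 by omega),
      coeff_eq_zero_of_natDegree_lt (show A.natDegree < n + 1 + 1 + 1 by omega),
      if_pos (by omega), show n + 1 + 1 - 2 = n by omega]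
    push_cast
    ring

theorem cauchyInt_skewOp_mul (c : ℂ) (A B : ℝ[X]) {d e : ℕ} (hA : A.natDegree ≤ d)
    (hB : B.natDegree ≤ e) (h : (d : ℝ) + e + 2 * c.re + 2 < 0) :
    cauchyInt c (skewOp c A * B) = -cauchyInt c (A * skewOp c B) := by
  have key := cauchyInt_deriv c (A * B) (natDegree_mul_le_of_le hA hB) (by push_cast; linarith)
  have e1 : (1 + X ^ 2) * derivative (A * B) +
      (C (2 * (c.re + 1)) * X + C (2 * c.im)) * (A * B) = skewOp c A * B + A * skewOp c B := by
    rw [skewOp, skewOp, derivative_mul, C_mul, C_mul, C_ofNat]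
    ring
  rw [e1, cauchyInt_add c (d := d + e + 1)] at key
  · linarith
  · exact (natDegree_mul_le_of_le (natDegree_skewOp_le c hA) hB).trans (by omega)
  · exact (natDegree_mul_le_of_le hA (natDegree_skewOp_le c hB)).trans (by omega)
  · push_cast; linarith

/-- The structure relation: `D P_0` for the antisymmetric operator `D`. -/
theorem skewOp_orthoPoly_zero (c : ℂ) (h : 1 < -c.re) :
    skewOp c (orthoPoly (cauchyWeight c) 0) =
      C (-(gammaCoeff c 0 * rrNorm c 0)) * orthoPoly (cauchyWeight c) 1 := by
  set P := orthoPoly (cauchyWeight c) with hP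
  have hn := (rrNorm_pos c 0 (by push_cast; linarith)).ne'
  have hP0 : (P 0).natDegree ≤ 0 := (natDegree_orthoPoly _ 0).le
  have hc := coeff_skewOp c hP0
  rw [hP, coeff_orthoPoly_self, ← hP] at hc
  have hd := degree_sub_C_mul_orthoPoly_lt (cauchyWeight c) (natDegree_skewOp_le c hP0)
  have hg : gammaCoeff c 0 * rrNorm c 0 = -c.re - 1 := by
    rw [gammaCoeff, div_mul_cancel₀ _ hn]
    simp
  rw [hc, ← hP] at hd
  rw [hg]
  have hDd : (skewOp c (P 0) - C (((0 : ℕ) + c.re + 1) * 1) * P 1).natDegree ≤ 0 :=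
    natDegree_le_of_degree_lt_succ hd
  have key : cauchyInt c ((skewOp c (P 0) - C (((0 : ℕ) + c.re + 1) * 1) * P 1) * P 0) = 0 := by
    rw [sub_mul, mul_assoc, cauchyInt_sub c (d := 1), cauchyInt_C_mul, hP,
      cauchyInt_orthoPoly_mul_orthoPoly c 1 (by push_cast; linarith) 0 one_pos, ← hP]
    · have := cauchyInt_skewOp_mul c (P 0) (P 0) hP0 hP0 (by push_cast; linarith)
      rw [mul_comm (P 0)] at this
      linarith
    · exact natDegree_mul_le_of_le (natDegree_skewOp_le c hP0) hP0
    · exact (natDegree_C_mul_le _ _).trans (natDegree_mul_le_of_le (natDegree_orthoPoly _ 1).le hP0)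
    · push_cast; linarith
  have hD0 : skewOp c (P 0) - C (((0 : ℕ) + c.re + 1) * 1) * P 1 = 0 := by
    refine eq_zero_of_cauchyInt_mul_self c _ hDd (by push_cast; linarith) ?_
    refine cauchyInt_mul_eq_zero_of_forall c (cauchyWeight c) _ 0 1 hDd
      (by push_cast; linarith) (fun m hm => ?_) _ ?_
    · rwa [Nat.lt_one_iff.1 hm]
    · exact degree_lt_succ_of_natDegree_le hDd
  rw [sub_eq_zero] at hD0
  rw [hD0]
  congr 2
  push_cast
  ring

/-- The structure relation `D P_j = -γ_j h_j P_{j+1} + γ_{j-1} h_j P_{j-1}` for the antisymmetric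
operator `D`. -/
theorem skewOp_orthoPoly_succ (c : ℂ) (j : ℕ) (h : (j : ℝ) + 2 < -c.re) :
    skewOp c (orthoPoly (cauchyWeight c) (j + 1)) =
      C (rrNorm c (j + 1)) * (C (gammaCoeff c j) * orthoPoly (cauchyWeight c) j -
        C (gammaCoeff c (j + 1)) * orthoPoly (cauchyWeight c) (j + 2)) := by
  set P := orthoPoly (cauchyWeight c) with hP
  have hn := (rrNorm_pos c (j + 1) (by push_cast; linarith)).ne'
  have hn0 := (rrNorm_pos c j (by linarith)).ne'
  have hPd : (P (j + 1)).natDegree ≤ j + 1 := (natDegree_orthoPoly _ _).le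
  have hSd := natDegree_skewOp_le c hPd
  have hc := coeff_skewOp c hPd
  rw [hP, coeff_orthoPoly_self, ← hP] at hc
  have hd := degree_sub_C_mul_orthoPoly_lt (cauchyWeight c) hSd
  rw [hc, ← hP] at hd
  have hg : rrNorm c (j + 1) * gammaCoeff c (j + 1) = -(((j + 1 : ℕ) : ℝ) + c.re + 1) := by
    rw [gammaCoeff, mul_div_cancel₀ _ hn]
    push_cast
    ring
  set D := skewOp c (P (j + 1)) - C (rrNorm c (j + 1)) * (C (gammaCoeff c j) * P j -
        C (gammaCoeff c (j + 1)) * P (j + 2)) with hD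
  have hDe : D = (skewOp c (P (j + 1)) - C ((((j + 1 : ℕ) : ℝ) + c.re + 1) * 1) * P (j + 2)) -
      C (rrNorm c (j + 1) * gammaCoeff c j) * P j := by
    have hg' := congrArg (C : ℝ → ℝ[X]) hg
    rw [C_mul, C_neg] at hg'
    rw [hD, mul_one, C_mul]
    linear_combination P (j + 2) * hg'
  have hDd : D.natDegree ≤ j + 1 := by
    rw [hDe]
    refine natDegree_sub_le_of_le ?_ ((natDegree_C_mul_le _ _).trans
      (natDegree_orthoPoly _ j).le) |>.trans (by simp : max (j + 1) j ≤ j + 1)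
    exact natDegree_le_of_degree_lt_succ hd
  have horth : ∀ m < j + 2, cauchyInt c (D * P m) = 0 := fun m hm => by
    have hPm : (P m).natDegree ≤ j + 1 := (natDegree_orthoPoly _ m).le.trans (by omega)
    have e : D * P m = (skewOp c (P (j + 1)) * P m -
        C ((((j + 1 : ℕ) : ℝ) + c.re + 1) * 1) * (P (j + 2) * P m)) -
        C (rrNorm c (j + 1) * gammaCoeff c j) * (P j * P m) := by
      rw [hDe]; ring
    have hd3 : (C ((((j + 1 : ℕ) : ℝ) + c.re + 1) * 1) * (P (j + 2) * P m)).natDegree ≤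
        j + 2 + (j + 1) :=
      (natDegree_C_mul_le _ _).trans (natDegree_mul_le_of_le (natDegree_orthoPoly _ _).le hPm)
    have hd4 : (C (rrNorm c (j + 1) * gammaCoeff c j) * (P j * P m)).natDegree ≤ j + 2 + (j + 1) :=
      (natDegree_C_mul_le _ _).trans (natDegree_mul_le_of_le
        ((natDegree_orthoPoly _ _).le.trans (by omega)) hPm)
    have hd5 : (skewOp c (P (j + 1)) * P m).natDegree ≤ j + 2 + (j + 1) :=
      natDegree_mul_le_of_le hSd hPm
    have hlt : ((j + 2 + (j + 1) : ℕ) : ℝ) + 2 * c.re < -1 := by push_cast; linarith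
    have hm2 : (m : ℝ) ≤ j + 1 := by exact_mod_cast Nat.lt_succ_iff.1 hm
    rw [e, cauchyInt_sub c (d := j + 2 + (j + 1)) _ _
      ((natDegree_sub_le_of_le hd5 hd3).trans (by simp)) hd4 hlt, cauchyInt_sub c _ _ hd5 hd3 hlt,
      cauchyInt_C_mul, cauchyInt_C_mul, hP,
      cauchyInt_orthoPoly_mul_orthoPoly c (j + 2) (by push_cast; linarith) m hm, ← hP]
    have hs := cauchyInt_skewOp_mul c (P (j + 1)) (P m) hPd (natDegree_orthoPoly _ m).le
      (by push_cast; linarith)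
    rcases (Nat.lt_succ_iff.1 hm).eq_or_lt with rfl | hmj
    · rw [mul_comm (P (j + 1)) (skewOp c _)] at hs
      have hz : cauchyInt c (P j * P (j + 1)) = 0 := by
        rw [mul_comm, hP, cauchyInt_orthoPoly_mul_orthoPoly c (j + 1) (by push_cast; linarith) j
          (by omega)]
      rw [hz]
      linarith
    · have hmj' : m ≤ j := Nat.lt_succ_iff.1 hmj
      have hsd := natDegree_skewOp_le c (natDegree_orthoPoly (cauchyWeight c) m).le
      rw [hs, hP, cauchyInt_orthoPoly_mul_of_natDegree_le c (j + 1) (by push_cast; linarith) _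
        (hsd.trans (by omega))]
      rcases hmj'.eq_or_lt with rfl | hmj
      · rw [coeff_skewOp c (natDegree_orthoPoly _ m).le, coeff_orthoPoly_self, ← rrNorm_eq,
          gammaCoeff]
        field_simp
        ring
      · rw [coeff_eq_zero_of_natDegree_lt (by omega),
          cauchyInt_orthoPoly_mul_orthoPoly c j (by linarith) m hmj]
        ring
  have hD0 : D = 0 := by
    refine eq_zero_of_cauchyInt_mul_self c D hDd (by push_cast; linarith) ?_
    refine cauchyInt_mul_eq_zero_of_forall c (cauchyWeight c) D (j + 1) (j + 2) hDd
      (by push_cast; linarith) horth D (degree_lt_succ_of_natDegree_le hDd)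
  exact sub_eq_zero.1 hD0

/-! ### Euler integrals for the Routh-Romanovski polynomials -/

/-- The polynomial `x ↦ euler r q (t ↦ (x - i (2 t - 1)) ^ n)`; see `eval_appell`. -/
def appell (r q : ℝ) (n : ℕ) : ℂ[X] :=
  ∑ j ∈ Finset.range (n + 1),
    C (euler r q (fun t => (-Complex.I * (2 * t - 1)) ^ (n - j)) * n.choose j) * X ^ j

theorem eval_appell (r q : ℝ) (h : EulerParam r q) (n : ℕ) (x : ℂ) :
    (appell r q n).eval x = euler r q (fun t => (x - Complex.I * (2 * t - 1)) ^ n) := by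
  have e : (fun t : ℝ => (x - Complex.I * (2 * t - 1)) ^ n) = fun t : ℝ =>
      ∑ j ∈ Finset.range (n + 1),
        (x ^ j * n.choose j) * (-Complex.I * (2 * t - 1)) ^ (n - j) := by
    ext t
    rw [sub_eq_add_neg, ← neg_mul, add_pow]
    exact Finset.sum_congr rfl fun j _ => by ring
  rw [e, euler_sum r q h _ fun j => by fun_prop, appell, eval_finsetSum]
  refine Finset.sum_congr rfl fun j _ => ?_
  rw [euler_const_mul, eval_mul, eval_C, eval_pow, eval_X]
  ring

theorem coeff_appell (r q : ℝ) (n j : ℕ) :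
    (appell r q n).coeff j =
      euler r q (fun t => (-Complex.I * (2 * t - 1)) ^ (n - j)) * n.choose j := by
  unfold appell
  rw [finsetSum_coeff]
  simp only [coeff_C_mul, coeff_X_pow]
  by_cases hj : j < n + 1
  · rw [Finset.sum_eq_single j (fun b _ hb => by simp [Ne.symm hb]) (by simp; omega)]
    simp
  · rw [Finset.sum_eq_zero fun b hb => ?_, Nat.choose_eq_zero_of_lt (by omega)]
    · simp
    · have : j ≠ b := by
        have := Finset.mem_range.1 hb
        omega
      simp [this]

/-- The Euler polynomials of fixed `r` and varying degree form an Appell sequence. -/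
theorem derivative_appell (r q : ℝ) (n : ℕ) :
    derivative (appell r q (n + 1)) = C ((n : ℂ) + 1) * appell r q n := by
  ext j
  have h : ((n + 1).choose (j + 1) : ℂ) * (j + 1) = (n + 1) * n.choose j := by
    exact_mod_cast (Nat.add_one_mul_choose_eq n j).symm
  rw [coeff_derivative, coeff_C_mul, coeff_appell, coeff_appell, Nat.add_sub_add_right]
  linear_combination euler r q (fun t => (-Complex.I * (2 * t - 1)) ^ (n - j)) * h

theorem natDegree_appell_le (r q : ℝ) (n : ℕ) : (appell r q n).natDegree ≤ n := by
  refine natDegree_le_iff_coeff_eq_zero.2 fun j hj => ?_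
  rw [coeff_appell, Nat.choose_eq_zero_of_lt hj]
  simp

theorem coeff_appell_self (r q : ℝ) (h : EulerParam r q) (n : ℕ) :
    (appell r q n).coeff n = 1 := by
  simp [coeff_appell, euler_one r q h]

theorem appell_zero (r q : ℝ) (h : EulerParam r q) : appell r q 0 = 1 := by
  simp [appell, euler_one r q h]

/-- The differential equation of the Euler integrals comes from an integration by parts in `t`. -/
theorem romOp_appell (r q : ℝ) (h : EulerParam r q) (n : ℕ) :
    romOp ((-r - n : ℝ) : ℂ) (q : ℂ) (appell r q n) =
      C (n * (n + 1 + 2 * ((-r - n : ℝ) : ℂ))) * appell r q n := by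
  rcases n with _ | n
  · simp [appell_zero r q h, romOp]
  refine Polynomial.funext fun x => ?_
  have h2 : derivative (appell r q n) = C (n : ℂ) * appell r q (n - 1) := by
    rcases n with _ | n
    · simp [appell_zero r q h]
    · simp [derivative_appell]
  have hd : ∀ t : ℝ, HasDerivAt (fun t : ℝ => (x - Complex.I * (2 * t - 1)) ^ n)
      (n * (x - Complex.I * (2 * t - 1)) ^ (n - 1) * (-(Complex.I * 2))) t := fun t => by
    have h1 : HasDerivAt (fun z : ℂ => x - Complex.I * (2 * z - 1)) (-(Complex.I * 2)) (t : ℂ) := by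
      simpa using ((((hasDerivAt_id (t : ℂ)).const_mul 2).sub_const 1).const_mul
        Complex.I).const_sub x
    exact (h1.pow n).comp_ofReal
  have key := euler_integral_by_parts r q h hd (by fun_prop)
  have comb : (1 + x ^ 2) * (n * euler r q (fun t => (x - Complex.I * (2 * t - 1)) ^ (n - 1))) +
      (2 * ((-r - (n + 1) : ℂ) + 1) * x + 2 * q) *
        euler r q (fun t => (x - Complex.I * (2 * t - 1)) ^ n) +
      (n + 2 * r) *
        euler r q (fun t => (x - Complex.I * (2 * t - 1)) ^ (n + 1)) = 0 := by
    have := congrArg (fun z => 2 * Complex.I * z) key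
    simp only [mul_zero] at this
    rw [← this, ← euler_const_mul r q (n : ℂ), ← euler_const_mul, ← euler_const_mul,
      ← euler_const_mul, ← euler_const_mul, ← euler_add r q h (by fun_prop) (by fun_prop),
      ← euler_add r q h (by fun_prop) (by fun_prop)]
    congr 1
    ext t
    rcases n with _ | n
    · simp
      linear_combination 2 * (q : ℂ) * Complex.I_sq
    · simp only [Nat.add_sub_cancel]
      push_cast
      simp only [pow_succ _ n, pow_succ _ (n + 1)]
      generalize (x - Complex.I * (2 * (t : ℂ) - 1)) ^ n = g
      linear_combination (n + 1 + 2 * (q : ℂ) * (x - Complex.I * (2 * (t : ℂ) - 1))) * g *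
        Complex.I_sq
  simp only [romOp, derivative_appell, derivative_mul, derivative_C, zero_mul, zero_add, h2,
    eval_add, eval_mul, eval_C, eval_one, eval_pow, eval_X, eval_appell r q h]
  push_cast
  linear_combination ((n : ℂ) + 1) * comb

theorem map_romOp (a b : ℝ) (A : ℝ[X]) :
    (romOp a b A).map Complex.ofRealHom = romOp (a : ℂ) (b : ℂ) (A.map Complex.ofRealHom) := by
  simp [romOp, derivative_map]

theorem romEig_ne {a : ℝ} {n m : ℕ} (hmn : m < n) (h : (n : ℝ) + m + 1 + 2 * a < 0) :
    (m * (m + 1 + 2 * a) : ℝ) ≠ n * (n + 1 + 2 * a) := by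
  intro h'
  have h1 : ((n : ℝ) - m) * (n + m + 1 + 2 * a) = 0 := by linear_combination -h'
  rcases mul_eq_zero.1 h1 with h2 | h2
  · have : (m : ℝ) < n := by exact_mod_cast hmn
    linarith
  · linarith

/-- The Routh-Romanovski polynomials as Euler integrals. -/
theorem map_orthoPoly (c : ℂ) (n : ℕ) (h : (n : ℝ) < -c.re) :
    (orthoPoly (cauchyWeight c) n).map Complex.ofRealHom = appell (-c.re - n) c.im n := by
  have hp : EulerParam (-c.re - n) c.im := Or.inl (by linarith)
  rw [← sub_eq_zero]
  refine eq_zero_of_romOp_eq (c.re : ℂ) (c.im : ℂ) n _ ?_ ?_ fun m hm => ?_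
  · refine (degree_lt_iff_coeff_zero _ _).2 fun m hm => ?_
    rcases hm.eq_or_lt with rfl | hm
    · simp [coeff_orthoPoly_self, coeff_appell_self _ _ hp]
    · rw [coeff_sub, coeff_map, coeff_eq_zero_of_natDegree_lt (by rwa [natDegree_orthoPoly]),
        coeff_eq_zero_of_natDegree_lt ((natDegree_appell_le _ _ _).trans_lt hm)]
      simp
  · have h1 := congrArg (map Complex.ofRealHom) (romOp_orthoPoly c n h)
    rw [map_romOp] at h1
    have h2 := romOp_appell (-c.re - n) c.im hp n
    rw [show -(-c.re - (n : ℝ)) - n = c.re by ring] at h2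
    have h3 : ∀ A B : ℂ[X], romOp (c.re : ℂ) (c.im : ℂ) (A - B) =
        romOp (c.re : ℂ) (c.im : ℂ) A - romOp (c.re : ℂ) (c.im : ℂ) B := fun A B => by
      simp only [romOp, derivative_sub]
      ring
    rw [h3, h1, h2]
    simp
    ring
  · have h1 : (m : ℝ) + 1 ≤ n := by exact_mod_cast hm
    have := romEig_ne hm (a := c.re) (by linarith)
    exact_mod_cast this

/-- The Routh-Romanovski polynomial is an Euler integral of `n`-th powers: both sides are monic
solutions of the same second-order equation. -/
theorem rr_eq_euler (c : ℂ) (n : ℕ) (h : (n : ℝ) < -c.re) (x : ℝ) :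
    (rr c n x : ℂ) =
      euler (-c.re - n) c.im (fun t => ((x : ℂ) - Complex.I * (2 * t - 1)) ^ n) := by
  have hp : EulerParam (-c.re - n) c.im := Or.inl (by linarith)
  rw [← eval_appell _ _ hp, ← map_orthoPoly c n h, rr]
  exact (eval_map_apply Complex.ofRealHom x).symm

/-- The Euler integrals are real. -/
theorem exists_map_eq_appell (r q : ℝ) (h : EulerParam r q) (n : ℕ) :
    ∃ R : ℝ[X], R.map Complex.ofRealHom = appell r q n := by
  rcases h with h | ⟨rfl, rfl⟩
  · have := map_orthoPoly ⟨-r - n, q⟩ n (by simp; linarith)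
    refine ⟨_, this.trans ?_⟩
    congr 1
    simp
  · refine ⟨∑ j ∈ Finset.range (n + 1), C ((euler 0 0
      (fun t => (-Complex.I * (2 * t - 1)) ^ (n - j))).re * n.choose j) * X ^ j, ?_⟩
    rw [appell, Polynomial.map_sum]
    refine Finset.sum_congr rfl fun j _ => ?_
    have : ((euler 0 0 (fun t => (-Complex.I * (2 * t - 1)) ^ (n - j))).re : ℂ) =
        euler 0 0 (fun t => (-Complex.I * (2 * t - 1)) ^ (n - j)) := by
      rw [← Complex.conj_eq_iff_re]
      have h2 : (starRingEnd ℂ) 2 = 2 := Complex.conj_ofNat 2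
      simp [euler, h2]
      norm_num
      rw [add_comm]
    rw [Polynomial.map_mul, Polynomial.map_pow, map_X, map_C, RingHom.map_mul,
      Complex.ofRealHom_eq_coe, this]
    simp

/-- The Christoffel-Darboux formula in terms of Euler integrals. -/
theorem sum_rr_eq_euler (c : ℂ) (n : ℕ) (h : EulerParam (-c.re - (n + 1 : ℕ)) c.im) (x y : ℝ) :
    (((x - y) * ∑ k ∈ Finset.range (n + 1), rr c k x * rr c k y / rrNorm c k : ℝ) : ℂ) =
      (euler (-c.re - (n + 1 : ℕ)) c.im
          (fun t => ((x : ℂ) - Complex.I * (2 * t - 1)) ^ (n + 1)) * rr c n y -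
        euler (-c.re - (n + 1 : ℕ)) c.im
          (fun t => ((y : ℂ) - Complex.I * (2 * t - 1)) ^ (n + 1)) * rr c n x) / rrNorm c n := by
  have hr : (0 : ℝ) ≤ -c.re - (n + 1 : ℕ) := h.elim le_of_lt fun h' => h'.1.ge
  push_cast at hr
  obtain ⟨R, hR⟩ := exists_map_eq_appell _ _ h (n + 1)
  have hinj : Function.Injective Complex.ofRealHom := Complex.ofRealHom.injective
  have hRd' : R.natDegree ≤ n + 1 := by
    rw [← natDegree_map_eq_of_injective hinj R, hR]
    exact natDegree_appell_le _ _ _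
  have hRc : R.coeff (n + 1) = 1 := by
    have := congrArg (fun A => A.coeff (n + 1)) hR
    simp only [coeff_map, coeff_appell_self _ _ h, Complex.ofRealHom_eq_coe] at this
    exact_mod_cast this
  have hRm : R.Monic := monic_of_natDegree_le_of_coeff_eq_one _ hRd' hRc
  have hRd : R.natDegree = n + 1 := natDegree_eq_of_le_of_coeff_ne_zero hRd' (by rw [hRc]; simp)
  have hode : romOp c.re c.im R = C (((n + 1 : ℕ) : ℝ) * ((n + 1 : ℕ) + 1 + 2 * c.re)) * R := by
    refine map_injective _ hinj ?_
    have h2 := romOp_appell _ _ h (n + 1)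
    rw [show -(-c.re - ((n + 1 : ℕ) : ℝ)) - (n + 1 : ℕ) = c.re by ring] at h2
    rw [map_romOp, hR, h2]
    simp [hR]
  rw [christoffel_darboux c n (by linarith) R hRm hRd fun m hm => ?_]
  · have he : ∀ z : ℝ, ((R.eval z : ℝ) : ℂ) = euler (-c.re - (n + 1 : ℕ)) c.im
        (fun t => ((z : ℂ) - Complex.I * (2 * t - 1)) ^ (n + 1)) := fun z => by
      rw [← eval_appell _ _ h, ← hR]
      exact (eval_map_apply Complex.ofRealHom z).symm
    push_cast [he]
    rfl
  -- `R` and `P_m` are eigenvectors of a symmetric operator for different eigenvalues.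
  · have hm1 : (m : ℝ) + 1 ≤ n := by exact_mod_cast hm
    have h1 := cauchyInt_romOp_mul c R _ hRd.le (natDegree_orthoPoly (cauchyWeight c) m).le
      (by push_cast; linarith)
    have h2 := cauchyInt_romOp_mul c _ R (natDegree_orthoPoly (cauchyWeight c) m).le hRd.le
      (by push_cast; linarith)
    rw [hode, mul_assoc, cauchyInt_C_mul] at h1
    rw [romOp_orthoPoly c m (by linarith), mul_assoc, cauchyInt_C_mul, mul_comm (orthoPoly _ m),
      show (1 + X ^ 2) * derivative (orthoPoly (cauchyWeight c) m) * derivative R =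
        (1 + X ^ 2) * derivative R * derivative (orthoPoly (cauchyWeight c) m) by ring,
      ← h1] at h2
    by_contra h0
    exact romEig_ne (show m < n + 1 by omega) (by push_cast; linarith) (mul_right_cancel₀ h0 h2)

theorem derivative_orthoPoly (c : ℂ) (n : ℕ) (h : (n : ℝ) + 1 < -c.re) :
    derivative (orthoPoly (cauchyWeight c) (n + 1)) =
      C ((n : ℝ) + 1) * orthoPoly (cauchyWeight (c + 1)) n := by
  refine map_injective _ Complex.ofRealHom.injective ?_
  have h1 := map_orthoPoly (c + 1) n (by simp; linarith)
  rw [Complex.add_re, Complex.add_im, Complex.one_re, Complex.one_im, add_zero,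
    show -(c.re + 1) - (n : ℝ) = -c.re - (n + 1 : ℕ) by push_cast; ring] at h1
  rw [← derivative_map, map_orthoPoly c (n + 1) (by push_cast; linarith), derivative_appell,
    Polynomial.map_mul, h1]
  simp

/-- Differentiation maps `P_{n+1}` for `c` to a multiple of `P_n` for `c + 1`; integrating by parts
relates the norms. -/
theorem rrNorm_succ (c : ℂ) (n : ℕ) (h : 2 * ((n + 1 : ℕ) : ℝ) + 2 * c.re < -1) :
    rrNorm c (n + 1) * (-(n + 2 + 2 * c.re)) = (n + 1) * rrNorm (c + 1) n := by
  push_cast at h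
  set P := orthoPoly (cauchyWeight c) (n + 1) with hP
  have hd : P.natDegree ≤ n + 1 := (natDegree_orthoPoly _ _).le
  have h1 := cauchyInt_romOp_mul c P P hd hd (by push_cast; linarith)
  have h2 : cauchyInt c ((1 + X ^ 2) * derivative P * derivative P) =
      (n + 1) ^ 2 * rrNorm (c + 1) n := by
    rw [rrNorm_eq, ← cauchyInt_C_mul, cauchyInt, cauchyInt, hP,
      derivative_orthoPoly c n (by linarith)]
    congr 1
    ext x
    rw [cauchyWeight_add_one]
    simp
    ring
  rw [hP, romOp_orthoPoly c (n + 1) (by push_cast; linarith), mul_assoc, cauchyInt_C_mul,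
    ← rrNorm_eq, ← hP, h2] at h1
  push_cast at h1
  have hn : (n + 1 : ℝ) ≠ 0 := by positivity
  refine mul_left_cancel₀ hn ?_
  linear_combination -h1

/-- The total mass `∫ (1 + x ^ 2) ^ (-r) exp (2 q arctan x) dx` of the generalised Cauchy
weight. -/
def cauchyMass (r q : ℝ) : ℝ := ∫ x, cauchyWeight ⟨-r, q⟩ x

/-- Each step of `rrNorm_succ` lowers `n` and keeps `r = -Re c - n` fixed, which reduces the norms
to the mass of a weight that does not depend on `n`. -/
theorem rrNorm_eq_cauchyMass (r q : ℝ) (h : 1 / 2 < r) (n : ℕ) :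
    rrNorm ⟨-r - n, q⟩ n * Real.Gamma (2 * r + n) =
      n.factorial * Real.Gamma (2 * r) * cauchyMass r q := by
  induction n with
  | zero =>
    simp [rrNorm, rr, orthoPoly_zero, cauchyMass]
    ring
  | succ n ih =>
    have h1 := rrNorm_succ ⟨-r - (n + 1 : ℕ), q⟩ n (by push_cast; linarith)
    have e : (⟨-r - (n + 1 : ℕ), q⟩ + 1 : ℂ) = ⟨-r - n, q⟩ := by
      apply Complex.ext
      · simp
        ring
      · simp
    rw [e] at h1
    have h2 : Real.Gamma (2 * r + (n + 1 : ℕ)) = (2 * r + n) * Real.Gamma (2 * r + n) := by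
      rw [← Real.Gamma_add_one (by positivity)]
      push_cast
      ring_nf
    rw [h2, Nat.factorial_succ]
    push_cast at h1 ⊢
    linear_combination Real.Gamma (2 * r + n) * h1 + ((n : ℝ) + 1) * ih

/-! ### The total mass of the weight -/

/-- The recursion for the mass: integration by parts against `1` and `x` eliminates the first and
second moments. -/
theorem cauchyMass_succ (r q : ℝ) (h : 1 / 2 < r) :
    2 * (r ^ 2 + q ^ 2) * cauchyMass (r + 1) q = (2 * r - 1) * r * cauchyMass r q := by
  set c : ℂ := ⟨-(r + 1), q⟩ with hc
  have h1 := cauchyInt_deriv c 1 (d := 0) (by simp) (by simp [hc]; linarith)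
  have h2 := cauchyInt_deriv c X (d := 1) (by simp) (by simp [hc]; linarith)
  have i0 := integrable_weight_mul_eval c (1 : ℝ[X]) (d := 0) (by simp) (by simp [hc]; linarith)
  have i1 := integrable_weight_mul_eval c (X : ℝ[X]) (d := 1) (by simp) (by simp [hc]; linarith)
  have i2 := integrable_weight_mul_eval c (X ^ 2 : ℝ[X]) (d := 2) (by simp)
    (by simp [hc]; linarith)
  simp only [eval_one, eval_X, eval_pow, mul_one] at i0 i1 i2
  have e0 : cauchyMass (r + 1) q = ∫ x, cauchyWeight c x := rfl
  have e2 : cauchyMass r q = (∫ x, cauchyWeight c x) + ∫ x, cauchyWeight c x * x ^ 2 := by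
    rw [← integral_add i0 i2, cauchyMass]
    have : (⟨-r, q⟩ : ℂ) = c + 1 := by
      apply Complex.ext <;> simp [hc]
    congr 1
    ext x
    rw [this, cauchyWeight_add_one]
    ring
  have e1 : (-2 * r) * (∫ x, cauchyWeight c x * x) + 2 * q * ∫ x, cauchyWeight c x = 0 := by
    rw [← integral_const_mul, ← integral_const_mul,
      ← integral_add (i1.const_mul _) (i0.const_mul _), ← h1, cauchyInt]
    congr 1
    ext x
    simp [hc]
    ring
  have e3 : (∫ x, cauchyWeight c x) + (1 - 2 * r) * (∫ x, cauchyWeight c x * x ^ 2) +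
      2 * q * (∫ x, cauchyWeight c x * x) = 0 := by
    have i3 : Integrable fun x => cauchyWeight c x + (1 - 2 * r) * (cauchyWeight c x * x ^ 2) :=
      i0.add (i2.const_mul _)
    rw [← integral_const_mul, ← integral_const_mul, ← integral_add i0 (i2.const_mul _),
      ← integral_add i3 (i1.const_mul _), ← h2, cauchyInt]
    congr 1
    ext x
    simp [hc]
    ring
  rw [e2, e0]
  linear_combination r * e3 + q * e1

/-- Laplace's method: after the substitution `x ↦ x / √n` the weight tends to a Gaussian. -/
theorem tendsto_sqrt_mul_cauchyMass (s q : ℝ) (hs : 0 ≤ s) :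
    Filter.Tendsto (fun n : ℕ => √n * cauchyMass (n + s) q) Filter.atTop (nhds √π) := by
  have hgauss : ∫ x : ℝ, Real.exp (-x ^ 2) = √π := by
    simpa using integral_gaussian 1
  rw [← hgauss]
  have hlim : Filter.Tendsto (fun n : ℕ => ∫ x : ℝ, cauchyWeight ⟨-(n + s), q⟩ (x / √n))
      Filter.atTop (nhds (∫ x : ℝ, Real.exp (-x ^ 2))) := by
    refine tendsto_integral_filter_of_dominated_convergence
      (fun x => Real.exp (|q| * π) * (1 + x ^ 2)⁻¹) ?_ ?_ ?_ ?_
    · exact Filter.Eventually.of_forall fun n =>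
        ((continuous_cauchyWeight _).comp (continuous_id.div_const _)).aestronglyMeasurable
    · filter_upwards [Filter.eventually_ge_atTop 1] with n hn
      refine Filter.Eventually.of_forall fun x => ?_
      have hn0 : (0 : ℝ) < n := by exact_mod_cast hn
      rw [Real.norm_of_nonneg (cauchyWeight_pos _ _).le]
      refine (cauchyWeight_le _ _).trans (mul_le_mul_of_nonneg_left ?_ (by positivity))
      rw [div_pow, Real.sq_sqrt hn0.le]
      have hb : (1 : ℝ) ≤ 1 + x ^ 2 / n := by
        have : 0 ≤ x ^ 2 / n := by positivity
        linarith
      have h1 : 1 + x ^ 2 ≤ (1 + x ^ 2 / n) ^ n := by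
        have := one_add_mul_le_pow (a := x ^ 2 / n) (by linarith) n
        rwa [mul_div_cancel₀ _ hn0.ne'] at this
      calc (1 + x ^ 2 / n) ^ (-(n + s)) ≤ (1 + x ^ 2 / n) ^ (-(n : ℝ)) :=
            Real.rpow_le_rpow_of_exponent_le hb (by linarith)
        _ = ((1 + x ^ 2 / n) ^ n)⁻¹ := by
          rw [Real.rpow_neg (by linarith), Real.rpow_natCast]
        _ ≤ (1 + x ^ 2)⁻¹ := by gcongr
    · exact integrable_inv_one_add_sq.const_mul _
    · refine Filter.Eventually.of_forall fun x => ?_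
      have h0 : Filter.Tendsto (fun n : ℕ => x ^ 2 / (n : ℝ)) Filter.atTop (nhds 0) :=
        tendsto_const_div_atTop_nhds_zero_nat _
      have h1 : Filter.Tendsto (fun n : ℕ => (1 + x ^ 2 / (n : ℝ)) ^ n) Filter.atTop
          (nhds (Real.exp (x ^ 2))) := Real.tendsto_one_add_div_pow_exp _
      have h2 : Filter.Tendsto (fun n : ℕ => (1 + x ^ 2 / (n : ℝ)) ^ (-s)) Filter.atTop
          (nhds 1) := by
        have := (h0.const_add 1).rpow_const (p := -s) (Or.inl (by norm_num))
        simpa using this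
      have h3 : Filter.Tendsto (fun n : ℕ => Real.exp (2 * q * Real.arctan (x / √n)))
          Filter.atTop (nhds 1) := by
        have h4 : Filter.Tendsto (fun n : ℕ => x / √(n : ℝ)) Filter.atTop (nhds 0) :=
          Filter.Tendsto.div_atTop tendsto_const_nhds
            (Real.tendsto_sqrt_atTop.comp tendsto_natCast_atTop_atTop)
        have h5 := (Real.continuous_exp.tendsto _).comp
          (((Real.continuous_arctan.tendsto _).comp h4).const_mul (2 * q))
        simpa [Function.comp_def] using h5
      have h4 := ((h1.inv₀ (Real.exp_pos _).ne').mul h2).mul h3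
      rw [mul_one, mul_one, ← Real.exp_neg] at h4
      refine h4.congr' ?_
      filter_upwards [Filter.eventually_ge_atTop 1] with n hn
      have hn0 : (0 : ℝ) < n := by exact_mod_cast hn
      have hb : (0 : ℝ) < 1 + x ^ 2 / n := by positivity
      rw [cauchyWeight, div_pow, Real.sq_sqrt hn0.le]
      dsimp only
      rw [neg_add, Real.rpow_add hb, Real.rpow_neg hb.le (n : ℝ), Real.rpow_natCast]
  refine hlim.congr fun n => ?_
  rw [Measure.integral_comp_div (fun x => cauchyWeight ⟨-(n + s), q⟩ x), cauchyMass,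
    abs_of_nonneg (Real.sqrt_nonneg _), smul_eq_mul]

theorem tendsto_norm_Gamma_div {z : ℂ} (hz : 0 < z.re) :
    Filter.Tendsto (fun n : ℕ => ‖Complex.Gamma (z + n + 1)‖ / ((n : ℝ) ^ z.re * n.factorial))
      Filter.atTop (nhds 1) := by
  have hG := Complex.Gamma_ne_zero_of_re_pos hz
  have h1 := ((Complex.GammaSeq_tendsto_Gamma z).inv₀ hG).const_mul (Complex.Gamma z)
  rw [mul_inv_cancel₀ hG] at h1
  have h2 := h1.norm
  rw [norm_one] at h2
  refine h2.congr' ?_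
  filter_upwards [Filter.eventually_ge_atTop 1] with n hn
  have hn0 : (0 : ℝ) < n := by exact_mod_cast hn
  have hz' : ∀ k : ℕ, z ≠ -k := fun k hk => by
    have : z.re = -k := by simp [hk]
    have hk : (0 : ℝ) ≤ k := Nat.cast_nonneg k
    linarith
  have h3 : Complex.Gamma (z + n + 1) =
      Complex.Gamma z * ∏ j ∈ Finset.range (n + 1), (z + j) := by
    have key : ∀ m : ℕ, Complex.Gamma (z + m) = Complex.Gamma z * ∏ j ∈ Finset.range m, (z + j) := by
      intro m
      induction m with
      | zero => simp
      | succ m ih =>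
        have hne : z + m ≠ 0 := fun h0 => hz' m (eq_neg_of_add_eq_zero_left h0)
        rw [Finset.prod_range_succ, ← mul_assoc, ← ih, Nat.cast_succ, ← add_assoc,
          Complex.Gamma_add_one _ hne, mul_comm]
    rw [← key (n + 1)]
    push_cast
    ring_nf
  rw [Complex.GammaSeq, h3, norm_mul, norm_inv, norm_div, norm_mul, norm_mul, inv_div,
    Complex.norm_natCast, ← Complex.ofReal_natCast, Complex.norm_cpow_eq_rpow_re_of_pos hn0]
  ring

theorem tendsto_Gamma_div {x : ℝ} (hx : 0 < x) :
    Filter.Tendsto (fun n : ℕ => Real.Gamma (x + n + 1) / ((n : ℝ) ^ x * n.factorial))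
      Filter.atTop (nhds 1) := by
  have h := tendsto_norm_Gamma_div (z := x) (by simpa using hx)
  refine h.congr fun n => ?_
  have e : (x + n + 1 : ℂ) = ((x + n + 1 : ℝ) : ℂ) := by push_cast; ring
  rw [e, Complex.Gamma_ofReal, Complex.norm_real, Real.norm_of_nonneg, Complex.ofReal_re]
  exact (Real.Gamma_pos_of_pos (by positivity)).le

/-- The mass of the weight as a quotient of Gamma functions: the product of both sides' quotient is
`1`-periodic in `r` by `cauchyMass_succ`, and its limit at infinity is known. -/
theorem cauchyMass_eq (r q : ℝ) (h : 1 / 2 < r) :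
    cauchyMass r q * ‖Complex.Gamma (r + Complex.I * q)‖ ^ 2 =
      2 ^ (2 - 2 * r) * π * Real.Gamma (2 * r - 1) := by
  have hr : 0 < r := by linarith
  let Φ : ℝ → ℝ := fun s => cauchyMass s q * ‖Complex.Gamma (s + Complex.I * q)‖ ^ 2 /
    (2 ^ (2 - 2 * s) * √π * Real.Gamma (2 * s - 1))
  -- The recursion for the mass and the functional equation of `Γ` make `Φ` periodic.
  have hper : ∀ s : ℝ, 1 / 2 < s → Φ (s + 1) = Φ s := fun s hs => by
    have hs0 : 0 < s := by linarith
    have h1 := cauchyMass_succ s q hs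
    have hne : (s + Complex.I * q : ℂ) ≠ 0 := fun h0 => by
      have := congrArg Complex.re h0
      simp at this
      linarith
    have h2 : ‖Complex.Gamma ((s + 1 : ℝ) + Complex.I * q)‖ ^ 2 =
        (s ^ 2 + q ^ 2) * ‖Complex.Gamma (s + Complex.I * q)‖ ^ 2 := by
      have : ((s + 1 : ℝ) + Complex.I * q : ℂ) = s + Complex.I * q + 1 := by push_cast; ring
      rw [this, Complex.Gamma_add_one _ hne, norm_mul, mul_pow, ← Complex.normSq_eq_norm_sq (s + _)]
      congr 1
      simp [Complex.normSq_apply]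
      ring
    have h3 : Real.Gamma (2 * (s + 1) - 1) = (2 * s) * ((2 * s - 1) * Real.Gamma (2 * s - 1)) := by
      rw [← Real.Gamma_add_one (by linarith), show 2 * s - 1 + 1 = 2 * s by ring,
        ← Real.Gamma_add_one (by linarith)]
      ring_nf
    have h4 : (2 : ℝ) ^ (2 - 2 * (s + 1)) = 2 ^ (2 - 2 * s) / 4 := by
      rw [show 2 - 2 * (s + 1) = (2 - 2 * s) - (2 : ℕ) by push_cast; ring,
        Real.rpow_sub_natCast (by norm_num)]
      norm_num
    have hG : 0 < Real.Gamma (2 * s - 1) := Real.Gamma_pos_of_pos (by linarith)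
    have h5 : (2 * s - 1 : ℝ) ≠ 0 := by linarith
    simp only [Φ]
    rw [h2, h3, h4, div_eq_div_iff (by positivity) (by positivity)]
    linear_combination (2 : ℝ) ^ (2 - 2 * s) * √π * Real.Gamma (2 * s - 1) *
      ‖Complex.Gamma (s + Complex.I * q)‖ ^ 2 / 2 * h1
  have hshift : ∀ n : ℕ, Φ (n + (r + 1)) = Φ r := fun n => by
    induction n with
    | zero => simpa using hper r h
    | succ n ih =>
      have hn : (0 : ℝ) ≤ n := Nat.cast_nonneg n
      rw [← ih, ← hper (n + (r + 1)) (by linarith)]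
      push_cast
      ring_nf
  have h1 := tendsto_sqrt_mul_cauchyMass (r + 1) q (by linarith)
  have h2 := (tendsto_norm_Gamma_div (z := r + Complex.I * q) (by simpa using hr)).pow 2
  have h3 := (tendsto_Gamma_div hr).mul (tendsto_Gamma_div (x := r - 1 / 2) (by linarith))
  have h4 := (h1.mul h2).div h3 (by norm_num)
  -- Euler's limit for the Gamma functions, after the duplication formula for `Γ(2 s - 1)`.
  have hlim : Filter.Tendsto (fun n : ℕ => Φ (n + (r + 1))) Filter.atTop (nhds √π) := by
    have e : √π * 1 ^ 2 / (1 * 1) = √π := by ring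
    rw [e] at h4
    refine h4.congr' ?_
    filter_upwards [Filter.eventually_ge_atTop 1] with n hn
    have hn0 : (0 : ℝ) < n := by exact_mod_cast hn
    have hdup := Real.Gamma_mul_Gamma_add_half (n + (r + 1) - 1 / 2)
    rw [show n + (r + 1) - 1 / 2 + 1 / 2 = r + n + 1 by ring,
      show 2 * (n + (r + 1) - 1 / 2) = 2 * (n + (r + 1)) - 1 by ring,
      show 1 - (2 * (n + (r + 1)) - 1) = 2 - 2 * (n + (r + 1)) by ring,
      show n + (r + 1) - 1 / 2 = r - 1 / 2 + n + 1 by ring] at hdup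
    have hp : (n : ℝ) ^ r = (n : ℝ) ^ (r - 1 / 2) * √n := by
      rw [Real.sqrt_eq_rpow, ← Real.rpow_add hn0]
      ring_nf
    have hg1 : 0 < Real.Gamma (r + n + 1) := Real.Gamma_pos_of_pos (by positivity)
    have hg2 : 0 < Real.Gamma (r - 1 / 2 + n + 1) := Real.Gamma_pos_of_pos (by linarith)
    have hg3 : 0 < Real.Gamma (2 * (n + (r + 1)) - 1) := Real.Gamma_pos_of_pos (by linarith)
    have hf : (0 : ℝ) < n.factorial := by exact_mod_cast n.factorial_pos
    have hs : 0 < √(n : ℝ) := Real.sqrt_pos.2 hn0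
    have hq : 0 < (n : ℝ) ^ (r - 1 / 2) := Real.rpow_pos_of_pos hn0 _
    have ez : ((n + (r + 1) : ℝ) + Complex.I * q : ℂ) = r + Complex.I * q + n + 1 := by
      push_cast; ring
    have hre : (r + Complex.I * q : ℂ).re = r := by simp
    simp only [Φ]
    simp only [Pi.div_apply]
    rw [ez, hre, show (2 : ℝ) ^ (2 - 2 * (n + (r + 1))) * √π * Real.Gamma (2 * (n + (r + 1)) - 1) =
      Real.Gamma (r - 1 / 2 + n + 1) * Real.Gamma (r + n + 1) by rw [hdup]; ring, hp]
    field_simp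
  have h5 : Φ r = √π := tendsto_nhds_unique (tendsto_const_nhds.congr fun n => (hshift n).symm) hlim
  have hG : 0 < Real.Gamma (2 * r - 1) := Real.Gamma_pos_of_pos (by linarith)
  simp only [Φ] at h5
  rw [div_eq_iff (by positivity)] at h5
  rw [h5]
  have := Real.mul_self_sqrt Real.pi_pos.le
  linear_combination 2 ^ (2 - 2 * r) * Real.Gamma (2 * r - 1) * this

/-! ### Uniform approximation to second order -/

/-- `f N = g + O(1 / N ^ 2)` uniformly on `T`, with `g` bounded on `T`. -/
def UniformApprox {α : Type*} (T : Set α) (f : ℕ → α → ℂ) (g : α → ℂ) : Prop :=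
  (∃ B : ℝ, ∀ x ∈ T, ‖g x‖ ≤ B) ∧
    ∃ (B : ℝ) (N₀ : ℕ), ∀ N ≥ N₀, ∀ x ∈ T, ‖f N x - g x‖ ≤ B / (N : ℝ) ^ 2

namespace UniformApprox

variable {α : Type*} {T : Set α} {f f' : ℕ → α → ℂ} {g g' : α → ℂ}

theorem nonneg_bound (h : UniformApprox T f g) :
    ∃ B : ℝ, 0 ≤ B ∧ (∀ x ∈ T, ‖g x‖ ≤ B) ∧
      ∃ N₀ : ℕ, ∀ N ≥ N₀, ∀ x ∈ T, ‖f N x - g x‖ ≤ B / (N : ℝ) ^ 2 := by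
  obtain ⟨⟨B, hB⟩, B', N₀, h'⟩ := h
  refine ⟨max 0 (max B B'), le_max_left _ _, fun x hx => (hB x hx).trans
    ((le_max_left _ _).trans (le_max_right _ _)), N₀, fun N hN x hx => (h' N hN x hx).trans ?_⟩
  gcongr
  exact (le_max_right _ _).trans (le_max_right _ _)

theorem of_bounded (h : ∃ B : ℝ, ∀ x ∈ T, ‖g x‖ ≤ B) : UniformApprox T (fun _ => g) g :=
  ⟨h, 0, 0, fun N _ x _ => by simp⟩

theorem const (z : ℂ) : UniformApprox T (fun _ _ => z) fun _ => z :=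
  of_bounded ⟨‖z‖, fun _ _ => le_rfl⟩

theorem mul (h : UniformApprox T f g) (h' : UniformApprox T f' g') :
    UniformApprox T (fun N x => f N x * f' N x) fun x => g x * g' x := by
  obtain ⟨B, hB, hg, N₀, hf⟩ := h.nonneg_bound
  obtain ⟨B', hB', hg', N₁, hf'⟩ := h'.nonneg_bound
  refine ⟨⟨B * B', fun x hx => ?_⟩, B * (B' + B') + B * B', max 1 (max N₀ N₁), fun N hN x hx => ?_⟩
  · rw [norm_mul]
    exact mul_le_mul (hg x hx) (hg' x hx) (norm_nonneg _) hB
  · have hN1 : (1 : ℝ) ≤ N := by exact_mod_cast (le_max_left _ _).trans hN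
    have h1 := hf N (((le_max_left _ _).trans (le_max_right _ _)).trans hN) x hx
    have h2 := hf' N (((le_max_right _ _).trans (le_max_right _ _)).trans hN) x hx
    have h3 : ‖f' N x‖ ≤ B' + B' := by
      have h4 : B' / (N : ℝ) ^ 2 ≤ B' := div_le_self hB' (one_le_pow₀ hN1)
      calc ‖f' N x‖ = ‖g' x + (f' N x - g' x)‖ := by congr 1; ring
        _ ≤ ‖g' x‖ + ‖f' N x - g' x‖ := norm_add_le _ _
        _ ≤ B' + B' := add_le_add (hg' x hx) (h2.trans h4)
    calc ‖f N x * f' N x - g x * g' x‖ = ‖(f N x - g x) * f' N x + g x * (f' N x - g' x)‖ := by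
          congr 1; ring
      _ ≤ ‖f N x - g x‖ * ‖f' N x‖ + ‖g x‖ * ‖f' N x - g' x‖ := by
        refine (norm_add_le _ _).trans ?_
        rw [norm_mul, norm_mul]
      _ ≤ B / (N : ℝ) ^ 2 * (B' + B') + B * (B' / (N : ℝ) ^ 2) := by
        have := hg x hx
        gcongr
      _ = (B * (B' + B') + B * B') / (N : ℝ) ^ 2 := by ring

theorem add (h : UniformApprox T f g) (h' : UniformApprox T f' g') :
    UniformApprox T (fun N x => f N x + f' N x) fun x => g x + g' x := by
  obtain ⟨B, hB, hg, N₀, hf⟩ := h.nonneg_bound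
  obtain ⟨B', hB', hg', N₁, hf'⟩ := h'.nonneg_bound
  refine ⟨⟨B + B', fun x hx => (norm_add_le _ _).trans (add_le_add (hg x hx) (hg' x hx))⟩,
    B + B', max N₀ N₁, fun N hN x hx => ?_⟩
  have h1 := hf N ((le_max_left _ _).trans hN) x hx
  have h2 := hf' N ((le_max_right _ _).trans hN) x hx
  rw [add_sub_add_comm, add_div]
  exact (norm_add_le _ _).trans (add_le_add h1 h2)

theorem const_mul (z : ℂ) (h : UniformApprox T f g) :
    UniformApprox T (fun N x => z * f N x) fun x => z * g x := (const z).mul h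

theorem sub (h : UniformApprox T f g) (h' : UniformApprox T f' g') :
    UniformApprox T (fun N x => f N x - f' N x) fun x => g x - g' x := by
  simpa [sub_eq_add_neg] using h.add (h'.const_mul (-1))

theorem congr (h : UniformApprox T f g) (hff' : ∃ N₀ : ℕ, ∀ N ≥ N₀, ∀ x ∈ T, f' N x = f N x)
    (hgg' : ∀ x ∈ T, g' x = g x) : UniformApprox T f' g' := by
  obtain ⟨⟨B, hB⟩, B', N₀, h'⟩ := h
  obtain ⟨N₁, h1⟩ := hff'
  refine ⟨⟨B, fun x hx => (hgg' x hx) ▸ hB x hx⟩, B', max N₀ N₁, fun N hN x hx => ?_⟩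
  rw [h1 N ((le_max_right _ _).trans hN) x hx, hgg' x hx]
  exact h' N ((le_max_left _ _).trans hN) x hx

theorem comp {β : Type*} {S : Set β} (h : UniformApprox T f g) (φ : β → α) (hφ : ∀ y ∈ S, φ y ∈ T) :
    UniformApprox S (fun N y => f N (φ y)) fun y => g (φ y) := by
  obtain ⟨⟨B, hB⟩, B', N₀, h'⟩ := h
  exact ⟨⟨B, fun y hy => hB _ (hφ y hy)⟩, B', N₀, fun N hN y hy => h' N hN _ (hφ y hy)⟩

/-- Two approximations to the same limit, used for even and odd `N` respectively. -/
theorem ite (h : UniformApprox T f g) (h' : UniformApprox T f' g')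
    (hgg' : ∀ x ∈ T, g' x = g x) :
    UniformApprox T (fun N x => if Even N then f N x else f' N x) g := by
  obtain ⟨B, hB, hg, N₀, hf⟩ := h.nonneg_bound
  obtain ⟨-, B', N₁, hf'⟩ := h'
  refine ⟨⟨B, hg⟩, max B B', max N₀ N₁, fun N hN x hx => ?_⟩
  by_cases he : Even N
  · simp only [if_pos he]
    refine (hf N ((le_max_left _ _).trans hN) x hx).trans ?_
    gcongr
    exact le_max_left _ _
  · simp only [if_neg he]
    have := hf' N ((le_max_right _ _).trans hN) x hx
    rw [hgg' x hx] at this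
    refine this.trans ?_
    gcongr
    exact le_max_right _ _

theorem comp_two_mul (h : UniformApprox T f g) : UniformApprox T (fun N => f (2 * N)) g := by
  obtain ⟨B, hB, hg, N₀, hf⟩ := h.nonneg_bound
  refine ⟨⟨B, hg⟩, B, max 1 N₀, fun N hN x hx => ?_⟩
  have hN1 : 1 ≤ N := (le_max_left _ _).trans hN
  have hN0 : (0 : ℝ) < N := by exact_mod_cast hN1
  refine (hf (2 * N) (((le_max_right _ _).trans hN).trans (by omega)) x hx).trans ?_
  push_cast
  gcongr
  linarith

/-- Powers of real approximations that stay away from zero. -/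
theorem rpow {u : ℕ → α → ℝ} {v : α → ℝ} (a : ℝ)
    (h : UniformApprox T (fun N x => (u N x : ℂ)) fun x => (v x : ℂ)) {δ : ℝ} (hδ : 0 < δ)
    (hv : ∀ x ∈ T, δ ≤ v x) :
    UniformApprox T (fun N x => ((u N x ^ a : ℝ) : ℂ)) fun x => ((v x ^ a : ℝ) : ℂ) := by
  obtain ⟨B, hB, hg, N₀, hf⟩ := h.nonneg_bound
  have hcont : ∀ b : ℝ, ContinuousOn (fun y : ℝ => y ^ b) (Set.Icc (δ / 2) (B + 1)) := fun b y hy =>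
    (Real.continuousAt_rpow_const y b (Or.inl (by linarith [hy.1]))).continuousWithinAt
  have hvB : ∀ x ∈ T, v x ≤ B := fun x hx => by
    have := hg x hx
    rw [Complex.norm_real] at this
    exact (le_abs_self _).trans this
  obtain ⟨D, hD⟩ := isCompact_Icc.exists_bound_of_continuousOn
    ((hcont (a - 1)).const_smul a)
  obtain ⟨E, hE⟩ := isCompact_Icc.exists_bound_of_continuousOn (hcont a)
  refine ⟨⟨E, fun x hx => ?_⟩, ?_⟩
  · rw [Complex.norm_real]
    exact hE _ ⟨by linarith [hv x hx], by linarith [hvB x hx]⟩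
  · obtain ⟨N₁, hN₁⟩ := exists_nat_gt (B / min (δ / 2) 1 + 1)
    refine ⟨D * B, max N₀ N₁, fun N hN x hx => ?_⟩
    have hNN : (N₁ : ℝ) ≤ N := by exact_mod_cast (le_max_right _ _).trans hN
    have hδ1 : 0 < min (δ / 2) 1 := by positivity
    have hq : 0 ≤ B / min (δ / 2) 1 := by positivity
    have hN1 : (1 : ℝ) ≤ N := by linarith
    have hd := hf N ((le_max_left _ _).trans hN) x hx
    rw [← Complex.ofReal_sub, Complex.norm_real, Real.norm_eq_abs] at hd
    have hsmall : B / (N : ℝ) ^ 2 ≤ min (δ / 2) 1 := by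
      have h1 : B / min (δ / 2) 1 ≤ N := by linarith
      rw [div_le_iff₀ hδ1] at h1
      rw [div_le_iff₀ (by positivity)]
      nlinarith
    have h2 := abs_le.1 (hd.trans hsmall)
    have h3 : min (δ / 2) 1 ≤ δ / 2 := min_le_left _ _
    have h4 : min (δ / 2) 1 ≤ 1 := min_le_right _ _
    have hvx := hv x hx
    have hvx' := hvB x hx
    have hu : u N x ∈ Set.Icc (δ / 2) (B + 1) := ⟨by linarith, by linarith⟩
    have hvm : v x ∈ Set.Icc (δ / 2) (B + 1) := ⟨by linarith, by linarith⟩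
    have hlip := Convex.norm_image_sub_le_of_norm_hasDerivWithin_le (f := fun y : ℝ => y ^ a)
      (f' := fun y : ℝ => a * y ^ (a - 1)) (s := Set.Icc (δ / 2) (B + 1)) (C := D)
      (fun y hy => (Real.hasDerivAt_rpow_const (Or.inl (by linarith [hy.1]))).hasDerivWithinAt)
      (fun y hy => hD y hy) (convex_Icc _ _) hvm hu
    rw [← Complex.ofReal_sub, Complex.norm_real]
    have hD0 : 0 ≤ D := (norm_nonneg _).trans (hD _ hvm)
    refine hlip.trans ?_
    rw [mul_div_assoc]
    exact mul_le_mul_of_nonneg_left hd hD0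

end UniformApprox

/-! ### The trigonometric factors -/

theorem exists_shift_bound (p : ℝ) (K : ℝ) :
    ∃ N₀ : ℕ, ∀ N ≥ N₀, K ≤ (N : ℝ) + p ∧ 1 ≤ (N : ℝ) + p ∧ (N : ℝ) / 2 ≤ N + p ∧ 1 ≤ N := by
  obtain ⟨N₀, h⟩ := exists_nat_gt (|K| + 2 * |p| + 2)
  refine ⟨N₀, fun N hN => ?_⟩
  have hN' : (N₀ : ℝ) ≤ N := by exact_mod_cast hN
  have h1 := neg_abs_le p
  have h2 := le_abs_self K
  have h3 := abs_nonneg p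
  have h4 := abs_nonneg K
  refine ⟨by linarith, by linarith, by linarith, ?_⟩
  have : (1 : ℝ) ≤ N := by linarith
  exact_mod_cast this

theorem div_shift_sq_le {p : ℝ} {N : ℕ} (B : ℝ) (hB : 0 ≤ B) (h1 : (N : ℝ) / 2 ≤ N + p)
    (hN : 1 ≤ N) : B / ((N : ℝ) + p) ^ 2 ≤ (4 * B) / (N : ℝ) ^ 2 := by
  have hN0 : (0 : ℝ) < N := by exact_mod_cast hN
  calc B / ((N : ℝ) + p) ^ 2 ≤ B / ((N : ℝ) / 2) ^ 2 := by gcongr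
    _ = (4 * B) / (N : ℝ) ^ 2 := by field_simp; ring

theorem abs_sin_sub_self_le {y : ℝ} (hy : |y| ≤ 1) : |Real.sin y - y| ≤ |y| ^ 3 := by
  have h := Real.sin_bound hy
  have h0 := abs_nonneg y
  have h1 : |y| ^ 5 ≤ |y| ^ 3 := pow_le_pow_of_le_one h0 hy (by norm_num)
  have h2 : |y ^ 3 / 6| = |y| ^ 3 / 6 := by rw [abs_div, abs_pow]; norm_num
  calc |Real.sin y - y| = |(Real.sin y - (y - y ^ 3 / 6)) - y ^ 3 / 6| := by congr 1; ring
    _ ≤ |Real.sin y - (y - y ^ 3 / 6)| + |y ^ 3 / 6| := abs_sub _ _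
    _ ≤ |y| ^ 5 / 100 + |y| ^ 3 / 6 := by rw [h2]; gcongr
    _ ≤ |y| ^ 3 := by nlinarith [pow_nonneg h0 3]

theorem uniformApprox_sin_div (p R : ℝ) :
    UniformApprox {x : ℝ | x ≠ 0 ∧ |x| ≤ R}
      (fun N x => (((N + p) * Real.sin (x / (N + p)) / x : ℝ) : ℂ)) fun _ => ((1 : ℝ) : ℂ) := by
  refine ⟨⟨1, fun x _ => by simp⟩, ?_⟩
  obtain ⟨N₀, h⟩ := exists_shift_bound p R
  refine ⟨4 * R ^ 2, N₀, fun N hN x hx => ?_⟩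
  obtain ⟨h1, h2, h3, h4⟩ := h N hN
  have hM : (0 : ℝ) < N + p := by linarith
  rw [← Complex.ofReal_sub, Complex.norm_real, Real.norm_eq_abs]
  refine le_trans ?_ (div_shift_sq_le (p := p) (R ^ 2) (by positivity) h3 h4)
  set M := (N : ℝ) + p with hMd
  have hx0 : 0 < |x| := abs_pos.2 hx.1
  have hxM : |x / M| = |x| / M := by rw [abs_div, abs_of_pos hM]
  have hy : |x / M| ≤ 1 := by
    rw [hxM, div_le_one hM]
    exact hx.2.trans h1
  have hs := abs_sin_sub_self_le hy
  have e : M * Real.sin (x / M) / x - 1 = M / x * (Real.sin (x / M) - x / M) := by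
    have := hx.1
    field_simp
  rw [e, abs_mul, abs_div, abs_of_pos hM]
  calc M / |x| * |Real.sin (x / M) - x / M| ≤ M / |x| * (|x| / M) ^ 3 := by
        rw [← hxM]; gcongr
    _ = |x| ^ 2 / M ^ 2 := by field_simp
    _ ≤ R ^ 2 / M ^ 2 := by
      have := hx.2
      gcongr

/-- Powers of `M sin(x / M)` for `M = N + p`. -/
theorem uniformApprox_rpow_sin_div (p R a : ℝ) :
    UniformApprox {x : ℝ | x ≠ 0 ∧ |x| ≤ R}
      (fun N x => ((((N + p) * Real.sin (x / (N + p)) / x) ^ a : ℝ) : ℂ)) fun _ => 1 := by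
  refine ((uniformApprox_sin_div p R).rpow a one_pos fun x _ => le_rfl).congr
    ⟨0, fun N _ x _ => rfl⟩ fun x _ => by simp

/-! ### The limit of the Euler integrals -/

/-- The Euler integral of `(cos θ + i v sin θ) ^ n`, `v = 2 t - 1`; up to a power of `- sin θ` it
is the value of a Routh-Romanovski polynomial at `-cot θ`. -/
def trigEuler (r q : ℝ) (n : ℕ) (θ : ℝ) : ℂ :=
  euler r q (fun t => (Real.cos θ + Complex.I * (2 * t - 1) * Real.sin θ) ^ n)

/-- The Euler integral of `exp (i v X)`, `v = 2 t - 1`. -/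
def expEuler (r q : ℝ) (X : ℝ) : ℂ :=
  euler r q (fun t => Complex.exp (Complex.I * (2 * t - 1) * X))

theorem expEuler_eq (p q : ℝ) (k : ℕ) (h : 0 < p + k) (X : ℝ) :
    expEuler (p + k) q X = Complex.exp (-Complex.I * X) * C₀ p q k X := by
  have e := euler_exp q h (2 * Complex.I * X)
  have e1 : C₀ p q k X = hyp11 ((p + k : ℝ) - Complex.I * q) (2 * (p + k : ℝ)) (2 * Complex.I * X) := by
    rw [C₀]
    push_cast
    ring_nf
  rw [e1, ← e, expEuler, ← euler_const_mul]
  congr 1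
  ext t
  rw [← Complex.exp_add]
  congr 1
  ring

theorem norm_pow_sub_pow_le {z w : ℂ} (hz : ‖z‖ ≤ 1) (hw : ‖w‖ ≤ 1) (n : ℕ) :
    ‖z ^ n - w ^ n‖ ≤ n * ‖z - w‖ := by
  induction n with
  | zero => simp
  | succ n ih =>
    have hzn : ‖w ^ n‖ ≤ 1 := by
      rw [norm_pow]; exact pow_le_one₀ (norm_nonneg _) hw
    calc ‖z ^ (n + 1) - w ^ (n + 1)‖ = ‖(z ^ n - w ^ n) * z + w ^ n * (z - w)‖ := by
          congr 1; ring
      _ ≤ ‖z ^ n - w ^ n‖ * ‖z‖ + ‖w ^ n‖ * ‖z - w‖ := by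
        refine (norm_add_le _ _).trans ?_
        rw [norm_mul, norm_mul]
      _ ≤ n * ‖z - w‖ * 1 + 1 * ‖z - w‖ := by gcongr
      _ = _ := by push_cast; ring

theorem abs_sq_sub_one_le {v : ℝ} (hv : |v| ≤ 1) : |v ^ 2 - 1| ≤ 1 := by
  have : v ^ 2 ≤ 1 := by rw [← sq_abs]; exact pow_le_one₀ (abs_nonneg v) hv
  rw [abs_le]
  constructor <;> nlinarith [sq_nonneg v]

/-- The logarithm of `cos θ + i v sin θ` is `i v θ + (v² - 1) θ² / 2` up to
terms of third order, uniformly in `v`. -/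
theorem norm_trig_sub_exp_le {θ v : ℝ} (hθ : |θ| ≤ 1 / 2) (hv : |v| ≤ 1) :
    ‖((Real.cos θ + Complex.I * v * Real.sin θ : ℂ)) -
      Complex.exp (Complex.I * v * θ + (v ^ 2 - 1) * θ ^ 2 / 2)‖ ≤ 10 * |θ| ^ 3 := by
  have h0 := abs_nonneg θ
  have hv2 := abs_sq_sub_one_le hv
  have h4 : |θ| ^ 4 ≤ |θ| ^ 3 / 2 := by
    have : |θ| ^ 4 = |θ| ^ 3 * |θ| := by ring
    rw [this]
    nlinarith [pow_nonneg h0 3]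
  have hc := Real.cos_bound (x := θ) (by linarith)
  have hs := Real.sin_bound (x := θ) (by linarith)
  set w : ℂ := Complex.I * v * θ + (v ^ 2 - 1) * θ ^ 2 / 2 with hw
  have hwn : ‖w‖ ≤ 2 * |θ| := by
    have e1 : ‖(Complex.I * v * θ : ℂ)‖ = |v| * |θ| := by simp
    have e2 : ‖(((v : ℂ) ^ 2 - 1) * θ ^ 2 / 2 : ℂ)‖ = |v ^ 2 - 1| * |θ| ^ 2 / 2 := by
      have : (((v : ℂ) ^ 2 - 1) * θ ^ 2 / 2 : ℂ) = (((v ^ 2 - 1) * θ ^ 2 / 2 : ℝ) : ℂ) := by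
        push_cast; ring
      rw [this, Complex.norm_real, Real.norm_eq_abs, abs_div, abs_mul, abs_pow]
      norm_num
    refine (norm_add_le _ _).trans ?_
    rw [e1, e2]
    nlinarith [mul_le_mul_of_nonneg_right hv h0, mul_le_mul_of_nonneg_right hv2 (sq_nonneg |θ|)]
  have hexp := Complex.exp_bound (x := w) (by linarith) (n := 3) (by norm_num)
  have hsum : ∑ m ∈ Finset.range 3, w ^ m / (m.factorial : ℂ) = 1 + w + w ^ 2 / 2 := by
    simp [Finset.sum_range_succ, Nat.factorial]
  rw [hsum] at hexp
  have hexp' : ‖Complex.exp w - (1 + w + w ^ 2 / 2)‖ ≤ 2 * |θ| ^ 3 := by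
    refine hexp.trans ?_
    have : ‖w‖ ^ 3 ≤ (2 * |θ|) ^ 3 := by gcongr
    rw [mul_pow] at this
    norm_num [Nat.factorial]
    linarith [pow_nonneg h0 3]
  have e : (Real.cos θ + Complex.I * v * Real.sin θ : ℂ) - Complex.exp w =
      ((Real.cos θ - (1 - θ ^ 2 / 2) : ℝ) : ℂ) +
        Complex.I * ((v * (Real.sin θ - (θ - θ ^ 3 / 6)) - v * θ ^ 3 / 6 -
          v * (v ^ 2 - 1) * θ ^ 3 / 2 : ℝ) : ℂ) -
        (((v ^ 2 - 1) ^ 2 * θ ^ 4 / 8 : ℝ) : ℂ) - (Complex.exp w - (1 + w + w ^ 2 / 2)) := by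
    rw [hw]
    push_cast
    linear_combination (-(v : ℂ) ^ 2 * θ ^ 2 / 2) * Complex.I_sq
  rw [e]
  have hv0 := abs_nonneg v
  have b1 : ‖((Real.cos θ - (1 - θ ^ 2 / 2) : ℝ) : ℂ)‖ ≤ |θ| ^ 3 := by
    rw [Complex.norm_real, Real.norm_eq_abs]
    refine hc.trans ?_
    nlinarith [pow_nonneg h0 3]
  have b2 : ‖Complex.I * ((v * (Real.sin θ - (θ - θ ^ 3 / 6)) - v * θ ^ 3 / 6 -
          v * (v ^ 2 - 1) * θ ^ 3 / 2 : ℝ) : ℂ)‖ ≤ 3 * |θ| ^ 3 := by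
    rw [norm_mul, Complex.norm_I, one_mul, Complex.norm_real, Real.norm_eq_abs]
    have t1 : |v * (Real.sin θ - (θ - θ ^ 3 / 6))| ≤ |θ| ^ 3 := by
      rw [abs_mul]
      calc |v| * |Real.sin θ - (θ - θ ^ 3 / 6)| ≤ 1 * (|θ| ^ 5 / 100) := by gcongr
        _ ≤ |θ| ^ 3 := by
          have h5 : |θ| ^ 5 ≤ |θ| ^ 3 := pow_le_pow_of_le_one h0 (by linarith) (by norm_num)
          linarith [pow_nonneg h0 3]
    have t2 : |v * θ ^ 3 / 6| ≤ |θ| ^ 3 := by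
      rw [abs_div, abs_mul, abs_pow, abs_of_pos (by norm_num : (0 : ℝ) < 6)]
      nlinarith [pow_nonneg h0 3, mul_le_mul_of_nonneg_right hv (pow_nonneg h0 3)]
    have t3 : |v * (v ^ 2 - 1) * θ ^ 3 / 2| ≤ |θ| ^ 3 := by
      rw [abs_div, abs_mul, abs_mul, abs_pow, abs_of_pos (by norm_num : (0 : ℝ) < 2)]
      have : |v| * |v ^ 2 - 1| ≤ 1 := mul_le_one₀ hv (abs_nonneg _) hv2
      nlinarith [pow_nonneg h0 3, mul_le_mul_of_nonneg_right this (pow_nonneg h0 3)]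
    calc _ ≤ |v * (Real.sin θ - (θ - θ ^ 3 / 6))| + |v * θ ^ 3 / 6| +
          |v * (v ^ 2 - 1) * θ ^ 3 / 2| :=
          (abs_sub _ _).trans (add_le_add (abs_sub _ _) le_rfl)
      _ ≤ 3 * |θ| ^ 3 := by linarith
  have b3 : ‖(((v ^ 2 - 1) ^ 2 * θ ^ 4 / 8 : ℝ) : ℂ)‖ ≤ |θ| ^ 3 := by
    rw [Complex.norm_real, Real.norm_eq_abs, abs_div, abs_mul, abs_pow, abs_pow,
      abs_of_pos (by norm_num : (0 : ℝ) < 8)]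
    have : |v ^ 2 - 1| ^ 2 ≤ 1 := pow_le_one₀ (abs_nonneg _) hv2
    nlinarith [pow_nonneg h0 3, mul_le_mul_of_nonneg_right this (pow_nonneg h0 4)]
  calc _ ≤ |θ| ^ 3 + 3 * |θ| ^ 3 + |θ| ^ 3 + 2 * |θ| ^ 3 :=
        (norm_sub_le _ _).trans (add_le_add ((norm_sub_le _ _).trans (add_le_add
          ((norm_add_le _ _).trans (add_le_add b1 b2)) b3)) hexp')
    _ ≤ 10 * |θ| ^ 3 := by nlinarith [pow_nonneg h0 3]

theorem norm_trig_le_one {θ v : ℝ} (hv : |v| ≤ 1) :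
    ‖(Real.cos θ + Complex.I * v * Real.sin θ : ℂ)‖ ≤ 1 := by
  have e : (Real.cos θ + Complex.I * v * Real.sin θ : ℂ) =
      (Real.cos θ : ℂ) + ((v * Real.sin θ : ℝ) : ℂ) * Complex.I := by push_cast; ring
  rw [e, Complex.norm_add_mul_I]
  refine Real.sqrt_le_one.2 ?_
  have : v ^ 2 ≤ 1 := by rw [← sq_abs]; exact pow_le_one₀ (abs_nonneg v) hv
  nlinarith [Real.sin_sq_add_cos_sq θ, mul_le_mul_of_nonneg_right this (sq_nonneg (Real.sin θ))]

/-- The term of order `1 / M` in the expansion of `trigEuler` integrates to zero. -/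
theorem euler_first_order (r q : ℝ) (h : EulerParam r q) (X : ℝ) :
    euler r q (fun t => Complex.exp (Complex.I * (2 * t - 1) * X) *
      (((2 * t - 1) ^ 2 - 1) * X ^ 2 / 2 - r * Complex.I * (2 * t - 1) * X + q * X)) = 0 := by
  have hd : ∀ t : ℝ, HasDerivAt (fun t : ℝ => Complex.exp (Complex.I * (2 * t - 1) * X))
      (Complex.exp (Complex.I * (2 * t - 1) * X) * (Complex.I * 2 * X)) t := fun t => by
    have h1 : HasDerivAt (fun z : ℂ => Complex.I * (2 * z - 1) * X) (Complex.I * 2 * X) (t : ℂ) := by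
      simpa using ((((hasDerivAt_id (t : ℂ)).const_mul 2).sub_const 1).const_mul
        Complex.I).mul_const (X : ℂ)
    exact h1.cexp.comp_ofReal
  have key := euler_integral_by_parts r q h hd (by fun_prop)
  have := congrArg (fun z => Complex.I * X * z) key
  simp only [mul_zero] at this
  rw [← this, ← euler_const_mul]
  congr 1
  ext t
  linear_combination (-Complex.exp (Complex.I * (2 * t - 1) * X)) *
    (-(q : ℂ) * X + 2 * t * (1 - t) * X ^ 2) * Complex.I_sq

theorem norm_ofReal_exp_mul_pow_sub_le {M R q r x v : ℝ} {n : ℕ} (hM : 1 ≤ M) (hx : |x| ≤ R)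
    (hn : (n : ℝ) = M - r) (hv : |v| ≤ 1) {z : ℂ} (hz : ‖z‖ ≤ 1)
    (hzw : ‖((Real.cos (x / M) + Complex.I * v * Real.sin (x / M) : ℂ)) - z‖ ≤
      10 * |x / M| ^ 3) :
    ‖(Real.exp (q * (x / M)) : ℂ) * ((Real.cos (x / M) + Complex.I * v * Real.sin (x / M)) ^ n -
      z ^ n)‖ ≤ Real.exp (|q| * R) * ((1 + |r|) * (10 * R ^ 3)) / M ^ 2 := by
  have hM0 : 0 < M := by linarith
  have hR : 0 ≤ R := (abs_nonneg x).trans hx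
  have hθ : |x / M| ≤ R / M := by rw [abs_div, abs_of_pos hM0]; gcongr
  rw [norm_mul, Complex.norm_real, Real.norm_of_nonneg (Real.exp_pos _).le]
  have q1 : Real.exp (q * (x / M)) ≤ Real.exp (|q| * R) := by
    refine Real.exp_le_exp.2 ((le_abs_self _).trans ?_)
    rw [abs_mul]
    exact mul_le_mul_of_nonneg_left (hθ.trans (div_le_self hR hM)) (abs_nonneg _)
  have q4 : (n : ℝ) ≤ (1 + |r|) * M := by
    have h1 : |r| ≤ |r| * M := le_mul_of_one_le_right (abs_nonneg r) hM
    linarith [neg_abs_le r]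
  have q2 : ‖(Real.cos (x / M) + Complex.I * v * Real.sin (x / M) : ℂ) ^ n - z ^ n‖ ≤
      (1 + |r|) * (10 * R ^ 3) / M ^ 2 := by
    refine (norm_pow_sub_pow_le (norm_trig_le_one hv) hz n).trans ?_
    calc _ ≤ ((1 + |r|) * M) * (10 * (R / M) ^ 3) := by
          refine mul_le_mul q4 (hzw.trans ?_) (norm_nonneg _) (by positivity)
          gcongr
      _ = (1 + |r|) * (10 * R ^ 3) / M ^ 2 := by field_simp
  calc _ ≤ Real.exp (|q| * R) * ((1 + |r|) * (10 * R ^ 3) / M ^ 2) :=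
        mul_le_mul q1 q2 (norm_nonneg _) (Real.exp_pos _).le
    _ = _ := by ring

/-- The second-order expansion of `exp (q θ) (cos θ + i v sin θ) ^ n` at `θ = x / M`,
`n = M - r`. -/
theorem norm_trig_pow_expansion_le {M R q r x v G : ℝ} {n : ℕ} (hM : 1 ≤ M) (hx : |x| ≤ R)
    (hRM : 2 * R ≤ M) (hG : G = R ^ 2 / 2 + |r| * R + |q| * R + |r| * R ^ 2 / 2) (hGM : G ≤ M)
    (hn : (n : ℝ) = M - r) (hv : |v| ≤ 1) :
    ‖(Real.exp (q * (x / M)) : ℂ) * (Real.cos (x / M) + Complex.I * v * Real.sin (x / M)) ^ n +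
      (-1 * Complex.exp (Complex.I * v * x) + (-1 / M) * (Complex.exp (Complex.I * v * x) *
        (((v : ℂ) ^ 2 - 1) * x ^ 2 / 2 - r * Complex.I * v * x + q * x)))‖ ≤
      (Real.exp (|q| * R) * ((1 + |r|) * (10 * R ^ 3)) + (G ^ 2 + G)) / M ^ 2 := by
  have hM0 : 0 < M := by linarith
  have hR : 0 ≤ R := (abs_nonneg x).trans hx
  have hG0 : 0 ≤ G := by rw [hG]; positivity
  have hv2 := abs_sq_sub_one_le hv
  have hθ2 : |x / M| ≤ 1 / 2 := by
    rw [abs_div, abs_of_pos hM0, div_le_iff₀ hM0]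
    linarith
  -- The total exponent `w n + q x / M` equals `i v x + g1 / M + g2 / M²`.
  set w : ℂ := Complex.I * v * (x / M : ℝ) + (v ^ 2 - 1) * (x / M : ℝ) ^ 2 / 2 with hw
  set g1 : ℂ := ((v : ℂ) ^ 2 - 1) * x ^ 2 / 2 - r * Complex.I * v * x + q * x with hg1
  set g2 : ℂ := -(r * ((v : ℂ) ^ 2 - 1) * x ^ 2 / 2) with hg2
  have hMc : (M : ℂ) ≠ 0 := by exact_mod_cast hM0.ne'
  have hx2 : |x| ^ 2 ≤ R ^ 2 := by gcongr
  have hvx : |v ^ 2 - 1| * |x| ^ 2 ≤ R ^ 2 := by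
    have := mul_le_mul hv2 hx2 (by positivity) zero_le_one
    linarith
  have hg1n : ‖g1‖ ≤ R ^ 2 / 2 + |r| * R + |q| * R := by
    have t1 : ‖((v : ℂ) ^ 2 - 1) * x ^ 2 / 2‖ ≤ R ^ 2 / 2 := by
      have : (((v : ℂ) ^ 2 - 1) * x ^ 2 / 2 : ℂ) = (((v ^ 2 - 1) * x ^ 2 / 2 : ℝ) : ℂ) := by
        push_cast; ring
      rw [this, Complex.norm_real, Real.norm_eq_abs, abs_div, abs_mul, abs_pow, abs_two]
      linarith
    have t2 : ‖(r * Complex.I * v * x : ℂ)‖ ≤ |r| * R := by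
      simp only [norm_mul, Complex.norm_real, Complex.norm_I, Real.norm_eq_abs, mul_one]
      calc |r| * |v| * |x| ≤ |r| * 1 * R := by gcongr
        _ = |r| * R := by ring
    have t3 : ‖(q * x : ℂ)‖ ≤ |q| * R := by
      simp only [norm_mul, Complex.norm_real, Real.norm_eq_abs]
      gcongr
    exact (norm_add_le _ _).trans (add_le_add ((norm_sub_le _ _).trans (add_le_add t1 t2)) t3)
  have hg2n : ‖g2‖ ≤ |r| * R ^ 2 / 2 := by
    have : g2 = ((-(r * (v ^ 2 - 1) * x ^ 2 / 2) : ℝ) : ℂ) := by rw [hg2]; push_cast; ring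
    rw [this, Complex.norm_real, Real.norm_eq_abs, abs_neg, abs_div, abs_mul, abs_mul, abs_pow,
      abs_two, mul_assoc]
    have := mul_le_mul_of_nonneg_left hvx (abs_nonneg r)
    linarith
  set E : ℂ := g1 / M + g2 / M ^ 2 with hE
  have hEn : ‖E‖ ≤ G / M := by
    have t1 : ‖g1 / M‖ ≤ (R ^ 2 / 2 + |r| * R + |q| * R) / M := by
      rw [norm_div, Complex.norm_real, Real.norm_of_nonneg hM0.le]
      gcongr
    have t2 : ‖g2 / (M : ℂ) ^ 2‖ ≤ (|r| * R ^ 2 / 2) / M := by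
      rw [norm_div, norm_pow, Complex.norm_real, Real.norm_of_nonneg hM0.le]
      have : M ≤ M ^ 2 := le_self_pow₀ hM (by norm_num)
      gcongr
    refine (norm_add_le _ _).trans ((add_le_add t1 t2).trans (le_of_eq ?_))
    rw [hG]
    ring
  have hE1 : ‖E‖ ≤ 1 := hEn.trans (by rw [div_le_one hM0]; linarith)
  have hexpE := Complex.norm_exp_sub_one_sub_id_le hE1
  have hpow : Real.exp (q * (x / M)) * Complex.exp w ^ n =
      Complex.exp (Complex.I * v * x) * Complex.exp E := by
    rw [← Complex.exp_nat_mul, Complex.ofReal_exp, ← Complex.exp_add, ← Complex.exp_add]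
    congr 1
    have hnc : (n : ℂ) = M - r := by
      have := congrArg (fun y : ℝ => (y : ℂ)) hn
      simpa using this
    rw [hnc, hE, hg1, hg2, hw]
    push_cast
    field_simp
    ring
  have hwre : ‖Complex.exp w‖ ≤ 1 := by
    rw [Complex.norm_exp, Real.exp_le_one_iff]
    have : w = (((v ^ 2 - 1) * (x / M) ^ 2 / 2 : ℝ) : ℂ) + ((v * (x / M) : ℝ) : ℂ) * Complex.I := by
      rw [hw]; push_cast; ring
    rw [this, Complex.add_re, Complex.ofReal_re, Complex.re_ofReal_mul, Complex.I_re]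
    have hvv : v ^ 2 ≤ 1 := by rw [← sq_abs]; exact pow_le_one₀ (abs_nonneg v) hv
    have := mul_nonneg (sub_nonneg.2 hvv) (sq_nonneg (x / M))
    linarith
  have hnorm1 : ‖Complex.exp (Complex.I * v * x)‖ = 1 := by
    rw [show Complex.I * v * x = ((x * v : ℝ) : ℂ) * Complex.I by push_cast; ring,
      Complex.norm_exp_ofReal_mul_I]
  have p1 := norm_ofReal_exp_mul_pow_sub_le (q := q) hM hx hn hv hwre
    (norm_trig_sub_exp_le hθ2 hv)
  set ζ : ℂ := Real.cos (x / M) + Complex.I * v * Real.sin (x / M) with hζ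
  have e : Real.exp (q * (x / M)) * ζ ^ n + (-1 * Complex.exp (Complex.I * v * x) +
      (-1 / M) * (Complex.exp (Complex.I * v * x) * g1)) =
      Real.exp (q * (x / M)) * (ζ ^ n - Complex.exp w ^ n) +
      Complex.exp (Complex.I * v * x) * ((Complex.exp E - 1 - E) + g2 / M ^ 2) := by
    rw [mul_sub, hpow, hE]
    ring
  have p2 : ‖Complex.exp (Complex.I * v * x) * ((Complex.exp E - 1 - E) + g2 / (M : ℂ) ^ 2)‖ ≤
      (G ^ 2 + G) / M ^ 2 := by
    rw [norm_mul, hnorm1, one_mul, add_div]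
    refine (norm_add_le _ _).trans (add_le_add ?_ ?_)
    · refine hexpE.trans ?_
      rw [← div_pow]
      gcongr
    · rw [norm_div, norm_pow, Complex.norm_real, Real.norm_of_nonneg hM0.le]
      have : |r| * R ^ 2 / 2 ≤ G := by
        rw [hG]
        have : 0 ≤ R ^ 2 / 2 + |r| * R + |q| * R := by positivity
        linarith
      gcongr
      exact hg2n.trans this
  rw [e, add_div]
  exact (norm_add_le _ _).trans (add_le_add p1 p2)

/-- The rescaled Euler integrals converge with an error `O(1 / N ^ 2)`: there is no term of
order `1 / N` when the scale is `N + p`. -/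
theorem uniformApprox_trigEuler (p q : ℝ) (k : ℕ) (h : EulerParam (p + k) q) (R : ℝ) (hR : 0 ≤ R) :
    UniformApprox {x : ℝ | |x| ≤ R}
      (fun N x => Real.exp (q * (x / (N + p))) * trigEuler (p + k) q (N - k) (x / (N + p)))
      (expEuler (p + k) q) := by
  set r := p + k with hr
  obtain ⟨B, hB, hbd⟩ := exists_norm_euler_le r q h
  have hv1 : ∀ t ∈ Set.Icc (0 : ℝ) 1, |2 * t - 1| ≤ 1 := fun t ht =>
    abs_le.2 ⟨by linarith [ht.1], by linarith [ht.2]⟩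
  refine ⟨⟨B * 1, fun x _ => hbd _ _ fun t _ => ?_⟩, ?_⟩
  · rw [show Complex.I * (2 * t - 1) * x = ((x * (2 * t - 1) : ℝ) : ℂ) * Complex.I by
      push_cast; ring, Complex.norm_exp_ofReal_mul_I]
  set G := R ^ 2 / 2 + |r| * R + |q| * R + |r| * R ^ 2 / 2 with hG
  have hGn : 0 ≤ G := by positivity
  set D := Real.exp (|q| * R) * ((1 + |r|) * (10 * R ^ 3)) + (G ^ 2 + G) with hD
  have hDn : 0 ≤ D := by positivity
  obtain ⟨N₀, hN₀⟩ := exists_shift_bound p (2 * R + G)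
  refine ⟨4 * (B * D), max N₀ k, fun N hN x hx => ?_⟩
  obtain ⟨h1, h2, h3, h4⟩ := hN₀ N ((le_max_left _ _).trans hN)
  refine le_trans ?_ (div_shift_sq_le (p := p) (B * D) (by positivity) h3 h4)
  have hNk : ((N - k : ℕ) : ℝ) = N + p - r := by
    rw [Nat.cast_sub ((le_max_right _ _).trans hN), hr]; ring
  have hsplit : Real.exp (q * (x / (N + p))) * trigEuler r q (N - k) (x / (N + p)) -
      expEuler r q x = euler r q (fun t => Real.exp (q * (x / (N + p))) *
        (Real.cos (x / (N + p)) + Complex.I * (2 * t - 1) * Real.sin (x / (N + p))) ^ (N - k) +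
        (-1 * Complex.exp (Complex.I * (2 * t - 1) * x) +
        (-1 / (N + p : ℝ)) * (Complex.exp (Complex.I * (2 * t - 1) * x) *
      (((2 * t - 1) ^ 2 - 1) * x ^ 2 / 2 - r * Complex.I * (2 * t - 1) * x + q * x)))) := by
    rw [euler_add r q h (by fun_prop) (by fun_prop), euler_add r q h (by fun_prop) (by fun_prop),
      euler_const_mul, euler_const_mul, euler_const_mul, euler_first_order r q h, trigEuler,
      expEuler]
    ring
  rw [hsplit, mul_div_assoc]
  refine hbd _ _ fun t ht => ?_
  have evc : (2 * t - 1 : ℂ) = ((2 * t - 1 : ℝ) : ℂ) := by push_cast; ring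
  rw [evc]
  exact norm_trig_pow_expansion_le h2 hx (by linarith) hG (by linarith) hNk (hv1 t ht)

/-! ### Quotients of Gamma functions -/

/-- The quotient `Γ(x + r) / Γ(x + 1 - r) * x ^ (1 - 2 r)`, which is `1 + O(1 / x ^ 2)`. -/
def gammaRatio (r x : ℝ) : ℝ := Real.Gamma (x + r) / Real.Gamma (x + 1 - r) * x ^ (1 - 2 * r)

theorem abs_log_one_add_sub_le {y : ℝ} (hy : |y| ≤ 1 / 2) :
    |Real.log (1 + y) - y + y ^ 2 / 2| ≤ 2 * |y| ^ 3 := by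
  have h := Real.abs_log_sub_add_sum_range_le (x := -y) (by rw [abs_neg]; linarith) 2
  rw [abs_neg, sub_neg_eq_add] at h
  have e : ∑ i ∈ Finset.range 2, (-y) ^ (i + 1) / ((i : ℝ) + 1) + Real.log (1 + y) =
      Real.log (1 + y) - y + y ^ 2 / 2 := by
    simp [Finset.sum_range_succ]
    ring
  rw [e] at h
  refine h.trans ?_
  rw [div_le_iff₀ (by linarith)]
  have := mul_nonneg (pow_nonneg (abs_nonneg y) 3) (by linarith : 0 ≤ 1 - 2 * |y|)
  norm_num
  linarith

theorem gammaRatio_pos (r : ℝ) {x : ℝ} (hx : |r| + 1 ≤ x) : 0 < gammaRatio r x := by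
  have h1 := neg_abs_le r
  have h2 := le_abs_self r
  have h3 := abs_nonneg r
  exact mul_pos (div_pos (Real.Gamma_pos_of_pos (by linarith)) (Real.Gamma_pos_of_pos (by linarith)))
    (Real.rpow_pos_of_pos (by linarith) _)

theorem abs_log_gammaRatio_succ_sub_le (r : ℝ) {x : ℝ} (hx : 2 * |r| + 4 ≤ x) :
    |Real.log (gammaRatio r (x + 1)) - Real.log (gammaRatio r x)| ≤
      (2 * |r| ^ 3 + 2 * |1 - r| ^ 3 + 2 * |1 - 2 * r|) / x ^ 3 := by
  have h1 := neg_abs_le r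
  have h2 := le_abs_self r
  have h3 := abs_nonneg r
  have hx0 : 0 < x := by linarith
  have e : Real.log (gammaRatio r (x + 1)) - Real.log (gammaRatio r x) =
      Real.log (1 + r / x) - Real.log (1 + (1 - r) / x) + (1 - 2 * r) * Real.log (1 + 1 / x) := by
    have g1 : Real.Gamma (x + 1 + r) = (x + r) * Real.Gamma (x + r) := by
      rw [← Real.Gamma_add_one (by linarith)]; ring_nf
    have g2 : Real.Gamma (x + 1 + 1 - r) = (x + 1 - r) * Real.Gamma (x + 1 - r) := by
      rw [← Real.Gamma_add_one (by linarith)]; ring_nf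
    have p1 : 0 < Real.Gamma (x + r) := Real.Gamma_pos_of_pos (by linarith)
    have p2 : 0 < Real.Gamma (x + 1 - r) := Real.Gamma_pos_of_pos (by linarith)
    have p3 : 0 < x + r := by linarith
    have p4 : 0 < x + 1 - r := by linarith
    have q1 : 0 < x ^ (1 - 2 * r) := Real.rpow_pos_of_pos hx0 _
    have q2 : 0 < (x + 1) ^ (1 - 2 * r) := Real.rpow_pos_of_pos (by linarith) _
    have l1 : 1 + r / x = (x + r) / x := by field_simp
    have l2 : 1 + (1 - r) / x = (x + 1 - r) / x := by field_simp; ring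
    have l3 : 1 + 1 / x = (x + 1) / x := by field_simp
    rw [gammaRatio, gammaRatio, g1, g2, l1, l2, l3, Real.log_mul (by positivity) q2.ne',
      Real.log_mul (by positivity) q1.ne', Real.log_div (by positivity) (by positivity),
      Real.log_div p1.ne' p2.ne', Real.log_mul p3.ne' p1.ne', Real.log_mul p4.ne' p2.ne',
      Real.log_div p3.ne' hx0.ne', Real.log_div p4.ne' hx0.ne',
      Real.log_div (by linarith) hx0.ne', Real.log_rpow hx0, Real.log_rpow (by linarith)]
    ring
  have habs : ∀ y : ℝ, |y / x| = |y| / x := fun y => by rw [abs_div, abs_of_pos hx0]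
  have hb : |1 - r| ≤ 1 + |r| := by
    have := abs_sub (1 : ℝ) r
    rwa [abs_one] at this
  have b1 := abs_log_one_add_sub_le (y := r / x) (by
    rw [habs, div_le_iff₀ hx0]; linarith)
  have b2 := abs_log_one_add_sub_le (y := (1 - r) / x) (by
    rw [habs, div_le_iff₀ hx0]; linarith)
  have b3 := abs_log_one_add_sub_le (y := 1 / x) (by
    rw [habs, div_le_iff₀ hx0, abs_one]; linarith)
  rw [habs] at b1 b2 b3
  -- the terms of order `1 / x` and `1 / x ^ 2` cancel
  have e2 : Real.log (1 + r / x) - Real.log (1 + (1 - r) / x) +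
      (1 - 2 * r) * Real.log (1 + 1 / x) =
      (Real.log (1 + r / x) - r / x + (r / x) ^ 2 / 2) -
      (Real.log (1 + (1 - r) / x) - (1 - r) / x + ((1 - r) / x) ^ 2 / 2) +
      (1 - 2 * r) * (Real.log (1 + 1 / x) - 1 / x + (1 / x) ^ 2 / 2) := by
    ring
  rw [e, e2]
  calc _ ≤ 2 * (|r| / x) ^ 3 + 2 * (|1 - r| / x) ^ 3 + |1 - 2 * r| * (2 * (|1| / x) ^ 3) := by
        refine (abs_add_le _ _).trans (add_le_add ((abs_sub _ _).trans (add_le_add b1 b2)) ?_)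
        rw [abs_mul]
        gcongr
    _ = _ := by rw [abs_one]; ring

theorem tendsto_gammaRatio_add (r : ℝ) {x : ℝ} (hx : 2 * |r| + 4 ≤ x) :
    Filter.Tendsto (fun n : ℕ => gammaRatio r (x + n)) Filter.atTop (nhds 1) := by
  have h1 := neg_abs_le r
  have h2 := le_abs_self r
  have h3 := abs_nonneg r
  have t1 := tendsto_Gamma_div (x := x + r - 1) (by linarith)
  have t2 := tendsto_Gamma_div (x := x - r) (by linarith)
  have t3 : Filter.Tendsto (fun n : ℕ => (1 + x / (n : ℝ)) ^ (1 - 2 * r)) Filter.atTop (nhds 1) := by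
    have := ((tendsto_const_div_atTop_nhds_zero_nat x).const_add 1).rpow_const (p := 1 - 2 * r)
      (Or.inl (by norm_num))
    simpa using this
  have t4 := (t1.div t2 one_ne_zero).mul t3
  rw [div_one, one_mul] at t4
  refine t4.congr' ?_
  filter_upwards [Filter.eventually_ge_atTop 1] with n hn
  have hn0 : (0 : ℝ) < n := by exact_mod_cast hn
  have p2 : 0 < Real.Gamma (x - r + n + 1) := Real.Gamma_pos_of_pos (by linarith)
  have hf : (0 : ℝ) < n.factorial := by exact_mod_cast n.factorial_pos
  have e1 : 1 + x / n = (x + n) / n := by field_simp; ring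
  have e2 : (n : ℝ) ^ (x - r) = (n : ℝ) ^ (x + r - 1) * (n : ℝ) ^ (1 - 2 * r) := by
    rw [← Real.rpow_add hn0]
    ring_nf
  have p3 : 0 < (n : ℝ) ^ (x + r - 1) := Real.rpow_pos_of_pos hn0 _
  have p4 : 0 < (n : ℝ) ^ (1 - 2 * r) := Real.rpow_pos_of_pos hn0 _
  rw [gammaRatio, Pi.div_apply, e1, Real.div_rpow (by linarith) hn0.le, e2,
    show x + n + r = x + r - 1 + n + 1 by ring, show x + n + 1 - r = x - r + n + 1 by ring]
  field_simp

/-- A null sequence with increments `O((x + n) ^ (-3))` starts with a term `O(x ^ (-2))`, by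
telescoping. -/
theorem abs_le_of_abs_succ_sub_le {u : ℕ → ℝ} {C x : ℝ} (hC : 0 ≤ C) (hx : 1 ≤ x)
    (h : ∀ n : ℕ, |u (n + 1) - u n| ≤ C / (x + n) ^ 3)
    (hlim : Filter.Tendsto u Filter.atTop (nhds 0)) : |u 0| ≤ 2 * C / x ^ 2 := by
  have hstep : ∀ n : ℕ, C / (x + n) ^ 3 ≤ 2 * C / (x + n) ^ 2 - 2 * C / (x + (n + 1 : ℕ)) ^ 2 := by
    intro n
    have hn : (0 : ℝ) ≤ n := Nat.cast_nonneg n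
    set y := x + n with hy
    have hy1 : 1 ≤ y := by linarith
    have e : x + ((n + 1 : ℕ) : ℝ) = y + 1 := by push_cast; ring
    rw [e, div_sub_div _ _ (by positivity) (by positivity), div_le_div_iff₀ (by positivity)
      (by positivity)]
    have key : y ^ 2 * (y + 1) ^ 2 ≤ 2 * ((y + 1) ^ 2 - y ^ 2) * y ^ 3 := by
      have : 0 ≤ y ^ 2 * (3 * y ^ 2 - 1) := by
        have : 1 ≤ y ^ 2 := one_le_pow₀ hy1
        nlinarith [sq_nonneg y]
      nlinarith
    nlinarith [mul_le_mul_of_nonneg_left key hC]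
  have hz : Filter.Tendsto (fun n : ℕ => 2 * C / (x + n) ^ 2) Filter.atTop (nhds 0) := by
    refine Filter.Tendsto.div_atTop tendsto_const_nhds ?_
    exact (Filter.tendsto_pow_atTop two_ne_zero).comp
      (Filter.tendsto_atTop_add_const_left _ _ tendsto_natCast_atTop_atTop)
  have hmono : Monotone fun n : ℕ => u n - 2 * C / (x + n) ^ 2 := monotone_nat_of_le_succ fun n => by
    have := (abs_le.1 (h n)).1
    have := hstep n
    linarith
  have hanti : Antitone fun n : ℕ => u n + 2 * C / (x + n) ^ 2 := antitone_nat_of_succ_le fun n => by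
    have := (abs_le.1 (h n)).2
    have := hstep n
    linarith
  have l1 := hmono.ge_of_tendsto (by simpa using hlim.sub hz) 0
  have l2 := hanti.le_of_tendsto (by simpa using hlim.add hz) 0
  simp only [Nat.cast_zero, add_zero] at l1 l2
  rw [abs_le]
  constructor <;> linarith

/-- The symmetry `r ↦ 1 - r` of the arguments removes the term of order `1 / x`: the logarithm of
`gammaRatio r x` changes by `O(x ^ (-3))` when `x` increases by one. -/
theorem exists_abs_gammaRatio_sub_one_le (r : ℝ) :
    ∃ B x₀ : ℝ, 0 ≤ B ∧ ∀ x ≥ x₀, |gammaRatio r x - 1| ≤ B / x ^ 2 := by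
  set C := 2 * |r| ^ 3 + 2 * |1 - r| ^ 3 + 2 * |1 - 2 * r| with hC
  have hC0 : 0 ≤ C := by positivity
  refine ⟨4 * C, 2 * |r| + 4 + 2 * C, by positivity, fun x hx => ?_⟩
  have h3 := abs_nonneg r
  have hx1 : 2 * |r| + 4 ≤ x := by linarith
  have hlog : |Real.log (gammaRatio r x)| ≤ 2 * C / x ^ 2 := by
    have := abs_le_of_abs_succ_sub_le (u := fun n : ℕ => Real.log (gammaRatio r (x + n))) (x := x)
      hC0 (by linarith) (fun n => ?_) ?_
    · simpa using this
    · have hn : (0 : ℝ) ≤ n := Nat.cast_nonneg n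
      have := abs_log_gammaRatio_succ_sub_le r (x := x + n) (by linarith)
      push_cast
      rwa [← add_assoc]
    · have := (tendsto_gammaRatio_add r hx1).log one_ne_zero
      rwa [Real.log_one] at this
  have hx2 : 0 < x := by linarith
  have hsmall : |Real.log (gammaRatio r x)| ≤ 1 := by
    refine hlog.trans ?_
    rw [div_le_one (by positivity)]
    nlinarith
  have := Real.abs_exp_sub_one_le hsmall
  rw [Real.exp_log (gammaRatio_pos r (by linarith))] at this
  calc _ ≤ 2 * |Real.log (gammaRatio r x)| := this
    _ ≤ 2 * (2 * C / x ^ 2) := by gcongr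
    _ = _ := by ring

/-- The quotients of Gamma functions at the scales `a (N + p)`. -/
theorem uniformApprox_gammaRatio {α : Type*} (T : Set α) (p r a : ℝ) (ha : 0 < a) :
    UniformApprox T (fun N _ => ((gammaRatio r (a * (N + p)) : ℝ) : ℂ)) fun _ => ((1 : ℝ) : ℂ) := by
  obtain ⟨B, x₀, hB, h⟩ := exists_abs_gammaRatio_sub_one_le r
  obtain ⟨N₀, hN₀⟩ := exists_shift_bound p (x₀ / a)
  refine ⟨⟨1, fun _ _ => by simp⟩, 4 * (B / a ^ 2), N₀, fun N hN x _ => ?_⟩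
  obtain ⟨h1, h2, h3, h4⟩ := hN₀ N hN
  rw [← Complex.ofReal_sub, Complex.norm_real, Real.norm_eq_abs]
  refine le_trans ?_ (div_shift_sq_le (p := p) (B / a ^ 2) (by positivity) h3 h4)
  rw [div_le_iff₀ ha] at h1
  refine (h _ (by linarith)).trans (le_of_eq ?_)
  have hM : (N : ℝ) + p ≠ 0 := by linarith
  field_simp

/-! ### The weight and the polynomials in the angular variable -/

theorem one_add_cot_sq {θ : ℝ} (hs : 0 < Real.sin θ) :
    1 + (-Real.cot θ) ^ 2 = (Real.sin θ ^ 2)⁻¹ := by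
  rw [Real.cot_eq_cos_div_sin]
  have := Real.sin_sq_add_cos_sq θ
  field_simp
  linarith

theorem arctan_neg_cot {θ : ℝ} (h0 : 0 < θ) (hπ : θ < π) :
    Real.arctan (-Real.cot θ) = θ - π / 2 := by
  have : -Real.cot θ = Real.tan (θ - π / 2) := by
    rw [Real.tan_eq_sin_div_cos, Real.sin_sub_pi_div_two, Real.cos_sub_pi_div_two,
      Real.cot_eq_cos_div_sin]
    ring
  rw [this, Real.arctan_tan (by linarith) (by linarith)]

theorem cauchyWeight_neg_cot (c : ℂ) {θ : ℝ} (h0 : 0 < θ) (hπ : θ < π) :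
    cauchyWeight c (-Real.cot θ) =
      Real.sin θ ^ (-2 * c.re) * Real.exp (2 * c.im * (θ - π / 2)) := by
  have hs := Real.sin_pos_of_pos_of_lt_pi h0 hπ
  rw [cauchyWeight, one_add_cot_sq hs, arctan_neg_cot h0 hπ, Real.inv_rpow (by positivity),
    ← Real.rpow_natCast, ← Real.rpow_mul hs.le, ← Real.rpow_neg hs.le]
  congr 2
  push_cast
  ring

theorem euler_neg_cot (r q : ℝ) (n : ℕ) {θ : ℝ} (h0 : 0 < θ) (hπ : θ < π) :
    euler r q (fun t => (((-Real.cot θ : ℝ) : ℂ) - Complex.I * (2 * t - 1)) ^ n) =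
      (-1) ^ n * ((Real.sin θ ^ (-(n : ℝ)) : ℝ) : ℂ) * trigEuler r q n θ := by
  have hs := Real.sin_pos_of_pos_of_lt_pi h0 hπ
  have hsc : (Real.sin θ : ℂ) ≠ 0 := by exact_mod_cast hs.ne'
  rw [trigEuler, ← euler_const_mul]
  congr 1
  ext t
  rw [Real.rpow_neg hs.le, Real.rpow_natCast, Real.cot_eq_cos_div_sin]
  push_cast [-Complex.ofReal_sin, -Complex.ofReal_cos]
  rw [← inv_pow, ← mul_pow, ← mul_pow]
  congr 1
  field_simp
  ring

theorem rr_neg_cot (c : ℂ) (n : ℕ) (h : (n : ℝ) < -c.re) {θ : ℝ} (h0 : 0 < θ) (hπ : θ < π) :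
    (rr c n (-Real.cot θ) : ℂ) = (-1) ^ n * ((Real.sin θ ^ (-(n : ℝ)) : ℝ) : ℂ) *
      trigEuler (-c.re - n) c.im n θ := by
  rw [rr_eq_euler c n h, euler_neg_cot _ _ _ h0 hπ]

theorem neg_cot_sub_neg_cot {θ φ : ℝ} (hθ : Real.sin θ ≠ 0) (hφ : Real.sin φ ≠ 0) :
    -Real.cot θ - -Real.cot φ = Real.sin (θ - φ) / (Real.sin θ * Real.sin φ) := by
  rw [Real.cot_eq_cos_div_sin, Real.cot_eq_cos_div_sin, Real.sin_sub]
  field_simp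
  ring

/-- The Christoffel-Darboux kernel in the angular variable. -/
theorem cdKernel_neg_cot (c : ℂ) (n : ℕ) (h : EulerParam (-c.re - (n + 1 : ℕ)) c.im) {θ φ : ℝ}
    (hθ0 : 0 < θ) (hθπ : θ < π) (hφ0 : 0 < φ) (hφπ : φ < π) (hne : θ ≠ φ) :
    (cdKernel c (n + 1) (-Real.cot θ) (-Real.cot φ) : ℂ) =
      ((Real.exp (-c.im * π) * (Real.sin θ * Real.sin φ) ^ (-c.re - n) /
        (Real.sin (θ - φ) * rrNorm c n) : ℝ) : ℂ) *
      (Real.sin θ * (Real.exp (c.im * θ) * trigEuler (-c.re - n) c.im n θ) *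
          (Real.exp (c.im * φ) * trigEuler (-c.re - (n + 1 : ℕ)) c.im (n + 1) φ) -
        Real.sin φ * (Real.exp (c.im * φ) * trigEuler (-c.re - n) c.im n φ) *
          (Real.exp (c.im * θ) * trigEuler (-c.re - (n + 1 : ℕ)) c.im (n + 1) θ)) := by
  have hr : (0 : ℝ) ≤ -c.re - (n + 1 : ℕ) := h.elim le_of_lt fun h' => h'.1.ge
  push_cast at hr
  have hs := Real.sin_pos_of_pos_of_lt_pi hθ0 hθπ
  have hs' := Real.sin_pos_of_pos_of_lt_pi hφ0 hφπ
  have hsd : Real.sin (θ - φ) ≠ 0 := by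
    rcases hne.lt_or_gt with h' | h'
    · exact (Real.sin_neg_of_neg_of_neg_pi_lt (by linarith) (by linarith)).ne
    · exact (Real.sin_pos_of_pos_of_lt_pi (by linarith) (by linarith)).ne'
  have hh := rrNorm_pos c n (by linarith)
  have hw : √(cauchyWeight c (-Real.cot θ) * cauchyWeight c (-Real.cot φ)) =
      (Real.sin θ * Real.sin φ) ^ (-c.re) * Real.exp (c.im * θ) * Real.exp (c.im * φ) *
        Real.exp (-c.im * π) := by
    rw [cauchyWeight_neg_cot c hθ0 hθπ, cauchyWeight_neg_cot c hφ0 hφπ]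
    refine (Real.sqrt_eq_iff_eq_sq (by positivity) (by positivity)).2 ?_
    rw [mul_pow, mul_pow, mul_pow, ← Real.exp_nat_mul, ← Real.exp_nat_mul, ← Real.exp_nat_mul,
      ← Real.rpow_natCast, ← Real.rpow_mul (by positivity), Real.mul_rpow hs.le hs'.le]
    have e : Real.exp (2 * c.im * (θ - π / 2)) * Real.exp (2 * c.im * (φ - π / 2)) =
        Real.exp ((2 : ℕ) * (c.im * θ)) * Real.exp ((2 : ℕ) * (c.im * φ)) *
          Real.exp ((2 : ℕ) * (-c.im * π)) := by
      rw [← Real.exp_add, ← Real.exp_add, ← Real.exp_add]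
      congr 1
      push_cast
      ring
    rw [show -c.re * ((2 : ℕ) : ℝ) = -2 * c.re by push_cast; ring]
    linear_combination Real.sin θ ^ (-2 * c.re) * Real.sin φ ^ (-2 * c.re) * e
  have hsum := sum_rr_eq_euler c n h (-Real.cot θ) (-Real.cot φ)
  rw [neg_cot_sub_neg_cot hs.ne' hs'.ne', euler_neg_cot _ _ _ hθ0 hθπ, euler_neg_cot _ _ _ hφ0 hφπ,
    rr_neg_cot c n (by linarith) hθ0 hθπ, rr_neg_cot c n (by linarith) hφ0 hφπ] at hsum
  have hp : ∀ y : ℝ, 0 < y → y ^ (-((n + 1 : ℕ) : ℝ)) = y ^ (-(n : ℝ)) / y := fun y hy => by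
    rw [← Real.rpow_sub_one hy.ne']
    congr 1
    push_cast
    ring
  rw [hp _ hs, hp _ hs'] at hsum
  have hpow : (Real.sin θ * Real.sin φ) ^ (-c.re - n) =
      (Real.sin θ * Real.sin φ) ^ (-c.re) * (Real.sin θ ^ (-(n : ℝ)) * Real.sin φ ^ (-(n : ℝ))) := by
    rw [sub_eq_add_neg, Real.rpow_add (by positivity), Real.mul_rpow hs.le hs'.le (z := -(n : ℝ))]
  rw [cdKernel, hw, hpow]
  set S := ∑ k ∈ Finset.range (n + 1), rr c k (-Real.cot θ) * rr c k (-Real.cot φ) / rrNorm c k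
  generalize trigEuler (-c.re - n) c.im n θ = a1 at hsum ⊢
  generalize trigEuler (-c.re - n) c.im n φ = a2 at hsum ⊢
  generalize trigEuler (-c.re - (n + 1 : ℕ)) c.im (n + 1) θ = b1 at hsum ⊢
  generalize trigEuler (-c.re - (n + 1 : ℕ)) c.im (n + 1) φ = b2 at hsum ⊢
  generalize Real.sin (θ - φ) = d at hsum hsd ⊢
  generalize (Real.sin θ * Real.sin φ) ^ (-c.re) = w
  generalize Real.sin θ ^ (-(n : ℝ)) = u1 at hsum ⊢
  generalize Real.sin φ ^ (-(n : ℝ)) = u2 at hsum ⊢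
  generalize Real.exp (c.im * θ) = e1
  generalize Real.exp (c.im * φ) = e2
  generalize Real.exp (-c.im * π) = e3
  generalize Real.sin θ = s1 at hsum hs ⊢
  generalize Real.sin φ = s2 at hsum hs' ⊢
  generalize rrNorm c n = hn at hsum hh ⊢
  have hdc : (d : ℂ) ≠ 0 := by exact_mod_cast hsd
  have hs1c : (s1 : ℂ) ≠ 0 := by exact_mod_cast hs.ne'
  have hs2c : (s2 : ℂ) ≠ 0 := by exact_mod_cast hs'.ne'
  have hhc : (hn : ℂ) ≠ 0 := by exact_mod_cast hh.ne'
  have hsg : ((-1 : ℂ) ^ n) * (-1) ^ n = 1 := by rw [← mul_pow]; simp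
  rw [pow_succ] at hsum
  push_cast at hsum ⊢
  field_simp at hsum ⊢
  rw [hsum]
  linear_combination (-(w : ℂ) * u1 * u2 * e1 * e2 * e3 * (b1 * a2 * s2 - b2 * a1 * s1)) * hsg

/-! ### The limit for Dyson index 2 -/

/-- The sets exhausting `{X > 0, Y > 0, X ≠ Y}`. -/
def box (δ R : ℝ) : Set (ℝ × ℝ) :=
  {Z | δ ≤ Z.1 ∧ Z.1 ≤ R ∧ δ ≤ Z.2 ∧ Z.2 ≤ R ∧ δ ≤ |Z.1 - Z.2|}

theorem exists_subset_box {T : Set (ℝ × ℝ)} (hT : IsCompact T)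
    (h : ∀ Z ∈ T, 0 < Z.1 ∧ 0 < Z.2 ∧ Z.1 ≠ Z.2) : ∃ δ R : ℝ, 0 < δ ∧ T ⊆ box δ R := by
  obtain ⟨a, ha, ha'⟩ := hT.exists_forall_le' (f := fun Z : ℝ × ℝ => Z.1) (by fun_prop)
    (a := 0) fun Z hZ => (h Z hZ).1
  obtain ⟨b, hb, hb'⟩ := hT.exists_forall_le' (f := fun Z : ℝ × ℝ => Z.2) (by fun_prop)
    (a := 0) fun Z hZ => (h Z hZ).2.1
  obtain ⟨d, hd, hd'⟩ := hT.exists_forall_le' (f := fun Z : ℝ × ℝ => |Z.1 - Z.2|) (by fun_prop)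
    (a := 0) fun Z hZ => abs_pos.2 (sub_ne_zero.2 (h Z hZ).2.2)
  obtain ⟨R, hR⟩ := hT.exists_bound_of_continuousOn (f := fun Z : ℝ × ℝ => Z) (by fun_prop)
  refine ⟨min a (min b d), R, by positivity, fun Z hZ => ?_⟩
  have h1 := (norm_fst_le Z).trans (hR Z hZ)
  have h2 := (norm_snd_le Z).trans (hR Z hZ)
  exact ⟨(min_le_left _ _).trans (ha' Z hZ), (le_abs_self _).trans h1,
    ((min_le_right _ _).trans (min_le_left _ _)).trans (hb' Z hZ), (le_abs_self _).trans h2,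
    ((min_le_right _ _).trans (min_le_right _ _)).trans (hd' Z hZ)⟩

theorem isOInvSq_of_uniformApprox {S : ℕ → ℝ → ℝ → ℂ} {K : ℝ → ℝ → ℂ}
    (h : ∀ δ R : ℝ, 0 < δ → UniformApprox (box δ R) (fun N Z => S N Z.1 Z.2) fun Z => K Z.1 Z.2) :
    IsOInvSq fun N X Y => S N X Y - K X Y := by
  intro T hT hT'
  obtain ⟨δ, R, hδ, hsub⟩ := exists_subset_box hT hT'
  obtain ⟨-, B, N₀, hB⟩ := h δ R hδ
  exact ⟨B, N₀, fun N hN Z hZ => hB N hN Z (hsub hZ)⟩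

theorem deriv_zScale {M X : ℝ} (h : Real.sin (X / M) ≠ 0) :
    HasDerivAt (zScale M) (1 / (M * Real.sin (X / M) ^ 2)) X := by
  have hd : HasDerivAt (fun x : ℝ => x / M) (1 / M) X := (hasDerivAt_id X).div_const M
  have h1 := ((hd.cos.div hd.sin h).neg)
  have e : zScale M = -((fun x => Real.cos (x / M)) / fun x => Real.sin (x / M)) := by
    ext x
    simp [zScale, Real.cot_eq_cos_div_sin]
  rw [e]
  refine h1.congr_deriv ?_
  have := Real.sin_sq_add_cos_sq (X / M)
  rw [← neg_div, show -(-Real.sin (X / M) * (1 / M) * Real.sin (X / M) -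
    Real.cos (X / M) * (Real.cos (X / M) * (1 / M))) = 1 / M by
      linear_combination (1 / M) * this, div_div]

/-- For `p = q = 0` the function `C₀` of index one is elementary. -/
theorem mul_C₀_one (X : ℝ) :
    2 * Complex.I * X * C₀ 0 0 1 X = Complex.exp (2 * Complex.I * X) - 1 := by
  have hf : ∀ n : ℕ, (n.factorial : ℂ) ≠ 0 := fun n => by exact_mod_cast n.factorial_ne_zero
  have h1 : ∀ n : ℕ, (ascPochhammer ℂ n).eval (1 : ℂ) = n.factorial := fun n =>
    ascPochhammer_eval_one ℂ n
  have h2 : ∀ n : ℕ, (ascPochhammer ℂ n).eval (2 : ℂ) = (n + 1).factorial := fun n => by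
    have := ascPochhammer_succ_left ℂ n
    have e := congrArg (Polynomial.eval (1 : ℂ)) this
    rw [h1] at e
    simp only [eval_mul, eval_X, eval_comp, eval_add, eval_one, one_mul] at e
    rw [e]
    norm_num
  set z := 2 * Complex.I * X with hz
  have hs := (NormedSpace.expSeries_div_hasSum_exp (𝔸 := ℂ) z)
  rw [← Complex.exp_eq_exp_ℂ] at hs
  have hs' := (hasSum_nat_add_iff' 1).2 hs
  simp only [Finset.sum_range_one, pow_zero, Nat.factorial_zero, Nat.cast_one, div_one] at hs'
  rw [C₀, hyp11, ← hs'.tsum_eq, ← tsum_mul_left]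
  congr 1
  ext n
  have e1 : ((0 : ℝ) + (1 : ℕ) - Complex.I * (0 : ℝ) : ℂ) = 1 := by simp
  have e2 : (2 * (0 : ℝ) + 2 * (1 : ℕ) : ℂ) = 2 := by simp
  rw [e1, e2, h1, h2, pow_succ]
  have := hf n
  have := hf (n + 1)
  rw [← hz]
  field_simp

theorem hyp11_zero_zero (z : ℂ) : hyp11 0 0 z = 1 := by
  rw [hyp11, tsum_eq_single 0 fun n hn => ?_]
  · simp
  · rw [ascPochhammer_ne_zero_eval_zero ℂ hn]
    simp

theorem C₀_zero (X : ℝ) : C₀ 0 0 0 X = 1 := by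
  rw [C₀]
  convert hyp11_zero_zero _ using 2 <;> simp

theorem expEuler_zero (X : ℝ) : expEuler 0 0 X = Real.cos X := by
  rw [expEuler, euler, if_pos rfl, Complex.ofReal_cos, Complex.cos]
  rw [add_comm]
  congr 3 <;> push_cast <;> ring

/-- The combination of Euler integrals in the limit of the Christoffel-Darboux kernel. For
`p = q = k = 0` the two sides agree although the factors do not. -/
theorem expEuler_combination (p q : ℝ) (k : ℕ) (h : EulerParam (p + k) q) (X Y : ℝ) :
    X * expEuler (p + (k + 1 : ℕ)) q X * expEuler (p + k) q Y -
      Y * expEuler (p + (k + 1 : ℕ)) q Y * expEuler (p + k) q X =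
    Complex.exp (-Complex.I * (X + Y)) * J₀ p q k X Y := by
  have hp : 0 < p + (k + 1 : ℕ) := by
    push_cast
    rcases h with h | h <;> linarith [h]
  rw [expEuler_eq p q (k + 1) hp, expEuler_eq p q (k + 1) hp, J₀,
    show -Complex.I * ((X : ℂ) + Y) = -Complex.I * X + -Complex.I * Y by ring, Complex.exp_add]
  rcases h with h | ⟨h, rfl⟩
  · rw [expEuler_eq p q k h, expEuler_eq p q k h]
    ring
  · have e0 : C₀ p 0 k = C₀ 0 0 0 := by
      ext Z
      have : (p : ℂ) + k = 0 := by exact_mod_cast h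
      rw [C₀, C₀, this, show (2 * p + 2 * k : ℂ) = 2 * (p + k) by ring, this]
      simp
    have e1 : C₀ p 0 (k + 1) = C₀ 0 0 1 := by
      ext Z
      have : (p : ℂ) + (k + 1 : ℕ) = 1 := by
        have h' : (p : ℂ) + k = 0 := by exact_mod_cast h
        push_cast
        linear_combination h'
      rw [C₀, C₀, this, show (2 * p + 2 * (k + 1 : ℕ) : ℂ) = 2 * (p + (k + 1 : ℕ)) by ring, this]
      simp
    have m : ∀ Z : ℝ, (Z : ℂ) * C₀ 0 0 1 Z =
        (Complex.exp (2 * Complex.I * Z) - 1) / (2 * Complex.I) := fun Z => by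
      rw [← mul_C₀_one]
      field_simp
    have c : ∀ Z : ℝ, ((Real.cos Z : ℝ) : ℂ) =
        (Complex.exp (2 * Complex.I * Z) + 1) / 2 * Complex.exp (-Complex.I * Z) := fun Z => by
      rw [Complex.ofReal_cos, Complex.cos, div_mul_eq_mul_div, add_mul, ← Complex.exp_add]
      ring_nf
    rw [h, e0, e1, expEuler_zero, expEuler_zero, C₀_zero, C₀_zero, c, c]
    linear_combination Complex.exp (-Complex.I * X) * Complex.exp (-Complex.I * Y) *
      (((Complex.exp (2 * Complex.I * Y) - 1) / 2) * m X -
        ((Complex.exp (2 * Complex.I * X) - 1) / 2) * m Y)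

/-- The factor `M sin(x / M) / x` with `M = N + p`. -/
def sincFactor (p : ℝ) (N : ℕ) (x : ℝ) : ℝ := (N + p) * Real.sin (x / (N + p)) / x

theorem uniformApprox_sincFactor_rpow (p R a : ℝ) :
    UniformApprox {x : ℝ | x ≠ 0 ∧ |x| ≤ R} (fun N x => ((sincFactor p N x ^ a : ℝ) : ℂ))
      fun _ => 1 := uniformApprox_rpow_sin_div p R a

theorem sin_eq_sincFactor (p : ℝ) {N : ℕ} {x : ℝ} (hx : x ≠ 0) (hM : (N : ℝ) + p ≠ 0) :
    Real.sin (x / (N + p)) = x * sincFactor p N x / (N + p) := by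
  rw [sincFactor]
  field_simp

theorem sincFactor_pos (p : ℝ) {N : ℕ} {x : ℝ} (hx : x ≠ 0) (hM : |x| < π * ((N : ℝ) + p)) :
    0 < sincFactor p N x := by
  have hM0 : 0 < (N : ℝ) + p := by
    have := abs_nonneg x
    have := pi_pos
    by_contra hneg
    nlinarith
  rw [abs_lt] at hM
  rw [sincFactor]
  rcases hx.lt_or_gt with h | h
  · refine div_pos_of_neg_of_neg (mul_neg_of_pos_of_neg hM0
      (Real.sin_neg_of_neg_of_neg_pi_lt (div_neg_of_neg_of_pos h hM0) ?_)) h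
    rw [lt_div_iff₀ hM0]
    linarith
  · exact div_pos (mul_pos hM0 (Real.sin_pos_of_pos_of_lt_pi (div_pos h hM0)
      ((div_lt_iff₀ hM0).2 hM.2))) h

/-- The normalisation `h_n` with `n = N - 1 - k`, in terms of `M = N + p`. -/
theorem inv_rrNorm_eq (p q : ℝ) (k : ℕ) {N : ℕ} (hN : k + 1 ≤ N) (h : 0 ≤ p + k)
    (hM : 0 < (N : ℝ) + p) :
    (rrNorm ⟨-N - p, q⟩ (N - (k + 1)))⁻¹ = gammaRatio (p + k + 1) (N + p) *
      ((N : ℝ) + p) ^ (2 * (p + k) + 1) /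
        (Real.Gamma (2 * (p + k) + 2) * cauchyMass (p + k + 1) q) := by
  have e := rrNorm_eq_cauchyMass (p + k + 1) q (by linarith) (N - (k + 1))
  have hc : ((N - (k + 1) : ℕ) : ℝ) = N - (k + 1) := by
    rw [Nat.cast_sub hN]; push_cast; ring
  have hf : ((N - (k + 1)).factorial : ℝ) = Real.Gamma (N + p + 1 - (p + k + 1)) := by
    rw [← Real.Gamma_nat_eq_factorial, hc]
    ring_nf
  rw [show (⟨-(p + k + 1) - (N - (k + 1) : ℕ), q⟩ : ℂ) = ⟨-N - p, q⟩ by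
      rw [hc]; congr 1; ring, hf, hc,
    show 2 * (p + k + 1) + (N - ((k : ℝ) + 1)) = N + p + (p + k + 1) by ring,
    show 2 * (p + k + 1) = 2 * (p + k) + 2 by ring] at e
  have hkN : (k : ℝ) + 1 ≤ N := by exact_mod_cast hN
  have hk : (0 : ℝ) ≤ k := Nat.cast_nonneg k
  have hh : 0 < rrNorm ⟨-N - p, q⟩ (N - (k + 1)) := rrNorm_pos _ _ (by
    simp only
    rw [hc]
    linarith)
  have g1 : 0 < Real.Gamma (N + p + 1 - (p + k + 1)) := Real.Gamma_pos_of_pos (by linarith)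
  have g2 : 0 < Real.Gamma (N + p + (p + k + 1)) := Real.Gamma_pos_of_pos (by linarith)
  have g3 : 0 < Real.Gamma (2 * (p + k) + 2) := Real.Gamma_pos_of_pos (by linarith)
  have hm : cauchyMass (p + k + 1) q ≠ 0 := by
    intro h0
    rw [h0, mul_zero] at e
    exact (mul_pos hh g2).ne' e
  have hpw : ((N : ℝ) + p) ^ (1 - 2 * (p + k + 1)) * ((N : ℝ) + p) ^ (2 * (p + k) + 1) = 1 := by
    rw [← Real.rpow_add hM, show 1 - 2 * (p + k + 1) + (2 * (p + k) + 1) = (0 : ℝ) by ring,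
      Real.rpow_zero]
  rw [gammaRatio, mul_assoc, hpw, mul_one]
  generalize Real.Gamma (2 * (p + k) + 2) = g at e g3 ⊢
  field_simp
  linarith

/-- The constant in the limit of `1 / h_n` and in `prefactorTwo`. -/
theorem inv_Gamma_mul_cauchyMass (r q : ℝ) (h : 0 ≤ r) :
    (Real.Gamma (2 * r + 2) * cauchyMass (r + 1) q)⁻¹ =
      2 ^ (2 * r) * ‖Complex.Gamma (r + 1 - Complex.I * q)‖ ^ 2 /
        (π * Real.Gamma (2 * r + 2) * Real.Gamma (2 * r + 1)) := by
  have e := cauchyMass_eq (r + 1) q (by linarith)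
  have hn : ‖Complex.Gamma (r + 1 - Complex.I * q)‖ = ‖Complex.Gamma ((r + 1 : ℝ) + Complex.I * q)‖ := by
    rw [← Complex.norm_conj, ← Complex.Gamma_conj]
    congr 2
    simp
  rw [← hn, show 2 - 2 * (r + 1) = -(2 * r) by ring, show 2 * (r + 1) - 1 = 2 * r + 1 by ring,
    Real.rpow_neg zero_le_two] at e
  have g1 : 0 < Real.Gamma (2 * r + 1) := Real.Gamma_pos_of_pos (by linarith)
  have g2 : 0 < Real.Gamma (2 * r + 2) := Real.Gamma_pos_of_pos (by linarith)
  have h2 : (0 : ℝ) < 2 ^ (2 * r) := by positivity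
  have hm : cauchyMass (r + 1) q ≠ 0 := by
    intro h0
    rw [h0, zero_mul] at e
    have := pi_pos
    exact (by positivity : (0 : ℝ) < (2 ^ (2 * r))⁻¹ * π * Real.Gamma (2 * r + 1)).ne e
  have := pi_pos
  field_simp at e ⊢
  linarith

/-- The part of the limit of the Christoffel-Darboux kernel that does not depend on `N`. -/
def boxFactor (p q : ℝ) (k : ℕ) (Z : ℝ × ℝ) : ℝ :=
  (Real.Gamma (2 * (p + k) + 2) * cauchyMass (p + k + 1) q)⁻¹ * Real.exp (-q * π) *
    ((Z.1 * Z.2) ^ (p + k + 1) / (Z.1 ^ 2 * (Z.1 - Z.2)))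

theorem isCompact_box (δ R : ℝ) : IsCompact (box δ R) := by
  refine (isCompact_Icc.prod (isCompact_Icc (a := δ) (b := R))).of_isClosed_subset ?_
    (s := Set.Icc δ R ×ˢ Set.Icc δ R) fun Z hZ => ⟨⟨hZ.1, hZ.2.1⟩, hZ.2.2.1, hZ.2.2.2.1⟩
  have h1 : Continuous fun Z : ℝ × ℝ => Z.1 := continuous_fst
  have h2 : Continuous fun Z : ℝ × ℝ => Z.2 := continuous_snd
  exact (isClosed_le continuous_const h1).inter ((isClosed_le h1 continuous_const).inter
    ((isClosed_le continuous_const h2).inter ((isClosed_le h2 continuous_const).inter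
      (isClosed_le continuous_const (h1.sub h2).abs))))

theorem exists_abs_boxFactor_le (p q : ℝ) (k : ℕ) {δ : ℝ} (R : ℝ) (hδ : 0 < δ) :
    ∃ B : ℝ, ∀ Z ∈ box δ R, ‖(boxFactor p q k Z : ℂ)‖ ≤ B := by
  refine (isCompact_box δ R).exists_bound_of_continuousOn ?_
  refine Complex.continuous_ofReal.comp_continuousOn (continuousOn_const.mul ?_)
  refine ContinuousOn.div ?_ (by fun_prop) fun Z hZ => ?_
  · refine ContinuousOn.rpow_const (by fun_prop) fun Z hZ => Or.inl ?_
    have h1 : 0 < Z.1 := hδ.trans_le hZ.1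
    have h2 : 0 < Z.2 := hδ.trans_le hZ.2.2.1
    positivity
  · have h1 : 0 < Z.1 := hδ.trans_le hZ.1
    have h3 : Z.1 - Z.2 ≠ 0 := abs_pos.1 (hδ.trans_le hZ.2.2.2.2)
    exact mul_ne_zero (by positivity) h3

/-- The scaled Christoffel-Darboux kernel as a product of factors, each with a known limit and an
error `O(1 / N ^ 2)`. -/
theorem scaled_cdKernel (p q : ℝ) (k : ℕ) (h : EulerParam (p + k) q) {N : ℕ} (hN : k + 1 ≤ N)
    {X Y : ℝ} (hX : 0 < X) (hY : 0 < Y) (hXM : X < π * ((N : ℝ) + p)) (hYM : Y < π * ((N : ℝ) + p))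
    (hne : X ≠ Y) :
    ((scaled (cdKernel ⟨-N - p, q⟩ (N - k)) (N + p) X Y : ℝ) : ℂ) =
      boxFactor p q k (X, Y) * (gammaRatio (p + k + 1) (1 * (N + p)) : ℝ) *
        (((sincFactor p N X ^ (p + k - 1) : ℝ) : ℂ) * ((sincFactor p N Y ^ (p + k + 1) : ℝ) : ℂ) *
          ((sincFactor p N (X - Y) ^ (-1 : ℝ) : ℝ) : ℂ)) *
        (X * ((sincFactor p N X ^ (1 : ℝ) : ℝ) : ℂ) *
          (Real.exp (q * (X / (N + p))) *
            trigEuler (p + (k + 1 : ℕ)) q (N - (k + 1)) (X / (N + p))) *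
          (Real.exp (q * (Y / (N + p))) * trigEuler (p + k) q (N - k) (Y / (N + p))) -
        Y * ((sincFactor p N Y ^ (1 : ℝ) : ℝ) : ℂ) *
          (Real.exp (q * (Y / (N + p))) *
            trigEuler (p + (k + 1 : ℕ)) q (N - (k + 1)) (Y / (N + p))) *
          (Real.exp (q * (X / (N + p))) * trigEuler (p + k) q (N - k) (X / (N + p)))) := by
  have hM : 0 < (N : ℝ) + p := by
    have := pi_pos
    by_contra hneg
    nlinarith
  have hr : 0 ≤ p + k := h.elim le_of_lt fun h' => h'.1.ge
  have hsX := sincFactor_pos p hX.ne' (N := N) (by rwa [abs_of_pos hX])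
  have hsY := sincFactor_pos p hY.ne' (N := N) (by rwa [abs_of_pos hY])
  have hsD := sincFactor_pos p (sub_ne_zero.2 hne) (N := N) (by
    rw [abs_lt]; constructor <;> linarith)
  obtain ⟨n, rfl⟩ : ∃ n, N = n + 1 + k := ⟨N - (k + 1), by omega⟩
  have en : n + 1 + k - (k + 1) = n := by omega
  have en' : n + 1 + k - k = n + 1 := by omega
  have hnorm := inv_rrNorm_eq p q k hN hr hM
  rw [en] at hnorm
  set N := n + 1 + k with hNd
  have hNc : (N : ℝ) = n + 1 + k := by rw [hNd]; push_cast; ring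
  set c : ℂ := ⟨-N - p, q⟩ with hc
  have hre : -c.re - (n + 1 : ℕ) = p + k := by
    simp only [hc, hNc]; push_cast; ring
  have hre' : -c.re - n = p + (k + 1 : ℕ) := by
    simp only [hc, hNc]; push_cast; ring
  have sX := sin_eq_sincFactor p (N := N) hX.ne' hM.ne'
  have sY := sin_eq_sincFactor p (N := N) hY.ne' hM.ne'
  have sD := sin_eq_sincFactor p (N := N) (sub_ne_zero.2 hne) hM.ne'
  have hsin : Real.sin (X / (N + p)) ≠ 0 := by rw [sX]; positivity
  rw [scaled, (deriv_zScale hsin).deriv, en, en', zScale, zScale, Complex.ofReal_mul,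
    cdKernel_neg_cot c n (by rw [hre]; exact h) (by positivity) ((div_lt_iff₀ hM).2 hXM)
      (by positivity) ((div_lt_iff₀ hM).2 hYM) (fun e => hne ((div_left_inj' hM.ne').1 e)),
    hre, hre', show c.im = q from rfl, one_mul, Real.rpow_one, Real.rpow_one]
  generalize trigEuler (p + (k + 1 : ℕ)) q n (X / (N + p)) = A1
  generalize trigEuler (p + (k + 1 : ℕ)) q n (Y / (N + p)) = A2
  generalize trigEuler (p + k) q (n + 1) (X / (N + p)) = B1
  generalize trigEuler (p + k) q (n + 1) (Y / (N + p)) = B2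
  have key : Real.exp (-q * π) * (Real.sin (X / (N + p)) * Real.sin (Y / (N + p))) ^
        (p + (k + 1 : ℕ)) / (Real.sin (X / (N + p) - Y / (N + p)) * rrNorm c n) *
        (1 / ((N + p) * Real.sin (X / (N + p)) ^ 2)) / (N + p) =
      boxFactor p q k (X, Y) * gammaRatio (p + k + 1) (N + p) *
        (sincFactor p N X ^ (p + k - 1) * sincFactor p N Y ^ (p + k + 1) *
          sincFactor p N (X - Y) ^ (-1 : ℝ)) := by
    rw [← sub_div, sX, sY, sD, boxFactor, Real.rpow_neg_one,
      show p + ((k + 1 : ℕ) : ℝ) = p + k + 1 by push_cast; ring,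
      show X * sincFactor p N X / (N + p) * (Y * sincFactor p N Y / (N + p)) =
        (X * Y) * (sincFactor p N X * sincFactor p N Y) / ((N + p) * (N + p)) by
          field_simp, Real.div_rpow (by positivity) (by positivity),
      Real.mul_rpow (by positivity) (by positivity), Real.mul_rpow hsX.le hsY.le,
      show p + k + 1 = (p + k - 1) + 2 by ring, Real.rpow_add hsX, Real.rpow_two]
    rw [show (p + k - 1) + 2 = p + k + 1 by ring]
    have hMp : (((N : ℝ) + p) * (N + p)) ^ (p + k + 1) =
        (N + p) ^ (2 * (p + k) + 1) * (N + p) := by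
      rw [Real.mul_rpow hM.le hM.le, ← Real.rpow_add hM, ← Real.rpow_add_one hM.ne']
      ring_nf
    rw [hMp]
    have hdiv : ∀ a b d e : ℝ, a / (b * rrNorm c n) * d / e = a / b * d / e * (rrNorm c n)⁻¹ := by
      intro a b d e
      rw [div_mul_eq_div_div, div_eq_mul_inv (a / b)]
      ring
    rw [hdiv, hnorm]
    have hne' := sub_ne_zero.2 hne
    have : ((N : ℝ) + p) ^ (2 * (p + k) + 1) ≠ 0 := (Real.rpow_pos_of_pos hM _).ne'
    generalize ((N : ℝ) + p) ^ (2 * (p + k) + 1) = P at this ⊢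
    generalize sincFactor p N X ^ (p + k - 1) = u
    generalize sincFactor p N Y ^ (p + k + 1) = v
    generalize (X * Y) ^ (p + k + 1) = w
    generalize gammaRatio (p + k + 1) (N + p) = g
    generalize Real.Gamma (2 * (p + k) + 2) * cauchyMass (p + k + 1) q = m
    generalize Real.exp (-q * π) = e
    rw [div_eq_mul_inv _ m]
    field_simp
  have keyC := congrArg (fun t : ℝ => (t : ℂ)) key
  simp only [Complex.ofReal_mul] at keyC
  rw [← keyC, sX, sY]
  have hMc : ((N : ℂ) + p) ≠ 0 := by exact_mod_cast hM.ne'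
  push_cast
  field_simp

/-- The limit of the Christoffel-Darboux kernel at the shifted scale. -/
theorem uniformApprox_cdKernel (p q : ℝ) (k : ℕ) (h : EulerParam (p + k) q) {δ : ℝ} (R : ℝ)
    (hδ : 0 < δ) :
    UniformApprox (box δ R)
      (fun N Z => ((scaled (cdKernel ⟨-N - p, q⟩ (N - k)) (N + p) Z.1 Z.2 : ℝ) : ℂ))
      fun Z => KTwo p q k Z.1 Z.2 := by
  have hr : 0 ≤ p + k := h.elim le_of_lt fun h' => h'.1.ge
  have h' : EulerParam (p + (k + 1 : ℕ)) q := Or.inl (by push_cast; linarith)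
  have hX : ∀ Z ∈ box δ R, Z.1 ≠ 0 ∧ |Z.1| ≤ |R| := fun Z hZ => by
    have := hδ.trans_le hZ.1
    exact ⟨this.ne', abs_le_abs_of_nonneg this.le hZ.2.1⟩
  have hY : ∀ Z ∈ box δ R, Z.2 ≠ 0 ∧ |Z.2| ≤ |R| := fun Z hZ => by
    have := hδ.trans_le hZ.2.2.1
    exact ⟨this.ne', abs_le_abs_of_nonneg this.le hZ.2.2.2.1⟩
  have hD : ∀ Z ∈ box δ R, Z.1 - Z.2 ≠ 0 ∧ |Z.1 - Z.2| ≤ |R| := fun Z hZ => by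
    refine ⟨abs_pos.1 (hδ.trans_le hZ.2.2.2.2), ?_⟩
    have := le_abs_self R
    rw [abs_le]
    constructor <;> linarith [hZ.1, hZ.2.1, hZ.2.2.1, hZ.2.2.2.1]
  have bX : UniformApprox (box δ R) (fun _ Z => (Z.1 : ℂ)) fun Z => (Z.1 : ℂ) :=
    .of_bounded ⟨|R|, fun Z hZ => by rw [Complex.norm_real]; exact (hX Z hZ).2⟩
  have bY : UniformApprox (box δ R) (fun _ Z => (Z.2 : ℂ)) fun Z => (Z.2 : ℂ) :=
    .of_bounded ⟨|R|, fun Z hZ => by rw [Complex.norm_real]; exact (hY Z hZ).2⟩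
  have sX := fun a => (uniformApprox_sincFactor_rpow p |R| a).comp _ hX
  have sY := fun a => (uniformApprox_sincFactor_rpow p |R| a).comp _ hY
  have sD := fun a => (uniformApprox_sincFactor_rpow p |R| a).comp _ hD
  have A := uniformApprox_trigEuler p q (k + 1) h' |R| (abs_nonneg R)
  have B := uniformApprox_trigEuler p q k h |R| (abs_nonneg R)
  have main := (((UniformApprox.of_bounded (exists_abs_boxFactor_le p q k R hδ)).mul
    (uniformApprox_gammaRatio (box δ R) p (p + k + 1) 1 one_pos)).mul
    (((sX (p + k - 1)).mul (sY (p + k + 1))).mul (sD (-1)))).mul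
    ((((bX.mul (sX 1)).mul (A.comp Prod.fst fun Z hZ => (hX Z hZ).2)).mul
      (B.comp Prod.snd fun Z hZ => (hY Z hZ).2)).sub
      (((bY.mul (sY 1)).mul (A.comp Prod.snd fun Z hZ => (hY Z hZ).2)).mul
      (B.comp Prod.fst fun Z hZ => (hX Z hZ).2)))
  refine main.congr ?_ fun Z hZ => ?_
  · obtain ⟨N₀, hN₀⟩ := exists_shift_bound p |R|
    refine ⟨max N₀ (k + 1), fun N hN Z hZ => ?_⟩
    obtain ⟨h1, h2, -, -⟩ := hN₀ N ((le_max_left _ _).trans hN)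
    have h3 : (N : ℝ) + p < π * (N + p) := by
      have := Real.pi_gt_three
      nlinarith
    have hX1 := (le_abs_self _).trans (hX Z hZ).2
    have hY1 := (le_abs_self _).trans (hY Z hZ).2
    exact scaled_cdKernel p q k h ((le_max_right _ _).trans hN) (hδ.trans_le hZ.1)
      (hδ.trans_le hZ.2.2.1) (by linarith) (by linarith) (sub_ne_zero.1 (hD Z hZ).1)
  · have e := expEuler_combination p q k h Z.1 Z.2
    have e2 : Complex.exp (-Complex.I * (Z.1 + Z.2) - q * π) =
        Complex.exp (-Complex.I * (Z.1 + Z.2)) * (Real.exp (-q * π) : ℝ) := by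
      rw [sub_eq_add_neg, Complex.exp_add]
      push_cast
      ring_nf
    have e3 := inv_Gamma_mul_cauchyMass (p + k) q hr
    simp only [mul_one, Complex.ofReal_one]
    rw [e, KTwo, prefactorTwo, e2, boxFactor, e3,
      show 2 * p + 2 * (k : ℝ) + 2 = 2 * (p + k) + 2 by ring,
      show 2 * p + 2 * (k : ℝ) + 1 = 2 * (p + k) + 1 by ring]
    push_cast
    ring

/-! ### The confluent hypergeometric function -/

theorem eval_ascPochhammer_ofReal_ne_zero {b : ℝ} (hb : 0 < b) (n : ℕ) :
    (ascPochhammer ℂ n).eval (b : ℂ) ≠ 0 := by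
  have h : (ascPochhammer ℂ n).eval (b : ℂ) = (((ascPochhammer ℝ n).eval b : ℝ) : ℂ) := by
    rw [← ascPochhammer_map Complex.ofRealHom, Polynomial.eval_map]
    exact (Polynomial.hom_eval₂ _ (RingHom.id ℝ) Complex.ofRealHom b).symm
  rw [h]
  exact_mod_cast (ascPochhammer_pos n b hb).ne'

/-- The quotient of Pochhammer symbols `(a)_n / (b)_n`. -/
def pochRatio (a b : ℂ) (n : ℕ) : ℂ := (ascPochhammer ℂ n).eval a / (ascPochhammer ℂ n).eval b

theorem pochRatio_zero (a b : ℂ) : pochRatio a b 0 = 1 := by simp [pochRatio]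

theorem mul_pochRatio_succ (a : ℂ) {b : ℝ} (hb : 0 < b) (n : ℕ) :
    (b + n) * pochRatio a b (n + 1) = (a + n) * pochRatio a b n := by
  have h1 := eval_ascPochhammer_ofReal_ne_zero hb n
  have h2 : (b + n : ℂ) ≠ 0 := by
    have : (0 : ℝ) < b + n := by positivity
    exact_mod_cast this.ne'
  rw [pochRatio, pochRatio, ascPochhammer_succ_eval, ascPochhammer_succ_eval]
  field_simp

theorem pochRatio_succ (a b : ℂ) (n : ℕ) :
    pochRatio a b (n + 1) = a / b * pochRatio (a + 1) (b + 1) n := by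
  rw [pochRatio, pochRatio, ascPochhammer_succ_left]
  simp only [eval_mul, eval_X, eval_comp, eval_add, eval_one]
  rw [mul_div_mul_comm]

theorem norm_pochRatio_le (a : ℂ) {b : ℝ} (hb : 0 < b) (n : ℕ) :
    ‖pochRatio a b n‖ ≤ (‖a‖ / b + 1) ^ n := by
  induction n with
  | zero => simp [pochRatio_zero]
  | succ n ih =>
    have hn : (0 : ℝ) ≤ n := Nat.cast_nonneg n
    have h := congrArg norm (mul_pochRatio_succ a hb n)
    rw [norm_mul, norm_mul, show (b + n : ℂ) = ((b + n : ℝ) : ℂ) by push_cast; ring,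
      Complex.norm_real, Real.norm_of_nonneg (by positivity)] at h
    have h2 : ‖a + n‖ ≤ (‖a‖ / b + 1) * (b + n) := by
      refine (norm_add_le _ _).trans ?_
      rw [Complex.norm_natCast]
      have : (‖a‖ / b + 1) * (b + n) = ‖a‖ + n + (b + ‖a‖ / b * n) := by field_simp; ring
      rw [this]
      have : 0 ≤ b + ‖a‖ / b * n := by positivity
      linarith
    have h3 : (b + n) * ‖pochRatio a b (n + 1)‖ ≤ (b + n) * (‖a‖ / b + 1) ^ (n + 1) := by
      rw [h]
      calc _ ≤ (‖a‖ / b + 1) * (b + n) * (‖a‖ / b + 1) ^ n := by gcongr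
        _ = _ := by ring
    exact le_of_mul_le_mul_left h3 (by positivity)

theorem summable_hyp11_bound (K R : ℝ) :
    Summable fun n : ℕ => K ^ n * R ^ n / (n.factorial : ℝ) := by
  simpa [mul_pow] using Real.summable_pow_div_factorial (K * R)

theorem hasSum_hyp11 (a : ℂ) {b : ℝ} (hb : 0 < b) (z : ℂ) :
    HasSum (fun n : ℕ => pochRatio a b n * z ^ n / n.factorial) (hyp11 a b z) := by
  refine Summable.hasSum ((summable_hyp11_bound (‖a‖ / b + 1) ‖z‖).of_norm_bounded fun n => ?_)
  rw [norm_div, norm_mul, norm_pow, Complex.norm_natCast]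
  gcongr
  exact norm_pochRatio_le a hb n

theorem hasSum_hyp11_succ (a : ℂ) {b : ℝ} (hb : 0 < b) (z : ℂ) :
    HasSum (fun n : ℕ => pochRatio a b (n + 1) * z ^ n / n.factorial)
      (a / b * hyp11 (a + 1) (b + 1) z) := by
  have h := (hasSum_hyp11 (a + 1) (b := b + 1) (by linarith) z).mul_left (a / b)
  push_cast at h
  refine h.congr_fun fun n => ?_
  rw [pochRatio_succ]
  ring

theorem hasDerivAt_hyp11 (a : ℂ) {b : ℝ} (hb : 0 < b) (z : ℂ) :
    HasDerivAt (hyp11 a b) (a / b * hyp11 (a + 1) (b + 1) z) z := by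
  set K := ‖a‖ / b + 1
  set R := ‖z‖ + 1
  have hs : Summable fun n : ℕ => K * (K ^ (n - 1) * R ^ (n - 1) / ((n - 1).factorial : ℝ)) :=
    (summable_nat_add_iff 1).1 (by simpa using (summable_hyp11_bound K R).mul_left K)
  have hz : z ∈ Metric.ball (0 : ℂ) R := by simp [R]
  have h := hasDerivAt_tsum_of_isPreconnected (g := fun (n : ℕ) y => pochRatio a b n * y ^ n / n.factorial)
    (g' := fun n y => pochRatio a b n * (n * y ^ (n - 1)) / n.factorial) hs Metric.isOpen_ball
    (convex_ball 0 R).isPreconnected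
    (fun n y _ => ((hasDerivAt_pow n y).const_mul _).div_const _) (fun n y hy => ?_) hz
    (hasSum_hyp11 a hb z).summable hz
  · refine h.congr_deriv ?_
    refine HasSum.tsum_eq ((hasSum_nat_add_iff' 1).1 ?_)
    simp only [Finset.sum_range_one, Nat.cast_zero, zero_mul, mul_zero, zero_div, sub_zero]
    refine (hasSum_hyp11_succ a hb z).congr_fun fun n => ?_
    have h1 : ((n : ℂ) + 1) ≠ 0 := by exact_mod_cast n.succ_ne_zero
    rw [Nat.factorial_succ, Nat.add_sub_cancel]
    push_cast
    field_simp
  · rcases n with _ | n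
    · simp only [Nat.cast_zero, zero_mul, mul_zero, zero_div, norm_zero]
      positivity
    · have h1 : ((n : ℂ) + 1) ≠ 0 := by exact_mod_cast n.succ_ne_zero
      have hy' : ‖y‖ ≤ R := (mem_ball_zero_iff.1 hy).le
      have e : pochRatio a b (n + 1) * (((n + 1 : ℕ) : ℂ) * y ^ (n + 1 - 1)) / (n + 1).factorial =
          pochRatio a b (n + 1) * y ^ n / n.factorial := by
        rw [Nat.factorial_succ, Nat.add_sub_cancel]
        push_cast
        field_simp
      rw [e, norm_div, norm_mul, norm_pow, Complex.norm_natCast, Nat.add_sub_cancel]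
      calc _ ≤ K ^ (n + 1) * R ^ n / (n.factorial : ℝ) := by
            gcongr
            exact norm_pochRatio_le a hb (n + 1)
        _ = _ := by ring

/-- Kummer's differential equation. -/
theorem kummer (a : ℂ) {b : ℝ} (hb : 0 < b) (z : ℂ) :
    z * (a / b * ((a + 1) / (b + 1) * hyp11 (a + 2) (b + 2) z)) +
      (b - z) * (a / b * hyp11 (a + 1) (b + 1) z) = a * hyp11 a b z := by
  have hb' : 0 < b + 1 := by linarith
  have h0 := hasSum_hyp11 a hb z
  have h1 := hasSum_hyp11_succ a hb z
  have h2 := (hasSum_hyp11_succ (a + 1) hb' z).mul_left (a / b)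
  push_cast at h2
  rw [add_assoc a, add_assoc (b : ℂ), one_add_one_eq_two] at h2
  have hz1 : HasSum (fun n : ℕ => (n : ℂ) * (pochRatio a b n * z ^ n / n.factorial))
      (z * (a / b * hyp11 (a + 1) (b + 1) z)) := by
    refine (hasSum_nat_add_iff' 1).1 ?_
    simp only [Finset.sum_range_one, Nat.cast_zero, zero_mul, sub_zero]
    refine (h1.mul_left z).congr_fun fun n => ?_
    have h1 : ((n : ℂ) + 1) ≠ 0 := by exact_mod_cast n.succ_ne_zero
    rw [Nat.factorial_succ]
    push_cast
    field_simp
    ring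
  have hz2 : HasSum (fun n : ℕ => (n : ℂ) * (pochRatio a b (n + 1) * z ^ n / n.factorial))
      (z * (a / b * ((a + 1) / (b + 1) * hyp11 (a + 2) (b + 2) z))) := by
    refine (hasSum_nat_add_iff' 1).1 ?_
    simp only [Finset.sum_range_one, Nat.cast_zero, zero_mul, sub_zero]
    refine (h2.mul_left z).congr_fun fun n => ?_
    have h1 : ((n : ℂ) + 1) ≠ 0 := by exact_mod_cast n.succ_ne_zero
    rw [Nat.factorial_succ, pochRatio_succ a b (n + 1)]
    push_cast
    field_simp
    ring
  have h := (((hz2.add (h1.mul_left (b : ℂ))).sub hz1).sub (h0.mul_left a))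
  have hzero : HasSum (fun _ : ℕ => (0 : ℂ)) 0 := hasSum_zero
  have e := h.unique (hzero.congr_fun fun n => ?_)
  · linear_combination e
  · linear_combination z ^ n / n.factorial * mul_pochRatio_succ a hb n

/-! ### Derivatives of the functions in the limiting kernels -/

theorem differentiable_hyp11 (a : ℂ) {b : ℝ} (hb : 0 < b) : Differentiable ℂ (hyp11 a b) :=
  fun z => (hasDerivAt_hyp11 a hb z).differentiableAt

theorem contDiff_C₀_of_pos (p q : ℝ) (k : ℕ) (h : 0 < p + k) {n : WithTop ℕ∞} :
    ContDiff ℝ n (C₀ p q k) := by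
  have h1 : ContDiff ℂ n (hyp11 (p + k - Complex.I * q) ((2 * (p + k) : ℝ) : ℂ)) :=
    (differentiable_hyp11 _ (by linarith)).contDiff
  have h2 : ContDiff ℝ n fun X : ℝ => 2 * Complex.I * (X : ℂ) :=
    contDiff_const.mul Complex.ofRealCLM.contDiff
  have e : C₀ p q k =
      hyp11 (p + k - Complex.I * q) ((2 * (p + k) : ℝ) : ℂ) ∘ fun X : ℝ => 2 * Complex.I * (X : ℂ) := by
    ext X
    simp only [C₀, Function.comp]
    push_cast
    ring_nf
  rw [e]
  exact (h1.restrict_scalars ℝ).comp h2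

theorem C₀_of_add_eq_zero {p : ℝ} {k : ℕ} (h : p + k = 0) : C₀ p 0 k = fun _ => 1 := by
  ext Z
  have h' : (p : ℂ) + k = 0 := by exact_mod_cast h
  rw [C₀, h', show (2 * p + 2 * k : ℂ) = 2 * (p + k) by ring, h']
  simp [hyp11_zero_zero]

theorem contDiff_C₀ (p q : ℝ) (k : ℕ) (h : EulerParam (p + k) q) {n : WithTop ℕ∞} :
    ContDiff ℝ n (C₀ p q k) := by
  rcases h with h | ⟨h, rfl⟩
  · exact contDiff_C₀_of_pos p q k h
  · rw [C₀_of_add_eq_zero h]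
    exact contDiff_const

/-- The function `C₁` is a derivative of `C₀`, by Kummer's equation. -/
theorem C₁_eq (p q : ℝ) (k : ℕ) (h : EulerParam (p + k) q) (hk : k = 0 ∨ 0 < p + k) (X : ℝ) :
    C₁ p q k X = p * (X * deriv (C₀ p q k) X - Complex.I * X * C₀ p q k X) := by
  rcases h with h | ⟨h, rfl⟩
  · set a : ℂ := p + k - Complex.I * q with ha
    set b : ℝ := 2 * (p + k) with hb
    have hb0 : 0 < b := by linarith
    have hbc : ((2 * p + 2 * k : ℂ)) = b := by rw [hb]; push_cast; ring
    have hC : C₀ p q k = fun X : ℝ => hyp11 a b (2 * Complex.I * X) := by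
      ext Z
      rw [C₀, hbc]
    have hd : HasDerivAt (C₀ p q k)
        (a / b * hyp11 (a + 1) (b + 1) (2 * Complex.I * X) * (2 * Complex.I)) X := by
      rw [hC]
      have h1 : HasDerivAt (fun z : ℂ => 2 * Complex.I * z) (2 * Complex.I) (X : ℂ) := by
        simpa using (hasDerivAt_id (X : ℂ)).const_mul (2 * Complex.I)
      exact ((hasDerivAt_hyp11 a hb0 _).comp (X : ℂ) h1).comp_ofReal
    have hK := kummer a hb0 (2 * Complex.I * X)
    have hA1 : Atilde (p + k) q 1 X = a / b * hyp11 (a + 1) (b + 1) (2 * Complex.I * X) := by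
      rw [Atilde, ascPochhammer_one, eval_X, eval_X, hb, ha]
      push_cast
      ring_nf
    have hA2 : Atilde (p + k) q 2 X =
        a / b * ((a + 1) / (b + 1) * hyp11 (a + 2) (b + 2) (2 * Complex.I * X)) := by
      have h2 : ∀ z : ℂ, (ascPochhammer ℂ 2).eval z = z * (z + 1) := fun z => by
        rw [ascPochhammer_succ_eval, ascPochhammer_one, eval_X, Nat.cast_one]
      rw [Atilde, h2, h2, mul_div_mul_comm, hb, ha]
      push_cast
      ring_nf
    rw [hd.deriv, C₁, hA1, hA2, hC]
    simp only
    generalize a / (b : ℂ) * ((a + 1) / (b + 1) * hyp11 (a + 2) (b + 2) (2 * Complex.I * X)) = F2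
      at hK ⊢
    generalize a / (b : ℂ) * hyp11 (a + 1) (b + 1) (2 * Complex.I * X) = F1 at hK ⊢
    generalize hyp11 a (b : ℂ) (2 * Complex.I * X) = F0 at hK ⊢
    have hbc' : (b : ℂ) = 2 * (p + k) := by rw [hb]; push_cast; ring
    rw [hbc', ha] at hK
    linear_combination (-(Complex.I * X)) * hK + ((q : ℂ) * X * F0) * Complex.I_sq
  · rcases hk with rfl | hk
    · obtain rfl : p = 0 := by simpa using h
      simp [C₁, Atilde]
    · linarith

/-! ### The weight `ω̃₁` and the kernels for Dyson indices 1 and 4 -/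

/-- The exponent of `ω̃₁` as a Cauchy weight. -/
def halfExponent (c : ℂ) : ℂ := ⟨(c.re - 1) / 2, c.im / 2⟩

theorem weightOne_eq (c : ℂ) : weightOne c = cauchyWeight (halfExponent c) := by
  ext x
  have hx : (0 : ℝ) < 1 + x ^ 2 := by positivity
  have hp := cauchyWeight_pos (halfExponent c) x
  rw [weightOne, Real.sqrt_eq_iff_eq_sq (div_nonneg (cauchyWeight_pos c x).le hx.le) hp.le,
    div_eq_iff hx.ne', cauchyWeight, cauchyWeight, mul_pow, ← Real.exp_nat_mul,
    ← Real.rpow_mul_natCast hx.le, mul_right_comm (_ ^ (_ * _)), ← Real.rpow_add_one hx.ne']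
  simp only [halfExponent]
  congr 2 <;> push_cast <;> ring

theorem weightOne_pos (c : ℂ) (x : ℝ) : 0 < weightOne c x := by
  rw [weightOne_eq]
  exact cauchyWeight_pos _ x

theorem weightOne_sq (c : ℂ) (x : ℝ) : cauchyWeight c x = (1 + x ^ 2) * weightOne c x ^ 2 := by
  have hx : (0 : ℝ) < 1 + x ^ 2 := by positivity
  rw [weightOne, Real.sq_sqrt (div_nonneg (cauchyWeight_pos c x).le hx.le)]
  field_simp

theorem integrable_weightOne_mul_eval (c : ℂ) (A : ℝ[X]) {d : ℕ} (hd : A.natDegree ≤ d)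
    (h : (d : ℝ) < -c.re) : Integrable fun x => weightOne c x * A.eval x := by
  rw [weightOne_eq]
  exact integrable_weight_mul_eval _ A hd (by simp only [halfExponent]; linarith)

theorem integrable_weightOne_mul_rr (c : ℂ) {n : ℕ} (h : (n : ℝ) < -c.re) :
    Integrable fun x => weightOne c x * rr c n x :=
  integrable_weightOne_mul_eval c _ (natDegree_orthoPoly _ n).le h

theorem sign_mul_ae_eq (g : ℝ → ℝ) (x : ℝ) :
    (fun t => Real.sign (x - t) * g t) =ᵐ[volume] fun t => 2 * (Set.Iic x).indicator g t - g t := by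
  have : ∀ᵐ t : ℝ, t ≠ x := by simp [ae_iff, measure_singleton]
  filter_upwards [this] with t ht
  rcases ht.lt_or_gt with h | h
  · rw [Real.sign_of_pos (by linarith), Set.indicator_of_mem (Set.mem_Iic.2 h.le)]
    ring
  · rw [Real.sign_of_neg (by linarith), Set.indicator_of_notMem (by simpa using h)]
    ring

theorem integrable_sign_mul {g : ℝ → ℝ} (hg : Integrable g) (x : ℝ) :
    Integrable fun t => Real.sign (x - t) * g t :=
  (((hg.indicator measurableSet_Iic).const_mul 2).sub hg).congr (sign_mul_ae_eq g x).symm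

theorem integral_sign_mul {g : ℝ → ℝ} (hg : Integrable g) (x : ℝ) :
    ∫ t, Real.sign (x - t) * g t = 2 * (∫ t in Set.Iic x, g t) - ∫ t, g t := by
  rw [integral_congr_ae (sign_mul_ae_eq g x), integral_sub
    ((hg.indicator measurableSet_Iic).const_mul 2) hg, integral_const_mul,
    integral_indicator measurableSet_Iic]

/-- The incomplete integral `∫_{-∞}^x ω̃₁ P_n`. -/
def lowerInt (c : ℂ) (n : ℕ) (x : ℝ) : ℝ := ∫ t in Set.Iic x, weightOne c t * rr c n t

theorem integral_sign_mul_rr (c : ℂ) {n : ℕ} (h : (n : ℝ) < -c.re) (x : ℝ) :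
    ∫ t, Real.sign (x - t) * (weightOne c t * rr c n t) = 2 * (lowerInt c n x - sTilde c n) := by
  rw [integral_sign_mul (integrable_weightOne_mul_rr c h), lowerInt, sTilde]
  ring

/-- The operator `skewOp` comes from differentiating `(1 + x ^ 2) ω̃₁ A`. -/
theorem integral_weightOne_mul_skewOp (c : ℂ) (A : ℝ[X]) {d : ℕ} (hd : A.natDegree ≤ d)
    (h : (d : ℝ) + 1 < -c.re) (x : ℝ) :
    ∫ t in Set.Iic x, weightOne c t * (skewOp c A).eval t =
      (1 + x ^ 2) * weightOne c x * A.eval x ∧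
    ∫ t, weightOne c t * (skewOp c A).eval t = 0 := by
  have hd' : ∀ t, HasDerivAt (fun t => cauchyWeight (halfExponent c + 1) t * A.eval t)
      (weightOne c t * (skewOp c A).eval t) t := fun t => by
    have h1 := (hasDerivAt_cauchyWeight_add_one (halfExponent c) t).mul (A.hasDerivAt t)
    refine h1.congr_deriv ?_
    rw [weightOne_eq, cauchyWeight_add_one]
    simp only [skewOp, eval_add, eval_mul, eval_one, eval_pow, eval_X, eval_C, halfExponent]
    ring
  have hint := integrable_weightOne_mul_eval c (skewOp c A) (natDegree_skewOp_le c hd)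
    (by push_cast; linarith)
  have hre : (d : ℝ) + 2 * (halfExponent c + 1).re < 0 := by
    simp only [halfExponent, Complex.add_re, Complex.one_re]
    linarith
  obtain ⟨ht, hb⟩ := tendsto_weight_mul_eval (halfExponent c + 1) A hd hre
  constructor
  · rw [integral_Iic_of_hasDerivAt_of_tendsto' (fun t _ => hd' t) hint.integrableOn hb,
      cauchyWeight_add_one, weightOne_eq]
    ring
  · rw [integral_of_hasDerivAt_of_tendsto hd' hint hb ht, sub_zero]

theorem gammaCoeff_pos (c : ℂ) (j : ℕ) (h : (j : ℝ) + 1 < -c.re) : 0 < gammaCoeff c j :=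
  div_pos (by linarith) (rrNorm_pos c j (by have : (0 : ℝ) ≤ j := Nat.cast_nonneg j; linarith))

/-- The structure relation for `ω̃₁ P_j`, integrated over `(-∞, x]`. -/
theorem lowerInt_add_two (c : ℂ) (j : ℕ) (h : (j : ℝ) + 2 < -c.re) (x : ℝ) :
    gammaCoeff c j * lowerInt c j x - gammaCoeff c (j + 1) * lowerInt c (j + 2) x =
      (1 + x ^ 2) * weightOne c x * rr c (j + 1) x / rrNorm c (j + 1) := by
  have hj : (0 : ℝ) ≤ j := Nat.cast_nonneg j
  have hn := rrNorm_pos c (j + 1) (by push_cast; linarith)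
  have h1 := (integral_weightOne_mul_skewOp c _ (natDegree_orthoPoly (cauchyWeight c) (j + 1)).le
    (by push_cast; linarith) x).1
  rw [skewOp_orthoPoly_succ c j h] at h1
  rw [eq_div_iff hn.ne', rr, ← h1, lowerInt, lowerInt, ← integral_const_mul, ← integral_const_mul,
    ← integral_sub, ← integral_mul_const]
  · congr 1
    ext t
    simp only [rr, eval_mul, eval_sub, eval_C]
    ring
  · exact ((integrable_weightOne_mul_rr c (by linarith)).const_mul _).integrableOn
  · exact ((integrable_weightOne_mul_rr c (by push_cast; linarith)).const_mul _).integrableOn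

/-- The structure relation integrated over the whole line, where the boundary terms vanish. -/
theorem sTilde_add_two (c : ℂ) (j : ℕ) (h : (j : ℝ) + 2 < -c.re) :
    gammaCoeff c (j + 1) * sTilde c (j + 2) = gammaCoeff c j * sTilde c j := by
  have hj : (0 : ℝ) ≤ j := Nat.cast_nonneg j
  have hn := rrNorm_pos c (j + 1) (by push_cast; linarith)
  have h1 := (integral_weightOne_mul_skewOp c _ (natDegree_orthoPoly (cauchyWeight c) (j + 1)).le
    (by push_cast; linarith) 0).2
  rw [skewOp_orthoPoly_succ c j h] at h1
  have h2 : ∫ t, rrNorm c (j + 1) * (gammaCoeff c j * (weightOne c t * rr c j t) -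
      gammaCoeff c (j + 1) * (weightOne c t * rr c (j + 2) t)) = 0 := by
    rw [← h1]
    congr 1
    ext t
    simp only [rr, eval_mul, eval_sub, eval_C]
    ring
  rw [integral_const_mul, integral_sub
    ((integrable_weightOne_mul_rr c (by linarith)).const_mul _)
    ((integrable_weightOne_mul_rr c (by push_cast; linarith)).const_mul _),
    integral_const_mul, integral_const_mul] at h2
  have h3 := (mul_eq_zero.1 h2).resolve_left hn.ne'
  simp only [sTilde]
  linarith

theorem sTilde_odd (c : ℂ) (i : ℕ) (h : 2 * (i : ℝ) + 1 < -c.re) : sTilde c (2 * i + 1) = 0 := by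
  induction i with
  | zero =>
    have h1 := (integral_weightOne_mul_skewOp c _ (natDegree_orthoPoly (cauchyWeight c) 0).le
      (by push_cast at h ⊢; linarith) 0).2
    have hn := rrNorm_pos c 0 (by push_cast at h ⊢; linarith)
    have hg := gammaCoeff_pos c 0 (by push_cast at h ⊢; linarith)
    rw [skewOp_orthoPoly_zero c (by push_cast at h; linarith)] at h1
    have h2 : ∫ t, -(gammaCoeff c 0 * rrNorm c 0) * (weightOne c t * rr c 1 t) = 0 := by
      rw [← h1]
      congr 1
      ext t
      simp only [rr, eval_mul, eval_C]
      ring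
    rw [integral_const_mul] at h2
    have h3 := (mul_eq_zero.1 h2).resolve_left (neg_ne_zero.2 (mul_pos hg hn).ne')
    rw [mul_zero, zero_add, sTilde, h3, mul_zero]
  | succ i ih =>
    push_cast at h
    have h1 := sTilde_add_two c (2 * i + 1) (by push_cast; linarith)
    rw [ih (by linarith), mul_zero] at h1
    exact (mul_eq_zero.1 h1).resolve_left (gammaCoeff_pos c _ (by push_cast; linarith)).ne'

theorem sqrt_div_mul_weightOne (c : ℂ) (x y : ℝ) :
    √(cauchyWeight c x / cauchyWeight c y) * (weightOne c y / weightOne c x) =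
      √((1 + x ^ 2) / (1 + y ^ 2)) := by
  have h1 := weightOne_pos c x
  have h2 := weightOne_pos c y
  rw [weightOne_sq c x, weightOne_sq c y, mul_div_mul_comm,
    Real.sqrt_mul (by positivity), ← div_pow, Real.sqrt_sq (by positivity)]
  field_simp

theorem kernelOneEven_eq (c : ℂ) (m : ℕ) (h : ((m - 2 : ℕ) : ℝ) < -c.re) (x y : ℝ) :
    kernelOneEven c m x y = √((1 + x ^ 2) / (1 + y ^ 2)) * cdKernel c (m - 1) x y +
      gammaCoeff c (m - 2) * (weightOne c y * rr c (m - 1) y) *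
        (lowerInt c (m - 2) x - sTilde c (m - 2)) := by
  have e : ∫ t, Real.sign (x - t) * rr c (m - 2) t * weightOne c t =
      2 * (lowerInt c (m - 2) x - sTilde c (m - 2)) := by
    rw [← integral_sign_mul_rr c h]
    congr 1
    ext t
    ring
  rw [kernelOneEven, sqrt_div_mul_weightOne, e]
  ring

theorem cdKernel_succ (c : ℂ) (n : ℕ) (x y : ℝ) :
    cdKernel c (n + 1) x y = cdKernel c n x y +
      √(cauchyWeight c x * cauchyWeight c y) * (rr c n x * rr c n y / rrNorm c n) := by
  rw [cdKernel, Finset.sum_range_succ, mul_add, cdKernel]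

/-- For an odd number of particles the kernel has the same shape as for an even number; the
constant `s̃` is replaced by a multiple of `1 / s̃`. -/
theorem kernelOneOdd_eq (c : ℂ) (i : ℕ) (h : 2 * (i : ℝ) + 2 < -c.re)
    (hs : sTilde c (2 * i + 2) ≠ 0) (x y : ℝ) :
    kernelOneOdd c (2 * i + 3) x y =
      √((1 + x ^ 2) / (1 + y ^ 2)) * cdKernel c (2 * i + 2) x y +
        gammaCoeff c (2 * i + 1) * (weightOne c y * rr c (2 * i + 2) y) *
          (lowerInt c (2 * i + 1) x -
            -(1 / (2 * gammaCoeff c (2 * i + 1) * sTilde c (2 * i + 2)))) := by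
  have hj : (0 : ℝ) ≤ i := Nat.cast_nonneg i
  have hg := gammaCoeff_pos c (2 * i + 1) (by push_cast; linarith)
  have i1 := integrable_weightOne_mul_rr c (n := 2 * i + 1) (by push_cast; linarith)
  have i2 := integrable_weightOne_mul_rr c (n := 2 * i + 2) (by push_cast; linarith)
  have e : ∫ t, weightOne c t * Real.sign (x - t) *
        (rr c (2 * i + 2) t * rr c (2 * i + 1) y - rr c (2 * i + 1) t * rr c (2 * i + 2) y) =
      rr c (2 * i + 1) y * (2 * (lowerInt c (2 * i + 2) x - sTilde c (2 * i + 2))) -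
        rr c (2 * i + 2) y * (2 * lowerInt c (2 * i + 1) x) := by
    have e1 := integral_sign_mul_rr c (n := 2 * i + 1) (by push_cast; linarith) x
    have e2 := integral_sign_mul_rr c (n := 2 * i + 2) (by push_cast; linarith) x
    rw [sTilde_odd c i (by linarith), sub_zero] at e1
    rw [← e1, ← e2, ← integral_const_mul, ← integral_const_mul, ← integral_sub
      ((integrable_sign_mul i2 x).const_mul _) ((integrable_sign_mul i1 x).const_mul _)]
    congr 1
    ext t
    ring
  have hrec := sTilde_add_two c (2 * i) (by push_cast; linarith)
  have hlow := lowerInt_add_two c (2 * i) (by push_cast; linarith) x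
  have hρ : √((1 + x ^ 2) / (1 + y ^ 2)) * √(cauchyWeight c x * cauchyWeight c y) =
      (1 + x ^ 2) * weightOne c x * weightOne c y := by
    have h1 := weightOne_pos c x
    have h2 := weightOne_pos c y
    rw [← Real.sqrt_mul (by positivity), weightOne_sq c x, weightOne_sq c y,
      Real.sqrt_eq_iff_eq_sq (by positivity) (by positivity)]
    field_simp
  rw [kernelOneOdd, show 2 * i + 3 - 1 = 2 * i + 2 by omega, show 2 * i + 3 - 2 = 2 * i + 1 by omega,
    show 2 * i + 3 - 3 = 2 * i by omega, e,
    kernelOneEven_eq c (2 * i + 2) (by push_cast; linarith),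
    show 2 * i + 2 - 1 = 2 * i + 1 by omega, show 2 * i + 2 - 2 = 2 * i by omega,
    cdKernel_succ c (2 * i + 1), mul_add, ← mul_assoc (√((1 + x ^ 2) / (1 + y ^ 2))) (√_), hρ]
  have e3 : 1 / 2 * gammaCoeff c (2 * i) * sTilde c (2 * i) *
      (weightOne c y / sTilde c (2 * i + 2)) = 1 / 2 * gammaCoeff c (2 * i + 1) * weightOne c y := by
    rw [mul_assoc (1 / 2 : ℝ), ← hrec]
    field_simp
  have e4 : gammaCoeff c (2 * i + 1) * (weightOne c y * rr c (2 * i + 2) y) *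
      -(1 / (2 * gammaCoeff c (2 * i + 1) * sTilde c (2 * i + 2))) =
      -(weightOne c y * rr c (2 * i + 2) y / (2 * sTilde c (2 * i + 2))) := by
    field_simp
  rw [e3, mul_sub (gammaCoeff c (2 * i + 1) * (weightOne c y * rr c (2 * i + 2) y)), e4]
  linear_combination weightOne c y * rr c (2 * i + 1) y * (hlow + hrec)

/-- Up to the factor `1 / 2` the kernel for Dyson index 4 has the shape of `kernelOneEven_eq`
without the constant `s̃`, since `s̃_{2N-1} = 0` turns the upper tail into minus the
lower one. -/
theorem kernelFourAux_eq (c : ℂ) (N : ℕ) (hN : 1 ≤ N) (h : 2 * (N : ℝ) - 1 < -c.re) (x y : ℝ) :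
    kernelFourAux c N x y = 1 / 2 * (√((1 + x ^ 2) / (1 + y ^ 2)) * cdKernel c (2 * N) x y +
      gammaCoeff c (2 * N - 1) * (weightOne c y * rr c (2 * N) y) * lowerInt c (2 * N - 1) x) := by
  have hw : ∀ t, cauchyWeight c t / √(weightFour c t) = weightOne c t := fun t => by
    have h1 := weightOne_pos c t
    rw [weightFour, weightOne_sq c t, show (1 + t ^ 2) * weightOne c t ^ 2 * (1 + t ^ 2) =
      ((1 + t ^ 2) * weightOne c t) ^ 2 by ring, Real.sqrt_sq (by positivity)]
    field_simp
  have hr : cauchyWeight c y * weightFour c x / (weightFour c y * cauchyWeight c x) =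
      (1 + x ^ 2) / (1 + y ^ 2) := by
    have h1 := cauchyWeight_pos c x
    have h2 := cauchyWeight_pos c y
    rw [weightFour, weightFour]
    field_simp
  obtain ⟨i, rfl⟩ : ∃ i, N = i + 1 := ⟨N - 1, by omega⟩
  have hi : 2 * (i + 1) - 1 = 2 * i + 1 := by omega
  push_cast at h
  have hint := integrable_weightOne_mul_rr c (n := 2 * i + 1) (by push_cast; linarith)
  have hs := sTilde_odd c i (by linarith)
  have htail : ∫ t in Set.Ioi x, rr c (2 * i + 1) t * (cauchyWeight c t / √(weightFour c t)) =
      -lowerInt c (2 * i + 1) x := by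
    have e := integral_add_compl (measurableSet_Iic (a := x)) hint
    rw [Set.compl_Iic] at e
    rw [sTilde] at hs
    have e2 : ∫ t in Set.Ioi x, rr c (2 * i + 1) t * (cauchyWeight c t / √(weightFour c t)) =
        ∫ t in Set.Ioi x, weightOne c t * rr c (2 * i + 1) t := by
      congr 1
      ext t
      rw [hw, mul_comm]
    rw [e2, lowerInt]
    linarith
  rw [kernelFourAux, hw, hr, hi, htail]
  ring

/-! ### The integrals of `ω̃₁ P_k` -/

theorem rrNorm_succ_mul (c : ℂ) (j : ℕ) {s : ℝ} (hs : 1 / 2 < s) (h : s = -c.re - 1 - j) :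
    rrNorm c (j + 1) * (s ^ 2 * (4 * s ^ 2 - 1)) =
      rrNorm c j * ((j + 1) * (2 * s + j + 1) * (s ^ 2 + c.im ^ 2)) := by
  have hj : (0 : ℝ) ≤ j := Nat.cast_nonneg j
  have e1 := rrNorm_eq_cauchyMass s c.im hs (j + 1)
  have e2 := rrNorm_eq_cauchyMass (s + 1) c.im (by linarith) j
  have e3 := cauchyMass_succ s c.im hs
  have c1 : (⟨-s - (j + 1 : ℕ), c.im⟩ : ℂ) = c := by
    apply Complex.ext
    · simp only [h]; push_cast; ring
    · rfl
  have c2 : (⟨-(s + 1) - j, c.im⟩ : ℂ) = c := by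
    apply Complex.ext
    · simp only [h]; ring
    · rfl
  have hg : 0 < Real.Gamma (2 * s + j + 1) := Real.Gamma_pos_of_pos (by linarith)
  rw [c1, Nat.factorial_succ, show 2 * s + ((j + 1 : ℕ) : ℝ) = 2 * s + j + 1 by push_cast; ring] at e1
  rw [c2, show 2 * (s + 1) + (j : ℝ) = 2 * s + j + 1 + 1 by ring,
    Real.Gamma_add_one (s := 2 * s + j + 1) (by linarith),
    show 2 * (s + 1) = 2 * s + 1 + 1 by ring, Real.Gamma_add_one (s := 2 * s + 1) (by linarith),
    Real.Gamma_add_one (s := 2 * s) (by linarith)] at e2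
  push_cast at e1
  refine mul_right_cancel₀ hg.ne' ?_
  linear_combination s ^ 2 * (4 * s ^ 2 - 1) * e1 - (j + 1) * (s ^ 2 + c.im ^ 2) * e2 -
    (j + 1) * j.factorial * Real.Gamma (2 * s) * (2 * s + 1) * s * e3

/-- The constant in the closed form of `s̃_{2 m}`, with `r = -Re c - 2 m`. -/
def sConst (q r : ℝ) : ℝ :=
  2 ^ (-r) * √π * (Real.Gamma r * Real.Gamma (r + 1 / 2)) /
    ‖Complex.Gamma ((r + 1) / 2 + Complex.I * q)‖ ^ 2

theorem norm_Gamma_pos {r : ℝ} (q : ℝ) (hr : 0 < r) : 0 < ‖Complex.Gamma (r + Complex.I * q)‖ :=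
  norm_pos_iff.2 (Complex.Gamma_ne_zero_of_re_pos (by simpa using hr))

theorem sConst_pos (q : ℝ) {r : ℝ} (hr : 0 < r) : 0 < sConst q r := by
  have h1 := norm_Gamma_pos q (r := (r + 1) / 2) (by linarith)
  push_cast at h1
  have h2 : 0 < Real.Gamma r := Real.Gamma_pos_of_pos hr
  have h3 : 0 < Real.Gamma (r + 1 / 2) := Real.Gamma_pos_of_pos (by linarith)
  have := pi_pos
  unfold sConst
  positivity

theorem sConst_add_two (q : ℝ) {s : ℝ} (hs : 1 < s) :
    sConst q (s + 1) * (s ^ 2 + 4 * q ^ 2) =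
      sConst q (s - 1) * (s * (s - 1) * (s ^ 2 - 1 / 4)) := by
  have h1 := norm_Gamma_pos q (r := s / 2) (by linarith)
  have hz : ((s / 2 : ℝ) + Complex.I * q : ℂ) ≠ 0 := fun h0 => by
    have := congrArg Complex.re h0
    simp at this
    linarith
  have e1 : ‖Complex.Gamma ((((s + 1 : ℝ) : ℂ) + 1) / 2 + Complex.I * q)‖ ^ 2 =
      (s ^ 2 / 4 + q ^ 2) * ‖Complex.Gamma ((s / 2 : ℝ) + Complex.I * q)‖ ^ 2 := by
    rw [show ((((s + 1 : ℝ) : ℂ) + 1) / 2 + Complex.I * q) = ((s / 2 : ℝ) + Complex.I * q) + 1 by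
      push_cast; ring, Complex.Gamma_add_one _ hz, norm_mul, mul_pow]
    congr 1
    rw [mul_comm Complex.I, ← Complex.normSq_eq_norm_sq, Complex.normSq_add_mul_I]
    ring
  have e2 : ((((s - 1 : ℝ) : ℂ) + 1) / 2 + Complex.I * q) = ((s / 2 : ℝ) + Complex.I * q) := by
    push_cast; ring
  have g1 : Real.Gamma (s + 1) = s * ((s - 1) * Real.Gamma (s - 1)) := by
    rw [Real.Gamma_add_one (by linarith), ← Real.Gamma_add_one (s := s - 1) (by linarith)]
    ring_nf
  have g2 : Real.Gamma (s + 1 + 1 / 2) =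
      (s + 1 / 2) * ((s - 1 / 2) * Real.Gamma (s - 1 + 1 / 2)) := by
    rw [show s + 1 + 1 / 2 = s + 1 / 2 + 1 by ring, Real.Gamma_add_one (by linarith),
      show s + 1 / 2 = s - 1 / 2 + 1 by ring, Real.Gamma_add_one (s := s - 1 / 2) (by linarith)]
    ring_nf
  have g3 : (2 : ℝ) ^ (-(s - 1)) = 4 * 2 ^ (-(s + 1)) := by
    rw [show -(s - 1) = -(s + 1) + 2 by ring, Real.rpow_add two_pos]
    norm_num
    ring
  rw [sConst, sConst, e1, e2, g1, g2, g3]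
  have : 0 < s ^ 2 / 4 + q ^ 2 := by positivity
  field_simp
  ring

/-- The closed form follows from `sTilde_add_two`, starting at the mass of the weight `ω̃₁`. -/
theorem sTilde_even (c : ℂ) (m : ℕ) (h : 2 * (m : ℝ) < -c.re) :
    sTilde c (2 * m) = sConst (c.im / 2) (-c.re - 2 * m) *
      (Real.Gamma (m + 1 / 2) / Real.Gamma (-c.re - m + 1 / 2)) := by
  induction m with
  | zero =>
    rw [Nat.cast_zero, mul_zero] at h
    have e := cauchyMass_eq ((-c.re + 1) / 2) (c.im / 2) (by linarith)
    have hc : (⟨-((-c.re + 1) / 2), c.im / 2⟩ : ℂ) = halfExponent c := by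
      rw [halfExponent]
      congr 1
      ring
    rw [cauchyMass, hc, ← weightOne_eq] at e
    have h1 := norm_Gamma_pos (c.im / 2) (r := (-c.re + 1) / 2) (by linarith)
    have h3 : 0 < Real.Gamma (-c.re + 1 / 2) := Real.Gamma_pos_of_pos (by linarith)
    have hp : (2 : ℝ) ^ (2 - 2 * ((-c.re + 1) / 2)) = 2 * 2 ^ (-(-c.re)) := by
      rw [show 2 - 2 * ((-c.re + 1) / 2) = 1 + -(-c.re) by ring, Real.rpow_add two_pos,
        Real.rpow_one]
    have hz : ((-c.re : ℝ) + 1 : ℂ) / 2 = (((-c.re + 1) / 2 : ℝ) : ℂ) := by push_cast; ring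
    have hπ : √π * √π = π := Real.mul_self_sqrt pi_pos.le
    rw [hp, show 2 * ((-c.re + 1) / 2) - 1 = -c.re by ring] at e
    simp only [mul_zero, Nat.cast_zero, sub_zero, zero_add, sTilde, rr, orthoPoly_zero, eval_one,
      mul_one, sConst, Real.Gamma_one_half_eq]
    rw [hz]
    generalize Real.Gamma (-c.re + 1 / 2) = g at h3 ⊢
    generalize ‖Complex.Gamma (((-c.re + 1) / 2 : ℝ) + Complex.I * (c.im / 2 : ℝ))‖ = A at e h1 ⊢
    generalize (2 : ℝ) ^ (-(-c.re)) = w at e ⊢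
    field_simp
    rw [sq √π, hπ]
    linarith
  | succ m ih =>
    have hm : (0 : ℝ) ≤ m := Nat.cast_nonneg m
    push_cast at h
    set s := -c.re - 1 - (2 * m : ℕ) with hs
    have hs' : s = -c.re - 1 - 2 * m := by rw [hs]; push_cast; ring
    have hs1 : 1 < s := by linarith
    have e1 := sTilde_add_two c (2 * m) (by push_cast; linarith)
    have e2 := rrNorm_succ_mul c (2 * m) (by linarith) hs
    have e3 := sConst_add_two (c.im / 2) hs1
    have n1 := rrNorm_pos c (2 * m) (by push_cast; linarith)
    have n2 := rrNorm_pos c (2 * m + 1) (by push_cast; linarith)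
    rw [ih (by linarith), gammaCoeff, gammaCoeff, show -c.re - 2 * m = s + 1 by rw [hs']; ring] at e1
    rw [show 2 * (m + 1) = 2 * m + 2 by ring, show -c.re - 2 * ((m + 1 : ℕ) : ℝ) = s - 1 by
      rw [hs']; push_cast; ring, show ((m + 1 : ℕ) : ℝ) + 1 / 2 = m + 1 / 2 + 1 by push_cast; ring,
      Real.Gamma_add_one (by linarith), show -c.re - ((m + 1 : ℕ) : ℝ) + 1 / 2 = s + m + 1 / 2 by
      rw [hs']; push_cast; ring]
    rw [show -c.re - (m : ℝ) + 1 / 2 = s + m + 1 / 2 + 1 by rw [hs']; ring,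
      Real.Gamma_add_one (by linarith), show -c.re - 1 - ((2 * m + 1 : ℕ) : ℝ) = s - 1 by
      rw [hs']; push_cast; ring, show -c.re - 1 - ((2 * m : ℕ) : ℝ) = s by
      rw [hs']; push_cast; ring] at e1
    have g1 : 0 < Real.Gamma (s + m + 1 / 2) := Real.Gamma_pos_of_pos (by linarith)
    push_cast at e2
    have hs0 : 0 < s - 1 := by linarith
    have hsm : 0 < s + m + 1 / 2 := by linarith
    have hs4 : 0 < 4 * s ^ 2 - 1 := by nlinarith
    generalize sConst (c.im / 2) (s + 1) = a at e1 e3 ⊢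
    generalize sConst (c.im / 2) (s - 1) = b at e1 e3 ⊢
    generalize rrNorm c (2 * m) = u at e1 e2 n1
    generalize rrNorm c (2 * m + 1) = v at e1 e2 n2
    generalize Real.Gamma (m + 1 / 2) = g at e1 ⊢
    generalize Real.Gamma (s + m + 1 / 2) = g' at e1 g1 ⊢
    generalize sTilde c (2 * m + 2) = t at e1 ⊢
    -- the recursion for `s̃`, solved for the new term
    have e4 : t = s / (s - 1) * (v / u) * (a * (g / ((s + m + 1 / 2) * g'))) := by
      field_simp at e1 ⊢
      linarith
    have e5 : v / u = (2 * m + 1) * (2 * s + 2 * m + 1) * (s ^ 2 + c.im ^ 2) /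
        (s ^ 2 * (4 * s ^ 2 - 1)) := by
      rw [div_eq_div_iff n1.ne' (by positivity)]
      linarith
    have e6 : a * (s ^ 2 + c.im ^ 2) = b * (s * (s - 1) * (s ^ 2 - 1 / 4)) := by
      rw [← e3]; ring
    rw [e4, e5]
    calc _ = (2 * m + 1) * (2 * s + 2 * m + 1) * g / (s * (s - 1) * (4 * s ^ 2 - 1) *
          ((s + m + 1 / 2) * g')) * (a * (s ^ 2 + c.im ^ 2)) := by
          field_simp
      _ = _ := by
          rw [e6, show s ^ 2 - 1 / 4 = (4 * s ^ 2 - 1) / 4 by ring]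
          generalize 4 * s ^ 2 - 1 = d at hs4 ⊢
          field_simp
          ring

theorem sTilde_asymptotic (p q : ℝ) (k : ℕ) {N : ℕ} (hN : k ≤ N) (hk : Even (N - k))
    (h : 0 < p + k) :
    sTilde ⟨-N - p, 2 * q⟩ (N - k) = 2 ^ (p + k) * sConst q (p + k) *
      gammaRatio (1 / 2 - (p + k) / 2) (1 / 2 * (N + p)) * ((N : ℝ) + p) ^ (-(p + k)) := by
  obtain ⟨m, hm⟩ := hk
  have hNm : (N : ℝ) = 2 * m + k := by
    have : N = 2 * m + k := by omega
    rw [this]; push_cast; ring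
  have hm0 : (0 : ℝ) ≤ m := Nat.cast_nonneg m
  rw [show N - k = 2 * m by omega, sTilde_even _ m (by simp only; linarith)]
  have hM : 0 < (N : ℝ) + p := by linarith
  simp only
  rw [show 2 * q / 2 = q by ring, show -(-(N : ℝ) - p) - 2 * m = p + k by rw [hNm]; ring,
    show -(-(N : ℝ) - p) - m + 1 / 2 = m + p + k + 1 / 2 by rw [hNm]; ring, gammaRatio,
    show 1 / 2 * ((N : ℝ) + p) + (1 / 2 - (p + k) / 2) = m + 1 / 2 by rw [hNm]; ring,
    show 1 / 2 * ((N : ℝ) + p) + 1 - (1 / 2 - (p + k) / 2) = m + p + k + 1 / 2 by rw [hNm]; ring,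
    show 1 - 2 * (1 / 2 - (p + k) / 2) = p + k by ring, Real.mul_rpow (by norm_num) hM.le,
    Real.rpow_neg hM.le, one_div, Real.inv_rpow zero_le_two]
  have h2 : (2 : ℝ) ^ (p + k) ≠ 0 := by positivity
  have h3 : ((N : ℝ) + p) ^ (p + k) ≠ 0 := (Real.rpow_pos_of_pos hM _).ne'
  field_simp

/-- The constant that multiplies the rank one part for Dyson index 1. -/
def oddEvenConst (p q : ℝ) (N : ℕ) : ℝ :=
  if Even N then sTilde ⟨-N - p, 2 * q⟩ (N - 2) else
    -(1 / (2 * gammaCoeff ⟨-N - p, 2 * q⟩ (N - 2) * sTilde ⟨-N - p, 2 * q⟩ (N - 1)))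

theorem η₁_eq (p q : ℝ) : η₁ p q / 2 = 2 ^ (p + 2) * sConst q (p + 2) := by
  have h2 : (2 : ℝ) ^ (p + 2) ≠ 0 := by positivity
  rw [η₁, sConst, Real.rpow_neg zero_le_two, show p + 2 + 1 / 2 = p + 5 / 2 by ring]
  push_cast
  rw [show ((p : ℂ) + 2 + 1) / 2 = (p + 3) / 2 by ring]
  field_simp

/-- The constants for even and odd particle numbers agree, by the duplication formula. -/
theorem Gamma_mul_cauchyMass_eq (p q : ℝ) (hp : -1 < p) :
    Real.Gamma (2 * (p + 1) + 2) * cauchyMass (p + 1 + 1) (2 * q) =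
      (p + 1) * η₁ p q * (2 ^ (p + 1) * sConst q (p + 1)) := by
  have e := inv_Gamma_mul_cauchyMass (p + 1) (2 * q) (by linarith)
  rw [inv_eq_iff_eq_inv, inv_div] at e
  have d1 := Complex.Gamma_mul_Gamma_add_half (((p + 2) / 2 : ℝ) + Complex.I * q)
  have d2 := Real.Gamma_mul_Gamma_add_half (p + 1)
  have d3 := Real.Gamma_mul_Gamma_add_half (p + 2)
  have d1' := congrArg (fun z => ‖z‖ ^ 2) d1
  simp only [norm_mul, mul_pow] at d1'
  have n1 : ‖(2 : ℂ) ^ (1 - 2 * (((p + 2) / 2 : ℝ) + Complex.I * q))‖ = 2 ^ (-(p + 1)) := by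
    rw [show (2 : ℂ) = ((2 : ℝ) : ℂ) by norm_num, Complex.norm_cpow_eq_rpow_re_of_pos two_pos]
    congr 1
    simp
    ring
  have n2 : ‖((√π : ℝ) : ℂ)‖ ^ 2 = π := by
    rw [Complex.norm_real, Real.norm_of_nonneg (Real.sqrt_nonneg _), Real.sq_sqrt pi_pos.le]
  have n3 : ‖Complex.Gamma ((p + 1 : ℝ) + 1 - Complex.I * (2 * q : ℝ))‖ =
      ‖Complex.Gamma (2 * (((p + 2) / 2 : ℝ) + Complex.I * q))‖ := by
    rw [← Complex.norm_conj, ← Complex.Gamma_conj]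
    congr 2
    apply Complex.ext
    · simp
      ring
    · simp
  have z1 : ((p + 2) / 2 : ℝ) + Complex.I * q + 1 / 2 = (p + 3) / 2 + Complex.I * q := by
    push_cast; ring
  have z2 : (((p + 1 : ℝ) : ℂ) + 1) / 2 + Complex.I * q = ((p + 2) / 2 : ℝ) + Complex.I * q := by
    push_cast; ring
  have w1 := norm_Gamma_pos q (r := (p + 2) / 2) (by linarith)
  have w2 := norm_Gamma_pos q (r := (p + 3) / 2) (by linarith)
  rw [n1, n2, ← n3, z1] at d1'
  push_cast at w2
  have hw : (0 : ℝ) < 2 ^ (p + 1) := by positivity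
  have p1 : (2 : ℝ) ^ (2 * (p + 1)) = (2 ^ (p + 1)) ^ 2 := by
    rw [← Real.rpow_mul_natCast zero_le_two]
    congr 1
    push_cast
    ring
  have p2 : (2 : ℝ) ^ (1 - 2 * (p + 1)) = 2 / (2 ^ (p + 1)) ^ 2 := by
    rw [Real.rpow_sub two_pos, p1, Real.rpow_one]
  have p3 : (2 : ℝ) ^ (1 - 2 * (p + 2)) = 1 / (2 * (2 ^ (p + 1)) ^ 2) := by
    rw [show 1 - 2 * (p + 2) = 1 - 2 * (p + 1) - 2 by ring, Real.rpow_sub two_pos, p2]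
    norm_num
    ring
  have g1 : Real.Gamma (2 * (p + 1) + 1) = 2 * (p + 1) * Real.Gamma (2 * (p + 1)) :=
    Real.Gamma_add_one (by linarith)
  have g2 : 0 < Real.Gamma (2 * (p + 1)) := Real.Gamma_pos_of_pos (by linarith)
  rw [show p + 2 + 1 / 2 = p + 5 / 2 by ring, p3] at d3
  rw [p2] at d2
  rw [Real.rpow_neg zero_le_two] at d1'
  have hπ : √π ^ 2 = π := Real.sq_sqrt pi_pos.le
  have hC : ‖Complex.Gamma ((p + 1 : ℝ) + 1 - Complex.I * (2 * q : ℝ))‖ ^ 2 =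
      ‖Complex.Gamma (((p + 2) / 2 : ℝ) + Complex.I * q)‖ ^ 2 *
        ‖Complex.Gamma ((p + 3) / 2 + Complex.I * q)‖ ^ 2 * (2 ^ (p + 1)) ^ 2 / π := by
    rw [d1']
    have := pi_pos
    field_simp
  rw [e, η₁, sConst, z2, d2, d3, hC, p1, g1, Real.rpow_neg zero_le_two,
    show 2 * (p + 1) + 2 = 2 * (p + 2) by ring]
  have := pi_pos
  generalize Real.Gamma (2 * (p + 1)) = G1
  generalize Real.Gamma (2 * (p + 2)) = G2
  generalize ‖Complex.Gamma (((p + 2) / 2 : ℝ) + Complex.I * q)‖ = A at w1 ⊢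
  generalize ‖Complex.Gamma ((p + 3) / 2 + Complex.I * q)‖ = B at w2 ⊢
  generalize (2 : ℝ) ^ (p + 1) = w at hw ⊢
  field_simp
  rw [show √π ^ 4 = (√π ^ 2) ^ 2 by ring, hπ]
  ring

/-- The constants for even and odd numbers of particles have the same limit `η₁ / 2`. -/
theorem uniformApprox_oddEvenConst {α : Type*} (T : Set α) (p q : ℝ) (hp : -1 < p) :
    UniformApprox T
      (fun N _ => (((-1) ^ N * ((N : ℝ) + p) ^ (p + 2) * oddEvenConst p q N : ℝ) : ℂ))
      fun _ => ((η₁ p q / 2 : ℝ) : ℂ) := by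
  have hη : 0 < η₁ p q := by
    have := sConst_pos q (r := p + 2) (by linarith)
    have h2 := η₁_eq p q
    have : 0 < (2 : ℝ) ^ (p + 2) * sConst q (p + 2) := by positivity
    linarith
  have hev := (uniformApprox_gammaRatio T p (1 / 2 - (p + (2 : ℕ)) / 2) (1 / 2)
    (by norm_num)).const_mul ((η₁ p q / 2 : ℝ) : ℂ)
  have hodd := (((uniformApprox_gammaRatio T p (p + (1 : ℕ) + 1) 1 one_pos).rpow (-1) one_pos
    (fun _ _ => le_rfl)).mul ((uniformApprox_gammaRatio T p (1 / 2 - (p + (1 : ℕ)) / 2) (1 / 2)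
    (by norm_num)).rpow (-1) one_pos (fun _ _ => le_rfl))).const_mul ((η₁ p q / 2 : ℝ) : ℂ)
  refine (hev.ite hodd (fun x _ => by simp)).congr ?_ fun x _ => by simp
  obtain ⟨N₀, hN₀⟩ := exists_shift_bound p
    (2 * (|p + 1 + 1| + 1) + 2 * (|1 / 2 - (p + 1) / 2| + 1))
  refine ⟨max N₀ 3, fun N hN x _ => ?_⟩
  obtain ⟨hK, h1, -, -⟩ := hN₀ N ((le_max_left _ _).trans hN)
  have hN3 : 3 ≤ N := (le_max_right _ _).trans hN
  have hM : 0 < (N : ℝ) + p := by linarith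
  by_cases hev : Even N
  · have e := sTilde_asymptotic p q 2 (N := N) (by omega) (hev.tsub (by decide))
      (by push_cast; linarith)
    have hpw : ((N : ℝ) + p) ^ (p + 2) * ((N : ℝ) + p) ^ (-(p + (2 : ℕ))) = 1 := by
      rw [← Real.rpow_add hM]
      push_cast
      rw [add_neg_cancel, Real.rpow_zero]
    rw [if_pos hev, oddEvenConst, if_pos hev, hev.neg_one_pow, e, η₁_eq,
      show p + ((2 : ℕ) : ℝ) = p + 2 by norm_num]
    rw [show p + ((2 : ℕ) : ℝ) = p + 2 by norm_num] at hpw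
    rw [← Complex.ofReal_mul]
    congr 1
    linear_combination (2 ^ (p + 2) * sConst q (p + 2) *
      gammaRatio (1 / 2 - (p + 2) / 2) (1 / 2 * (N + p))) * hpw
  · have ho : Odd N := Nat.not_even_iff_odd.1 hev
    have e := sTilde_asymptotic p q 1 (N := N) (by omega) (by
      obtain ⟨i, rfl⟩ := ho
      exact ⟨i, by omega⟩) (by push_cast; linarith)
    have e2 := inv_rrNorm_eq p (2 * q) 1 (N := N) (by omega) (by push_cast; linarith) hM
    have hD := Gamma_mul_cauchyMass_eq p q hp
    simp only [Nat.cast_one] at e e2 hD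
    rw [hD] at e2
    have ha1 := abs_nonneg (p + 1 + 1)
    have ha2 := abs_nonneg (1 / 2 - (p + 1) / 2)
    have hs := sConst_pos q (r := p + 1) (by linarith)
    have hg1 : 0 < gammaRatio (p + 1 + 1) (N + p) := gammaRatio_pos _ (by linarith)
    have hg2 : 0 < gammaRatio (1 / 2 - (p + 1) / 2) (1 / 2 * (N + p)) :=
      gammaRatio_pos _ (by linarith)
    have p1 : ((N : ℝ) + p) ^ (2 * (p + 1) + 1) = (((N : ℝ) + p) ^ (p + 1)) ^ 2 * (N + p) := by
      rw [Real.rpow_add_one hM.ne', mul_comm 2, Real.rpow_mul hM.le, Real.rpow_two]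
    have p2 : ((N : ℝ) + p) ^ (p + 2) = ((N : ℝ) + p) ^ (p + 1) * (N + p) := by
      rw [← Real.rpow_add_one hM.ne']
      ring_nf
    have hc : ((N - (1 + 1) : ℕ) : ℝ) = N - 2 := by
      rw [Nat.cast_sub (by omega)]
      norm_num
    have hw : 0 < ((N : ℝ) + p) ^ (p + 1) := Real.rpow_pos_of_pos hM _
    have h2w : (0 : ℝ) < 2 ^ (p + 1) := by positivity
    have hp1 : 0 < p + 1 := by linarith
    have hγ : gammaCoeff ⟨-N - p, 2 * q⟩ (N - 2) = (p + 1) *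
        (gammaRatio (p + 1 + 1) (N + p) * ((((N : ℝ) + p) ^ (p + 1)) ^ 2 * (N + p)) /
          ((p + 1) * η₁ p q * (2 ^ (p + 1) * sConst q (p + 1)))) := by
      rw [gammaCoeff, div_eq_mul_inv, show N - 2 = N - (1 + 1) by omega, e2, p1, hc]
      congr 1
      simp only
      ring
    rw [if_neg hev, oddEvenConst, if_neg hev, ho.neg_one_pow, e, hγ, ← Complex.ofReal_mul,
      ← Complex.ofReal_mul, p2, Real.rpow_neg hM.le]
    congr 1
    simp only [Nat.cast_one, one_mul, Real.rpow_neg_one]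
    generalize gammaRatio (p + 1 + 1) (N + p) = a at hg1 ⊢
    generalize gammaRatio (1 / 2 - (p + 1) / 2) (1 / 2 * (N + p)) = b at hg2 ⊢
    generalize (2 : ℝ) ^ (p + 1) = u at h2w ⊢
    generalize ((N : ℝ) + p) ^ (p + 1) = v at hw ⊢
    generalize p + 1 = w at hp1 hs ⊢
    field_simp

/-! ### The incomplete integrals in the angular variable -/

theorem zScale_image_Ioc {M X : ℝ} (hM : 0 < M) (hX : 0 < X) (hXM : X < π * M) :
    zScale M '' Set.Ioc 0 X = Set.Iic (zScale M X) := by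
  have hat : ∀ s : ℝ, 0 < s → s < π * M → Real.arctan (zScale M s) = s / M - π / 2 := fun s h1 h2 =>
    arctan_neg_cot (div_pos h1 hM) ((div_lt_iff₀ hM).2 h2)
  ext t
  constructor
  · rintro ⟨s, hs, rfl⟩
    rw [Set.mem_Iic, ← Real.arctan_le_arctan_iff, hat s hs.1 (hs.2.trans_lt hXM), hat X hX hXM]
    have := hs.2
    gcongr
  · intro ht
    rw [Set.mem_Iic, ← Real.arctan_le_arctan_iff, hat X hX hXM] at ht
    have h1 := Real.neg_pi_div_two_lt_arctan t
    have hpos : 0 < M * (Real.arctan t + π / 2) := mul_pos hM (by linarith)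
    have hle : M * (Real.arctan t + π / 2) ≤ X := by
      rw [mul_comm, ← le_div_iff₀ hM]
      linarith
    refine ⟨M * (Real.arctan t + π / 2), ⟨hpos, hle⟩, Real.arctan_injective ?_⟩
    rw [hat _ hpos (hle.trans_lt hXM)]
    field_simp
    ring

theorem zScale_injOn {M X : ℝ} (hM : 0 < M) (hXM : X < π * M) :
    Set.InjOn (zScale M) (Set.Ioc 0 X) := by
  intro s hs t ht hst
  have h := congrArg Real.arctan hst
  rw [zScale, zScale, arctan_neg_cot (div_pos hs.1 hM) ((div_lt_iff₀ hM).2 (hs.2.trans_lt hXM)),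
    arctan_neg_cot (div_pos ht.1 hM) ((div_lt_iff₀ hM).2 (ht.2.trans_lt hXM))] at h
  have : s / M = t / M := by linarith
  exact (div_left_inj' hM.ne').1 this

theorem integral_Iic_zScale {M X : ℝ} (hM : 0 < M) (hX : 0 < X) (hXM : X < π * M) (g : ℝ → ℝ) :
    ∫ t in Set.Iic (zScale M X), g t =
      ∫ s in (0 : ℝ)..X, 1 / (M * Real.sin (s / M) ^ 2) * g (zScale M s) := by
  have hsin : ∀ s ∈ Set.Ioc 0 X, 0 < Real.sin (s / M) := fun s hs =>
    Real.sin_pos_of_pos_of_lt_pi (div_pos hs.1 hM) ((div_lt_iff₀ hM).2 (hs.2.trans_lt hXM))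
  rw [← zScale_image_Ioc hM hX hXM, integral_image_eq_integral_abs_deriv_smul measurableSet_Ioc
    (fun s hs => (deriv_zScale (hsin s hs).ne').hasDerivWithinAt) (zScale_injOn hM hXM),
    intervalIntegral.integral_of_le hX.le]
  refine setIntegral_congr_fun measurableSet_Ioc fun s hs => ?_
  have := hsin s hs
  simp only [smul_eq_mul]
  rw [abs_of_pos (by positivity)]

theorem weightOne_mul_rr_neg_cot (c : ℂ) (n : ℕ) (h : (n : ℝ) < -c.re) {θ : ℝ} (h0 : 0 < θ)
    (hπ : θ < π) :
    ((weightOne c (-Real.cot θ) * rr c n (-Real.cot θ) : ℝ) : ℂ) =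
      (-1) ^ n * ((Real.sin θ ^ (-c.re - n + 1) : ℝ) : ℂ) * (Real.exp (-c.im * π / 2) : ℝ) *
        (Real.exp (c.im * θ) * trigEuler (-c.re - n) c.im n θ) := by
  have hs := Real.sin_pos_of_pos_of_lt_pi h0 hπ
  rw [Complex.ofReal_mul, rr_neg_cot c n h h0 hπ, weightOne_eq, cauchyWeight_neg_cot _ h0 hπ]
  simp only [halfExponent]
  have e1 : Real.sin θ ^ (-c.re - n + 1) =
      Real.sin θ ^ (-2 * ((c.re - 1) / 2)) * Real.sin θ ^ (-(n : ℝ)) := by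
    rw [← Real.rpow_add hs]
    ring_nf
  have e2 : Real.exp (2 * (c.im / 2) * (θ - π / 2)) =
      Real.exp (-c.im * π / 2) * Real.exp (c.im * θ) := by
    rw [← Real.exp_add]
    ring_nf
  rw [e1, e2]
  push_cast
  ring

/-- The Euler integral of a Routh-Romanovski polynomial at the scale `N + p`, with the exponential
factor of the weight. -/
def angEuler (p q : ℝ) (k N : ℕ) (x : ℝ) : ℂ :=
  Real.exp (q * (x / (N + p))) * trigEuler (p + k) q (N - k) (x / (N + p))

theorem weightOne_mul_rr_zScale (p q : ℝ) (k : ℕ) {N : ℕ} (hN : k ≤ N) (hr : 0 < p + k) {x : ℝ}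
    (hx : 0 < x) (hxM : x < π * ((N : ℝ) + p)) :
    ((weightOne ⟨-N - p, q⟩ (zScale (N + p) x) *
        rr ⟨-N - p, q⟩ (N - k) (zScale (N + p) x) : ℝ) : ℂ) =
      (-1) ^ (N - k) * ((((N : ℝ) + p) ^ (-(p + k + 1)) * x ^ (p + k + 1) *
        sincFactor p N x ^ (p + k + 1) * Real.exp (-q * π / 2) : ℝ) : ℂ) * angEuler p q k N x := by
  have hM : 0 < (N : ℝ) + p := by
    have : (k : ℝ) ≤ N := by exact_mod_cast hN
    linarith
  have hc : ((N - k : ℕ) : ℝ) = N - k := Nat.cast_sub hN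
  have hs := sincFactor_pos p hx.ne' (N := N) (by rwa [abs_of_pos hx])
  have hre : -(⟨-N - p, q⟩ : ℂ).re - (N - k : ℕ) = p + k := by simp only [hc]; ring
  rw [zScale, weightOne_mul_rr_neg_cot _ _ (by linarith) (div_pos hx hM) ((div_lt_iff₀ hM).2 hxM),
    hre, angEuler, sin_eq_sincFactor p hx.ne' hM.ne', Real.div_rpow (by positivity) hM.le,
    Real.mul_rpow hx.le hs.le, Real.rpow_neg hM.le]
  push_cast
  ring

theorem lowerInt_zScale (p q : ℝ) (k : ℕ) {N : ℕ} (hN : k ≤ N) (hr : 0 < p + k) {X : ℝ}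
    (hX : 0 < X) (hXM : X < π * ((N : ℝ) + p)) :
    ((lowerInt ⟨-N - p, q⟩ (N - k) (zScale (N + p) X) : ℝ) : ℂ) =
      (-1) ^ (N - k) * ((((N : ℝ) + p) ^ (-(p + k)) * Real.exp (-q * π / 2) : ℝ) : ℂ) *
        ∫ s in (0 : ℝ)..X, ((s ^ (p + k - 1) : ℝ) : ℂ) *
          (((sincFactor p N s ^ (p + k - 1) : ℝ) : ℂ) * angEuler p q k N s) := by
  have hM : 0 < (N : ℝ) + p := by
    have : (k : ℝ) ≤ N := by exact_mod_cast hN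
    linarith
  rw [lowerInt, integral_Iic_zScale hM hX hXM, ← intervalIntegral.integral_ofReal,
    ← intervalIntegral.integral_const_mul, intervalIntegral.integral_of_le hX.le,
    intervalIntegral.integral_of_le hX.le]
  refine setIntegral_congr_fun measurableSet_Ioc fun s hs => ?_
  have hsM := hs.2.trans_lt hXM
  have hs0 : 0 < s := hs.1
  have hsc := sincFactor_pos p hs0.ne' (N := N) (by rwa [abs_of_pos hs0])
  rw [Complex.ofReal_mul, weightOne_mul_rr_zScale p q k hN hr hs0 hsM,
    sin_eq_sincFactor p hs0.ne' hM.ne']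
  have key : 1 / (((N : ℝ) + p) * (s * sincFactor p N s / (N + p)) ^ 2) *
      (((N : ℝ) + p) ^ (-(p + k + 1)) * s ^ (p + k + 1) * sincFactor p N s ^ (p + k + 1)) =
      ((N : ℝ) + p) ^ (-(p + k)) * s ^ (p + k - 1) * sincFactor p N s ^ (p + k - 1) := by
    rw [show p + k + 1 = p + k - 1 + 2 by ring, Real.rpow_add hs0, Real.rpow_add hsc,
      Real.rpow_two, Real.rpow_two, show -(p + k - 1 + 2) = -(p + k) - 1 by ring,
      Real.rpow_sub_one hM.ne']
    field_simp
  have keyC := congrArg (fun t : ℝ => (t : ℂ)) key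
  rw [Complex.ofReal_mul] at keyC
  rw [Complex.ofReal_mul _ (Real.exp _)]
  calc _ = (((1 / (((N : ℝ) + p) * (s * sincFactor p N s / (N + p)) ^ 2) : ℝ) : ℂ) *
      ((((N : ℝ) + p) ^ (-(p + k + 1)) * s ^ (p + k + 1) * sincFactor p N s ^ (p + k + 1) : ℝ) : ℂ)) *
      ((-1) ^ (N - k) * (Real.exp (-q * π / 2) : ℝ) * angEuler p q k N s) := by ring
    _ = _ := by
      rw [keyC]
      push_cast
      ring

theorem continuousOn_trigEuler {r : ℝ} (q : ℝ) (hr : 0 < r) (n : ℕ) :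
    ContinuousOn (trigEuler r q n) (Set.Ioo 0 π) := by
  have hsin : ∀ θ ∈ Set.Ioo 0 π, Real.sin θ ≠ 0 := fun θ hθ =>
    (Real.sin_pos_of_pos_of_lt_pi hθ.1 hθ.2).ne'
  have hcot : ContinuousOn (fun θ => -(Real.cos θ / Real.sin θ)) (Set.Ioo 0 π) :=
    (Real.continuous_cos.continuousOn.div Real.continuous_sin.continuousOn hsin).neg
  have hrr : Continuous fun x => rr ⟨-r - n, q⟩ n x := Polynomial.continuous _
  have hc : ContinuousOn (fun θ => (-1 : ℂ) ^ n * ((Real.sin θ ^ n : ℝ) : ℂ) *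
      ((rr ⟨-r - n, q⟩ n (-(Real.cos θ / Real.sin θ)) : ℝ) : ℂ)) (Set.Ioo 0 π) :=
    (Continuous.continuousOn (by fun_prop)).mul
      (Complex.continuous_ofReal.comp_continuousOn (hrr.comp_continuousOn hcot))
  refine hc.congr fun θ hθ => ?_
  have hs := Real.sin_pos_of_pos_of_lt_pi hθ.1 hθ.2
  have e := rr_neg_cot ⟨-r - n, q⟩ n (by simp only; linarith) hθ.1 hθ.2
  rw [Real.cot_eq_cos_div_sin] at e
  have hre : -(⟨-r - n, q⟩ : ℂ).re - n = r := by simp only; ring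
  beta_reduce
  rw [e, hre, Real.rpow_neg hs.le, Real.rpow_natCast]
  have hsc : ((Real.sin θ : ℝ) : ℂ) ≠ 0 := by exact_mod_cast hs.ne'
  have hsg : ((-1 : ℂ) ^ n) * (-1) ^ n = 1 := by rw [← mul_pow]; simp
  push_cast [-Complex.ofReal_sin]
  field_simp
  rw [sq, hsg, mul_one]

theorem continuousOn_sincFactor_mul_angEuler (p q a : ℝ) (k N : ℕ) (hr : 0 < p + k) {R : ℝ}
    (hM : 0 < (N : ℝ) + p) (hR : R < π * ((N : ℝ) + p)) :
    ContinuousOn (fun s => ((sincFactor p N s ^ a : ℝ) : ℂ) * angEuler p q k N s)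
      (Set.Ioc 0 R) := by
  have h1 : ContinuousOn (fun s => sincFactor p N s) (Set.Ioc 0 R) := by
    unfold sincFactor
    exact ContinuousOn.div (by fun_prop) continuousOn_id fun s hs => hs.1.ne'
  have h2 : ContinuousOn (fun s => trigEuler (p + k) q (N - k) (s / (N + p))) (Set.Ioc 0 R) :=
    (continuousOn_trigEuler q hr (N - k)).comp (by fun_prop) fun s hs =>
      ⟨div_pos hs.1 hM, (div_lt_iff₀ hM).2 (hs.2.trans_lt hR)⟩
  have h3 : ContinuousOn (fun s => sincFactor p N s ^ a) (Set.Ioc 0 R) :=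
    h1.rpow_const fun s hs => Or.inl (sincFactor_pos p hs.1.ne' (by
      rw [abs_of_pos hs.1]; exact hs.2.trans_lt hR)).ne'
  unfold angEuler
  exact (Complex.continuous_ofReal.comp_continuousOn h3).mul
    ((Continuous.continuousOn (by fun_prop)).mul h2)

theorem continuous_expEuler (p q : ℝ) (k : ℕ) (h : 0 < p + k) : Continuous (expEuler (p + k) q) := by
  have e : expEuler (p + k) q = fun X : ℝ => Complex.exp (-Complex.I * X) * C₀ p q k X :=
    funext (expEuler_eq p q k h)
  rw [e]
  have := (contDiff_C₀_of_pos p q k h (n := 0)).continuous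
  fun_prop

theorem intervalIntegrable_rpow_mul {r R X : ℝ} (hr : 0 < r) (hX : 0 ≤ X) (hXR : X ≤ R) {f : ℝ → ℂ}
    (hf : ContinuousOn f (Set.Ioc 0 R)) {B : ℝ} (hB : ∀ s ∈ Set.Ioc 0 R, ‖f s‖ ≤ B) :
    IntervalIntegrable (fun s => ((s ^ (r - 1) : ℝ) : ℂ) * f s) volume 0 X := by
  have h0 : IntervalIntegrable (fun s : ℝ => s ^ (r - 1)) volume 0 X :=
    intervalIntegral.intervalIntegrable_rpow' (by linarith)
  rw [intervalIntegrable_iff_integrableOn_Ioc_of_le hX] at h0 ⊢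
  have h1 : IntegrableOn (fun s : ℝ => ((s ^ (r - 1) : ℝ) : ℂ)) (Set.Ioc 0 X) := h0.ofReal
  have hsub : Set.Ioc 0 X ⊆ Set.Ioc 0 R := Set.Ioc_subset_Ioc_right hXR
  refine h1.mul_bdd (c := B) ((hf.mono hsub).aestronglyMeasurable measurableSet_Ioc) ?_
  exact (ae_restrict_mem measurableSet_Ioc).mono fun s hs => hB s (hsub hs)

/-- Integration against `s ^ (r - 1)` preserves uniform approximation. -/
theorem uniformApprox_integral {r R : ℝ} (hr : 0 < r) {f : ℕ → ℝ → ℂ} {g : ℝ → ℂ}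
    (h : UniformApprox (Set.Ioc 0 R) f g) (hg : ContinuousOn g (Set.Ioc 0 R))
    (hf : ∃ N₀ : ℕ, ∀ N ≥ N₀, ContinuousOn (f N) (Set.Ioc 0 R)) :
    UniformApprox (Set.Ioc 0 R) (fun N X => ∫ s in (0 : ℝ)..X, ((s ^ (r - 1) : ℝ) : ℂ) * f N s)
      fun X => ∫ s in (0 : ℝ)..X, ((s ^ (r - 1) : ℝ) : ℂ) * g s := by
  obtain ⟨B, hB, hgB, N₀, hN₀⟩ := h.nonneg_bound
  obtain ⟨N₁, hN₁⟩ := hf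
  have hbound : ∀ (E : ℝ) (F : ℝ → ℂ), 0 ≤ E → (∀ s ∈ Set.Ioc 0 R, ‖F s‖ ≤ E) →
      ∀ X ∈ Set.Ioc 0 R, ‖∫ s in (0 : ℝ)..X, ((s ^ (r - 1) : ℝ) : ℂ) * F s‖ ≤ E * (R ^ r / r) := by
    intro E F hE hF X hX
    have h1 : IntervalIntegrable (fun s : ℝ => s ^ (r - 1) * E) volume 0 X :=
      (intervalIntegral.intervalIntegrable_rpow' (by linarith)).mul_const E
    refine (intervalIntegral.norm_integral_le_of_norm_le hX.1.le
      (Filter.Eventually.of_forall fun s hs => ?_) h1).trans ?_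
    · rw [norm_mul, Complex.norm_real, Real.norm_of_nonneg (Real.rpow_nonneg hs.1.le _)]
      exact mul_le_mul_of_nonneg_left (hF s ⟨hs.1, hs.2.trans hX.2⟩) (Real.rpow_nonneg hs.1.le _)
    · rw [intervalIntegral.integral_mul_const, integral_rpow (Or.inl (by linarith)), sub_add_cancel,
        Real.zero_rpow hr.ne', sub_zero, mul_comm]
      have := hX.2
      have := hX.1.le
      gcongr
  refine ⟨⟨_, hbound B g hB hgB⟩, B * (R ^ r / r), max N₀ N₁, fun N hN X hX => ?_⟩
  have h1 := hN₀ N ((le_max_left _ _).trans hN)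
  have hB2 : 0 ≤ B / (N : ℝ) ^ 2 := by positivity
  have hfN : ∀ s ∈ Set.Ioc 0 R, ‖f N s‖ ≤ B + B / (N : ℝ) ^ 2 := fun s hs => by
    calc ‖f N s‖ = ‖g s + (f N s - g s)‖ := by congr 1; ring
      _ ≤ _ := (norm_add_le _ _).trans (add_le_add (hgB s hs) (h1 s hs))
  rw [← intervalIntegral.integral_sub
    (intervalIntegrable_rpow_mul hr hX.1.le hX.2 (hN₁ N ((le_max_right _ _).trans hN)) hfN)
    (intervalIntegrable_rpow_mul hr hX.1.le hX.2 hg hgB)]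
  simp only [← mul_sub]
  exact (hbound _ _ hB2 h1 X hX).trans (le_of_eq (by ring))

theorem uniformApprox_angEuler (p q : ℝ) (k : ℕ) (h : EulerParam (p + k) q) (R : ℝ) (hR : 0 ≤ R) :
    UniformApprox {x : ℝ | |x| ≤ R} (angEuler p q k) (expEuler (p + k) q) :=
  uniformApprox_trigEuler p q k h R hR

theorem uniformApprox_lowerInt (p q : ℝ) (k : ℕ) (hr : 0 < p + k) {R : ℝ} (hR : 0 < R) :
    UniformApprox (Set.Ioc 0 R)
      (fun N X => (((-1) ^ (N - k) * ((N : ℝ) + p) ^ (p + k) *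
        lowerInt ⟨-N - p, q⟩ (N - k) (zScale (N + p) X) : ℝ) : ℂ))
      fun X => (Real.exp (-q * π / 2) : ℝ) *
        ∫ s in (0 : ℝ)..X, ((s ^ (p + k - 1) : ℝ) : ℂ) * expEuler (p + k) q s := by
  have hsub : ∀ s ∈ Set.Ioc 0 R, s ≠ 0 ∧ |s| ≤ R := fun s hs =>
    ⟨hs.1.ne', by rw [abs_of_pos hs.1]; exact hs.2⟩
  obtain ⟨N₀, hN₀⟩ := exists_shift_bound p R
  have hbig : ∀ N ≥ max N₀ k, k ≤ N ∧ 0 < (N : ℝ) + p ∧ R < π * ((N : ℝ) + p) := fun N hN => by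
    obtain ⟨h1, h2, -, -⟩ := hN₀ N ((le_max_left _ _).trans hN)
    have := Real.pi_gt_three
    exact ⟨(le_max_right _ _).trans hN, by linarith, by nlinarith⟩
  have h1 := ((uniformApprox_sincFactor_rpow p R (p + k - 1)).comp id hsub).mul
    ((uniformApprox_angEuler p q k (Or.inl hr) R hR.le).comp id fun s hs => (hsub s hs).2)
  have h2 := (uniformApprox_integral hr h1 ?_ ⟨max N₀ k, fun N hN => ?_⟩).const_mul
    ((Real.exp (-q * π / 2) : ℝ) : ℂ)
  · refine h2.congr ⟨max N₀ k, fun N hN X hX => ?_⟩ fun X _ => by simp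
    obtain ⟨b1, b2, b3⟩ := hbig N hN
    rw [Complex.ofReal_mul, lowerInt_zScale p q k b1 hr hX.1 (hX.2.trans_lt b3)]
    have hpw : ((N : ℝ) + p) ^ (p + k) * ((N : ℝ) + p) ^ (-(p + k)) = 1 := by
      rw [← Real.rpow_add b2, add_neg_cancel, Real.rpow_zero]
    have hpwC := congrArg (fun t : ℝ => (t : ℂ)) hpw
    simp only [Complex.ofReal_mul, Complex.ofReal_one] at hpwC
    have hsg : ((-1 : ℂ) ^ (N - k)) * (-1) ^ (N - k) = 1 := by rw [← mul_pow]; simp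
    rw [Complex.ofReal_mul, Complex.ofReal_mul, Complex.ofReal_pow, Complex.ofReal_neg,
      Complex.ofReal_one]
    simp only [id]
    generalize (∫ s in (0 : ℝ)..X, _ : ℂ) = J
    generalize (((N : ℝ) + p) ^ (p + k) : ℝ) = a at hpwC
    generalize (((N : ℝ) + p) ^ (-(p + k)) : ℝ) = b at hpwC
    linear_combination ((-1) ^ (N - k) * (-1) ^ (N - k) * (Real.exp (-q * π / 2) : ℝ) * J) * hpwC +
      ((Real.exp (-q * π / 2) : ℝ) * J) * hsg
  · have := continuous_expEuler p q k hr
    simp only [id, one_mul]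
    exact this.continuousOn
  · obtain ⟨b1, b2, b3⟩ := hbig N hN
    exact continuousOn_sincFactor_mul_angEuler p q _ k N hr b2 b3

/-! ### The limits for Dyson indices 1 and 4 at the shifted scale -/

theorem box_fst {δ R : ℝ} (hδ : 0 < δ) : ∀ Z ∈ box δ R, Z.1 ≠ 0 ∧ |Z.1| ≤ R := fun Z hZ => by
  have := hδ.trans_le hZ.1
  exact ⟨this.ne', by rw [abs_of_pos this]; exact hZ.2.1⟩

theorem box_snd {δ R : ℝ} (hδ : 0 < δ) : ∀ Z ∈ box δ R, Z.2 ≠ 0 ∧ |Z.2| ≤ R := fun Z hZ => by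
  have := hδ.trans_le hZ.2.2.1
  exact ⟨this.ne', by rw [abs_of_pos this]; exact hZ.2.2.2.1⟩

theorem uniformApprox_of_continuousOn_box {δ R : ℝ} (hδ : 0 < δ) {g : ℝ × ℝ → ℂ}
    (hg : ContinuousOn g {Z | 0 < Z.1 ∧ 0 < Z.2 ∧ Z.1 ≠ Z.2}) :
    UniformApprox (box δ R) (fun _ => g) g :=
  .of_bounded ((isCompact_box δ R).exists_bound_of_continuousOn (hg.mono fun _ hZ =>
    ⟨hδ.trans_le hZ.1, hδ.trans_le hZ.2.2.1, sub_ne_zero.1 (abs_pos.1 (hδ.trans_le hZ.2.2.2.2))⟩))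

theorem exists_box_shift_bound (p : ℝ) (k : ℕ) {δ : ℝ} (R : ℝ) (hδ : 0 < δ) :
    ∃ N₀ : ℕ, ∀ N ≥ N₀, k ≤ N ∧ 0 < (N : ℝ) + p ∧ ∀ Z ∈ box δ R,
      (0 < Z.1 ∧ Z.1 < π * ((N : ℝ) + p)) ∧ (0 < Z.2 ∧ Z.2 < π * ((N : ℝ) + p)) := by
  obtain ⟨N₀, hN₀⟩ := exists_shift_bound p R
  refine ⟨max N₀ k, fun N hN => ?_⟩
  obtain ⟨h1, h2, -, -⟩ := hN₀ N ((le_max_left _ _).trans hN)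
  have h3 : R < π * ((N : ℝ) + p) := by
    have := Real.pi_gt_three
    nlinarith
  refine ⟨(le_max_right _ _).trans hN, by linarith, fun Z hZ => ⟨⟨hδ.trans_le hZ.1, ?_⟩,
    hδ.trans_le hZ.2.2.1, ?_⟩⟩
  · linarith [hZ.2.1]
  · linarith [hZ.2.2.2.1]

/-- The part of the limit of the rank one term that depends on `Y` and the prefactor. -/
def rankOneFactor (p q : ℝ) (k : ℕ) (Z : ℝ × ℝ) : ℝ :=
  (p + k) * (Real.Gamma (2 * (p + k) + 2) * cauchyMass (p + k + 1) q)⁻¹ *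
    Real.exp (-q * π / 2) * (Z.2 ^ (p + k + 1) / Z.1 ^ 2)

theorem uniformApprox_rankOneFactor (p q : ℝ) (k : ℕ) (hr : 0 < p + k) {δ : ℝ} (R : ℝ)
    (hδ : 0 < δ) :
    UniformApprox (box δ R)
      (fun N Z => ((gammaCoeff ⟨-N - p, q⟩ (N - (k + 1)) *
        (weightOne ⟨-N - p, q⟩ (zScale (N + p) Z.2) *
          rr ⟨-N - p, q⟩ (N - k) (zScale (N + p) Z.2)) * deriv (zScale (N + p)) Z.1 *
        ((-1) ^ (N - k) * ((N : ℝ) + p) ^ (-(p + k + 1))) : ℝ) : ℂ))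
      fun Z => rankOneFactor p q k Z * expEuler (p + k) q Z.2 := by
  have b : UniformApprox (box δ R) (fun _ Z => (rankOneFactor p q k Z : ℂ))
      fun Z => (rankOneFactor p q k Z : ℂ) := by
    refine uniformApprox_of_continuousOn_box hδ ?_
    refine Complex.continuous_ofReal.comp_continuousOn (continuousOn_const.mul ?_)
    exact ContinuousOn.div (ContinuousOn.rpow_const (by fun_prop) fun Z hZ => Or.inl hZ.2.1.ne')
      (by fun_prop) fun Z hZ => pow_ne_zero 2 hZ.1.ne'
  have sX := (uniformApprox_sincFactor_rpow p R (-2)).comp _ (box_fst hδ)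
  have sY := (uniformApprox_sincFactor_rpow p R (p + k + 1)).comp _ (box_snd hδ)
  have hg := uniformApprox_gammaRatio (box δ R) p (p + k + 1) 1 one_pos
  have main := ((b.mul hg).mul (sX.mul sY)).mul
    ((uniformApprox_angEuler p q k (Or.inl hr) |R| (abs_nonneg R)).comp Prod.snd
      fun Z hZ => ((box_snd hδ Z hZ).2.trans (le_abs_self R)))
  refine main.congr ?_ fun Z hZ => by simp
  obtain ⟨N₀, hN₀⟩ := exists_box_shift_bound p (k + 1) R hδ
  refine ⟨N₀, fun N hN Z hZ => ?_⟩
  obtain ⟨hk, hM, hb⟩ := hN₀ N hN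
  obtain ⟨⟨hX, hXM⟩, hY, hYM⟩ := hb Z hZ
  have hsX := sincFactor_pos p hX.ne' (N := N) (by rwa [abs_of_pos hX])
  have hsY := sincFactor_pos p hY.ne' (N := N) (by rwa [abs_of_pos hY])
  have e1 := weightOne_mul_rr_zScale p q k (N := N) (by omega) hr hY hYM
  have e2 := inv_rrNorm_eq p q k hk hr.le hM
  have hc : ((N - (k + 1) : ℕ) : ℝ) = N - (k + 1) := by
    rw [Nat.cast_sub hk]; push_cast; ring
  have hsin : Real.sin (Z.1 / (N + p)) ≠ 0 := by
    rw [sin_eq_sincFactor p hX.ne' hM.ne']; positivity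
  have hγ : gammaCoeff ⟨-N - p, q⟩ (N - (k + 1)) = (p + k) * (gammaRatio (p + k + 1) (N + p) *
      ((N : ℝ) + p) ^ (2 * (p + k) + 1) *
        (Real.Gamma (2 * (p + k) + 2) * cauchyMass (p + k + 1) q)⁻¹) := by
    rw [gammaCoeff, div_eq_mul_inv, e2, hc, div_eq_mul_inv]
    congr 1
    simp only
    ring
  have key : gammaCoeff ⟨-N - p, q⟩ (N - (k + 1)) * deriv (zScale (N + p)) Z.1 *
      ((N : ℝ) + p) ^ (-(p + k + 1)) * (((N : ℝ) + p) ^ (-(p + k + 1)) * Z.2 ^ (p + k + 1) *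
        sincFactor p N Z.2 ^ (p + k + 1) * Real.exp (-q * π / 2)) =
      rankOneFactor p q k Z * gammaRatio (p + k + 1) (1 * (N + p)) *
        (sincFactor p N Z.1 ^ (-2 : ℝ) * sincFactor p N Z.2 ^ (p + k + 1)) := by
    have hpw : ((N : ℝ) + p) ^ (2 * (p + k) + 1) * ((N : ℝ) + p) ^ (-(p + k + 1)) *
        ((N : ℝ) + p) ^ (-(p + k + 1)) * (N + p) = 1 := by
      rw [← Real.rpow_add hM, ← Real.rpow_add hM, ← Real.rpow_add_one hM.ne',
        show 2 * (p + k) + 1 + -(p + k + 1) + -(p + k + 1) + 1 = (0 : ℝ) by ring, Real.rpow_zero]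
    rw [hγ, (deriv_zScale hsin).deriv, sin_eq_sincFactor p hX.ne' hM.ne', rankOneFactor, one_mul,
      Real.rpow_neg hsX.le, Real.rpow_two]
    have e3 : 1 / (((N : ℝ) + p) * (Z.1 * sincFactor p N Z.1 / (N + p)) ^ 2) =
        (N + p) * (Z.1 ^ 2)⁻¹ * (sincFactor p N Z.1 ^ 2)⁻¹ := by
      field_simp
    rw [e3]
    linear_combination ((p + k) * (Real.Gamma (2 * (p + k) + 2) * cauchyMass (p + k + 1) q)⁻¹ *
      Real.exp (-q * π / 2) * (Z.2 ^ (p + k + 1) / Z.1 ^ 2) * gammaRatio (p + k + 1) (N + p) *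
        ((sincFactor p N Z.1 ^ 2)⁻¹ * sincFactor p N Z.2 ^ (p + k + 1))) * hpw
  have keyC := congrArg (fun t : ℝ => (t : ℂ)) key
  have hsg : ((-1 : ℂ) ^ (N - k)) * (-1) ^ (N - k) = 1 := by rw [← mul_pow]; simp
  have e4 : ∀ a b d e w : ℝ, ((a * w * b * (d * e) : ℝ) : ℂ) = ((a * b * e : ℝ) : ℂ) * d * (w : ℂ) :=
    fun a b d e w => by push_cast; ring
  rw [e4, e1]
  simp only [Complex.ofReal_mul] at keyC ⊢
  rw [← keyC, Complex.ofReal_pow, Complex.ofReal_neg, Complex.ofReal_one]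
  linear_combination ((gammaCoeff ⟨-N - p, q⟩ (N - (k + 1)) : ℝ) *
    (deriv (zScale (N + p)) Z.1 : ℝ) * ((((N : ℝ) + p) ^ (-(p + k + 1)) : ℝ) : ℂ) *
    (((((N : ℝ) + p) ^ (-(p + k + 1)) : ℝ) : ℂ) * ((Z.2 ^ (p + k + 1) : ℝ) : ℂ) *
      ((sincFactor p N Z.2 ^ (p + k + 1) : ℝ) : ℂ) * (Real.exp (-q * π / 2) : ℝ)) *
        angEuler p q k N Z.2) * hsg

/-- The limit of the rank one term; `σ` is the limit of a constant subtracted from `lowerInt`. -/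
theorem uniformApprox_rankOne (p q : ℝ) (k : ℕ) (hr : 0 < p + k) {δ : ℝ} (R : ℝ) (hδ : 0 < δ)
    {t : ℕ → ℝ} {σ : ℝ}
    (hσ : UniformApprox (box δ R)
      (fun N _ => (((-1) ^ (N - (k + 1)) * ((N : ℝ) + p) ^ (p + k + 1) * t N : ℝ) : ℂ))
      fun _ => (σ : ℂ)) :
    UniformApprox (box δ R)
      (fun N Z => ((gammaCoeff ⟨-N - p, q⟩ (N - (k + 1)) *
        (weightOne ⟨-N - p, q⟩ (zScale (N + p) Z.2) *
          rr ⟨-N - p, q⟩ (N - k) (zScale (N + p) Z.2)) *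
        (lowerInt ⟨-N - p, q⟩ (N - (k + 1)) (zScale (N + p) Z.1) - t N) *
          deriv (zScale (N + p)) Z.1 : ℝ) : ℂ))
      fun Z => -(rankOneFactor p q k Z * expEuler (p + k) q Z.2 * ((Real.exp (-q * π / 2) : ℝ) *
        (∫ s in (0 : ℝ)..Z.1, ((s ^ (p + k) : ℝ) : ℂ) * expEuler (p + k + 1) q s) - σ)) := by
  have hr' : 0 < p + (k + 1 : ℕ) := by push_cast; linarith
  have hfst : ∀ Z ∈ box δ R, Z.1 ∈ Set.Ioc 0 |R| := fun Z hZ =>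
    ⟨hδ.trans_le hZ.1, hZ.2.1.trans (le_abs_self R)⟩
  rcases (box δ R).eq_empty_or_nonempty with h0 | ⟨Z₀, hZ₀⟩
  · rw [h0]
    exact ⟨⟨0, by simp⟩, 0, 0, by simp⟩
  have hR : 0 < |R| := (hfst Z₀ hZ₀).1.trans_le (hfst Z₀ hZ₀).2
  have hL := (uniformApprox_lowerInt p q (k + 1) hr' hR).comp _ hfst
  have main := ((uniformApprox_rankOneFactor p q k hr R hδ).mul (hL.sub hσ)).const_mul (-1)
  obtain ⟨N₀, hN₀⟩ := exists_box_shift_bound p (k + 1) R hδ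
  refine main.congr ⟨N₀, fun N hN Z hZ => ?_⟩ fun Z _ => ?_
  · obtain ⟨hk, hM, -⟩ := hN₀ N hN
    have hpw : ((N : ℝ) + p) ^ (-(p + k + 1)) * ((N : ℝ) + p) ^ (p + k + 1) = 1 := by
      rw [← Real.rpow_add hM, neg_add_cancel, Real.rpow_zero]
    have hsg : ((-1 : ℝ) ^ (N - k)) * (-1) ^ (N - (k + 1)) = -1 := by
      rw [show N - k = N - (k + 1) + 1 by omega, pow_succ, mul_right_comm, ← mul_pow]
      simp
    rw [show p + ((k + 1 : ℕ) : ℝ) = p + k + 1 by push_cast; ring, ← Complex.ofReal_sub,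
      ← Complex.ofReal_mul, ← Complex.ofReal_one, ← Complex.ofReal_neg, ← Complex.ofReal_mul]
    congr 1
    generalize gammaCoeff ⟨-N - p, q⟩ (N - (k + 1)) = g
    generalize weightOne ⟨-N - p, q⟩ (zScale (N + p) Z.2) * _ = w
    generalize lowerInt ⟨-N - p, q⟩ (N - (k + 1)) (zScale (N + p) Z.1) = l
    generalize deriv (zScale (N + p)) Z.1 = d
    generalize ((N : ℝ) + p) ^ (-(p + k + 1)) = a at hpw ⊢
    generalize ((N : ℝ) + p) ^ (p + k + 1) = b at hpw ⊢
    linear_combination (g * w * d * (l - t N)) * ((-1 : ℝ) ^ (N - k) * (-1) ^ (N - (k + 1)) * hpw + hsg)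
  · rw [show p + ((k + 1 : ℕ) : ℝ) = p + k + 1 by push_cast; ring,
      show p + k + 1 - 1 = p + (k : ℝ) by ring]
    ring

/-- The part of the kernels for Dyson indices 1 and 4 that comes from Dyson index 2. -/
theorem uniformApprox_sqrt_mul_cdKernel (p q : ℝ) (k : ℕ) (h : EulerParam (p + k) q) {δ : ℝ} (R : ℝ)
    (hδ : 0 < δ) :
    UniformApprox (box δ R)
      (fun N Z => ((√((1 + zScale (N + p) Z.1 ^ 2) / (1 + zScale (N + p) Z.2 ^ 2)) *
        cdKernel ⟨-N - p, q⟩ (N - k) (zScale (N + p) Z.1) (zScale (N + p) Z.2) *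
          deriv (zScale (N + p)) Z.1 : ℝ) : ℂ))
      fun Z => Z.2 / Z.1 * KTwo p q k Z.1 Z.2 := by
  have b : UniformApprox (box δ R) (fun _ Z => (Z.2 / Z.1 : ℂ)) fun Z => (Z.2 / Z.1 : ℂ) := by
    refine uniformApprox_of_continuousOn_box hδ ?_
    exact ContinuousOn.div (by fun_prop) (by fun_prop) fun Z hZ => by exact_mod_cast hZ.1.ne'
  have sX := (uniformApprox_sincFactor_rpow p R (-1)).comp _ (box_fst hδ)
  have sY := (uniformApprox_sincFactor_rpow p R 1).comp _ (box_snd hδ)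
  have main := (b.mul (sX.mul sY)).mul (uniformApprox_cdKernel p q k h R hδ)
  refine main.congr ?_ fun Z hZ => by simp
  obtain ⟨N₀, hN₀⟩ := exists_box_shift_bound p k R hδ
  refine ⟨N₀, fun N hN Z hZ => ?_⟩
  obtain ⟨-, hM, hb⟩ := hN₀ N hN
  obtain ⟨⟨hX, hXM⟩, hY, hYM⟩ := hb Z hZ
  have hsX := sincFactor_pos p hX.ne' (N := N) (by rwa [abs_of_pos hX])
  have hsY := sincFactor_pos p hY.ne' (N := N) (by rwa [abs_of_pos hY])
  have e1 := sin_eq_sincFactor p (N := N) hX.ne' hM.ne'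
  have e2 := sin_eq_sincFactor p (N := N) hY.ne' hM.ne'
  have hsin1 : 0 < Real.sin (Z.1 / (N + p)) := by rw [e1]; positivity
  have hsin2 : 0 < Real.sin (Z.2 / (N + p)) := by rw [e2]; positivity
  have e3 : √((1 + zScale (N + p) Z.1 ^ 2) / (1 + zScale (N + p) Z.2 ^ 2)) =
      Z.2 / Z.1 * (sincFactor p N Z.1 ^ (-1 : ℝ) * sincFactor p N Z.2 ^ (1 : ℝ)) := by
    rw [zScale, zScale, one_add_cot_sq hsin1, one_add_cot_sq hsin2, ← inv_pow, ← inv_pow, ← div_pow,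
      Real.sqrt_sq (by positivity), e1, e2, Real.rpow_neg_one, Real.rpow_one]
    field_simp
  rw [e3, scaled, mul_assoc]
  push_cast
  ring

/-- The kernel for Dyson index 1, in a form common to even and odd particle numbers. -/
theorem kernelOne_eq (p q : ℝ) (hp : -1 < p) {N : ℕ} (hN : 3 ≤ N) (x y : ℝ) :
    kernelOne p q N x y = √((1 + x ^ 2) / (1 + y ^ 2)) * cdKernel ⟨-N - p, 2 * q⟩ (N - 1) x y +
      gammaCoeff ⟨-N - p, 2 * q⟩ (N - (1 + 1)) *
        (weightOne ⟨-N - p, 2 * q⟩ y * rr ⟨-N - p, 2 * q⟩ (N - 1) y) *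
        (lowerInt ⟨-N - p, 2 * q⟩ (N - (1 + 1)) x - oddEvenConst p q N) := by
  rw [kernelOne, oddEvenConst]
  by_cases he : Even N
  · have hc : ((N - 2 : ℕ) : ℝ) = N - 2 := by
      rw [Nat.cast_sub (by omega)]
      norm_num
    rw [if_pos he, if_pos he, kernelOneEven_eq _ N (by simp only [hc]; linarith)]
  · obtain ⟨i, hi⟩ : ∃ i, N = 2 * i + 3 := by
      obtain ⟨j, hj⟩ := Nat.not_even_iff_odd.1 he
      exact ⟨j - 1, by omega⟩
    have hNi : (N : ℝ) = 2 * i + 3 := by rw [hi]; push_cast; ring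
    have hi0 : (0 : ℝ) ≤ i := Nat.cast_nonneg i
    have hs : sTilde ⟨-N - p, 2 * q⟩ (2 * i + 2) ≠ 0 := by
      rw [show 2 * i + 2 = 2 * (i + 1) by ring,
        sTilde_even _ (i + 1) (by simp only; push_cast; linarith)]
      refine (mul_pos (sConst_pos _ ?_) (div_pos (Real.Gamma_pos_of_pos ?_)
        (Real.Gamma_pos_of_pos ?_))).ne'
      all_goals try simp only
      all_goals push_cast; linarith
    rw [if_neg he, if_neg he]
    generalize hc : (⟨-N - p, 2 * q⟩ : ℂ) = c at hs ⊢
    have hre : c.re = -N - p := by rw [← hc]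
    subst hi
    rw [kernelOneOdd_eq c i (by rw [hre]; linarith) hs]
    rfl

/-- The limit for Dyson index 1 at the shifted scale, for even and odd `N` together. -/
theorem uniformApprox_kernelOne (p q : ℝ) (hp : -1 < p) {δ : ℝ} (R : ℝ) (hδ : 0 < δ) :
    UniformApprox (box δ R)
      (fun N Z => ((scaled (kernelOne p q N) (N + p) Z.1 Z.2 : ℝ) : ℂ))
      fun Z => KOne p q Z.1 Z.2 := by
  have hr : 0 < p + (1 : ℕ) := by push_cast; linarith
  have hσ : UniformApprox (box δ R) (fun N _ => (((-1) ^ (N - (1 + 1)) *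
      ((N : ℝ) + p) ^ (p + (1 : ℕ) + 1) * oddEvenConst p q N : ℝ) : ℂ))
      fun _ => ((η₁ p q / 2 : ℝ) : ℂ) := by
    refine (uniformApprox_oddEvenConst (box δ R) p q hp).congr ⟨2, fun N hN Z _ => ?_⟩ fun _ _ => rfl
    obtain ⟨n, rfl⟩ : ∃ n, N = n + 2 := ⟨N - 2, by omega⟩
    rw [show n + 2 - (1 + 1) = n by omega, pow_add, show p + ((1 : ℕ) : ℝ) + 1 = p + 2 by
      push_cast; ring]
    norm_num
  have main := (uniformApprox_sqrt_mul_cdKernel p (2 * q) 1 (Or.inl hr) R hδ).add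
    (uniformApprox_rankOne p (2 * q) 1 hr R hδ hσ)
  refine main.congr ⟨3, fun N hN Z hZ => ?_⟩ fun Z hZ => ?_
  · rw [← Complex.ofReal_add, scaled, kernelOne_eq p q hp hN]
    congr 1
    ring
  · have e1 := inv_Gamma_mul_cauchyMass (p + 1) (2 * q) (by linarith)
    have e2 : ∀ s : ℝ, expEuler (p + (1 : ℕ) + 1) (2 * q) s =
        Complex.exp (-Complex.I * s) * C₀ p (2 * q) 2 s := fun s => by
      rw [← expEuler_eq p (2 * q) 2 (by push_cast; linarith)]
      push_cast
      ring_nf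
    have e3 : Jo p q (C₀ p (2 * q) 2) Z.1 = (Real.exp (-(2 * q) * π / 2) : ℝ) *
        ∫ s in (0 : ℝ)..Z.1, ((s ^ (p + (1 : ℕ)) : ℝ) : ℂ) * expEuler (p + (1 : ℕ) + 1) (2 * q) s := by
      rw [Jo, ← intervalIntegral.integral_const_mul]
      congr 1
      ext s
      rw [e2, sub_eq_add_neg, Complex.exp_add, Nat.cast_one]
      push_cast
      ring_nf
    have e4 : rankOneFactor p (2 * q) 1 Z = -(η₂ p q / Z.1 ^ 2 * Z.2 ^ (p + 2)) := by
      have h1 : (p : ℂ) + 2 - 2 * Complex.I * q = (p + 1 : ℝ) + 1 - Complex.I * (2 * q : ℝ) := by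
        push_cast; ring
      rw [rankOneFactor, η₂, h1]
      simp only [Nat.cast_one]
      rw [e1, show -(2 * q) * π / 2 = -q * π by ring, show p + 1 + 1 = p + 2 by ring,
        show 2 * (p + 1) + 2 = 2 * p + 4 by ring, show 2 * (p + 1) + 1 = 2 * p + 3 by ring,
        show 2 * (p + 1) = 2 * p + 2 by ring]
      ring
    rw [KOne, e4, expEuler_eq p (2 * q) 1 hr, e3]
    push_cast
    ring

/-- The limit for Dyson index 4 at the shifted scale. The polynomials have degree up to `2 N` and
the exponent is `-2 N - 2 p + i q`, so the results for Dyson index 2 and parameter `2 p` apply with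
`2 X`, `2 Y` in place of `X`, `Y`. -/
theorem uniformApprox_kernelFour (p q : ℝ) (h : 0 < p ∨ (p = 0 ∧ q = 0)) {δ : ℝ} (R : ℝ)
    (hδ : 0 < δ) :
    UniformApprox (box δ R)
      (fun N Z => ((scaled (kernelFour p q N) (N + p) Z.1 Z.2 : ℝ) : ℂ))
      fun Z => KFour p q Z.1 Z.2 := by
  have hp0 : 0 ≤ p := h.elim le_of_lt fun h' => h'.1.ge
  have hbox : ∀ Z ∈ box δ R, (2 * Z.1, 2 * Z.2) ∈ box (2 * δ) (2 * R) := fun Z hZ => by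
    refine ⟨by linarith [hZ.1], by linarith [hZ.2.1], by linarith [hZ.2.2.1],
      by linarith [hZ.2.2.2.1], ?_⟩
    rw [← mul_sub, abs_mul, abs_two]
    linarith [hZ.2.2.2.2]
  have hE : EulerParam (2 * p + (0 : ℕ)) q := by
    rcases h with h | ⟨h, h'⟩
    · exact Or.inl (by push_cast; linarith)
    · exact Or.inr ⟨by push_cast; linarith, h'⟩
  have hz : ∀ (N : ℕ) (X : ℝ), zScale (N + p) X = zScale ((2 * N : ℕ) + 2 * p) (2 * X) :=
    fun N X => by
      rw [zScale, zScale]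
      push_cast
      rw [← mul_add, mul_div_mul_left _ _ two_ne_zero]
  have hker : ∀ (N : ℕ), 1 ≤ N → ∀ X Y : ℝ,
      kernelFour p q N (zScale (N + p) X) (zScale (N + p) Y) =
      1 / 2 * (√((1 + zScale ((2 * N : ℕ) + 2 * p) (2 * X) ^ 2) /
        (1 + zScale ((2 * N : ℕ) + 2 * p) (2 * Y) ^ 2)) *
        cdKernel ⟨-(2 * N : ℕ) - 2 * p, q⟩ (2 * N - 0) (zScale ((2 * N : ℕ) + 2 * p) (2 * X))
          (zScale ((2 * N : ℕ) + 2 * p) (2 * Y)) +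
        gammaCoeff ⟨-(2 * N : ℕ) - 2 * p, q⟩ (2 * N - (0 + 1)) *
          (weightOne ⟨-(2 * N : ℕ) - 2 * p, q⟩ (zScale ((2 * N : ℕ) + 2 * p) (2 * Y)) *
            rr ⟨-(2 * N : ℕ) - 2 * p, q⟩ (2 * N - 0) (zScale ((2 * N : ℕ) + 2 * p) (2 * Y))) *
          (lowerInt ⟨-(2 * N : ℕ) - 2 * p, q⟩ (2 * N - (0 + 1))
            (zScale ((2 * N : ℕ) + 2 * p) (2 * X)) - 0)) := fun N hN X Y => by
    have hc : (⟨-2 * N - 2 * p, q⟩ : ℂ) = ⟨-(2 * N : ℕ) - 2 * p, q⟩ := by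
      congr 1
      push_cast
      ring
    rw [kernelFour, hc, kernelFourAux_eq _ N hN (by simp only; push_cast; linarith), hz, hz,
      sub_zero]
    rfl
  have hder : ∀ (N : ℕ) (X : ℝ), Real.sin (X / (N + p)) ≠ 0 →
      deriv (zScale (N + p)) X = 2 * deriv (zScale ((2 * N : ℕ) + 2 * p)) (2 * X) := fun N X hX => by
    have e : 2 * X / ((2 * N : ℕ) + 2 * p) = X / (N + p) := by
      push_cast
      rw [← mul_add, mul_div_mul_left _ _ two_ne_zero]
    rw [(deriv_zScale hX).deriv, (deriv_zScale (by rwa [e])).deriv, e]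
    push_cast
    rw [← mul_add, mul_assoc 2, mul_one_div, div_mul_cancel_left₀ two_ne_zero, one_div]
  have hsin : ∃ N₀ : ℕ, ∀ N ≥ N₀, 1 ≤ N ∧ ∀ Z ∈ box δ R, Real.sin (Z.1 / (N + p)) ≠ 0 := by
    obtain ⟨N₀, hN₀⟩ := exists_box_shift_bound p 1 R hδ
    refine ⟨N₀, fun N hN => ?_⟩
    obtain ⟨h1, hM, hb⟩ := hN₀ N hN
    exact ⟨h1, fun Z hZ => (Real.sin_pos_of_pos_of_lt_pi (div_pos (hb Z hZ).1.1 hM)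
      ((div_lt_iff₀ hM).2 (hb Z hZ).1.2)).ne'⟩
  obtain ⟨N₀, hN₀⟩ := hsin
  have hcd := ((uniformApprox_sqrt_mul_cdKernel (2 * p) q 0 hE (2 * R)
    (mul_pos two_pos hδ)).comp_two_mul).comp _ hbox
  -- For `p = 0` the coefficient `γ_{2N-1}` vanishes and with it the rank one term; the limit has
  -- the factor `p`.
  rcases hp0.eq_or_lt with rfl | hp
  · refine hcd.congr ⟨N₀, fun N hN Z hZ => ?_⟩ fun Z hZ => ?_
    · obtain ⟨h1, h2⟩ := hN₀ N hN
      have hγ : gammaCoeff ⟨-(2 * N : ℕ) - 2 * 0, q⟩ (2 * N - (0 + 1)) = 0 := by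
        have : ((2 * N - (0 + 1) : ℕ) : ℝ) = 2 * N - 1 := by
          rw [Nat.cast_sub (by omega)]
          push_cast
          ring
        rw [gammaCoeff, this]
        simp
      rw [scaled, hker N h1, hder N _ (h2 Z hZ), hγ]
      congr 1
      ring
    · simp only [KFour, Js₀, Js]
      push_cast
      rw [mul_div_mul_left _ _ (two_ne_zero : (2 : ℂ) ≠ 0)]
      simp
  · have hr : 0 < 2 * p + (0 : ℕ) := by push_cast; linarith
    have hrank := ((uniformApprox_rankOne (2 * p) q 0 hr (2 * R) (mul_pos two_pos hδ) (t := fun _ => 0)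
      (σ := 0) ((UniformApprox.const 0).congr ⟨0, fun N _ Z _ => by simp⟩
        fun _ _ => by simp)).comp_two_mul).comp _ hbox
    refine (hcd.add hrank).congr ⟨N₀, fun N hN Z hZ => ?_⟩ fun Z hZ => ?_
    · obtain ⟨h1, h2⟩ := hN₀ N hN
      rw [scaled, hker N h1, hder N _ (h2 Z hZ), ← Complex.ofReal_add]
      congr 1
      ring
    · have e1 := inv_Gamma_mul_cauchyMass (2 * p) q (by linarith)
      have e2 : ∀ s : ℝ, expEuler (2 * p + (0 : ℕ) + 1) q s =
          Complex.exp (-Complex.I * s) * C₀ (2 * p) q 1 s := fun s => by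
        rw [← expEuler_eq (2 * p) q 1 (by push_cast; linarith)]
        push_cast
        ring_nf
      have e3 : (∫ s in (0 : ℝ)..2 * Z.1, ((s ^ (2 * p + (0 : ℕ)) : ℝ) : ℂ) *
          expEuler (2 * p + (0 : ℕ) + 1) q s) =
          ((2 ^ (2 * p) * 2 : ℝ) : ℂ) * ∫ s in (0 : ℝ)..Z.1, Complex.exp (-2 * Complex.I * s) *
            ((s ^ (2 * p) : ℝ) : ℂ) * C₀ (2 * p) q 1 (2 * s) := by
        have hsub := intervalIntegral.smul_integral_comp_mul_left (E := ℂ) (a := 0) (b := Z.1)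
          (fun s : ℝ => ((s ^ (2 * p + (0 : ℕ)) : ℝ) : ℂ) * expEuler (2 * p + (0 : ℕ) + 1) q s) 2
        rw [mul_zero] at hsub
        rw [← hsub, Complex.real_smul, ← intervalIntegral.integral_const_mul,
          ← intervalIntegral.integral_const_mul]
        refine intervalIntegral.integral_congr fun s hs => ?_
        have hs0 : 0 ≤ s := by
          rw [Set.uIcc_of_le (hδ.trans_le hZ.1).le] at hs
          exact hs.1
        simp only [Nat.cast_zero, add_zero] at e2 ⊢
        rw [e2, Real.mul_rpow zero_le_two hs0]
        push_cast
        ring_nf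
      have h2 : (2 : ℝ) ^ (8 * p + 1) = (2 ^ (2 * p)) ^ 4 * 2 := by
        rw [Real.rpow_add_one two_ne_zero, ← Real.rpow_mul_natCast zero_le_two]
        congr 2
        push_cast
        ring
      have h3 : (2 : ℝ) ^ (2 * (2 * p)) = (2 ^ (2 * p)) ^ 2 := by
        rw [← Real.rpow_mul_natCast zero_le_two]
        congr 1
        push_cast
        ring
      have hY : 0 ≤ Z.2 := (hδ.trans_le hZ.2.2.1).le
      have h4 : (2 * Z.2) ^ (2 * p + 1) = 2 ^ (2 * p) * 2 * Z.2 ^ (2 * p + 1) := by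
        rw [Real.mul_rpow zero_le_two hY, Real.rpow_add_one two_ne_zero]
      have e4 : rankOneFactor (2 * p) q 0 (2 * Z.1, 2 * Z.2) * (2 ^ (2 * p) * 2) =
          p * (2 ^ (8 * p + 1) * ‖Complex.Gamma (2 * p + 1 - Complex.I * q)‖ ^ 2 /
            (π * Real.Gamma (4 * p + 1) * Real.Gamma (4 * p + 2))) * Real.exp (-q * π / 2) *
            (Z.2 ^ (2 * p + 1) / Z.1 ^ 2) := by
        rw [rankOneFactor]
        simp only [Nat.cast_zero, add_zero]
        rw [e1, h2, h3, h4, show 2 * (2 * p) + 2 = 4 * p + 2 by ring,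
          show 2 * (2 * p) + 1 = 4 * p + 1 by ring]
        push_cast
        ring
      have e4C := congrArg (fun t : ℝ => (t : ℂ)) e4
      have e5 : Complex.exp (-q * π - 2 * Complex.I * Z.2) = (Real.exp (-q * π / 2) : ℝ) *
          (Real.exp (-q * π / 2) : ℝ) * Complex.exp (-Complex.I * (2 * Z.2 : ℝ)) := by
        push_cast
        rw [← Complex.exp_add, ← Complex.exp_add]
        ring_nf
      have e6 : (∫ s in (0 : ℝ)..Z.1, Complex.exp (-2 * Complex.I * s) * ((s ^ (2 * p) : ℝ) : ℂ) *
          (C₀ (2 * p) q 0 (2 * Z.2) * C₀ (2 * p) q 1 (2 * s))) = C₀ (2 * p) q 0 (2 * Z.2) *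
          ∫ s in (0 : ℝ)..Z.1, Complex.exp (-2 * Complex.I * s) * ((s ^ (2 * p) : ℝ) : ℂ) *
            C₀ (2 * p) q 1 (2 * s) := by
        rw [← intervalIntegral.integral_const_mul]
        congr 1
        ext s
        ring
      simp only [Complex.ofReal_mul] at e4C
      rw [KFour, Js₀, Js, e3, expEuler_eq (2 * p) q 0 hr, e6, e5]
      generalize (∫ s in (0 : ℝ)..Z.1, Complex.exp (-2 * Complex.I * s) * ((s ^ (2 * p) : ℝ) : ℂ) *
        C₀ (2 * p) q 1 (2 * s)) = J
      generalize rankOneFactor (2 * p) q 0 (2 * Z.1, 2 * Z.2) = F at e4C ⊢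
      generalize Real.exp (-q * π / 2) = E at e4C ⊢
      generalize (2 : ℝ) ^ (2 * p) = w at e4C ⊢
      generalize Z.2 ^ (2 * p + 1) = y at e4C ⊢
      generalize 2 ^ (8 * p + 1) * ‖Complex.Gamma (2 * p + 1 - Complex.I * q)‖ ^ 2 /
        (π * Real.Gamma (4 * p + 1) * Real.Gamma (4 * p + 2)) = G at e4C ⊢
      push_cast at e4C ⊢
      rw [mul_div_mul_left _ _ (two_ne_zero : (2 : ℂ) ≠ 0)]
      linear_combination (E * Complex.exp (-Complex.I * (2 * Z.2)) * C₀ (2 * p) q 0 (2 * Z.2) * J) *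
        e4C

/-! ### From the shifted scaling to the unshifted one -/

/-- The domain `{X > 0, Y > 0, X ≠ Y}` of the limiting kernels. -/
def offDiagonal : Set (ℝ × ℝ) := {Z | 0 < Z.1 ∧ 0 < Z.2 ∧ Z.1 ≠ Z.2}

theorem isOpen_offDiagonal : IsOpen offDiagonal :=
  (isOpen_lt continuous_const continuous_fst).inter
    ((isOpen_lt continuous_const continuous_snd).inter (isOpen_ne_fun continuous_fst continuous_snd))

theorem box_subset_offDiagonal {δ : ℝ} (R : ℝ) (hδ : 0 < δ) : box δ R ⊆ offDiagonal := by
  intro Z hZ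
  refine ⟨hδ.trans_le hZ.1, hδ.trans_le hZ.2.2.1, fun h => ?_⟩
  have := hZ.2.2.2.2
  rw [h, sub_self, abs_zero] at this
  linarith

theorem smul_mem_box {δ R t : ℝ} (hδ : 0 < δ) (ht : 1 / 2 ≤ t) (ht' : t ≤ 2) {Z : ℝ × ℝ}
    (hZ : Z ∈ box δ R) : t • Z ∈ box (δ / 2) (2 * R) := by
  obtain ⟨h1, h2, h3, h4, h5⟩ := hZ
  refine ⟨?_, ?_, ?_, ?_, ?_⟩
  any_goals simp only [Prod.smul_fst, Prod.smul_snd, smul_eq_mul]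
  · nlinarith
  · nlinarith
  · nlinarith
  · nlinarith
  · rw [← mul_sub, abs_mul, abs_of_nonneg (by linarith)]
    nlinarith

/-- Taylor's theorem to second order for `t ↦ t K(t X, t Y)` at `t = 1`, uniformly on boxes. -/
theorem exists_dilation_bound {F : ℝ × ℝ → ℂ} (hF : ContDiffOn ℝ 2 F offDiagonal) {δ : ℝ} (R : ℝ)
    (hδ : 0 < δ) : ∃ B : ℝ, 0 ≤ B ∧ ∀ ε : ℝ, |ε| ≤ 1 / 2 → ∀ Z ∈ box δ R,
      ‖((1 + ε : ℝ) : ℂ) * F ((1 + ε) • Z) - F Z - ε * (fderiv ℝ F Z Z + F Z)‖ ≤ B * ε ^ 2 := by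
  set E : ℝ × ℝ → ℂ := fun W => fderiv ℝ F W W + F W
  have hE : ContDiffOn ℝ 1 E offDiagonal :=
    ((hF.fderiv_of_isOpen isOpen_offDiagonal (m := 1) (by norm_num)).clm_apply contDiffOn_id).add
      (hF.of_le (by norm_num))
  have hE' : ContinuousOn (fderiv ℝ E) offDiagonal :=
    hE.continuousOn_fderiv_of_isOpen isOpen_offDiagonal le_rfl
  have hsub := box_subset_offDiagonal (2 * R) (half_pos hδ)
  obtain ⟨M, hM⟩ := (isCompact_box (δ / 2) (2 * R)).exists_bound_of_continuousOn (hE'.mono hsub)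
  obtain ⟨D, hD⟩ := (isCompact_box δ R).exists_bound_of_continuousOn (f := id) continuousOn_id
  refine ⟨max M 0 * max D 0, by positivity, fun ε hε Z hZ => ?_⟩
  have hmem : ∀ t ∈ Set.Icc (-|ε|) |ε|, (1 + t) • Z ∈ offDiagonal ∧
      (1 + t) • Z ∈ box (δ / 2) (2 * R) := fun t ht => by
    have := smul_mem_box hδ (t := 1 + t) (by linarith [ht.1]) (by linarith [ht.2]) hZ
    exact ⟨hsub this, this⟩
  have hline : ∀ t : ℝ, HasDerivAt (fun t : ℝ => (1 + t) • Z) Z t := fun t => by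
    simpa using ((hasDerivAt_id t).const_add 1).smul_const Z
  have hd1 : ∀ t ∈ Set.Icc (-|ε|) |ε|,
      HasDerivAt (fun t : ℝ => ((1 + t : ℝ) : ℂ) * F ((1 + t) • Z)) (E ((1 + t) • Z)) t := by
    intro t ht
    have hFd := ((hF.differentiableOn (by norm_num)).differentiableAt
      (isOpen_offDiagonal.mem_nhds (hmem t ht).1)).hasFDerivAt.comp_hasDerivAt t (hline t)
    have h1 : HasDerivAt (fun t : ℝ => ((1 + t : ℝ) : ℂ)) 1 t := by
      simpa using ((hasDerivAt_id t).const_add 1).ofReal_comp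
    refine (h1.mul hFd).congr_deriv ?_
    simp only [E, map_smul, Complex.real_smul, Function.comp]
    ring
  have hd2 : ∀ t ∈ Set.Icc (-|ε|) |ε|,
      HasDerivAt (fun t : ℝ => E ((1 + t) • Z)) (fderiv ℝ E ((1 + t) • Z) Z) t := fun t ht =>
    ((hE.differentiableOn (by norm_num)).differentiableAt
      (isOpen_offDiagonal.mem_nhds (hmem t ht).1)).hasFDerivAt.comp_hasDerivAt t (hline t)
  have h0 : (0 : ℝ) ∈ Set.Icc (-|ε|) |ε| := ⟨by simp, abs_nonneg _⟩
  have hεm : ε ∈ Set.Icc (-|ε|) |ε| := ⟨neg_abs_le _, le_abs_self _⟩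
  have hb2 : ∀ t ∈ Set.Icc (-|ε|) |ε|, ‖fderiv ℝ E ((1 + t) • Z) Z‖ ≤ max M 0 * max D 0 :=
    fun t ht => (ContinuousLinearMap.le_opNorm _ _).trans (by
      gcongr
      · exact (hM _ (hmem t ht).2).trans (le_max_left _ _)
      · exact (hD Z hZ).trans (le_max_left _ _))
  have hb1 : ∀ t ∈ Set.Icc (-|ε|) |ε|, ‖E ((1 + t) • Z) - E Z‖ ≤ max M 0 * max D 0 * |ε| := by
    intro t ht
    have h := (convex_Icc (-|ε|) |ε|).norm_image_sub_le_of_norm_hasDerivWithin_le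
      (fun t ht => (hd2 t ht).hasDerivWithinAt) hb2 h0 ht
    simp only [add_zero, one_smul, sub_zero, Real.norm_eq_abs] at h
    exact h.trans (mul_le_mul_of_nonneg_left (abs_le.2 ht) (by positivity))
  have h := (convex_Icc (-|ε|) |ε|).norm_image_sub_le_of_norm_hasDerivWithin_le
    (f := fun t : ℝ => ((1 + t : ℝ) : ℂ) * F ((1 + t) • Z) - t * E Z)
    (f' := fun t : ℝ => E ((1 + t) • Z) - E Z)
    (fun t ht => ((hd1 t ht).sub (by
      simpa using (hasDerivAt_id t).ofReal_comp.mul_const (E Z))).hasDerivWithinAt) hb1 h0 hεm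
  simp only [add_zero, one_smul, sub_zero, Real.norm_eq_abs, Complex.ofReal_one, one_mul,
    Complex.ofReal_zero, zero_mul, mul_assoc, abs_mul_abs_self] at h
  rw [pow_two, sub_right_comm, mul_assoc]
  exact h

theorem scaled_eq_scaled_shift (S : ℝ → ℝ → ℝ) {M p : ℝ} (hM : M ≠ 0) (hMp : M + p ≠ 0) (X Y : ℝ) :
    scaled S M X Y = (1 + p / M) * scaled S (M + p) ((1 + p / M) * X) ((1 + p / M) * Y) := by
  have e : ∀ X, zScale M X = zScale (M + p) ((1 + p / M) * X) := fun X => by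
    rw [zScale, zScale]
    congr 2
    field_simp
  have e' : deriv (zScale M) X = (1 + p / M) * deriv (zScale (M + p)) ((1 + p / M) * X) := by
    rw [funext e, deriv_comp_mul_left, smul_eq_mul]
  rw [scaled, scaled, e', e, e]
  ring

theorem IsDerivCorrection.eq_fderiv {p : ℝ} {K L : ℝ → ℝ → ℂ} (h : IsDerivCorrection p K L)
    {Z : ℝ × ℝ} (hZ : Z ∈ offDiagonal) :
    L Z.1 Z.2 = p * (fderiv ℝ (fun W : ℝ × ℝ => K W.1 W.2) Z Z + K Z.1 Z.2) := by
  obtain ⟨X, Y⟩ := Z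
  obtain ⟨hd, hL⟩ := h X Y hZ.1 hZ.2.1 hZ.2.2
  have h1 := hd.hasFDerivAt.comp_hasDerivAt X ((hasDerivAt_id X).prodMk (hasDerivAt_const X Y))
  have h2 := hd.hasFDerivAt.comp_hasDerivAt Y ((hasDerivAt_const Y X).prodMk (hasDerivAt_id Y))
  have e : ((X, Y) : ℝ × ℝ) = X • (1, 0) + Y • (0, 1) := by simp
  have h3 : fderiv ℝ (fun W : ℝ × ℝ => K W.1 W.2) (X, Y) (X, Y) =
      X * fderiv ℝ (fun W : ℝ × ℝ => K W.1 W.2) (X, Y) (1, 0) +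
        Y * fderiv ℝ (fun W : ℝ × ℝ => K W.1 W.2) (X, Y) (0, 1) := by
    conv_lhs => rw [e, map_add, map_smul, map_smul, Complex.real_smul, Complex.real_smul, ← e]
  rw [hL, h3]
  congr 3
  · congr 1
    exact h1.deriv
  · congr 1
    exact h2.deriv

/-- An expansion in the variable `X / (N + p)` without a term of order `1 / N` gives an expansion
in the variable `X / N`, since passing from one to the other is a dilation by `1 + p / N`. -/
theorem isOInvSq_unshifted {S : ℕ → ℝ → ℝ → ℝ} {p : ℝ} {K L : ℝ → ℝ → ℂ}
    (hK : ContDiffOn ℝ 2 (fun Z : ℝ × ℝ => K Z.1 Z.2) offDiagonal) (hL : IsDerivCorrection p K L)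
    (h : ∀ δ R : ℝ, 0 < δ → UniformApprox (box δ R)
      (fun N Z => ((scaled (S N) (N + p) Z.1 Z.2 : ℝ) : ℂ)) fun Z => K Z.1 Z.2) :
    IsOInvSq fun N X Y => scaled (S N) N X Y - (K X Y + 1 / (N : ℂ) * L X Y) := by
  intro T hT hT'
  obtain ⟨δ, R, hδ, hsub⟩ := exists_subset_box hT hT'
  obtain ⟨-, B, N₀, hB⟩ := h (δ / 2) (2 * R) (half_pos hδ)
  obtain ⟨B', hB'0, hB'⟩ := exists_dilation_bound hK R hδ
  have hB0 : (0 : ℝ) ≤ |B| := abs_nonneg B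
  refine ⟨2 * |B| + B' * p ^ 2, max N₀ (⌈2 * |p|⌉₊ + 1), fun N hN Z hZ => ?_⟩
  have hN1 : N₀ ≤ N := (le_max_left _ _).trans hN
  have hN2 : 2 * |p| < N := (Nat.le_ceil _).trans_lt (by
    exact_mod_cast (Nat.lt_succ_self _).trans_le ((le_max_right _ _).trans hN))
  have hNpos : (0 : ℝ) < N := lt_of_le_of_lt (by positivity) hN2
  have hε : |p / N| ≤ 1 / 2 := by
    rw [abs_div, abs_of_pos hNpos, div_le_iff₀ hNpos]
    linarith
  obtain ⟨hε1, hε2⟩ := abs_le.1 hε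
  have hNp : (N : ℝ) + p ≠ 0 := by
    have := neg_abs_le p
    have := abs_nonneg p
    linarith
  have hZb := hsub hZ
  have hT1 := hB' (p / N) hε Z hZb
  have hS := hB N hN1 _ (smul_mem_box hδ (t := 1 + p / N) (by linarith) (by linarith) hZb)
  simp only [Prod.smul_fst, Prod.smul_snd, smul_eq_mul] at hS hT1
  beta_reduce
  rw [scaled_eq_scaled_shift _ hNpos.ne' hNp, hL.eq_fderiv (box_subset_offDiagonal R hδ hZb)]
  set s := scaled (S N) (N + p) ((1 + p / N) * Z.1) ((1 + p / N) * Z.2)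
  set k := K ((1 + p / N) * Z.1) ((1 + p / N) * Z.2)
  set d := fderiv ℝ (fun W : ℝ × ℝ => K W.1 W.2) Z Z
  have e : (((1 + p / N) * s : ℝ) : ℂ) - (K Z.1 Z.2 + 1 / (N : ℂ) * (p * (d + K Z.1 Z.2))) =
      ((1 + p / N : ℝ) : ℂ) * (s - k) +
        (((1 + p / N : ℝ) : ℂ) * k - K Z.1 Z.2 - ((p / N : ℝ) : ℂ) * (d + K Z.1 Z.2)) := by
    push_cast
    ring
  rw [e]
  refine (norm_add_le _ _).trans ?_
  rw [norm_mul, Complex.norm_real, Real.norm_of_nonneg (by linarith), add_div]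
  refine add_le_add ?_ (hT1.trans_eq ?_)
  · calc (1 + p / N) * ‖(s : ℂ) - k‖ ≤ 2 * (|B| / (N : ℝ) ^ 2) := by
          gcongr
          · linarith
          · exact hS.trans (by gcongr; exact le_abs_self B)
      _ = _ := by ring
  · rw [div_pow]
    ring

/-! ### Smoothness of the limiting kernels and their derivatives along dilations -/

/-- The correction is determined by the derivative of the kernel along the dilations
`t ↦ (t X, t Y)`. -/
theorem isDerivCorrection_of_dilation {p : ℝ} {K L D : ℝ → ℝ → ℂ}
    (hK : ContDiffOn ℝ 2 (fun Z : ℝ × ℝ => K Z.1 Z.2) offDiagonal)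
    (hD : ∀ X Y, (X, Y) ∈ offDiagonal → HasDerivAt (fun t : ℝ => K (t * X) (t * Y)) (D X Y) 1)
    (hL : ∀ X Y, (X, Y) ∈ offDiagonal → L X Y = p * (D X Y + K X Y)) :
    IsDerivCorrection p K L := by
  intro X Y hX hY hXY
  have hm : (X, Y) ∈ offDiagonal := ⟨hX, hY, hXY⟩
  have hd := (hK.differentiableOn (by norm_num)).differentiableAt (isOpen_offDiagonal.mem_nhds hm)
  refine ⟨hd, ?_⟩
  have h1 := hd.hasFDerivAt.comp_hasDerivAt X ((hasDerivAt_id X).prodMk (hasDerivAt_const X Y))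
  have h2 := hd.hasFDerivAt.comp_hasDerivAt Y ((hasDerivAt_const Y X).prodMk (hasDerivAt_id Y))
  have e1 : deriv (fun x => K x Y) X = _ := h1.deriv
  have e2 : deriv (fun y => K X y) Y = _ := h2.deriv
  have h3 : HasDerivAt (fun t : ℝ => K (t * X) (t * Y))
      (fderiv ℝ (fun W : ℝ × ℝ => K W.1 W.2) (X, Y) (X, Y)) 1 := by
    have hl : HasDerivAt (fun t : ℝ => ((t * X, t * Y) : ℝ × ℝ)) (X, Y) 1 := by
      simpa using ((hasDerivAt_id (1 : ℝ)).mul_const X).prodMk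
        ((hasDerivAt_id (1 : ℝ)).mul_const Y)
    refine HasFDerivAt.comp_hasDerivAt (f := fun t : ℝ => ((t * X, t * Y) : ℝ × ℝ))
      (l := fun W : ℝ × ℝ => K W.1 W.2) 1 ?_ hl
    simpa using hd.hasFDerivAt
  have e : ((X, Y) : ℝ × ℝ) = X • (1, 0) + Y • (0, 1) := by simp
  have h4 : fderiv ℝ (fun W : ℝ × ℝ => K W.1 W.2) (X, Y) (X, Y) =
      X * fderiv ℝ (fun W : ℝ × ℝ => K W.1 W.2) (X, Y) (1, 0) +
        Y * fderiv ℝ (fun W : ℝ × ℝ => K W.1 W.2) (X, Y) (0, 1) := by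
    conv_lhs => rw [e, map_add, map_smul, map_smul, Complex.real_smul, Complex.real_smul, ← e]
  rw [hL X Y hm, e1, e2, ← h4, (hD X Y hm).unique h3]

theorem contDiffOn_prefactorTwo (p q : ℝ) (k : ℕ) :
    ContDiffOn ℝ 2 (fun Z : ℝ × ℝ => prefactorTwo p q k Z.1 Z.2) offDiagonal := by
  intro Z hZ
  refine ContDiffAt.contDiffWithinAt ?_
  have hr : ContDiffAt ℝ 2 (fun Z : ℝ × ℝ =>
      (Z.1 * Z.2) ^ (p + k + 1) / (Z.1 ^ 2 * (Z.1 - Z.2))) Z := by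
    refine ContDiffAt.div ?_ (by fun_prop) ?_
    · exact (contDiffAt_fst.mul contDiffAt_snd).rpow_const_of_ne (mul_pos hZ.1 hZ.2.1).ne'
    · exact mul_ne_zero (pow_ne_zero _ hZ.1.ne') (sub_ne_zero.2 hZ.2.2)
  have h1 : ContDiffAt ℝ 2 (fun Z : ℝ × ℝ => (Z.1 : ℂ)) Z :=
    Complex.ofRealCLM.contDiff.contDiffAt.comp Z contDiffAt_fst
  have h2 : ContDiffAt ℝ 2 (fun Z : ℝ × ℝ => (Z.2 : ℂ)) Z :=
    Complex.ofRealCLM.contDiff.contDiffAt.comp Z contDiffAt_snd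
  have he : ContDiffAt ℝ 2 (fun Z : ℝ × ℝ =>
      Complex.exp (-Complex.I * (Z.1 + Z.2) - q * π)) Z :=
    ((contDiffAt_const.mul (h1.add h2)).sub contDiffAt_const).cexp
  exact (contDiffAt_const.mul he).mul (Complex.ofRealCLM.contDiff.contDiffAt.comp Z hr)

theorem contDiffOn_KTwo (p q : ℝ) (k : ℕ) (h : EulerParam (p + k) q) :
    ContDiffOn ℝ 2 (fun Z : ℝ × ℝ => KTwo p q k Z.1 Z.2) offDiagonal := by
  have hk : 0 < p + (k + 1 : ℕ) := by
    have := h.elim le_of_lt fun h' => h'.1.ge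
    push_cast
    linarith
  have hc := contDiff_C₀ p q k h (n := 2)
  have hc' := contDiff_C₀_of_pos p q (k + 1) hk (n := 2)
  refine (contDiffOn_prefactorTwo p q k).mul (ContDiff.contDiffOn ?_)
  have h1 : ContDiff ℝ 2 (fun Z : ℝ × ℝ => (Z.1 : ℂ)) := Complex.ofRealCLM.contDiff.comp contDiff_fst
  have h2 : ContDiff ℝ 2 (fun Z : ℝ × ℝ => (Z.2 : ℂ)) := Complex.ofRealCLM.contDiff.comp contDiff_snd
  exact ((h1.mul (hc'.comp contDiff_fst)).mul (hc.comp contDiff_snd)).sub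
    ((h2.mul (hc'.comp contDiff_snd)).mul (hc.comp contDiff_fst))

theorem hasDerivAt_comp_dilation {f : ℝ → ℂ} {X : ℝ} (hf : DifferentiableAt ℝ f X) :
    HasDerivAt (fun t : ℝ => f (t * X)) (X * deriv f X) 1 := by
  have h1 : HasDerivAt (fun t : ℝ => t * X) X 1 := by
    simpa using (hasDerivAt_id (1 : ℝ)).mul_const X
  have h2 : HasDerivAt f (deriv f X) (1 * X) := by simpa using hf.hasDerivAt
  rw [← Complex.real_smul]
  exact h2.scomp 1 h1

theorem hasDerivAt_ofReal_dilation (X : ℝ) : HasDerivAt (fun t : ℝ => ((t * X : ℝ) : ℂ)) X 1 := by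
  have h1 : HasDerivAt (fun t : ℝ => t * X) X 1 := by
    simpa using (hasDerivAt_id (1 : ℝ)).mul_const X
  exact h1.ofReal_comp

theorem hasDerivAt_rpow_dilation (a : ℝ) {X : ℝ} (hX : 0 < X) :
    HasDerivAt (fun t : ℝ => (((t * X) ^ a : ℝ) : ℂ)) (a * ((X ^ a : ℝ) : ℂ)) 1 := by
  have h1 : HasDerivAt (fun t : ℝ => t * X) X 1 := by
    simpa using (hasDerivAt_id (1 : ℝ)).mul_const X
  have h2 := (h1.rpow_const (p := a) (Or.inl (by simpa using hX.ne'))).ofReal_comp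
  refine h2.congr_deriv ?_
  have hX' : (X : ℂ) ≠ 0 := by exact_mod_cast hX.ne'
  rw [one_mul, Real.rpow_sub_one hX.ne']
  push_cast
  field_simp

theorem hasDerivAt_prefactorTwo (p q : ℝ) (k : ℕ) {X Y : ℝ} (h : (X, Y) ∈ offDiagonal) :
    HasDerivAt (fun t : ℝ => prefactorTwo p q k (t * X) (t * Y))
      (prefactorTwo p q k X Y * (2 * (p + k) - 1 - Complex.I * (X + Y))) 1 := by
  obtain ⟨hX, hY, hXY⟩ := h
  simp only at hX hY hXY
  have hXY' : X - Y ≠ 0 := sub_ne_zero.2 hXY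
  have h1 : ∀ X : ℝ, HasDerivAt (fun t : ℝ => t * X) X 1 := fun X => by
    simpa using (hasDerivAt_id (1 : ℝ)).mul_const X
  have hnum := ((h1 X).mul (h1 Y)).rpow_const (p := p + k + 1)
    (Or.inl (by simpa using ⟨hX.ne', hY.ne'⟩))
  have hden := ((h1 X).pow 2).mul ((h1 X).sub (h1 Y))
  have hr := (hnum.div hden (by simpa using ⟨hX.ne', hXY'⟩)).ofReal_comp
  have he := ((((hasDerivAt_ofReal_dilation X).add
    (hasDerivAt_ofReal_dilation Y)).const_mul (-Complex.I)).sub_const ((q : ℂ) * π)).cexp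
  have key := (he.const_mul ((2 ^ (2 * (p + k)) * ‖Complex.Gamma (p + k + 1 - Complex.I * q)‖ ^ 2 /
      (π * Real.Gamma (2 * p + 2 * k + 2) * Real.Gamma (2 * p + 2 * k + 1)) : ℝ) : ℂ)).mul hr
  refine key.congr_deriv ?_
  simp only [prefactorTwo, one_mul, Pi.add_apply, Pi.mul_apply, Pi.sub_apply, Pi.pow_apply,
    Pi.div_apply]
  rw [Real.rpow_sub_one (mul_pos hX hY).ne']
  have hX' : (X : ℂ) ≠ 0 := by exact_mod_cast hX.ne'
  have hY' : (Y : ℂ) ≠ 0 := by exact_mod_cast hY.ne'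
  have hXYc : (X : ℂ) - Y ≠ 0 := by exact_mod_cast hXY'
  generalize ((2 ^ (2 * (p + k)) * ‖Complex.Gamma (p + k + 1 - Complex.I * q)‖ ^ 2 /
      (π * Real.Gamma (2 * p + 2 * k + 2) * Real.Gamma (2 * p + 2 * k + 1)) : ℝ)) = A
  generalize Complex.exp (-Complex.I * (X + Y) - q * π) = B
  generalize (X * Y) ^ (p + k + 1) = E
  push_cast
  field_simp
  ring

/-- The derivative of `K̂_{∞,2}` along dilations, in terms of `L̂_{1,2}`. -/
theorem exists_hasDerivAt_KTwo (p q : ℝ) (k : ℕ) (h : EulerParam (p + k) q)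
    (hk : k = 0 ∨ 0 < p + k) {X Y : ℝ} (hXY : (X, Y) ∈ offDiagonal) :
    ∃ D : ℂ, HasDerivAt (fun t : ℝ => KTwo p q k (t * X) (t * Y)) D 1 ∧
      LTwo p q k X Y = p * (D + KTwo p q k X Y) := by
  have hk' : 0 < p + (k + 1 : ℕ) := by
    have := h.elim le_of_lt fun h' => h'.1.ge
    push_cast
    linarith
  have hc : ∀ X, HasDerivAt (fun t : ℝ => C₀ p q k (t * X)) (X * deriv (C₀ p q k) X) 1 := fun X =>
    hasDerivAt_comp_dilation ((contDiff_C₀ p q k h (n := 1)).differentiable (by norm_num) X)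
  have hc' : ∀ X, HasDerivAt (fun t : ℝ => C₀ p q (k + 1) (t * X))
      (X * deriv (C₀ p q (k + 1)) X) 1 := fun X =>
    hasDerivAt_comp_dilation
      ((contDiff_C₀_of_pos p q (k + 1) hk' (n := 1)).differentiable (by norm_num) X)
  have hJ := (((hasDerivAt_ofReal_dilation X).mul (hc' X)).mul (hc Y)).sub
    (((hasDerivAt_ofReal_dilation Y).mul (hc' Y)).mul (hc X))
  refine ⟨_, (hasDerivAt_prefactorTwo p q k hXY).mul hJ, ?_⟩
  simp only [LTwo, KTwo, J₁, J₀, one_mul, C₁_eq p q k h hk,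
    C₁_eq p q (k + 1) (Or.inl hk') (Or.inr hk'), Pi.mul_apply]
  ring

theorem isDerivCorrection_KTwo (p q : ℝ) (h : 0 < p ∨ (p = 0 ∧ q = 0)) :
    IsDerivCorrection p (KTwo p q 0) (LTwo p q 0) := by
  have hE : EulerParam (p + (0 : ℕ)) q := by simpa [EulerParam] using h
  choose! D hD using fun (X Y : ℝ) (hm : (X, Y) ∈ offDiagonal) =>
    exists_hasDerivAt_KTwo p q 0 hE (Or.inl rfl) hm
  exact isDerivCorrection_of_dilation (contDiffOn_KTwo p q 0 hE) (fun X Y hm => (hD X Y hm).1)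
    fun X Y hm => (hD X Y hm).2

/-! ### Primitives with a power weight -/

/-- The primitive `∫_0^X s ^ a f(s) ds`. -/
def powPrimitive (a : ℝ) (f : ℝ → ℂ) (X : ℝ) : ℂ := ∫ s in (0 : ℝ)..X, ((s ^ a : ℝ) : ℂ) * f s

theorem intervalIntegrable_rpow_mul_continuous {a : ℝ} (ha : -1 < a) {f : ℝ → ℂ} (hf : Continuous f)
    (X : ℝ) : IntervalIntegrable (fun s => ((s ^ a : ℝ) : ℂ) * f s) volume 0 X := by
  have h0 : IntervalIntegrable (fun s : ℝ => s ^ a) volume 0 X :=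
    intervalIntegral.intervalIntegrable_rpow' ha
  have h1 : IntervalIntegrable (fun s : ℝ => ((s ^ a : ℝ) : ℂ)) volume 0 X :=
    ⟨h0.1.ofReal, h0.2.ofReal⟩
  exact h1.mul_continuousOn hf.continuousOn

theorem hasDerivAt_powPrimitive {a : ℝ} (ha : -1 < a) {f : ℝ → ℂ} (hf : Continuous f) {X : ℝ}
    (hX : 0 < X) : HasDerivAt (powPrimitive a f) (((X ^ a : ℝ) : ℂ) * f X) X := by
  have hc : ContinuousOn (fun s : ℝ => ((s ^ a : ℝ) : ℂ) * f s) (Set.Ioi 0) := fun s hs =>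
    ((Complex.continuous_ofReal.continuousAt.comp
      (Real.continuousAt_rpow_const s a (Or.inl (ne_of_gt hs)))).mul
        hf.continuousAt).continuousWithinAt
  exact intervalIntegral.integral_hasDerivAt_right (intervalIntegrable_rpow_mul_continuous ha hf X)
    (hc.stronglyMeasurableAtFilter isOpen_Ioi X hX) (hc.continuousAt (Ioi_mem_nhds hX))

theorem contDiffOn_powPrimitive {a : ℝ} (ha : -1 < a) {f : ℝ → ℂ} (hf : ContDiff ℝ 1 f) :
    ContDiffOn ℝ 2 (powPrimitive a f) (Set.Ioi 0) := by
  rw [show (2 : WithTop ℕ∞) = 1 + 1 by norm_num, contDiffOn_succ_iff_deriv_of_isOpen isOpen_Ioi]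
  refine ⟨fun X hX => (hasDerivAt_powPrimitive ha hf.continuous hX).differentiableAt.differentiableWithinAt,
    by simp, ?_⟩
  have h : ContDiffOn ℝ 1 (fun s : ℝ => ((s ^ a : ℝ) : ℂ) * f s) (Set.Ioi 0) := fun s hs =>
    ((Complex.ofRealCLM.contDiff.contDiffAt.comp s
      (contDiffAt_id.rpow_const_of_ne (ne_of_gt hs))).mul hf.contDiffAt).contDiffWithinAt
  exact h.congr fun X hX => (hasDerivAt_powPrimitive ha hf.continuous hX).deriv

/-- Integration by parts. -/
theorem powPrimitive_mul_deriv {a : ℝ} (ha : -1 < a) {f : ℝ → ℂ} (hf : ContDiff ℝ 1 f) {X : ℝ}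
    (hX : 0 < X) : powPrimitive a (fun s => s * deriv f s) X =
      ((X ^ (a + 1) : ℝ) : ℂ) * f X - (a + 1) * powPrimitive a f X := by
  have hf' : Continuous (deriv f) := hf.continuous_deriv le_rfl
  have hi := (intervalIntegrable_rpow_mul_continuous ha hf.continuous X).const_mul ((a : ℂ) + 1)
  have hi' := intervalIntegrable_rpow_mul_continuous ha (f := fun s : ℝ => (s : ℂ) * deriv f s)
    (by fun_prop) X
  have ha1 : a + 1 ≠ 0 := by linarith
  have h := intervalIntegral.integral_eq_sub_of_hasDerivAt_of_le hX.le
    (f := fun s : ℝ => ((s ^ (a + 1) : ℝ) : ℂ) * f s)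
    (f' := fun s : ℝ => (a + 1) * (((s ^ a : ℝ) : ℂ) * f s) + ((s ^ a : ℝ) : ℂ) * (s * deriv f s))
    ?_ ?_ (hi.add hi')
  · rw [intervalIntegral.integral_add hi hi', intervalIntegral.integral_const_mul,
      Real.zero_rpow ha1, Complex.ofReal_zero, zero_mul, sub_zero] at h
    rw [powPrimitive, powPrimitive, ← h]
    ring
  · exact ((Complex.continuous_ofReal.comp
      (Real.continuous_rpow_const (by linarith))).mul hf.continuous).continuousOn
  · intro s hs
    have h1 := (Real.hasDerivAt_rpow_const (x := s) (p := a + 1) (Or.inl hs.1.ne')).ofReal_comp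
    refine (h1.mul (hf.differentiable (by norm_num) s).hasDerivAt).congr_deriv ?_
    rw [add_sub_cancel_right, Real.rpow_add_one hs.1.ne']
    push_cast
    ring

/-! ### The corrections for Dyson indices 1 and 4 -/

theorem contDiffOn_ofReal_comp {f : ℝ × ℝ → ℝ} {n : WithTop ℕ∞} {s : Set (ℝ × ℝ)}
    (hf : ContDiffOn ℝ n f s) : ContDiffOn ℝ n (fun Z => (f Z : ℂ)) s :=
  Complex.ofRealCLM.contDiff.comp_contDiffOn hf

theorem contDiffOn_ofReal_fst : ContDiffOn ℝ 2 (fun Z : ℝ × ℝ => (Z.1 : ℂ)) offDiagonal :=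
  contDiffOn_ofReal_comp contDiffOn_fst

theorem contDiffOn_ofReal_snd : ContDiffOn ℝ 2 (fun Z : ℝ × ℝ => (Z.2 : ℂ)) offDiagonal :=
  contDiffOn_ofReal_comp contDiffOn_snd

theorem ofReal_fst_ne_zero {Z : ℝ × ℝ} (hZ : Z ∈ offDiagonal) : (Z.1 : ℂ) ≠ 0 := by
  exact_mod_cast hZ.1.ne'

theorem contDiffOn_div_ofReal : ContDiffOn ℝ 2 (fun Z : ℝ × ℝ => (Z.2 : ℂ) / Z.1) offDiagonal := by
  simp_rw [div_eq_mul_inv]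
  exact contDiffOn_ofReal_snd.mul (contDiffOn_ofReal_fst.inv fun Z hZ => ofReal_fst_ne_zero hZ)

theorem contDiffOn_const_div_sq (A : ℂ) :
    ContDiffOn ℝ 2 (fun Z : ℝ × ℝ => A / (Z.1 : ℂ) ^ 2) offDiagonal := by
  simp_rw [div_eq_mul_inv]
  exact contDiffOn_const.mul ((contDiffOn_ofReal_fst.pow 2).inv fun _ hZ =>
    pow_ne_zero _ (ofReal_fst_ne_zero hZ))

theorem contDiffOn_rpow_snd (a : ℝ) :
    ContDiffOn ℝ 2 (fun Z : ℝ × ℝ => ((Z.2 ^ a : ℝ) : ℂ)) offDiagonal :=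
  contDiffOn_ofReal_comp (contDiffOn_snd.rpow_const_of_ne fun _ hZ => hZ.2.1.ne')

theorem hasDerivAt_const_div_sq_dilation (A : ℂ) {X : ℝ} (hX : 0 < X) :
    HasDerivAt (fun t : ℝ => A / ((t * X : ℝ) : ℂ) ^ 2) (-2 * (A / (X : ℂ) ^ 2)) 1 := by
  have hX' : (X : ℂ) ≠ 0 := by exact_mod_cast hX.ne'
  have h := ((hasDerivAt_const (1 : ℝ) A).div ((hasDerivAt_ofReal_dilation X).pow 2)
    (by simpa using hX.ne'))
  refine h.congr_deriv ?_
  simp only [Pi.pow_apply, one_mul]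
  push_cast
  field_simp
  ring

theorem div_dilation (X Y : ℝ) :
    (fun t : ℝ => ((t * Y : ℝ) : ℂ) / ((t * X : ℝ) : ℂ)) =ᶠ[nhds 1] fun _ => (Y : ℂ) / X := by
  filter_upwards [eventually_ne_nhds (one_ne_zero (α := ℝ))] with t ht
  have : (t : ℂ) ≠ 0 := by exact_mod_cast ht
  push_cast
  rw [mul_div_mul_left _ _ this]

theorem hasDerivAt_powPrimitive_dilation {a : ℝ} (ha : -1 < a) {f : ℝ → ℂ} (hf : Continuous f)
    {X : ℝ} (hX : 0 < X) :
    HasDerivAt (fun t : ℝ => powPrimitive a f (t * X)) (((X ^ (a + 1) : ℝ) : ℂ) * f X) 1 := by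
  have h := hasDerivAt_powPrimitive ha hf hX
  refine (hasDerivAt_comp_dilation h.differentiableAt).congr_deriv ?_
  rw [h.deriv, Real.rpow_add_one hX.ne']
  push_cast
  ring

/-- The integrand of `𝒥_o[C̃₀^{(2)}]` without the power. -/
def oddIntegrand (p q : ℝ) (s : ℝ) : ℂ :=
  Complex.exp (-Complex.I * s - q * π) * C₀ p (2 * q) 2 s

theorem contDiff_oddIntegrand (p q : ℝ) (hp : -1 < p) {n : WithTop ℕ∞} :
    ContDiff ℝ n (oddIntegrand p q) :=
  ((contDiff_const.mul Complex.ofRealCLM.contDiff).sub contDiff_const).cexp.mul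
    (contDiff_C₀_of_pos p (2 * q) 2 (by push_cast; linarith))

theorem Jo_C₀ (p q X : ℝ) : Jo p q (C₀ p (2 * q) 2) X = powPrimitive (p + 1) (oddIntegrand p q) X := by
  rw [Jo, powPrimitive]
  congr 1
  ext s
  rw [oddIntegrand]
  ring

/-- The derivative in `C₁` is removed by an integration by parts. -/
theorem Jo_C₁ (p q : ℝ) (hp : -1 < p) {X : ℝ} (hX : 0 < X) :
    Jo p q (C₁ p (2 * q) 2) X = p * (((X ^ (p + 2) : ℝ) : ℂ) * oddIntegrand p q X -
      (p + 2) * powPrimitive (p + 1) (oddIntegrand p q) X) := by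
  have h2 : 0 < p + (2 : ℕ) := by push_cast; linarith
  have h := powPrimitive_mul_deriv (a := p + 1) (by linarith) (contDiff_oddIntegrand p q hp) hX
  rw [show p + 1 + 1 = p + 2 by ring, show ((p + 1 : ℝ) : ℂ) + 1 = p + 2 by push_cast; ring] at h
  rw [← h, Jo, powPrimitive, ← intervalIntegral.integral_const_mul]
  congr 1
  ext s
  have he : HasDerivAt (fun s : ℝ => Complex.exp (-Complex.I * s - q * π))
      (Complex.exp (-Complex.I * s - q * π) * (-Complex.I)) s := by
    simpa using (((hasDerivAt_id s).ofReal_comp.const_mul (-Complex.I)).sub_const ((q : ℂ) * π)).cexp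
  have hd := he.mul ((contDiff_C₀_of_pos p (2 * q) 2 h2 (n := 1)).differentiable (by norm_num)
    s).hasDerivAt
  have hd' : deriv (oddIntegrand p q) s = _ := hd.deriv
  rw [hd', C₁_eq p (2 * q) 2 (Or.inl h2) (Or.inr h2)]
  ring

theorem contDiffOn_KOne (p q : ℝ) (hp : -1 < p) :
    ContDiffOn ℝ 2 (fun Z : ℝ × ℝ => KOne p q Z.1 Z.2) offDiagonal := by
  have h1 : 0 < p + (1 : ℕ) := by push_cast; linarith
  simp only [KOne, Jo_C₀]
  refine (contDiffOn_div_ofReal.mul (contDiffOn_KTwo p (2 * q) 1 (Or.inl h1))).add ?_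
  refine (((contDiffOn_const_div_sq _).mul (contDiffOn_const.mul contDiffOn_ofReal_snd).cexp).mul
    (contDiffOn_rpow_snd _)).mul (ContDiffOn.mul ?_ (ContDiffOn.sub ?_ contDiffOn_const))
  · exact (contDiff_C₀_of_pos p (2 * q) 1 h1).comp_contDiffOn contDiffOn_snd
  · exact (contDiffOn_powPrimitive (by linarith) (contDiff_oddIntegrand p q hp)).comp contDiffOn_fst
      fun Z hZ => hZ.1

theorem isDerivCorrection_KOne (p q : ℝ) (hp : -1 < p) :
    IsDerivCorrection p (KOne p q) (LOne p q) := by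
  have h1 : 0 < p + (1 : ℕ) := by push_cast; linarith
  have key : ∀ X Y : ℝ, (X, Y) ∈ offDiagonal → ∃ D : ℂ,
      HasDerivAt (fun t : ℝ => KOne p q (t * X) (t * Y)) D 1 ∧
        LOne p q X Y = p * (D + KOne p q X Y) := by
    intro X Y hm
    obtain ⟨D, hD, hL⟩ := exists_hasDerivAt_KTwo p (2 * q) 1 (Or.inl h1) (Or.inr h1) hm
    have hq := (hasDerivAt_const (1 : ℝ) ((Y : ℂ) / X)).congr_of_eventuallyEq (div_dilation X Y)
    have he := ((hasDerivAt_ofReal_dilation Y).const_mul (-Complex.I)).cexp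
    have hc := hasDerivAt_comp_dilation (X := Y)
      ((contDiff_C₀_of_pos p (2 * q) 1 h1 (n := 1)).differentiable (by norm_num) Y)
    have hJ := (hasDerivAt_powPrimitive_dilation (a := p + 1) (by linarith)
      (contDiff_oddIntegrand p q hp (n := 0)).continuous hm.1).sub_const ((η₁ p q : ℂ) / 2)
    have h := (hq.mul hD).add ((((hasDerivAt_const_div_sq_dilation (η₂ p q) hm.1).mul he).mul
      (hasDerivAt_rpow_dilation (p + 2) hm.2.1)).mul (hc.mul hJ))
    refine ⟨_, by simp only [KOne, Jo_C₀]; exact h, ?_⟩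
    simp only [LOne, KOne, hL, Jo_C₀, Jo_C₁ p q hp hm.1, C₁_eq p (2 * q) 1 (Or.inl h1) (Or.inr h1),
      one_mul, Pi.mul_apply, show p + 1 + 1 = p + 2 by ring]
    push_cast
    ring
  choose! D hD using key
  exact isDerivCorrection_of_dilation (contDiffOn_KOne p q hp) (fun X Y hm => (hD X Y hm).1)
    fun X Y hm => (hD X Y hm).2

/-- The integrand of `𝒥_{s,0}` without the power and the factors depending on `Y`. -/
def symplecticIntegrand (p q : ℝ) (s : ℝ) : ℂ :=
  Complex.exp (-2 * Complex.I * s) * C₀ (2 * p) q 1 (2 * s)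

theorem contDiff_symplecticIntegrand (p q : ℝ) (hp : 0 ≤ p) {n : WithTop ℕ∞} :
    ContDiff ℝ n (symplecticIntegrand p q) :=
  (contDiff_const.mul Complex.ofRealCLM.contDiff).cexp.mul
    ((contDiff_C₀_of_pos (2 * p) q 1 (by push_cast; linarith)).comp (contDiff_const.mul contDiff_id))

/-- The constant in `𝒥_s`. -/
def symplecticConst (p q : ℝ) : ℝ :=
  -p * (2 ^ (8 * p + 1) * ‖Complex.Gamma (2 * p + 1 - Complex.I * q)‖ ^ 2 /
    (π * Real.Gamma (4 * p + 1) * Real.Gamma (4 * p + 2)))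

theorem Js₀_eq (p q X Y : ℝ) : Js₀ p q X Y =
    symplecticConst p q * Complex.exp (-q * π - 2 * Complex.I * Y) * ((Y ^ (2 * p + 1) : ℝ) : ℂ) *
      (C₀ (2 * p) q 0 (2 * Y) * powPrimitive (2 * p) (symplecticIntegrand p q) X) := by
  have h : C₀ (2 * p) q 0 (2 * Y) * powPrimitive (2 * p) (symplecticIntegrand p q) X =
      ∫ s in (0 : ℝ)..X, Complex.exp (-2 * Complex.I * s) * ((s ^ (2 * p) : ℝ) : ℂ) *
        (C₀ (2 * p) q 0 (2 * Y) * C₀ (2 * p) q 1 (2 * s)) := by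
    rw [powPrimitive, ← intervalIntegral.integral_const_mul]
    refine intervalIntegral.integral_congr fun s _ => ?_
    simp only [symplecticIntegrand]
    ring
  rw [h, Js₀, Js, symplecticConst]

/-- The derivative in `C₁` under the integral is removed by an integration by parts. -/
theorem Js₁_eq (p q : ℝ) (hp : 0 ≤ p) {X : ℝ} (hX : 0 < X) (Y : ℝ) : Js₁ p q X Y =
    symplecticConst p q * Complex.exp (-q * π - 2 * Complex.I * Y) * ((Y ^ (2 * p + 1) : ℝ) : ℂ) *
      (C₁ (2 * p) q 0 (2 * Y) * powPrimitive (2 * p) (symplecticIntegrand p q) X +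
        C₀ (2 * p) q 0 (2 * Y) * (2 * p * (((X ^ (2 * p + 1) : ℝ) : ℂ) * symplecticIntegrand p q X -
          (2 * p + 1) * powPrimitive (2 * p) (symplecticIntegrand p q) X))) +
    2 * p * (4 * p + 1) * Js₀ p q X Y := by
  have h2 : 0 < 2 * p + (1 : ℕ) := by push_cast; linarith
  have hφ := contDiff_symplecticIntegrand p q hp (n := 1)
  have h := powPrimitive_mul_deriv (a := 2 * p) (by linarith) hφ hX
  have e : ((2 * p : ℝ) : ℂ) + 1 = 2 * p + 1 := by push_cast; ring
  rw [e] at h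
  have hi := intervalIntegrable_rpow_mul_continuous (a := 2 * p) (by linarith) hφ.continuous X
  have hi' := intervalIntegrable_rpow_mul_continuous (a := 2 * p) (by linarith)
    (f := fun s : ℝ => (s : ℂ) * deriv (symplecticIntegrand p q) s)
    (Complex.continuous_ofReal.mul (hφ.continuous_deriv le_rfl)) X
  rw [← h, Js₁, Js]
  congr 2
  rw [powPrimitive, powPrimitive, ← mul_assoc, ← intervalIntegral.integral_const_mul,
    ← intervalIntegral.integral_const_mul,
    ← intervalIntegral.integral_add (hi.const_mul _) (hi'.const_mul _)]
  congr 1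
  ext s
  have he : HasDerivAt (fun s : ℝ => Complex.exp (-2 * Complex.I * s))
      (Complex.exp (-2 * Complex.I * s) * (-2 * Complex.I)) s := by
    simpa using ((hasDerivAt_id s).ofReal_comp.const_mul (-2 * Complex.I)).cexp
  have hc : HasDerivAt (fun s : ℝ => C₀ (2 * p) q 1 (2 * s))
      (2 * deriv (C₀ (2 * p) q 1) (2 * s)) s := by
    have h1 := ((contDiff_C₀_of_pos (2 * p) q 1 h2 (n := 1)).differentiable (by norm_num)
      (2 * s)).hasDerivAt.scomp s ((hasDerivAt_id s).const_mul (2 : ℝ))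
    exact h1.congr_deriv (by simp)
  have hd : deriv (symplecticIntegrand p q) s = _ := (he.mul hc).deriv
  rw [hd, C₁_eq (2 * p) q 1 (Or.inl h2) (Or.inr h2), symplecticIntegrand]
  push_cast
  ring

theorem contDiffOn_KFour (p q : ℝ) (h : 0 < p ∨ (p = 0 ∧ q = 0)) :
    ContDiffOn ℝ 2 (fun Z : ℝ × ℝ => KFour p q Z.1 Z.2) offDiagonal := by
  have hp0 : 0 ≤ p := h.elim le_of_lt fun h' => h'.1.ge
  have hE : EulerParam (2 * p + (0 : ℕ)) q := by simpa [EulerParam] using h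
  simp only [KFour, Js₀_eq]
  refine (contDiffOn_div_ofReal.mul ?_).add ((contDiffOn_const_div_sq 1).mul ?_)
  · refine (contDiffOn_KTwo (2 * p) q 0 hE).comp
      (f := fun Z : ℝ × ℝ => ((2 * Z.1, 2 * Z.2) : ℝ × ℝ)) (ContDiff.contDiffOn (by fun_prop)) ?_
    intro Z hZ
    exact ⟨mul_pos two_pos hZ.1, mul_pos two_pos hZ.2.1, fun e => hZ.2.2 (by
      simpa using e)⟩
  · refine ((contDiffOn_const.mul (contDiffOn_const.sub
      (contDiffOn_const.mul contDiffOn_ofReal_snd)).cexp).mul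
      (contDiffOn_rpow_snd _)).mul (ContDiffOn.mul ?_ ?_)
    · exact (contDiff_C₀ (2 * p) q 0 hE).comp_contDiffOn (contDiffOn_const.mul contDiffOn_snd)
    · exact (contDiffOn_powPrimitive (by linarith) (contDiff_symplecticIntegrand p q hp0)).comp
        contDiffOn_fst fun Z hZ => hZ.1

theorem isDerivCorrection_KFour (p q : ℝ) (h : 0 < p ∨ (p = 0 ∧ q = 0)) :
    IsDerivCorrection p (KFour p q) (LFour p q) := by
  have hp0 : 0 ≤ p := h.elim le_of_lt fun h' => h'.1.ge
  have hE : EulerParam (2 * p + (0 : ℕ)) q := by simpa [EulerParam] using h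
  have key : ∀ X Y : ℝ, (X, Y) ∈ offDiagonal → ∃ D : ℂ,
      HasDerivAt (fun t : ℝ => KFour p q (t * X) (t * Y)) D 1 ∧
        LFour p q X Y = p * (D + KFour p q X Y) := by
    intro X Y hm
    obtain ⟨D, hD, hL⟩ := exists_hasDerivAt_KTwo (2 * p) q 0 hE (Or.inl rfl) (X := 2 * X)
      (Y := 2 * Y) ⟨mul_pos two_pos hm.1, mul_pos two_pos hm.2.1, fun e => hm.2.2 (by
        simpa using e)⟩
    simp only [mul_left_comm _ (2 : ℝ)] at hD
    have hq := (hasDerivAt_const (1 : ℝ) ((Y : ℂ) / X)).congr_of_eventuallyEq (div_dilation X Y)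
    have he := (((hasDerivAt_ofReal_dilation Y).const_mul (2 * Complex.I)).const_sub
      (-(q : ℂ) * π)).cexp
    have hc := hasDerivAt_comp_dilation (X := 2 * Y)
      ((contDiff_C₀ (2 * p) q 0 hE (n := 1)).differentiable (by norm_num) (2 * Y))
    simp only [mul_left_comm _ (2 : ℝ)] at hc
    have hJ := hasDerivAt_powPrimitive_dilation (a := 2 * p) (by linarith)
      (contDiff_symplecticIntegrand p q hp0 (n := 0)).continuous hm.1
    have h := (hq.mul hD).add ((hasDerivAt_const_div_sq_dilation 1 hm.1).mul
      (((he.const_mul (symplecticConst p q : ℂ)).mul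
        (hasDerivAt_rpow_dilation (2 * p + 1) hm.2.1)).mul (hc.mul hJ)))
    refine ⟨_, by simp only [KFour, Js₀_eq]; exact h, ?_⟩
    simp only [LFour, KFour, hL, Js₁_eq p q hp0 hm.1, Js₀_eq, C₁_eq (2 * p) q 0 hE (Or.inl rfl),
      one_mul, Pi.mul_apply]
    push_cast
    ring
  choose! D hD using key
  exact isDerivCorrection_of_dilation (contDiffOn_KFour p q h) (fun X Y hm => (hD X Y hm).1)
    fun X Y hm => (hD X Y hm).2

end

end CircularJacobi

theorem proposition1 (p q : ℝ) :
    -- Dyson index 2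
    ((0 < p ∨ (p = 0 ∧ q = 0)) →
      IsOInvSq (fun N X Y => scaled (kernelTwo p q N) N X Y -
        (KTwo p q 0 X Y + 1 / (N : ℂ) * LTwo p q 0 X Y)) ∧
      IsDerivCorrection p (KTwo p q 0) (LTwo p q 0) ∧
      IsOInvSq (fun N X Y => scaled (kernelTwo p q N) (N + p) X Y - KTwo p q 0 X Y)) ∧
    -- Dyson index 1
    (-1 < p →
      IsOInvSq (fun N X Y => scaled (kernelOne p q N) N X Y -
        (KOne p q X Y + 1 / (N : ℂ) * LOne p q X Y)) ∧
      IsDerivCorrection p (KOne p q) (LOne p q) ∧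
      IsOInvSq (fun N X Y => scaled (kernelOne p q N) (N + p) X Y - KOne p q X Y)) ∧
    -- Dyson index 4
    ((0 < p ∨ (p = 0 ∧ q = 0)) →
      IsOInvSq (fun N X Y => scaled (kernelFour p q N) N X Y -
        (KFour p q X Y + 1 / (N : ℂ) * LFour p q X Y)) ∧
      IsDerivCorrection p (KFour p q) (LFour p q) ∧
      IsOInvSq (fun N X Y => scaled (kernelFour p q N) (N + p) X Y - KFour p q X Y)) := by
  refine ⟨fun h => ?_, fun h => ?_, fun h => ?_⟩
  · have hE : EulerParam (p + (0 : ℕ)) q := by simpa [EulerParam] using h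
    have hA : ∀ δ R : ℝ, 0 < δ → UniformApprox (box δ R)
        (fun N Z => ((scaled (kernelTwo p q N) (N + p) Z.1 Z.2 : ℝ) : ℂ))
        fun Z => KTwo p q 0 Z.1 Z.2 := fun δ R hδ => uniformApprox_cdKernel p q 0 hE R hδ
    exact ⟨isOInvSq_unshifted (contDiffOn_KTwo p q 0 hE) (isDerivCorrection_KTwo p q h) hA,
      isDerivCorrection_KTwo p q h, isOInvSq_of_uniformApprox hA⟩
  · have hA : ∀ δ R : ℝ, 0 < δ → UniformApprox (box δ R)
        (fun N Z => ((scaled (kernelOne p q N) (N + p) Z.1 Z.2 : ℝ) : ℂ))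
        fun Z => KOne p q Z.1 Z.2 := fun δ R hδ => uniformApprox_kernelOne p q h R hδ
    exact ⟨isOInvSq_unshifted (contDiffOn_KOne p q h) (isDerivCorrection_KOne p q h) hA,
      isDerivCorrection_KOne p q h, isOInvSq_of_uniformApprox hA⟩
  · have hA : ∀ δ R : ℝ, 0 < δ → UniformApprox (box δ R)
        (fun N Z => ((scaled (kernelFour p q N) (N + p) Z.1 Z.2 : ℝ) : ℂ))
        fun Z => KFour p q Z.1 Z.2 := fun δ R hδ => uniformApprox_kernelFour p q h R hδ
    exact ⟨isOInvSq_unshifted (contDiffOn_KFour p q h) (isDerivCorrection_KFour p q h) hA,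
      isDerivCorrection_KFour p q h, isOInvSq_of_uniformApprox hA⟩
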